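/- **Groups.** Let $\Omega_n=\sum_{i=1}^n(-1)^{i+1}E_{i,n+1-i}$ and $G=G(\Omega_n)=\{A\in GL_n(\mathbb C): A\Omega_nA^t=\Omega_n\}$. Thus $G=Sp_{2k}$ if $n=2k$ and $G=O_{2k+1}$ if $n=2k+1$. Let $B_+$ and $B_-$ be the subgroups of upper and lower triangular matrices in $G$, let $T=B_+\cap B_-$ be the subgroup of diagonal matrices, and let $W=N_G(T)/T$. For $u,v\in W$ the double Bruhat cell is $G^{u,v}=B_+uB_+\cap B_-vB_-$. The simple reflections $s_1,\dots,s_k$ of $W$ permute the diagonal entries of elements of $T$: for $i<k$, $s_i$ exchanges the entries $i,i+1$ and also the entries $n+1-i,n-i$; $s_k$ exchanges the entries $k,k+1$ if $n=2k$, and the entries $k,k+2$ if $n=2k+1$. A double word is a word $\mathbf i$ in the alphabet $\{\pm1,\dots,\pm k\}$. It represents $(u,v)\in W\times W$ if $u$ is the product of the $s_i$ over the letters $-i$ of $\mathbf i$, and $v$ is the product of the $s_i$ over the letters $+i$, both in the order of the word. It is reduced if no shorter double word represents the same $(u,v)$. **Plabic graphs.** An $n$-valent plabic graph $\Gamma$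 is a finite graph embedded in a rectangle, with $n$ univalent vertices (sources) on the left side, $n$ univalent vertices (sinks) on the right side, both numbered $1,\dots,n$ from the bottom up, and with all other vertices in the interior and colored black or white. A face weighting assigns a nonzero complex number to each face (component of the complement of $\Gamma$ in the rectangle), with product $1$; $\mathcal F(\Gamma)$ is the space of face weightings. In a perfect orientation, edges leave the sources and enter the sinks, every white vertex has exactly one incoming edge, and every black vertex has exactly one outgoing edge. Nonzero edge weights on an oriented graph induce the face weights $$y_F=\prod_{e\subset\partial F}\mathrm{wt}(e)^{\pm1},$$ with exponent $+1$ if $e$ is oriented counterclockwise along $\partial F$ and $-1$ otherwise. The boundary measurement matrix $\mathrm{Meas}(\mathcal Y)$ of $\mathcal Y\in\mathcal F(\Gamma)$ is obtained by choosing a perfect orientation and edge weights that induce $\mathcal Y$ and setting $$A_{ij}=\sum_{\gamma:i\to j}(-1)^{\mathrm{wind}(\gamma)}\mathrm{wt}(\gamma),$$ where the sum is over directed paths $\gamma$ from source $i$ to sink $j$, $\mathrm{wt}(\gamma)$ is the product of the weights of the edges of $\gamma$, and $\mathrm{wind}(\gamma)$ is the number of full turns made by $\gamma$; the result does not depend on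 the choices. (Each graph $\Gamma_{\mathbf i}$ below has exactly one perfect orientation, and it is acyclic, so these sums are finite.) **Move-symmetric weightings.** A square move at a square face of weight $y_0$ whose vertices have alternating colors reverses the colors of these four vertices, replaces $y_0$ by $y_0^{-1}$, and multiplies the weight of the face across each side of the square by $1+y_0$ or by $(1+y_0^{-1})^{-1}$, according to whether the end of that side which is on the left when one leaves the square through it is white or black (this preserves the boundary measurement matrix). The midline of the rectangle is the line through the midpoints of its left and right sides. $\Gamma$, or $(\Gamma,\mathcal Y)$, is move-symmetric if performing the square moves at all square faces which have two opposite vertices on the midline, and then reflecting in the midline, gives the initial graph (with the same face weights) but with all colors reversed. $\mathcal F^{ms}(\Gamma)\subset\mathcal F(\Gamma)$ is the set of weightings $\mathcal Y$ such that $(\Gamma,\mathcal Y)$ is move-symmetric; in particular these square moves have to be defined at $\mathcal Y$, i.e. $1+y_0\ne0$ at the squares concerned. **The graphs $\Gamma_{\mathbf i}$.** Concatenation glues the sinks of a graph to the sources of the next one. All the following graphs consist of $n$ horizontal strands joining source $j$ to sink $j$, modified as follows. (a) For $i<k$, and also for $i=k$ if $n=2k$: $\Gamma_{\pm i}$ has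 a vertical edge between the strands $i$ and $i+1$ and a vertical edge between the strands $n-i$ and $n+1-i$, in symmetric position (these two edges are the same if $i=k$, $n=2k$). In $\Gamma_i$ the lower end of each vertical edge is white and the upper end is black; in $\Gamma_{-i}$ the lower end is black and the upper end is white. (b) If $n=2k+1$: in $\Gamma_{\pm k}$ the strand $k+1$, which lies on the midline, passes through the west and east corners of a square that has west and east corners white and north and south corners black. The north corner is joined by a vertical edge to a vertex on the strand $k+2$, and the south corner is joined by a vertical edge to a vertex on the strand $k$. In $\Gamma_k$ the vertex on the strand $k+2$ is black and that on the strand $k$ is white; in $\Gamma_{-k}$ it is the opposite. For a double word $\mathbf i=i_1\cdots i_m$ let $\Gamma_{\mathbf i}$ be the concatenation of $\Gamma_{i_1},\dots,\Gamma_{i_m}$, from left to right; for the empty word it consists of $n$ strands. **Proposition.** Let $G=G(\Omega_n)$ be $O_{2k+1}$ or $Sp_{2k}$, let $(u,v)\in W\times W$, and let $\mathbf i$ be a reduced double word representing $(u,v)$. Then the boundary measurement map sends $\mathcal F^{ms}(\Gamma_{\mathbf i})$ birationally onto $G^{u,v}$: it restricts to a biregular isomorphism of a Zariski open dense subset of $\mathcal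 F^{ms}(\Gamma_{\mathbf i})$ onto a Zariski open dense subset of $G^{u,v}$. -/

import Mathlib

/-! ### The groups `Sp_{2k}` and `O_{2k+1}`, their Borel subgroups and Weyl group

Indices run over `Fin n`, that is, from `0` to `n - 1`. -/

namespace DoubleBruhat

open Matrix

/-- The antidiagonal matrix with entries `1, -1, 1, …` from the first row down. -/
def Omega (n : ℕ) : Matrix (Fin n) (Fin n) ℂ :=
  Matrix.of fun i j => if j = i.rev then (-1) ^ (i : ℕ) else 0

/-- The group of matrices `A` with `A Ω Aᵀ = Ω`: symplectic for even `n`, orthogonal for odd `n`. -/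
def G (n : ℕ) : Subgroup (GL (Fin n) ℂ) where
  carrier := {A | (A : Matrix (Fin n) (Fin n) ℂ) * Omega n * (A : Matrix (Fin n) (Fin n) ℂ)ᵀ = Omega n}
  one_mem' := by simp
  mul_mem' := by
    intro A B hA hB
    simp only [Set.mem_ofPred_eq, Units.val_mul, transpose_mul] at *
    calc A.val * B.val * Omega n * (B.valᵀ * A.valᵀ)
        = A.val * (B.val * Omega n * B.valᵀ) * A.valᵀ := by simp only [Matrix.mul_assoc]
      _ = Omega n := by rw [hB, hA]
  inv_mem' := by
    intro A hA
    simp only [Set.mem_ofPred_eq] at *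
    have h1 : (A⁻¹).val * A.val = 1 := by rw [← Units.val_mul]; simp
    have h2 : A.valᵀ * (A⁻¹).valᵀ = 1 := by rw [← transpose_mul, h1, transpose_one]
    calc (A⁻¹).val * Omega n * (A⁻¹).valᵀ
        = (A⁻¹).val * (A.val * Omega n * A.valᵀ) * (A⁻¹).valᵀ := by rw [hA]
      _ = ((A⁻¹).val * A.val) * Omega n * (A.valᵀ * (A⁻¹).valᵀ) := by simp only [Matrix.mul_assoc]
      _ = Omega n := by rw [h1, h2]; simp

/-- The matrix of an element of `G n`. -/
abbrev mat {n : ℕ} (g : G n) : Matrix (Fin n) (Fin n) ℂ := g.1.val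

/-- The upper Borel subgroup: upper triangular matrices in `G n`. -/
def Bplus (n : ℕ) : Subgroup (G n) where
  carrier := {A | ∀ i j, j < i → mat A i j = 0}
  one_mem' := by
    intro i j h
    exact Matrix.one_apply_ne h.ne'
  mul_mem' := by
    intro A B hA hB
    have hA' : BlockTriangular (mat A) id := fun i j h => hA i j h
    have hB' : BlockTriangular (mat B) id := fun i j h => hB i j h
    exact fun i j h => hA'.mul hB' h
  inv_mem' := by
    intro A hA
    have hA' : BlockTriangular (mat A) id := fun i j h => hA i j h
    have h : mat A⁻¹ = (mat A)⁻¹ := by simp [mat, Matrix.coe_units_inv]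
    have := A.1.invertible
    have h' := blockTriangular_inv_of_blockTriangular hA'
    intro i j hij
    rw [h]
    exact h' hij

/-- The lower Borel subgroup: lower triangular matrices in `G n`. -/
def Bminus (n : ℕ) : Subgroup (G n) where
  carrier := {A | ∀ i j, i < j → mat A i j = 0}
  one_mem' := by
    intro i j h
    exact Matrix.one_apply_ne h.ne
  mul_mem' := by
    intro A B hA hB
    have hA' : BlockTriangular (mat A) OrderDual.toDual := fun i j h => hA i j h
    have hB' : BlockTriangular (mat B) OrderDual.toDual := fun i j h => hB i j h
    exact fun i j h => hA'.mul hB' h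
  inv_mem' := by
    intro A hA
    have hA' : BlockTriangular (mat A) OrderDual.toDual := fun i j h => hA i j h
    have h : mat A⁻¹ = (mat A)⁻¹ := by simp [mat, Matrix.coe_units_inv]
    have := A.1.invertible
    have h' := blockTriangular_inv_of_blockTriangular hA'
    intro i j hij
    rw [h]
    exact h' hij

/-- The maximal torus `B₊ ∩ B₋`: diagonal matrices in `G n`. -/
def T (n : ℕ) : Subgroup (G n) := Bplus n ⊓ Bminus n

/-- The normalizer of the maximal torus. -/
abbrev N (n : ℕ) : Subgroup (G n) := Subgroup.normalizer (T n : Set (G n))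

/-- The Weyl group `N_G(T) / T`. -/
abbrev W (n : ℕ) : Type := N n ⧸ (T n).subgroupOf (N n)

/-- The sign in row `i` of `signedPermMatrix σ`. -/
def permSign {n : ℕ} (σ : Equiv.Perm (Fin n)) (i : Fin n) : ℂ :=
  if i < i.rev then (-1) ^ ((i : ℕ) + (σ i : ℕ)) else 1

/-- A signed permutation matrix, which lies in `G n` when `σ` commutes with `Fin.rev`. -/
def signedPermMatrix {n : ℕ} (σ : Equiv.Perm (Fin n)) : Matrix (Fin n) (Fin n) ℂ :=
  Matrix.of fun i j => if j = σ i then permSign σ i else 0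

lemma permSign_mul_self {n : ℕ} (σ : Equiv.Perm (Fin n)) (i : Fin n) :
    permSign σ i * permSign σ i = 1 := by
  unfold permSign
  split_ifs
  · rw [← mul_pow]; simp
  · simp

lemma signedPermMatrix_mul_mul {n : ℕ} (σ : Equiv.Perm (Fin n)) (X : Matrix (Fin n) (Fin n) ℂ)
    (i j : Fin n) :
    (signedPermMatrix σ * X * (signedPermMatrix σ)ᵀ) i j =
      permSign σ i * X (σ i) (σ j) * permSign σ j := by
  simp [Matrix.mul_apply, signedPermMatrix]

lemma signedPermMatrix_mul_transpose {n : ℕ} (σ : Equiv.Perm (Fin n)) :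
    signedPermMatrix σ * (signedPermMatrix σ)ᵀ = 1 := by
  ext i j
  have h := signedPermMatrix_mul_mul σ 1 i j
  rw [Matrix.mul_one] at h
  rw [h]
  by_cases hij : i = j
  · subst hij
    simp [permSign_mul_self]
  · simp [hij]

/-- The signed permutation matrix as an invertible matrix. -/
def signedPermGL {n : ℕ} (σ : Equiv.Perm (Fin n)) : GL (Fin n) ℂ where
  val := signedPermMatrix σ
  inv := (signedPermMatrix σ)ᵀ
  val_inv := signedPermMatrix_mul_transpose σ
  inv_val := mul_eq_one_comm.mp (signedPermMatrix_mul_transpose σ)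

lemma signedPermGL_mem {n : ℕ} (σ : Equiv.Perm (Fin n)) (h : ∀ i, σ i.rev = (σ i).rev) :
    signedPermGL σ ∈ G n := by
  change signedPermMatrix σ * Omega n * (signedPermMatrix σ)ᵀ = Omega n
  ext i j
  rw [signedPermMatrix_mul_mul]
  simp only [Omega, Matrix.of_apply]
  by_cases hij : j = i.rev
  · subst hij
    have hpar : ((-1 : ℂ)) ^ ((i.rev : ℕ) + (σ i.rev : ℕ)) = (-1) ^ ((i : ℕ) + (σ i : ℕ)) := by
      rw [h, neg_one_pow_eq_pow_mod_two, neg_one_pow_eq_pow_mod_two (n := (i : ℕ) + _)]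
      congr 1
      simp only [Fin.val_rev]
      have := i.2
      have := (σ i).2
      omega
    have hpow : ((-1 : ℂ)) ^ ((i : ℕ) + (σ i : ℕ)) * (-1) ^ (σ i : ℕ) = (-1) ^ (i : ℕ) := by
      rw [pow_add, mul_assoc, ← mul_pow]; simp
    simp only [h, if_true]
    unfold permSign
    rw [hpar, Fin.rev_rev]
    rcases lt_trichotomy i i.rev with hlt | heq | hgt
    · rw [if_pos hlt, if_neg (not_lt.mpr hlt.le), mul_one, hpow]
    · have h2 := h i
      rw [← heq] at h2
      rw [← heq, if_neg (lt_irrefl _), one_mul, mul_one]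
      have e1 : (i : ℕ) = (σ i : ℕ) := by
        have a := congrArg Fin.val heq
        have b := congrArg Fin.val h2
        simp only [Fin.val_rev] at a b
        omega
      rw [← e1]
    · rw [if_neg (not_lt.mpr hgt.le), if_pos hgt, one_mul, mul_comm, hpow]
  · have : ¬ σ j = (σ i).rev := by
      rw [← h]
      exact fun hh => hij (σ.injective hh)
    simp [hij, this]

lemma mem_T_iff {n : ℕ} (t : G n) : t ∈ T n ↔ ∀ i j, i ≠ j → mat t i j = 0 := by
  constructor
  · rintro ⟨h1, h2⟩ i j hij
    rcases lt_or_gt_of_ne hij with h | h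
    · exact h2 i j h
    · exact h1 i j h
  · intro h
    exact ⟨fun i j hij => h i j hij.ne', fun i j hij => h i j hij.ne⟩

/-- The element of `N_G(T)` given by the signed permutation matrix of `σ`. -/
def signedPerm {n : ℕ} (σ : Equiv.Perm (Fin n)) (h : ∀ i, σ i.rev = (σ i).rev) : N n :=
  ⟨⟨signedPermGL σ, signedPermGL_mem σ h⟩, by
    have hs : ∀ i, permSign σ i ≠ 0 := fun i h0 => by
      have := permSign_mul_self σ i
      rw [h0] at this
      simp at this
    refine Subgroup.mem_normalizer_iff.mpr fun t => ?_
    have key : ∀ i j, mat (⟨signedPermGL σ, signedPermGL_mem σ h⟩ * t *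
        (⟨signedPermGL σ, signedPermGL_mem σ h⟩ : G n)⁻¹) i j =
        permSign σ i * mat t (σ i) (σ j) * permSign σ j := fun i j =>
      signedPermMatrix_mul_mul σ (mat t) i j
    rw [mem_T_iff, mem_T_iff]
    constructor
    · intro ht i j hij
      rw [key, ht _ _ (fun hh => hij (σ.injective hh))]
      simp
    · intro ht i j hij
      have := ht (σ.symm i) (σ.symm j) (fun hh => hij (σ.symm.injective hh))
      rw [key] at this
      simpa [hs] using this⟩

/-- The permutation by which the simple reflection of the `(a+1)`-st simple root permutes the
diagonal entries of the torus. For odd `n`, the last simple reflection exchanges the two entries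
next to the middle one; for even `n`, it exchanges the two middle entries; all the others exchange
the entries `a`, `a+1` and the opposite entries. -/
def simplePerm (n : ℕ) (a : Fin (n / 2)) : Equiv.Perm (Fin n) :=
  if h : n % 2 = 1 ∧ (a : ℕ) + 1 = n / 2 then
    Equiv.swap ⟨a, by omega⟩ ⟨a + 2, by omega⟩
  else if (a : ℕ) + 1 = n / 2 then
    Equiv.swap ⟨a, by omega⟩ ⟨a + 1, by omega⟩
  else
    Equiv.swap ⟨a, by omega⟩ ⟨a + 1, by omega⟩ *
      Equiv.swap ⟨n - 1 - a, by omega⟩ ⟨n - 2 - a, by omega⟩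

lemma simplePerm_rev (n : ℕ) (a : Fin (n / 2)) (i : Fin n) :
    simplePerm n a i.rev = (simplePerm n a i).rev := by
  have ha := a.2
  have hi := i.2
  unfold simplePerm
  split_ifs with h1 h2
  · simp only [Equiv.swap_apply_def, Fin.ext_iff, Fin.val_rev]
    split_ifs <;> simp only [Fin.val_rev] <;> omega
  · simp only [Equiv.swap_apply_def, Fin.ext_iff, Fin.val_rev]
    split_ifs <;> simp only [Fin.val_rev] <;> omega
  · simp only [Equiv.Perm.mul_apply, Equiv.swap_apply_def, Fin.ext_iff, Fin.val_rev]
    split_ifs <;> simp only [Fin.val_rev] at * <;> omega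

/-- The simple reflection of the `(a+1)`-st simple root, the roots being ordered so that the double
edge of the Dynkin diagram joins the last two. -/
def simpleReflection (n : ℕ) (a : Fin (n / 2)) : W n :=
  QuotientGroup.mk (signedPerm (simplePerm n a) (simplePerm_rev n a))

/-- Letters of double words: `(a, true)` and `(a, false)` stand for the symbols `a + 1` and
`-(a + 1)`, where `0 ≤ a < k` and `k = n / 2` is the rank. -/
abbrev Letter (n : ℕ) : Type := Fin (n / 2) × Bool

/-- The element of `W × W` of a letter: negative symbols belong to the first copy of `W`, positive
symbols to the second one. -/
def letterElem {n : ℕ} (l : Letter n) : W n × W n :=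
  if l.2 then (1, simpleReflection n l.1) else (simpleReflection n l.1, 1)

/-- The element of `W × W` represented by a double word. -/
def wordElem {n : ℕ} (w : List (Letter n)) : W n × W n :=
  (w.map letterElem).prod

/-- A double word is reduced if no shorter one represents the same element. -/
def IsReducedWord {n : ℕ} (w : List (Letter n)) : Prop :=
  ∀ w' : List (Letter n), wordElem w' = wordElem w → w.length ≤ w'.length

/-- The double coset `B w B` of a Weyl group element `w`. -/
def bruhatCell {n : ℕ} (B : Subgroup (G n)) (w : W n) : Set (G n) :=
  {g | ∃ x : N n, (QuotientGroup.mk x : W n) = w ∧ ∃ b ∈ B, ∃ b' ∈ B, g = b * x * b'}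

/-- The double Bruhat cell `B₊ u B₊ ∩ B₋ v B₋`, as a subset of the space of matrices. -/
def doubleBruhatCell {n : ℕ} (u v : W n) : Set (Fin n × Fin n → ℂ) :=
  (fun g : G n => fun p : Fin n × Fin n => mat g p.1 p.2) ''
    (bruhatCell (Bplus n) u ∩ bruhatCell (Bminus n) v)

end DoubleBruhat

/-! ### Plabic graphs in a rectangle -/

/-- A point at which an edge of a graph in a rectangle ends. -/
inductive PlabicNode (V : Type) (n : ℕ) : Type
  | vertex (v : V)
  | source (j : Fin n)
  | sink (j : Fin n)

/-- An `n`-valent plabic graph, drawn with straight edges in the rectangle with corners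
`0 - I`, `width - I`, `width + n I`, `0 + n I` of the complex plane. The `j`-th vertex on the left
side (source) is the point `j I` and the `j`-th vertex on the right side (sink) is `width + j I`,
for `0 ≤ j < n`; so both sides are labelled from the bottom up.

Every edge is given a reference direction; this is only for bookkeeping and not an orientation of
the graph. Each source lies on one edge; these edges are indexed by `Fin n` and are directed to the
right. The other edges are indexed by `E`. The `n + 1` faces that touch the left side are indexed
by `Fin (n + 1)` from the bottom up, so that source `j` separates the faces `j` and `j + 1`; the
other faces are indexed by `F`. -/
structure PlabicGraph (n : ℕ) where
  /-- interior vertices -/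
  V : Type
  /-- edges that do not end at a source -/
  E : Type
  /-- faces that do not touch the left side of the rectangle -/
  F : Type
  [fintypeV : Fintype V]
  [fintypeE : Fintype E]
  [fintypeF : Fintype F]
  /-- the color: `true` for white, `false` for black -/
  white : V → Bool
  /-- the position of a vertex -/
  pos : V → ℂ
  width : ℝ
  /-- the first end of an edge -/
  start : E → V
  /-- the second end of an edge: an interior vertex or a sink -/
  finish : Fin n ⊕ E → V ⊕ Fin n
  /-- the face on the left of an edge -/
  left : E → Fin (n + 1) ⊕ F
  /-- the face on the right of an edge -/
  right : E → Fin (n + 1) ⊕ F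
  /-- the edge at a sink -/
  sinkEdge : Fin n → Fin n ⊕ E
  /-- the faces that touch the right side, from the bottom up -/
  rightFace : Fin (n + 1) → Fin (n + 1) ⊕ F
  finish_eq_sink_iff : ∀ e j, finish e = Sum.inr j ↔ e = sinkEdge j

namespace PlabicGraph

attribute [instance] fintypeV fintypeE fintypeF

/-- All edges. -/
abbrev Edge {n : ℕ} (Γ : PlabicGraph n) : Type := Fin n ⊕ Γ.E

/-- All faces. -/
abbrev Face {n : ℕ} (Γ : PlabicGraph n) : Type := Fin (n + 1) ⊕ Γ.F

abbrev Node {n : ℕ} (Γ : PlabicGraph n) : Type := PlabicNode Γ.V n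

/-! #### Concatenation -/

/-- The place of an edge of `Γ₂` in the concatenation of `Γ₁` and `Γ₂`: the edge at the source `j`
of `Γ₂` is glued to the edge at the sink `j` of `Γ₁`. -/
def glueEdge {n : ℕ} (Γ₁ Γ₂ : PlabicGraph n) : Γ₂.Edge → Fin n ⊕ (Γ₁.E ⊕ Γ₂.E) :=
  Sum.elim (fun j => (Γ₁.sinkEdge j).map id Sum.inl) (fun e => Sum.inr (Sum.inr e))

/-- The place of a face of `Γ₂` in the concatenation of `Γ₁` and `Γ₂`. -/
def glueFace {n : ℕ} (Γ₁ Γ₂ : PlabicGraph n) : Γ₂.Face → Fin (n + 1) ⊕ (Γ₁.F ⊕ Γ₂.F) :=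
  Sum.elim (fun r => (Γ₁.rightFace r).map id Sum.inl) (fun f => Sum.inr (Sum.inr f))

/-- The second end, in the concatenation of `Γ₁` and `Γ₂`, of an edge that comes from `Γ₁`. If the
edge ends at the sink `j` of `Γ₁`, it is prolonged by the edge at the source `j` of `Γ₂`. -/
def glueFinish {n : ℕ} (Γ₁ Γ₂ : PlabicGraph n) (e : Γ₁.Edge) : (Γ₁.V ⊕ Γ₂.V) ⊕ Fin n :=
  Sum.elim (fun v => Sum.inl (Sum.inl v)) (fun j => (Γ₂.finish (Sum.inl j)).map Sum.inr id)
    (Γ₁.finish e)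

/-- The concatenation of `Γ₁` (on the left) and `Γ₂` (on the right): the sinks of `Γ₁` are glued to
the sources of `Γ₂`, and then forgotten. -/
def concat {n : ℕ} (Γ₁ Γ₂ : PlabicGraph n) : PlabicGraph n where
  V := Γ₁.V ⊕ Γ₂.V
  E := Γ₁.E ⊕ Γ₂.E
  F := Γ₁.F ⊕ Γ₂.F
  white := Sum.elim Γ₁.white Γ₂.white
  pos := Sum.elim Γ₁.pos (fun v => Γ₁.width + Γ₂.pos v)
  width := Γ₁.width + Γ₂.width
  start := Sum.map Γ₁.start Γ₂.start
  finish := Sum.elim (fun j => glueFinish Γ₁ Γ₂ (Sum.inl j))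
    (Sum.elim (fun e => glueFinish Γ₁ Γ₂ (Sum.inr e)) (fun e => (Γ₂.finish (Sum.inr e)).map Sum.inr id))
  left := Sum.elim (fun e => (Γ₁.left e).map id Sum.inl) (fun e => glueFace Γ₁ Γ₂ (Γ₂.left e))
  right := Sum.elim (fun e => (Γ₁.right e).map id Sum.inl) (fun e => glueFace Γ₁ Γ₂ (Γ₂.right e))
  sinkEdge := fun j => glueEdge Γ₁ Γ₂ (Γ₂.sinkEdge j)
  rightFace := fun r => glueFace Γ₁ Γ₂ (Γ₂.rightFace r)
  finish_eq_sink_iff := by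
    have h1 := Γ₁.finish_eq_sink_iff
    have h2 := Γ₂.finish_eq_sink_iff
    have key : ∀ (e : Γ₁.Edge) (j : Fin n), glueFinish Γ₁ Γ₂ e = Sum.inr j ↔
        e.map id Sum.inl = glueEdge Γ₁ Γ₂ (Γ₂.sinkEdge j) := by
      intro e j
      unfold glueFinish glueEdge
      constructor
      · intro h
        rcases hs : Γ₁.finish e with v | i
        · rw [hs] at h; simp at h
        · rw [hs] at h
          simp only [Sum.elim_inr] at h
          have h3 : Γ₂.finish (Sum.inl i) = Sum.inr j := by
            rcases ht : Γ₂.finish (Sum.inl i) with v | i'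
            · rw [ht] at h; simp at h
            · rw [ht] at h; simpa using h
          rw [← (h2 _ _).mp h3, Sum.elim_inl, (h1 _ _).mp hs]
      · intro h
        rcases hs : Γ₂.sinkEdge j with i | e'
        · rw [hs] at h
          simp only [Sum.elim_inl] at h
          have hinj : Function.Injective (Sum.map (id : Fin n → Fin n)
              (Sum.inl : Γ₁.E → Γ₁.E ⊕ Γ₂.E)) :=
            Sum.map_injective.mpr ⟨Function.injective_id, Sum.inl_injective⟩
          rw [(h1 e i).mpr (hinj h), Sum.elim_inr, (h2 (Sum.inl i) j).mpr hs.symm]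
          rfl
        · rw [hs] at h
          rcases e with a | a <;> simp at h
    intro e j
    rcases e with i | e | e
    · exact key (Sum.inl i) j
    · exact key (Sum.inr e) j
    · have h3 := h2 (Sum.inr e) j
      simp only [Sum.elim_inr]
      unfold glueEdge
      constructor
      · intro h
        have h4 : Γ₂.finish (Sum.inr e) = Sum.inr j := by
          rcases ht : Γ₂.finish (Sum.inr e) with v | i'
          · rw [ht] at h; simp at h
          · rw [ht] at h; simpa using h
        rw [← h3.mp h4, Sum.elim_inr]
      · intro h
        rcases hs : Γ₂.sinkEdge j with i | e'
        · rw [hs] at h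
          rcases ha : Γ₁.sinkEdge i with a | a <;> rw [Sum.elim_inl, ha] at h <;> simp at h
        · rw [hs] at h
          simp only [Sum.elim_inr, Sum.inr.injEq] at h
          subst h
          rw [h3.mpr hs.symm]
          rfl

/-! #### The elementary graphs -/

/-- The graph in which every source is directly connected to the corresponding sink. -/
def strands (n : ℕ) : PlabicGraph n where
  V := Empty
  E := Empty
  F := Empty
  white := Empty.elim
  pos := Empty.elim
  width := 1
  start := Empty.elim
  finish := Sum.elim Sum.inr Empty.elim
  left := Empty.elim
  right := Empty.elim
  sinkEdge := Sum.inl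
  rightFace := Sum.inl
  finish_eq_sink_iff := by
    rintro (i | e) j
    · simp
    · exact e.elim

/-- In the graph of a letter `±(a+1)`, other than the last simple root for odd `n`, there are
vertical edges between the strands `a` and `a + 1` and between the opposite strands `n - 2 - a` and
`n - 1 - a`; these coincide for the last simple root for even `n`. This predicate says that there
is a vertical edge that goes up from the strand `j`. -/
abbrev IsLower {n : ℕ} (a : Fin (n / 2)) (j : Fin n) : Prop :=
  (j : ℕ) = a ∨ (j : ℕ) = n - 2 - a

/-- The strand `j` carries a vertex, namely the lower or the upper end of a vertical edge. -/
abbrev IsTouched {n : ℕ} (a : Fin (n / 2)) (j : Fin n) : Prop :=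
  IsLower a j ∨ ∃ i : Fin n, IsLower a i ∧ (j : ℕ) = i + 1

lemma IsLower.lt {n : ℕ} {a : Fin (n / 2)} {j : Fin n} (h : IsLower a j) : (j : ℕ) + 1 < n := by
  have := a.2
  rcases h with h | h <;> omega

/-- The face that touches the right side between the strands `r - 1` and `r` in the graph
`bridges`. -/
def bridgesRightFace {n : ℕ} (a : Fin (n / 2)) :
    Fin (n + 1) → Fin (n + 1) ⊕ {j : Fin n // IsLower a j} :=
  Fin.cases (Sum.inl 0) (fun j => if h : IsLower a j then Sum.inr ⟨j, h⟩ else Sum.inl j.succ)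

/-- The graph of the letter `±(a+1)`, with vertical edges as in `IsLower`. The lower end of a
vertical edge is white and the upper end is black if the letter is positive, and vice versa if it
is negative. The strand `j` is the horizontal line at the height `j`, with at most one vertex `j`
on it, in the middle.

The edges other than those at the sources are the right halves of the strands with a vertex, and
the vertical edges (indexed by the lower strand, and directed up). The faces that do not touch the
left side are those on the right of a vertical edge. -/
noncomputable def bridges (n : ℕ) (a : Fin (n / 2)) (positive : Bool) : PlabicGraph n where
  V := {j : Fin n // IsTouched a j}
  E := {j : Fin n // IsTouched a j} ⊕ {j : Fin n // IsLower a j}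
  F := {j : Fin n // IsLower a j}
  white := fun v => decide (IsLower a v.1) == positive
  pos := fun v => 1 / 2 + (v.1 : ℕ) * Complex.I
  width := 1
  start := Sum.elim id (fun j => ⟨j.1, Or.inl j.2⟩)
  finish := Sum.elim (fun j => if h : IsTouched a j then Sum.inl ⟨j, h⟩ else Sum.inr j)
    (Sum.elim (fun j => Sum.inr j.1)
      (fun j => Sum.inl ⟨⟨j.1 + 1, j.2.lt⟩, Or.inr ⟨j.1, j.2, rfl⟩⟩))
  left := Sum.elim (fun j => bridgesRightFace a j.1.succ) (fun j => Sum.inl j.1.succ)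
  right := Sum.elim (fun j => bridgesRightFace a j.1.castSucc) (fun j => Sum.inr j)
  sinkEdge := fun j => if h : IsTouched a j then Sum.inr (Sum.inl ⟨j, h⟩) else Sum.inl j
  rightFace := bridgesRightFace a
  finish_eq_sink_iff := by
    rintro (i | i | i) j
    · by_cases hi : IsTouched a i
      · by_cases hj : IsTouched a j
        · simp only [Sum.elim_inl, dif_pos hi, dif_pos hj]; simp
        · have : i ≠ j := fun h => hj (h ▸ hi)
          simp only [Sum.elim_inl, dif_pos hi, dif_neg hj]; simp [this]
      · by_cases hj : IsTouched a j
        · have : i ≠ j := fun h => hi (h ▸ hj)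
          simp only [Sum.elim_inl, dif_neg hi, dif_pos hj]; simp [this]
        · simp only [Sum.elim_inl, dif_neg hi, dif_neg hj]; simp
    · obtain ⟨i, hi⟩ := i
      by_cases hj : IsTouched a j
      · simp only [Sum.elim_inr, Sum.elim_inl, dif_pos hj]; simp
      · have : i ≠ j := fun h => hj (h ▸ hi)
        simp only [Sum.elim_inr, Sum.elim_inl, dif_neg hj]; simp [this]
    · by_cases hj : IsTouched a j
      · simp only [Sum.elim_inr, dif_pos hj]; simp
      · simp only [Sum.elim_inr, dif_neg hj]; simp

/-- Vertices of the graph with a square: the corners of the square, and the vertices above and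
below it. -/
inductive SquareVertex : Type
  | west | north | east | south | top | bottom
  deriving DecidableEq

instance : Fintype SquareVertex where
  elems := {.west, .north, .east, .south, .top, .bottom}
  complete := by intro x; cases x <;> simp

/-- Edges of the graph with a square other than those at the sources: the four sides of the square,
the two vertical edges, and the three edges that end at a sink. -/
inductive SquareEdge : Type
  | westNorth | northEast | westSouth | southEast
  | bottomSouth | northTop
  | bottomOut | eastOut | topOut
  deriving DecidableEq

instance : Fintype SquareEdge where
  elems := {.westNorth, .northEast, .westSouth, .southEast, .bottomSouth, .northTop, .bottomOut, .eastOut, .topOut}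
  complete := by intro x; cases x <;> simp

/-- Faces of the graph with a square that do not touch the left side: the square, and the two
faces on the right of the vertical edges. -/
inductive SquareFace : Type
  | square | lowerRight | upperRight
  deriving DecidableEq

instance : Fintype SquareFace where
  elems := {.square, .lowerRight, .upperRight}
  complete := by intro x; cases x <;> simp

/-- The face that touches the right side between the strands `r - 1` and `r` in the graph
`square`. -/
def squareRightFace (n b : ℕ) (r : Fin (n + 1)) : Fin (n + 1) ⊕ SquareFace :=
  if (r : ℕ) = b + 1 then Sum.inr .lowerRight
  else if (r : ℕ) = b + 2 then Sum.inr .upperRight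
  else Sum.inl r

/-- The graph of the last simple root or of its negative for odd `n`. On the strands `b`, `b + 1`,
`b + 2` it looks as follows (and the other sources are directly connected to the sinks).
```
 b+2 ------- top -------
              |
            north
           /     \
 b+1 --- west   east ---
           \     /
            south
              |
 b ------- bottom ------
```
The corners `west`, `east` of the square are white, `north`, `south` are black. For the positive
root `top` is black and `bottom` is white, and vice versa for the negative root. -/
noncomputable def square (n b : ℕ) (hb : b + 2 < n) (positive : Bool) : PlabicGraph n where
  V := SquareVertex
  E := SquareEdge
  F := SquareFace
  white := fun v => match v with
    | .west => true
    | .north => false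
    | .east => true
    | .south => false
    | .top => !positive
    | .bottom => positive
  pos := fun v => match v with
    | .west => 1 / 4 + (b + 1) * Complex.I
    | .north => 1 / 2 + (b + 1 + 1 / 4) * Complex.I
    | .east => 3 / 4 + (b + 1) * Complex.I
    | .south => 1 / 2 + (b + 1 - 1 / 4) * Complex.I
    | .top => 1 / 2 + (b + 2) * Complex.I
    | .bottom => 1 / 2 + b * Complex.I
  width := 1
  start := fun e => match e with
    | .westNorth => .west
    | .northEast => .north
    | .westSouth => .west
    | .southEast => .south
    | .bottomSouth => .bottom
    | .northTop => .north
    | .bottomOut => .bottom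
    | .eastOut => .east
    | .topOut => .top
  finish := Sum.elim
    (fun j => if (j : ℕ) = b then Sum.inl .bottom
      else if (j : ℕ) = b + 1 then Sum.inl .west
      else if (j : ℕ) = b + 2 then Sum.inl .top
      else Sum.inr j)
    (fun e => match e with
    | .westNorth => Sum.inl .north
    | .northEast => Sum.inl .east
    | .westSouth => Sum.inl .south
    | .southEast => Sum.inl .east
    | .bottomSouth => Sum.inl .south
    | .northTop => Sum.inl .top
    | .bottomOut => Sum.inr ⟨b, by omega⟩
    | .eastOut => Sum.inr ⟨b + 1, by omega⟩
    | .topOut => Sum.inr ⟨b + 2, by omega⟩)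
  left := fun e => match e with
    | .westNorth => Sum.inl ⟨b + 2, by omega⟩
    | .northEast => Sum.inr .upperRight
    | .westSouth => Sum.inr .square
    | .southEast => Sum.inr .square
    | .bottomSouth => Sum.inl ⟨b + 1, by omega⟩
    | .northTop => Sum.inl ⟨b + 2, by omega⟩
    | .bottomOut => Sum.inr .lowerRight
    | .eastOut => Sum.inr .upperRight
    | .topOut => Sum.inl ⟨b + 3, by omega⟩
  right := fun e => match e with
    | .westNorth => Sum.inr .square
    | .northEast => Sum.inr .square
    | .westSouth => Sum.inl ⟨b + 1, by omega⟩
    | .southEast => Sum.inr .lowerRight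
    | .bottomSouth => Sum.inr .lowerRight
    | .northTop => Sum.inr .upperRight
    | .bottomOut => Sum.inl ⟨b, by omega⟩
    | .eastOut => Sum.inr .lowerRight
    | .topOut => Sum.inr .upperRight
  sinkEdge := fun j =>
    if (j : ℕ) = b then Sum.inr .bottomOut
    else if (j : ℕ) = b + 1 then Sum.inr .eastOut
    else if (j : ℕ) = b + 2 then Sum.inr .topOut
    else Sum.inl j
  rightFace := squareRightFace n b
  finish_eq_sink_iff := by
    rintro (i | e) j
    · simp only [Sum.elim_inl]
      split_ifs <;> simp [Fin.ext_iff] <;> omega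
    · simp only [Sum.elim_inr]
      cases e <;> split_ifs <;> simp [Fin.ext_iff] <;> omega

/-- The graph of a letter. -/
noncomputable def ofLetter {n : ℕ} (l : DoubleBruhat.Letter n) : PlabicGraph n :=
  if h : n % 2 = 1 ∧ (l.1 : ℕ) + 1 = n / 2 then square n l.1 (by omega) l.2
  else bridges n l.1 l.2

/-- The concatenation of the graphs of the letters of a double word. The concatenation starts with
`strands`, which is neutral for it (up to isotopy). -/
noncomputable def ofWord {n : ℕ} (w : List (DoubleBruhat.Letter n)) : PlabicGraph n :=
  w.foldl (fun Γ l => Γ.concat (ofLetter l)) (strands n)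

/-! #### Perfect orientations and the boundary measurement matrix -/

variable {n : ℕ} (Γ : PlabicGraph n)

/-- The first end of an edge. -/
def first : Γ.Edge → Γ.Node :=
  Sum.elim PlabicNode.source (fun e => .vertex (Γ.start e))

/-- The second end of an edge. -/
def second (e : Γ.Edge) : Γ.Node :=
  Sum.elim PlabicNode.vertex PlabicNode.sink (Γ.finish e)

/-- The face on the left of an edge in its reference direction. -/
def leftOf : Γ.Edge → Γ.Face :=
  Sum.elim (fun j => Sum.inl j.succ) Γ.left

/-- The face on the right of an edge in its reference direction. -/
def rightOf : Γ.Edge → Γ.Face :=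
  Sum.elim (fun j => Sum.inl j.castSucc) Γ.right

/-- The position of a node. -/
def nodePos : Γ.Node → ℂ
  | .vertex v => Γ.pos v
  | .source j => (j : ℕ) * Complex.I
  | .sink j => Γ.width + (j : ℕ) * Complex.I

/-- An orientation of a graph tells for each edge whether it is oriented in its reference
direction. -/
abbrev Orientation : Type := Γ.Edge → Bool

/-- The node at which an oriented edge begins. -/
def tail (o : Γ.Orientation) (e : Γ.Edge) : Γ.Node := if o e then Γ.first e else Γ.second e

/-- The node at which an oriented edge ends. -/
def head (o : Γ.Orientation) (e : Γ.Edge) : Γ.Node := if o e then Γ.second e else Γ.first e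

/-- An orientation is perfect if the left boundary vertices are sources, the right ones are sinks,
every white vertex has exactly one incoming edge and every black vertex has exactly one outgoing
edge. -/
def IsPerfect (o : Γ.Orientation) : Prop :=
  (∀ j, o (Sum.inl j) = true) ∧ (∀ j, o (Γ.sinkEdge j) = true) ∧
  (∀ v, Γ.white v = true → ∃! e, Γ.head o e = .vertex v) ∧
  (∀ v, Γ.white v = false → ∃! e, Γ.tail o e = .vertex v)

/-- Directed paths from the source `i` to the sink `j`, as lists of edges. -/
def IsPath (o : Γ.Orientation) (i j : Fin n) (γ : List Γ.Edge) : Prop :=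
  γ.IsChain (fun e e' => Γ.head o e = Γ.tail o e') ∧
  γ.head?.map (Γ.tail o) = some (.source i) ∧ γ.getLast?.map (Γ.head o) = some (.sink j)

/-- The direction of an oriented edge. -/
def dir (o : Γ.Orientation) (e : Γ.Edge) : ℂ := Γ.nodePos (Γ.head o e) - Γ.nodePos (Γ.tail o e)

/-- The winding index of a directed path: its total turning angle, divided by a full turn. -/
noncomputable def wind (o : Γ.Orientation) (γ : List Γ.Edge) : ℝ :=
  ((γ.zip γ.tail).map fun p => Complex.arg (Γ.dir o p.2 / Γ.dir o p.1)).sum / (2 * Real.pi)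

/-- The boundary measurement matrix of an oriented graph with edge weights `wt`:
the `(i, j)` entry is the sum of `(-1)^{wind γ} wt(γ)` over all directed paths `γ` from the source
`i` to the sink `j`. Here the power of `-1` is written as an exponential. All sums that occur below
are finite: the graph of a double word has a single perfect orientation, and that orientation has
no directed cycles. -/
noncomputable def networkMatrix (o : Γ.Orientation) (wt : Γ.Edge → ℂˣ) : Matrix (Fin n) (Fin n) ℂ :=
  Matrix.of fun i j => ∑ᶠ γ : {γ : List Γ.Edge // Γ.IsPath o i j γ},
    Complex.exp (Real.pi * Complex.I * Γ.wind o γ.1) * (γ.1.map fun e => (wt e : ℂ)).prod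

open Classical in
/-- The weight of a face: the product of the weights of the edges of its boundary, with exponent
`1` if the edge is oriented counterclockwise around the face (that is, if the face is on its left),
and with exponent `-1` otherwise. -/
noncomputable def faceWeight (o : Γ.Orientation) (wt : Γ.Edge → ℂˣ) (f : Γ.Face) : ℂˣ :=
  ∏ e, (if (if o e then Γ.leftOf e else Γ.rightOf e) = f then wt e else 1) *
    (if (if o e then Γ.rightOf e else Γ.leftOf e) = f then (wt e)⁻¹ else 1)

/-- Face weightings: nonzero numbers on the faces with product `1`. -/
def faceWeightings : Set (Γ.Face → ℂ) :=
  {y | (∀ f, y f ≠ 0) ∧ ∏ f, y f = 1}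

open Classical in
/-- The boundary measurement map: choose a perfect orientation, and edge weights with the given
face weights, and take the boundary measurement matrix of the resulting network. -/
noncomputable def meas (y : Γ.Face → ℂ) : Matrix (Fin n) (Fin n) ℂ :=
  if h : ∃ p : Γ.Orientation × (Γ.Edge → ℂˣ),
      Γ.IsPerfect p.1 ∧ ∀ f, (Γ.faceWeight p.1 p.2 f : ℂ) = y f then
    Γ.networkMatrix h.choose.1 h.choose.2
  else 0

/-! #### Square moves and move-symmetric weightings -/

/-- The edge `e` connects the vertices `v` and `w`. -/
def Joins (e : Γ.Edge) (v w : Γ.V) : Prop :=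
  (Γ.first e = .vertex v ∧ Γ.second e = .vertex w) ∨
  (Γ.first e = .vertex w ∧ Γ.second e = .vertex v)

/-- The edge `e` belongs to the boundary of the face `f`. -/
def Borders (e : Γ.Edge) (f : Γ.Face) : Prop := Γ.leftOf e = f ∨ Γ.rightOf e = f

/-- The vertex lies on the midline of the rectangle. -/
def OnMidline (v : Γ.V) : Prop := (Γ.pos v).im = ((n : ℝ) - 1) / 2

/-- A square face, with corners of alternating colors, which has two opposite vertices on the
midline. -/
def IsMidlineSquare (f : Γ.Face) : Prop :=
  ∃ v₁ v₂ v₃ v₄ : Γ.V, ∃ e₁ e₂ e₃ e₄ : Γ.Edge,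
    [v₁, v₂, v₃, v₄].Nodup ∧
    (∀ e, Γ.Borders e f ↔ e = e₁ ∨ e = e₂ ∨ e = e₃ ∨ e = e₄) ∧
    Γ.Joins e₁ v₁ v₂ ∧ Γ.Joins e₂ v₂ v₃ ∧ Γ.Joins e₃ v₃ v₄ ∧ Γ.Joins e₄ v₄ v₁ ∧
    Γ.white v₂ = !Γ.white v₁ ∧ Γ.white v₃ = Γ.white v₁ ∧ Γ.white v₄ = !Γ.white v₁ ∧
    Γ.OnMidline v₁ ∧ Γ.OnMidline v₃

/-- The vertex is a corner of a midline square. -/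
def IsMidlineCorner (v : Γ.V) : Prop :=
  ∃ f e, Γ.IsMidlineSquare f ∧ Γ.Borders e f ∧ (Γ.first e = .vertex v ∨ Γ.second e = .vertex v)

/-- The node is a white vertex. -/
def IsWhiteNode (x : Γ.Node) : Prop := ∃ v, x = .vertex v ∧ Γ.white v = true

open Classical in
/-- The factor by which a square move at a square face of weight `y₀` multiplies the weight of the
face on the other side of a side of the square. Here `x` is the end of that side which is on the
left when one leaves the square through it. -/
noncomputable def moveFactor (y₀ : ℂ) (x : Γ.Node) : ℂ :=
  if Γ.IsWhiteNode x then 1 + y₀ else (1 + y₀⁻¹)⁻¹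

open Classical in
/-- The face weights after square moves at all midline squares. (No two of these have a common
side in the graphs of double words, so that the order of the moves does not matter.) -/
noncomputable def squareMoves (y : Γ.Face → ℂ) (f : Γ.Face) : ℂ :=
  if Γ.IsMidlineSquare f then (y f)⁻¹
  else y f * ∏ e,
    (if Γ.IsMidlineSquare (Γ.leftOf e) ∧ Γ.rightOf e = f then
        Γ.moveFactor (y (Γ.leftOf e)) (Γ.second e) else 1) *
    (if Γ.IsMidlineSquare (Γ.rightOf e) ∧ Γ.leftOf e = f then
        Γ.moveFactor (y (Γ.rightOf e)) (Γ.first e) else 1)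

/-- The action on nodes of a reflection in the midline that acts on the vertices by `ρ`. -/
def reflectNode (ρ : Γ.V ≃ Γ.V) : Γ.Node → Γ.Node
  | .vertex v => .vertex (ρ v)
  | .source j => .source j.rev
  | .sink j => .sink j.rev

/-- The statement that the graph is move-symmetric: after square moves at all midline squares (which
change the colors of the corners of these squares), the reflection in the midline takes the graph to
the initial one with opposite colors. The fields describe the action of the reflection on vertices,
edges and faces. Being a reflection, it exchanges the two sides of an edge; it may also reverse
the reference direction. -/
structure MoveSymmetry where
  onV : Γ.V ≃ Γ.V
  onE : Γ.Edge ≃ Γ.Edge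
  onF : Γ.Face ≃ Γ.Face
  pos_onV : ∀ v, Γ.pos (onV v) = (starRingEnd ℂ) (Γ.pos v) + ((n : ℂ) - 1) * Complex.I
  edge : ∀ e,
    (Γ.first (onE e) = Γ.reflectNode onV (Γ.first e) ∧
      Γ.second (onE e) = Γ.reflectNode onV (Γ.second e) ∧
      Γ.leftOf (onE e) = onF (Γ.rightOf e) ∧ Γ.rightOf (onE e) = onF (Γ.leftOf e)) ∨
    (Γ.first (onE e) = Γ.reflectNode onV (Γ.second e) ∧
      Γ.second (onE e) = Γ.reflectNode onV (Γ.first e) ∧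
      Γ.leftOf (onE e) = onF (Γ.leftOf e) ∧ Γ.rightOf (onE e) = onF (Γ.rightOf e))
  color_corner : ∀ v, Γ.IsMidlineCorner v → Γ.white (onV v) = Γ.white v
  color : ∀ v, ¬ Γ.IsMidlineCorner v → Γ.white (onV v) = !Γ.white v

/-- Move-symmetric weightings: the square moves at the midline squares are defined, and the
reflection takes the resulting weights to the initial ones. -/
def moveSymmetricWeightings : Set (Γ.Face → ℂ) :=
  {y | y ∈ Γ.faceWeightings ∧ (∀ f, Γ.IsMidlineSquare f → 1 + y f ≠ 0) ∧
    ∃ ρ : Γ.MoveSymmetry, ∀ f, y (ρ.onF f) = Γ.squareMoves y f}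

end PlabicGraph

/-! ### Birational maps between subsets of affine spaces -/

namespace Birational

variable {ι κ : Type}

/-- `U` is a Zariski open subset of `X`. -/
def IsOpenIn (U X : Set (ι → ℂ)) : Prop :=
  ∃ S : Set (MvPolynomial ι ℂ), U = {x | x ∈ X ∧ ∃ p ∈ S, MvPolynomial.eval x p ≠ 0}

/-- The Zariski closure of `U` contains `X`. -/
def IsDenseIn (U X : Set (ι → ℂ)) : Prop :=
  ∀ p : MvPolynomial ι ℂ, (∀ x ∈ U, MvPolynomial.eval x p = 0) → ∀ x ∈ X, MvPolynomial.eval x p = 0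

/-- The map `f` is regular on `U`: its components are locally quotients of polynomials. -/
def IsRegularOn (f : (ι → ℂ) → κ → ℂ) (U : Set (ι → ℂ)) : Prop :=
  ∀ j, ∀ x ∈ U, ∃ p q : MvPolynomial ι ℂ, MvPolynomial.eval x q ≠ 0 ∧
    ∀ z ∈ U, MvPolynomial.eval z q ≠ 0 → f z j = MvPolynomial.eval z p / MvPolynomial.eval z q

/-- The map `f` maps `X` birationally onto `Y`: it restricts to an isomorphism of a Zariski open
dense subset of `X` onto a Zariski open dense subset of `Y`. -/
def MapsBirationallyOnto (f : (ι → ℂ) → κ → ℂ) (X : Set (ι → ℂ)) (Y : Set (κ → ℂ)) : Prop :=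
  ∃ (U : Set (ι → ℂ)) (V : Set (κ → ℂ)) (g : (κ → ℂ) → ι → ℂ),
    IsOpenIn U X ∧ IsDenseIn U X ∧ IsOpenIn V Y ∧ IsDenseIn V Y ∧
    Set.MapsTo f U V ∧ Set.MapsTo g V U ∧ Set.LeftInvOn g f U ∧ Set.RightInvOn g f V ∧
    IsRegularOn f U ∧ IsRegularOn g V

end Birational

namespace DoubleBruhat

open Matrix

variable {n : ℕ}

/-! ### Elements of the group given by matrices -/

lemma Omega_mul_transpose (n : ℕ) : Omega n * (Omega n)ᵀ = 1 := by
  ext i j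
  simp only [Matrix.mul_apply, Omega, Matrix.of_apply, Matrix.transpose_apply, ite_mul, zero_mul,
    Finset.sum_ite_eq', Finset.mem_univ, if_true, mul_ite, mul_zero, Fin.rev_inj]
  by_cases h : i = j
  · subst h
    rw [if_pos rfl, ← mul_pow]
    simp
  · simp [h, Ne.symm h]

/-- The element of `G n` with a given matrix. -/
def ofMat (A : Matrix (Fin n) (Fin n) ℂ) (h : A * Omega n * Aᵀ = Omega n) : G n :=
  ⟨⟨A, Omega n * Aᵀ * (Omega n)ᵀ,
    by rw [← Matrix.mul_assoc, ← Matrix.mul_assoc, h, Omega_mul_transpose],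
    by rw [mul_eq_one_comm, ← Matrix.mul_assoc, ← Matrix.mul_assoc, h, Omega_mul_transpose]⟩, h⟩

@[simp] lemma mat_ofMat (A : Matrix (Fin n) (Fin n) ℂ) (h : A * Omega n * Aᵀ = Omega n) :
    mat (ofMat A h) = A := rfl

lemma mat_mul (g h : G n) : mat (g * h) = mat g * mat h := rfl

lemma mat_one : mat (1 : G n) = 1 := rfl

lemma mat_injective : Function.Injective (mat : G n → Matrix (Fin n) (Fin n) ℂ) := fun _ _ h =>
  Subtype.ext (Units.ext h)

lemma mat_mul_inv (g : G n) : mat g * mat g⁻¹ = 1 := by rw [← mat_mul, mul_inv_cancel, mat_one]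

lemma mat_inv_mul (g : G n) : mat g⁻¹ * mat g = 1 := by rw [← mat_mul, inv_mul_cancel, mat_one]

lemma mat_rel (g : G n) : mat g * Omega n * (mat g)ᵀ = Omega n := g.2

lemma mat_inv (g : G n) : mat g⁻¹ = Omega n * (mat g)ᵀ * (Omega n)ᵀ := by
  have h : mat g * (Omega n * (mat g)ᵀ * (Omega n)ᵀ) = 1 := by
    rw [← Matrix.mul_assoc, ← Matrix.mul_assoc, mat_rel, Omega_mul_transpose]
  calc mat g⁻¹ = mat g⁻¹ * (mat g * (Omega n * (mat g)ᵀ * (Omega n)ᵀ)) := by rw [h, Matrix.mul_one]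
    _ = _ := by rw [← Matrix.mul_assoc, mat_inv_mul, Matrix.one_mul]

lemma mul_Omega_mul_transpose_apply (A : Matrix (Fin n) (Fin n) ℂ) (i j : Fin n) :
    (A * Omega n * Aᵀ) i j = ∑ c, A i c * ((-1) ^ (c : ℕ) * A j c.rev) := by
  rw [Matrix.mul_assoc, Matrix.mul_apply]
  refine Finset.sum_congr rfl fun c _ => ?_
  congr 1
  simp [Matrix.mul_apply, Omega]

lemma sum_entries (g : G n) (i j : Fin n) :
    ∑ c, mat g i c * ((-1) ^ (c : ℕ) * mat g j c.rev) = if j = i.rev then (-1) ^ (i : ℕ) else 0 := by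
  rw [← mul_Omega_mul_transpose_apply, mat_rel]
  rfl

/-- The matrix obtained by reversing the order of rows and of columns. -/
def flipMat (A : Matrix (Fin n) (Fin n) ℂ) : Matrix (Fin n) (Fin n) ℂ :=
  A.submatrix Fin.rev Fin.rev

lemma flipMat_mul (A B : Matrix (Fin n) (Fin n) ℂ) : flipMat (A * B) = flipMat A * flipMat B :=
  (Matrix.submatrix_mul_equiv A B Fin.rev Fin.revPerm Fin.rev).symm

lemma flipMat_flipMat (A : Matrix (Fin n) (Fin n) ℂ) : flipMat (flipMat A) = A := by
  ext i j
  simp [flipMat]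

lemma flipMat_rel {A : Matrix (Fin n) (Fin n) ℂ} (h : A * Omega n * Aᵀ = Omega n) :
    flipMat A * Omega n * (flipMat A)ᵀ = Omega n := by
  have hO : Omega n = ((-1 : ℂ) ^ (n - 1)) • flipMat (Omega n) := by
    ext i j
    simp only [flipMat, Omega, Matrix.smul_apply, Matrix.submatrix_apply, Matrix.of_apply,
      Fin.rev_inj, smul_eq_mul]
    by_cases hij : j = i.rev
    · rw [if_pos hij, if_pos hij]
      rw [← pow_add, neg_one_pow_eq_pow_mod_two, neg_one_pow_eq_pow_mod_two (n := n - 1 + _)]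
      congr 1
      simp only [Fin.val_rev]
      omega
    · rw [if_neg hij, if_neg hij, mul_zero]
  have ht : (flipMat A)ᵀ = flipMat Aᵀ := rfl
  rw [hO, Matrix.mul_smul, Matrix.smul_mul, ht, ← flipMat_mul, ← flipMat_mul, h]

/-- The automorphism of `G n` that reverses the order of rows and of columns. -/
def flip (n : ℕ) : G n ≃* G n where
  toFun g := ofMat (flipMat (mat g)) (flipMat_rel (mat_rel g))
  invFun g := ofMat (flipMat (mat g)) (flipMat_rel (mat_rel g))
  left_inv _ := mat_injective (flipMat_flipMat _)
  right_inv _ := mat_injective (flipMat_flipMat _)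
  map_mul' _ _ := mat_injective (flipMat_mul _ _)

lemma mat_flip (g : G n) (i j : Fin n) : mat (flip n g) i j = mat g i.rev j.rev := rfl

lemma flip_flip (g : G n) : flip n (flip n g) = g := (flip n).left_inv g

lemma flip_mem_Bminus (g : G n) : flip n g ∈ Bminus n ↔ g ∈ Bplus n := by
  constructor
  · intro h i j hij
    have := h i.rev j.rev (Fin.rev_lt_rev.mpr hij)
    rwa [mat_flip, Fin.rev_rev, Fin.rev_rev] at this
  · intro h i j hij
    exact h i.rev j.rev (Fin.rev_lt_rev.mpr hij)

/-! ### Monomial elements -/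

lemma perm_apply_inv {α : Type*} (σ : Equiv.Perm α) (x : α) : σ (σ⁻¹ x) = x :=
  σ.apply_symm_apply x

lemma perm_inv_apply {α : Type*} (σ : Equiv.Perm α) (x : α) : σ⁻¹ (σ x) = x :=
  σ.symm_apply_apply x

/-- The nonzero entries of the matrix of `P` are those in the positions `(i, σ i)`. -/
def IsMonomial (P : G n) (σ : Equiv.Perm (Fin n)) : Prop :=
  ∀ i j, mat P i j ≠ 0 ↔ j = σ i

namespace IsMonomial

variable {P Q : G n} {σ τ : Equiv.Perm (Fin n)}

lemma ne_zero (h : IsMonomial P σ) (i : Fin n) : mat P i (σ i) ≠ 0 := (h i _).mpr rfl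

lemma eq_zero (h : IsMonomial P σ) {i j : Fin n} (hij : j ≠ σ i) : mat P i j = 0 := by
  by_contra h'
  exact hij ((h i j).mp h')

lemma mul_apply (h : IsMonomial P σ) (A : Matrix (Fin n) (Fin n) ℂ) (i j : Fin n) :
    (mat P * A) i j = mat P i (σ i) * A (σ i) j := by
  rw [Matrix.mul_apply]
  exact Finset.sum_eq_single _ (fun c _ hc => by rw [h.eq_zero hc, zero_mul]) (by simp)

lemma apply_mul (h : IsMonomial P σ) (A : Matrix (Fin n) (Fin n) ℂ) (i j : Fin n) :
    (A * mat P) i (σ j) = A i j * mat P j (σ j) := by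
  rw [Matrix.mul_apply]
  refine Finset.sum_eq_single _ (fun c _ hc => ?_) (by simp)
  rw [h.eq_zero (fun h' => hc (σ.injective h').symm), mul_zero]

lemma mul (hP : IsMonomial P σ) (hQ : IsMonomial Q τ) : IsMonomial (P * Q) (τ * σ) := by
  intro i j
  rw [mat_mul, hP.mul_apply, mul_ne_zero_iff, hQ]
  simp [hP.ne_zero]

lemma one : IsMonomial (1 : G n) 1 := by
  intro i j
  rw [mat_one, Matrix.one_apply]
  simp [eq_comm]

lemma inv (hP : IsMonomial P σ) : IsMonomial P⁻¹ σ⁻¹ := by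
  intro i j
  have h : ∀ i j, mat P i (σ i) * mat P⁻¹ (σ i) j = (1 : Matrix (Fin n) (Fin n) ℂ) i j := by
    intro i j
    rw [← hP.mul_apply, mat_mul_inv]
  have h' := h (σ⁻¹ i) j
  rw [perm_apply_inv] at h'
  rw [Matrix.one_apply] at h'
  by_cases hij : j = σ⁻¹ i
  · simp only [hij, iff_true]
    rw [hij, if_pos rfl] at h'
    exact right_ne_zero_of_mul (h' ▸ one_ne_zero)
  · rw [if_neg (Ne.symm hij)] at h'
    have := hP.ne_zero (σ⁻¹ i)
    rw [perm_apply_inv] at this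
    simp only [hij, iff_false, not_not]
    exact (mul_eq_zero.mp h').resolve_left this

lemma conj_apply (h : IsMonomial P σ) (g : G n) (i j : Fin n) :
    mat (P * g * P⁻¹) i j = mat P i (σ i) * mat g (σ i) (σ j) * mat P⁻¹ (σ j) j := by
  have h2 := h.inv.apply_mul (mat (P * g)) i (σ j)
  rw [perm_inv_apply] at h2
  rw [mat_mul, h2, mat_mul, h.mul_apply]

/-- Monomial elements for the same permutation differ by an element of the torus. -/
lemma inv_mul_mem_T (hP : IsMonomial P σ) (hQ : IsMonomial Q σ) : P⁻¹ * Q ∈ T n := by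
  rw [mem_T_iff]
  intro i j hij
  by_contra h
  have := (hP.inv.mul hQ i j).mp h
  rw [mul_inv_cancel] at this
  exact hij this.symm

lemma flip (hP : IsMonomial P σ) (hσ : ∀ i, σ i.rev = (σ i).rev) :
    IsMonomial (DoubleBruhat.flip n P) σ := by
  intro i j
  rw [mat_flip, hP, hσ, Fin.rev_inj]

end IsMonomial

/-- The signed permutation matrix of a simple reflection. -/
def refl (a : Fin (n / 2)) : G n := (signedPerm (simplePerm n a) (simplePerm_rev n a)).1

lemma isMonomial_refl (a : Fin (n / 2)) : IsMonomial (refl a) (simplePerm n a) := by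
  intro i j
  change signedPermMatrix (simplePerm n a) i j ≠ 0 ↔ _
  have : permSign (simplePerm n a) i ≠ 0 := fun h0 => by
    have := permSign_mul_self (simplePerm n a) i
    rw [h0] at this
    simp at this
  simp [signedPermMatrix, this]

/-- The product of the signed permutation matrices of a word in the simple reflections. -/
def reflProd (s : List (Fin (n / 2))) : G n := (s.map refl).prod

/-- The permutation of `reflProd s`. -/
def permProd (s : List (Fin (n / 2))) : Equiv.Perm (Fin n) :=
  (s.reverse.map (simplePerm n)).prod

@[simp] lemma reflProd_nil : reflProd ([] : List (Fin (n / 2))) = 1 := rfl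

lemma reflProd_concat (s : List (Fin (n / 2))) (a : Fin (n / 2)) :
    reflProd (s ++ [a]) = reflProd s * refl a := by simp [reflProd]

lemma permProd_append (s t : List (Fin (n / 2))) :
    permProd (s ++ t) = permProd t * permProd s := by simp [permProd]

lemma permProd_singleton (a : Fin (n / 2)) : permProd [a] = simplePerm n a := by simp [permProd]

lemma isMonomial_reflProd (s : List (Fin (n / 2))) : IsMonomial (reflProd s) (permProd s) := by
  induction s using List.reverseRecOn with
  | nil => exact IsMonomial.one
  | append_singleton s a ih =>
    rw [reflProd_concat, permProd_append, permProd_singleton]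
    exact ih.mul (isMonomial_refl a)

lemma permProd_rev (s : List (Fin (n / 2))) (i : Fin n) :
    permProd s i.rev = (permProd s i).rev := by
  induction s using List.reverseRecOn generalizing i with
  | nil => rfl
  | append_singleton s a ih =>
    rw [permProd_append, permProd_singleton, Equiv.Perm.mul_apply, ih, simplePerm_rev,
      Equiv.Perm.mul_apply]

lemma permProd_inv_rev (s : List (Fin (n / 2))) (i : Fin n) :
    (permProd s)⁻¹ i.rev = ((permProd s)⁻¹ i).rev := by
  rw [Equiv.Perm.inv_eq_iff_eq, permProd_rev, perm_apply_inv]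

end DoubleBruhat

namespace DoubleBruhat

open Matrix PlabicGraph

variable {n : ℕ}

/-! ### Root subgroups -/

/-- The last simple root for odd `n`, which is a short root. -/
abbrev IsShort (a : Fin (n / 2)) : Prop := n % 2 = 1 ∧ (a : ℕ) + 1 = n / 2

lemma simplePerm_val (a : Fin (n / 2)) (i : Fin n) :
    (simplePerm n a i : ℕ) = if IsShort a then
      (if (i : ℕ) = a then (a : ℕ) + 2 else if (i : ℕ) = a + 2 then (a : ℕ) else i) else
      (if (i : ℕ) = a then (a : ℕ) + 1 else if (i : ℕ) = a + 1 then (a : ℕ) else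
        if (i : ℕ) = n - 1 - a then n - 2 - a else if (i : ℕ) = n - 2 - a then n - 1 - a else i) := by
  by_cases hs : IsShort a
  · rw [simplePerm, dif_pos hs, if_pos hs]
    simp only [Equiv.swap_apply_def, Fin.ext_iff]
    split_ifs <;> rfl
  · rw [simplePerm, dif_neg hs, if_neg hs]
    by_cases h2 : (a : ℕ) + 1 = n / 2
    · rw [if_pos h2]
      simp only [Equiv.swap_apply_def, Fin.ext_iff]
      split_ifs <;> (try simp only at *) <;> omega
    · rw [if_neg h2]
      simp only [Equiv.Perm.mul_apply, Equiv.swap_apply_def, Fin.ext_iff]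
      split_ifs <;> simp only at * <;> omega

lemma simplePerm_simplePerm (a : Fin (n / 2)) (i : Fin n) :
    simplePerm n a (simplePerm n a i) = i := by
  apply Fin.ext
  rw [simplePerm_val, simplePerm_val]
  split_ifs <;> omega

lemma simplePerm_inv (a : Fin (n / 2)) : (simplePerm n a)⁻¹ = simplePerm n a := by
  ext i
  rw [Equiv.Perm.inv_eq_iff_eq.mpr (simplePerm_simplePerm a i).symm]

lemma simplePerm_spec (a : Fin (n / 2)) (i : Fin n) :
    (IsShort a ∧ ((i : ℕ) = a ∧ (simplePerm n a i : ℕ) = a + 2 ∨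
      (i : ℕ) = a + 2 ∧ (simplePerm n a i : ℕ) = a ∨
      (i : ℕ) ≠ a ∧ (i : ℕ) ≠ a + 2 ∧ (simplePerm n a i : ℕ) = i)) ∨
    (¬ IsShort a ∧ ((i : ℕ) = a ∧ (simplePerm n a i : ℕ) = a + 1 ∨
      (i : ℕ) = a + 1 ∧ (simplePerm n a i : ℕ) = a ∨
      (i : ℕ) = n - 1 - a ∧ (simplePerm n a i : ℕ) = n - 2 - a ∨
      (i : ℕ) = n - 2 - a ∧ (simplePerm n a i : ℕ) = n - 1 - a ∨
      (i : ℕ) ≠ a ∧ (i : ℕ) ≠ a + 1 ∧ (i : ℕ) ≠ n - 1 - a ∧ (i : ℕ) ≠ n - 2 - a ∧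
        (simplePerm n a i : ℕ) = i)) := by
  have h := simplePerm_val a i
  split_ifs at h <;> omega

/-- The matrix of the element with parameter `t` of the positive simple root subgroup. -/
noncomputable def rootMatrix (a : Fin (n / 2)) (t : ℂ) : Matrix (Fin n) (Fin n) ℂ :=
  Matrix.of fun i j => if i = j then 1 else if (j : ℕ) = i + 1 ∧ IsLower a i then t
    else if IsShort a ∧ (i : ℕ) = a ∧ (j : ℕ) = a + 2 then t ^ 2 / 2 else 0

lemma rootMatrix_rev (a : Fin (n / 2)) (t : ℂ) (i j : Fin n) :
    rootMatrix a t j.rev i.rev = rootMatrix a t i j := by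
  simp only [rootMatrix, Matrix.of_apply, Fin.ext_iff, IsLower, Fin.val_rev]
  split_ifs <;> first | rfl | omega

lemma rootMatrix_support {a : Fin (n / 2)} {t : ℂ} {i j : Fin n} (h : rootMatrix a t i j ≠ 0) :
    i = j ∨ ((j : ℕ) = i + 1 ∧ IsLower a i) ∨ (IsShort a ∧ (i : ℕ) = a ∧ (j : ℕ) = a + 2) := by
  by_contra hc
  push Not at hc
  apply h
  simp only [rootMatrix, Matrix.of_apply]
  rw [if_neg hc.1, if_neg (by simpa using hc.2.1), if_neg (by simpa using hc.2.2)]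

lemma sum_rootMatrix_of_not_isLower (a : Fin (n / 2)) (t : ℂ) {i : Fin n} (hi : ¬ IsLower a i)
    (f : Fin n → ℂ) : ∑ c, rootMatrix a t i c * f c = f i := by
  rw [Finset.sum_eq_single i]
  · simp [rootMatrix]
  · intro c _ hc
    have : rootMatrix a t i c = 0 := by
      by_contra h
      rcases rootMatrix_support h with h | h | h
      · exact hc h.symm
      · exact hi h.2
      · exact hi (Or.inl h.2.1)
    rw [this, zero_mul]
  · simp

lemma sum_rootMatrix_of_isLower (a : Fin (n / 2)) (t : ℂ) {i j : Fin n} (hi : IsLower a i)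
    (hs : ¬ (IsShort a ∧ (i : ℕ) = a)) (hj : (j : ℕ) = i + 1)
    (f : Fin n → ℂ) : ∑ c, rootMatrix a t i c * f c = f i + t * f j := by
  have : ∀ c, rootMatrix a t i c = (if c = i then 1 else 0) + (if c = j then t else 0) := by
    intro c
    simp only [rootMatrix, Matrix.of_apply, Fin.ext_iff]
    split_ifs <;> first | omega | simp
  simp [this, add_mul, Finset.sum_add_distrib]

lemma sum_rootMatrix_of_isShort (a : Fin (n / 2)) (t : ℂ) {i j k : Fin n} (hs : IsShort a)
    (hi : (i : ℕ) = a) (hj : (j : ℕ) = a + 1) (hk : (k : ℕ) = a + 2)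
    (f : Fin n → ℂ) : ∑ c, rootMatrix a t i c * f c = f i + t * f j + t ^ 2 / 2 * f k := by
  have : ∀ c, rootMatrix a t i c = (if c = i then 1 else 0) + (if c = j then t else 0) +
      (if c = k then t ^ 2 / 2 else 0) := by
    intro c
    simp only [rootMatrix, Matrix.of_apply, Fin.ext_iff]
    split_ifs <;> first | omega | simp
  simp [this, add_mul, Finset.sum_add_distrib]

lemma rootMatrix_rel (a : Fin (n / 2)) (t : ℂ) :
    rootMatrix a t * Omega n * (rootMatrix a t)ᵀ = Omega n := by
  ext i j
  rw [mul_Omega_mul_transpose_apply]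
  simp only [Omega, Matrix.of_apply]
  by_cases h1 : IsLower a i
  · by_cases h2 : IsShort a ∧ (i : ℕ) = a
    · rw [sum_rootMatrix_of_isShort a t h2.1 h2.2 (j := ⟨a + 1, by omega⟩)
        (k := ⟨a + 2, by omega⟩) rfl rfl]
      simp only [rootMatrix, Matrix.of_apply, Fin.ext_iff, Fin.val_rev, h2.2, pow_add]
      split_ifs <;> first | omega | ring1
    · have hlt := h1.lt
      rw [sum_rootMatrix_of_isLower a t h1 h2 (j := ⟨i + 1, hlt⟩) rfl]
      simp only [rootMatrix, Matrix.of_apply, Fin.ext_iff, Fin.val_rev, pow_succ]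
      split_ifs <;> first | omega | ring1
  · rw [sum_rootMatrix_of_not_isLower a t h1]
    simp only [rootMatrix, Matrix.of_apply, Fin.ext_iff, Fin.val_rev]
    split_ifs <;> first | omega | simp

/-- The element with parameter `t` of the positive simple root subgroup. -/
noncomputable def root (a : Fin (n / 2)) (t : ℂ) : G n := ofMat (rootMatrix a t) (rootMatrix_rel a t)

lemma mat_root (a : Fin (n / 2)) (t : ℂ) : mat (root a t) = rootMatrix a t := rfl

lemma root_mul_root_neg (a : Fin (n / 2)) (t : ℂ) : root a t * root a (-t) = 1 := by
  apply mat_injective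
  rw [mat_mul, mat_root, mat_root, mat_one]
  ext i j
  rw [Matrix.mul_apply, Matrix.one_apply]
  by_cases h1 : IsLower a i
  · by_cases h2 : IsShort a ∧ (i : ℕ) = a
    · rw [sum_rootMatrix_of_isShort a t h2.1 h2.2 (j := ⟨a + 1, by omega⟩)
        (k := ⟨a + 2, by omega⟩) rfl rfl]
      simp only [rootMatrix, Matrix.of_apply, Fin.ext_iff, IsLower, h2.2, true_or, true_and,
        and_true]
      split_ifs <;> first | omega | ring1
    · have hlt := h1.lt
      rw [sum_rootMatrix_of_isLower a t h1 h2 (j := ⟨i + 1, hlt⟩) rfl]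
      simp only [rootMatrix, Matrix.of_apply, Fin.ext_iff, IsLower]
      split_ifs <;> first | omega | ring1
  · rw [sum_rootMatrix_of_not_isLower a t h1]
    simp only [rootMatrix, Matrix.of_apply, Fin.ext_iff]
    split_ifs <;> first | omega | simp

lemma root_neg (a : Fin (n / 2)) (t : ℂ) : root a (-t) = (root a t)⁻¹ :=
  (inv_eq_of_mul_eq_one_right (root_mul_root_neg a t)).symm

lemma root_mem_Bplus (a : Fin (n / 2)) (t : ℂ) : root a t ∈ Bplus n := by
  intro i j hij
  by_contra h
  rcases rootMatrix_support h with h | h | h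
  · exact hij.ne h.symm
  · have := Fin.lt_def.mp hij
    omega
  · have := Fin.lt_def.mp hij
    omega

/-- The first index of the first block of a simple root. -/
def fstIdx (a : Fin (n / 2)) : Fin n := ⟨a, by have := a.2; omega⟩

/-- The second index of the first block of a simple root. -/
def sndIdx (a : Fin (n / 2)) : Fin n := ⟨a + 1, by have := a.2; omega⟩

@[simp] lemma fstIdx_val (a : Fin (n / 2)) : (fstIdx a : ℕ) = a := rfl

@[simp] lemma sndIdx_val (a : Fin (n / 2)) : (sndIdx a : ℕ) = a + 1 := rfl

lemma apply_mul_root_fst (g : G n) (a : Fin (n / 2)) (t : ℂ) (i : Fin n) :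
    mat (g * root a t) i (fstIdx a) = mat g i (fstIdx a) := by
  rw [mat_mul, Matrix.mul_apply, Finset.sum_eq_single (fstIdx a)]
  · simp [mat_root, rootMatrix]
  · intro c _ hc
    have : rootMatrix a t c (fstIdx a) = 0 := by
      by_contra h
      have hc' := Fin.ext_iff.not.mp hc
      simp only [fstIdx_val] at hc'
      rcases rootMatrix_support h with h | h | h
      · exact hc h
      · simp only [fstIdx_val] at h; omega
      · simp only [fstIdx_val] at h; omega
    rw [mat_root, this, mul_zero]
  · simp

lemma apply_mul_root_snd (g : G n) (a : Fin (n / 2)) (t : ℂ) (i : Fin n) :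
    mat (g * root a t) i (sndIdx a) = mat g i (sndIdx a) + t * mat g i (fstIdx a) := by
  have : ∀ c, rootMatrix a t c (sndIdx a) =
      (if c = sndIdx a then 1 else 0) + (if c = fstIdx a then t else 0) := by
    intro c
    have h1 := fstIdx_val a
    have h2 := sndIdx_val a
    simp only [rootMatrix, Matrix.of_apply, Fin.ext_iff]
    split_ifs <;> first | omega | simp
  rw [mat_mul, Matrix.mul_apply]
  simp only [mat_root, this, mul_add, Finset.sum_add_distrib, mul_ite, mul_one, mul_zero,
    Finset.sum_ite_eq', Finset.mem_univ, if_true]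
  ring

/-! ### Minimal parabolic subgroups -/

/-- The index of the block, for the minimal parabolic subgroup of a simple root, that contains a
given row or column. -/
def blk (a : Fin (n / 2)) (j : Fin n) : ℕ :=
  if (j : ℕ) = a + 1 then a else
    if (j : ℕ) = n - 1 - a then (if IsShort a then (a : ℕ) else n - 2 - a) else j

lemma blk_spec (a : Fin (n / 2)) (j : Fin n) :
    ((j : ℕ) = a + 1 ∧ blk a j = a) ∨ ((j : ℕ) ≠ a + 1 ∧ (j : ℕ) ≠ n - 1 - a ∧ blk a j = j) ∨
    ((j : ℕ) = n - 1 - a ∧ ¬ IsShort a ∧ blk a j = n - 2 - a) ∨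
    ((j : ℕ) = n - 1 - a ∧ IsShort a ∧ blk a j = a) := by
  unfold blk
  split_ifs <;> omega

/-- Matrices that are block lower triangular for the blocks of a simple root. -/
def BlockLow (a : Fin (n / 2)) (g : G n) : Prop := ∀ i j, blk a i < blk a j → mat g i j = 0

lemma BlockLow.mul {a : Fin (n / 2)} {g h : G n} (hg : BlockLow a g) (hh : BlockLow a h) :
    BlockLow a (g * h) := by
  have h1 : BlockTriangular (mat g) (OrderDual.toDual ∘ blk a) := fun i j h => hg i j h
  have h2 : BlockTriangular (mat h) (OrderDual.toDual ∘ blk a) := fun i j h => hh i j h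
  exact fun i j hij => h1.mul h2 hij

lemma blockLow_of_mem {a : Fin (n / 2)} {g : G n} (hg : g ∈ Bminus n) : BlockLow a g := by
  intro i j hij
  apply hg
  rw [Fin.lt_def]
  unfold blk at hij
  split_ifs at hij <;> omega

lemma blockLow_root (a : Fin (n / 2)) (t : ℂ) : BlockLow a (root a t) := by
  intro i j hij
  by_contra h
  unfold blk at hij
  rcases rootMatrix_support h with h | h | h
  · subst h; omega
  · split_ifs at hij <;> omega
  · split_ifs at hij <;> omega

lemma blk_simplePerm (a : Fin (n / 2)) (i : Fin n) : blk a (simplePerm n a i) = blk a i := by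
  unfold blk
  rw [simplePerm_val]
  split_ifs <;> omega

lemma blockLow_refl (a : Fin (n / 2)) : BlockLow a (refl a) := by
  intro i j hij
  refine (isMonomial_refl a).eq_zero fun h => ?_
  rw [h, blk_simplePerm] at hij
  exact hij.false

lemma blockLow_refl_inv (a : Fin (n / 2)) : BlockLow a (refl a)⁻¹ := by
  intro i j hij
  refine (isMonomial_refl a).inv.eq_zero fun h => ?_
  rw [h, simplePerm_inv, blk_simplePerm] at hij
  exact hij.false

lemma diag_ne_zero {b : G n} (hb : b ∈ Bminus n) (i : Fin n) : mat b i i ≠ 0 := by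
  have h := congrFun (congrFun (mat_mul_inv b) i) i
  rw [Matrix.mul_apply, Finset.sum_eq_single i, Matrix.one_apply_eq] at h
  · exact left_ne_zero_of_mul (h ▸ one_ne_zero)
  · intro c _ hc
    rcases lt_or_gt_of_ne hc with h | h
    · rw [(inv_mem hb : b⁻¹ ∈ Bminus n) c i h, mul_zero]
    · rw [hb i c h, zero_mul]
  · simp

/-- An element of the minimal parabolic subgroup whose first nontrivial row is lower triangular. -/
lemma mem_Bminus_of_row {a : Fin (n / 2)} {g : G n} (hg : BlockLow a g)
    (h : ∀ c, fstIdx a < c → mat g (fstIdx a) c = 0) : g ∈ Bminus n := by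
  have ha := a.2
  have h1 : mat g (fstIdx a) (fstIdx a) ≠ 0 := by
    have hs := sum_entries g (fstIdx a) (fstIdx a).rev
    rw [if_pos rfl, Finset.sum_eq_single (fstIdx a)] at hs
    · intro h0
      rw [h0, zero_mul] at hs
      exact pow_ne_zero _ (by norm_num) hs.symm
    · intro c _ hc
      rcases lt_or_gt_of_ne hc with hlt | hlt
      · rw [hg (fstIdx a).rev c.rev, mul_zero, mul_zero]
        have hlt' := Fin.lt_def.mp hlt
        simp only [fstIdx_val] at hlt'
        have s1 := blk_spec a (fstIdx a).rev
        have s2 := blk_spec a c.rev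
        simp only [Fin.val_rev, fstIdx_val] at s1 s2
        omega
      · rw [h c hlt, zero_mul]
    · simp
  have h2 : mat g ⟨n - 2 - a, by omega⟩ (fstIdx a).rev = 0 := by
    have hs := sum_entries g ⟨n - 2 - a, by omega⟩ (fstIdx a)
    rw [if_neg (by rw [Fin.ext_iff, Fin.val_rev, fstIdx_val]; simp only; omega),
      Finset.sum_eq_single (fstIdx a).rev] at hs
    · rw [Fin.rev_rev] at hs
      simpa [h1] using hs
    · intro c _ hc
      rcases lt_or_gt_of_ne hc with hlt | hlt
      · rw [h c.rev, mul_zero, mul_zero]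
        rwa [Fin.lt_rev_iff]
      · rw [hg _ c, zero_mul]
        have hlt' := Fin.lt_def.mp hlt
        simp only [Fin.val_rev, fstIdx_val] at hlt'
        unfold blk
        simp only
        split_ifs <;> omega
    · simp
  intro i j hij
  by_cases hb : blk a i < blk a j
  · exact hg i j hb
  · by_cases hi : i = fstIdx a
    · subst hi
      exact h j hij
    · have hi' := Fin.ext_iff.not.mp hi
      have hij' := Fin.lt_def.mp hij
      have e1 : i = ⟨n - 2 - a, by omega⟩ := by
        apply Fin.ext
        simp only [fstIdx_val] at hi' ⊢
        unfold blk at hb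
        split_ifs at hb <;> omega
      have e2 : j = (fstIdx a).rev := by
        apply Fin.ext
        simp only [fstIdx_val, Fin.val_rev] at hi' ⊢
        unfold blk at hb
        split_ifs at hb <;> omega
      rw [e1, e2, h2]

/-- The first row of the block of a short root is an isotropic vector. -/
lemma isotropic_row {a : Fin (n / 2)} (hs : IsShort a) {g : G n} (hg : BlockLow a g) :
    2 * mat g (fstIdx a) (fstIdx a) * mat g (fstIdx a) (simplePerm n a (fstIdx a)) =
      mat g (fstIdx a) (sndIdx a) ^ 2 := by
  have e3 : (simplePerm n a (fstIdx a) : ℕ) = a + 2 := by rw [simplePerm_val]; simp [hs]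
  set k := simplePerm n a (fstIdx a) with hk
  have r1 : (fstIdx a).rev = k := by
    apply Fin.ext; rw [Fin.val_rev, e3, fstIdx_val]; omega
  have r2 : (sndIdx a).rev = sndIdx a := by
    apply Fin.ext; rw [Fin.val_rev, sndIdx_val]; omega
  have r3 : k.rev = fstIdx a := by rw [← r1, Fin.rev_rev]
  have h := sum_entries g (fstIdx a) (fstIdx a)
  rw [if_neg (by rw [r1, Fin.ext_iff, e3, fstIdx_val]; omega)] at h
  have hsub : ∑ c, mat g (fstIdx a) c * ((-1) ^ (c : ℕ) * mat g (fstIdx a) c.rev) =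
      ∑ c ∈ {fstIdx a, sndIdx a, k}, mat g (fstIdx a) c * ((-1) ^ (c : ℕ) * mat g (fstIdx a) c.rev) := by
    symm
    apply Finset.sum_subset (Finset.subset_univ _)
    intro c _ hc
    simp only [Finset.mem_insert, Finset.mem_singleton, not_or, Fin.ext_iff, e3, fstIdx_val,
      sndIdx_val] at hc
    by_cases hlt : (c : ℕ) < a
    · rw [hg (fstIdx a) c.rev, mul_zero, mul_zero]
      unfold blk
      simp only [Fin.val_rev, fstIdx_val]
      split_ifs <;> omega
    · rw [hg (fstIdx a) c, zero_mul]
      unfold blk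
      simp only [fstIdx_val]
      split_ifs <;> omega
  rw [hsub, Finset.sum_insert, Finset.sum_insert, Finset.sum_singleton, r1, r2, r3, e3] at h
  · simp only [fstIdx_val, sndIdx_val, pow_succ] at h
    have hp : ((-1 : ℂ)) ^ (a : ℕ) ≠ 0 := pow_ne_zero _ (by norm_num)
    apply mul_left_cancel₀ hp
    linear_combination h
  · simp [Fin.ext_iff, e3]
  · simp [Fin.ext_iff, e3]

lemma apply_fst_eq_zero {a : Fin (n / 2)} {g : G n} (hg : BlockLow a g) {c : Fin n}
    (h1 : c ≠ sndIdx a) (h2 : c ≠ simplePerm n a (fstIdx a)) (h3 : fstIdx a < c) :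
    mat g (fstIdx a) c = 0 := by
  apply hg
  rw [Fin.lt_def] at h3
  have h2' := Fin.ext_iff.not.mp h2
  have h1' := Fin.ext_iff.not.mp h1
  have s0 := simplePerm_spec a (fstIdx a)
  simp only [fstIdx_val, sndIdx_val] at *
  have s1 := blk_spec a c
  have s2 := blk_spec a (fstIdx a)
  simp only [fstIdx_val] at s2
  omega

lemma simplePerm_fst_of_not_isShort {a : Fin (n / 2)} (hs : ¬ IsShort a) :
    simplePerm n a (fstIdx a) = sndIdx a := by
  apply Fin.ext
  rw [simplePerm_val, if_neg hs]
  simp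

lemma mul_root_mem {a : Fin (n / 2)} {p : G n} (hp : BlockLow a p)
    (h0 : mat p (fstIdx a) (fstIdx a) ≠ 0) :
    p * root a (-(mat p (fstIdx a) (sndIdx a) / mat p (fstIdx a) (fstIdx a))) ∈ Bminus n := by
  set t := mat p (fstIdx a) (sndIdx a) / mat p (fstIdx a) (fstIdx a) with ht
  have hq := hp.mul (blockLow_root a (-t))
  have h1 : mat (p * root a (-t)) (fstIdx a) (sndIdx a) = 0 := by
    rw [apply_mul_root_snd, ht]
    field_simp
    ring
  refine mem_Bminus_of_row hq fun c hc => ?_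
  by_cases e1 : c = sndIdx a
  · rw [e1, h1]
  by_cases e2 : c = simplePerm n a (fstIdx a)
  · by_cases hs : IsShort a
    · have := isotropic_row hs hq
      rw [h1, apply_mul_root_fst, ← e2] at this
      simpa [h0] using this
    · exact absurd (e2.trans (simplePerm_fst_of_not_isShort hs)) e1
  · exact apply_fst_eq_zero hq e1 e2 hc

lemma mul_refl_inv_mem {a : Fin (n / 2)} {p : G n} (hp : BlockLow a p)
    (h0 : mat p (fstIdx a) (fstIdx a) = 0) : p * (refl a)⁻¹ ∈ Bminus n := by
  refine mem_Bminus_of_row (hp.mul (blockLow_refl_inv a)) fun c hc => ?_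
  have h := (isMonomial_refl a).inv.apply_mul (mat p) (fstIdx a) (simplePerm n a c)
  rw [perm_inv_apply] at h
  rw [mat_mul, h]
  suffices mat p (fstIdx a) (simplePerm n a c) = 0 by rw [this, zero_mul]
  by_cases e : simplePerm n a c = fstIdx a
  · rw [e, h0]
  by_cases e1 : simplePerm n a c = sndIdx a
  · rw [e1]
    by_cases hs : IsShort a
    · have := isotropic_row hs hp
      rw [h0] at this
      simpa using this.symm
    · rw [← simplePerm_fst_of_not_isShort hs] at e1
      exact absurd ((simplePerm n a).injective e1) hc.ne'
  · apply apply_fst_eq_zero hp e1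
    · intro h
      exact hc.ne' ((simplePerm n a).injective h)
    · have ha := a.2
      have hc' := Fin.lt_def.mp hc
      have e' := Fin.ext_iff.not.mp e
      rw [Fin.lt_def]
      rw [simplePerm_val] at *
      simp only [fstIdx_val] at *
      split_ifs at * <;> omega

lemma flip_root_mem (a : Fin (n / 2)) (c : ℂ) : flip n (root a c) ∈ Bminus n := by
  rw [flip_mem_Bminus]
  exact root_mem_Bplus a c

lemma apply_mul_flip_root (g : G n) (a : Fin (n / 2)) (t : ℂ) (i j : Fin n) :
    mat (g * flip n (root a t)) i j = ∑ c, rootMatrix a t j c * mat g i c := by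
  rw [mat_mul, Matrix.mul_apply]
  refine Finset.sum_congr rfl fun c _ => ?_
  rw [mat_flip, mat_root, rootMatrix_rev, mul_comm]

lemma exists_eq_mul_refl_mul {a : Fin (n / 2)} {p : G n} (hp : BlockLow a p)
    (h0 : mat p (fstIdx a) (simplePerm n a (fstIdx a)) ≠ 0) :
    ∃ b ∈ Bminus n, ∃ c : ℂ, p = b * refl a * flip n (root a c) := by
  suffices ∃ c, mat (p * flip n (root a c)) (fstIdx a) (fstIdx a) = 0 by
    obtain ⟨c, hc⟩ := this
    have h := mul_refl_inv_mem (hp.mul (blockLow_of_mem (flip_root_mem a c))) hc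
    refine ⟨_, h, -c, ?_⟩
    rw [root_neg, map_inv]
    group
  by_cases hs : IsShort a
  · have h := isotropic_row hs hp
    refine ⟨- mat p (fstIdx a) (sndIdx a) / mat p (fstIdx a) (simplePerm n a (fstIdx a)), ?_⟩
    rw [apply_mul_flip_root, sum_rootMatrix_of_isShort a _ hs rfl (j := sndIdx a)
      (k := simplePerm n a (fstIdx a)) rfl (by rw [simplePerm_val]; simp [hs])]
    field_simp
    linear_combination h
  · rw [simplePerm_fst_of_not_isShort hs] at h0
    refine ⟨- mat p (fstIdx a) (fstIdx a) / mat p (fstIdx a) (sndIdx a), ?_⟩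
    rw [apply_mul_flip_root, sum_rootMatrix_of_isLower a _ (Or.inl rfl) (fun h => hs h.1)
      (j := sndIdx a) rfl]
    field_simp
    ring

/-! ### Bruhat cells -/

/-- The double coset of `P` for the lower Borel subgroup. -/
def cell (P : G n) : Set (G n) := {g | ∃ b ∈ Bminus n, ∃ c ∈ Bminus n, g = b * P * c}

/-- The condition that multiplication by a simple reflection increases the length. -/
def IsAscent (σ : Equiv.Perm (Fin n)) (a : Fin (n / 2)) : Prop :=
  σ⁻¹ (fstIdx a) < σ⁻¹ (simplePerm n a (fstIdx a))

lemma conj_root_mem {P : G n} {σ : Equiv.Perm (Fin n)} (hP : IsMonomial P σ)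
    (hσ : ∀ i : Fin n, σ⁻¹ i.rev = (σ⁻¹ i).rev) {a : Fin (n / 2)} (h : IsAscent σ a) (t : ℂ) :
    (P * refl a) * root a t * (P * refl a)⁻¹ ∈ Bminus n := by
  intro i j hij
  rw [(hP.mul (isMonomial_refl a)).conj_apply, mat_root]
  suffices rootMatrix a t ((simplePerm n a * σ) i) ((simplePerm n a * σ) j) = 0 by rw [this]; simp
  by_contra hne
  have key : ∀ k : Fin n, σ⁻¹ (simplePerm n a ((simplePerm n a * σ) k)) = k := by
    intro k
    rw [Equiv.Perm.mul_apply, simplePerm_simplePerm, perm_inv_apply]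
  set k := (simplePerm n a * σ) i with hk
  set l := (simplePerm n a * σ) j with hl
  have hij' : σ⁻¹ (simplePerm n a k) < σ⁻¹ (simplePerm n a l) := by rw [key, key]; exact hij
  have hkl : k ≠ l := by
    intro h
    rw [h] at hij'
    exact hij'.false
  unfold IsAscent at h
  have hr1 := hσ (fstIdx a)
  by_cases hs : IsShort a
  · have e2 : simplePerm n a (fstIdx a) = (fstIdx a).rev := by
      apply Fin.ext
      have := simplePerm_spec a (fstIdx a)
      simp only [Fin.val_rev, fstIdx_val] at *
      omega
    have hr2 := hσ (sndIdx a)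
    have e3 : (sndIdx a).rev = sndIdx a := by
      apply Fin.ext; rw [Fin.val_rev]; simp; omega
    have e4 : simplePerm n a (sndIdx a) = sndIdx a := by
      apply Fin.ext
      have := simplePerm_spec a (sndIdx a)
      simp only [sndIdx_val] at *
      omega
    have e5 : simplePerm n a (fstIdx a).rev = fstIdx a := by
      rw [← e2, simplePerm_simplePerm]
    rw [e2, hr1, Fin.lt_def, Fin.val_rev] at h
    rw [e3] at hr2
    have hm := congrArg Fin.val hr2
    rw [Fin.val_rev] at hm
    have hv1 := (σ⁻¹ (fstIdx a)).2
    have hv2 := (σ⁻¹ (sndIdx a)).2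
    have hkl' : (k = fstIdx a ∧ l = sndIdx a) ∨ (k = sndIdx a ∧ l = (fstIdx a).rev) ∨
        (k = fstIdx a ∧ l = (fstIdx a).rev) := by
      simp only [Fin.ext_iff, Fin.val_rev, fstIdx_val, sndIdx_val]
      rcases rootMatrix_support hne with h | h | h
      · exact absurd h hkl
      · unfold IsLower at h; omega
      · omega
    rcases hkl' with ⟨rfl', rfl''⟩ | ⟨rfl', rfl''⟩ | ⟨rfl', rfl''⟩ <;>
      rw [rfl', rfl''] at hij' <;>
      simp only [e2, e4, e5, hr1, Fin.lt_def, Fin.val_rev] at hij' <;> omega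
  · rw [simplePerm_fst_of_not_isShort hs] at h
    have f1 := simplePerm_fst_of_not_isShort hs
    have f2 : simplePerm n a (sndIdx a) = fstIdx a := by rw [← f1, simplePerm_simplePerm]
    have hkl' : (k = fstIdx a ∧ l = sndIdx a) ∨ (k = (sndIdx a).rev ∧ l = (fstIdx a).rev) := by
      simp only [Fin.ext_iff, Fin.val_rev, fstIdx_val, sndIdx_val]
      rcases rootMatrix_support hne with h | h | h
      · exact absurd h hkl
      · unfold IsLower at h; omega
      · exact absurd h.1 hs
    rcases hkl' with ⟨rfl', rfl''⟩ | ⟨rfl', rfl''⟩ <;> rw [rfl', rfl''] at hij'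
    · rw [f1, f2] at hij'
      exact hij'.not_gt h
    · rw [simplePerm_rev, simplePerm_rev, f1, f2, hσ, hσ, Fin.rev_lt_rev] at hij'
      exact hij'.not_gt h

lemma cell_mul_Bminus {P g b : G n} (hg : g ∈ cell P) (hb : b ∈ Bminus n) : g * b ∈ cell P := by
  obtain ⟨b₁, h₁, b₂, h₂, rfl⟩ := hg
  exact ⟨b₁, h₁, b₂ * b, mul_mem h₂ hb, by group⟩

lemma Bminus_mul_cell {P g b : G n} (hb : b ∈ Bminus n) (hg : g ∈ cell P) : b * g ∈ cell P := by
  obtain ⟨b₁, h₁, b₂, h₂, rfl⟩ := hg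
  exact ⟨b * b₁, mul_mem hb h₁, b₂, h₂, by group⟩

lemma cell_mul_refl {P : G n} {σ : Equiv.Perm (Fin n)} (hP : IsMonomial P σ)
    (hσ : ∀ i : Fin n, σ⁻¹ i.rev = (σ⁻¹ i).rev) {a : Fin (n / 2)} (h : IsAscent σ a)
    {g : G n} (hg : g ∈ cell P) : g * refl a ∈ cell (P * refl a) := by
  obtain ⟨b₁, h₁, b, hb, rfl⟩ := hg
  set p := (refl a)⁻¹ * b⁻¹ * refl a with hp
  have hbi : b⁻¹ ∈ Bminus n := inv_mem hb
  have hpl : BlockLow a p := ((blockLow_refl_inv a).mul (blockLow_of_mem hbi)).mul (blockLow_refl a)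
  have h0 : mat p (fstIdx a) (fstIdx a) ≠ 0 := by
    have := (isMonomial_refl a).inv.conj_apply b⁻¹ (fstIdx a) (fstIdx a)
    rw [inv_inv] at this
    rw [hp, this]
    refine mul_ne_zero (mul_ne_zero ((isMonomial_refl a).inv.ne_zero _) (diag_ne_zero hbi _)) ?_
    have h3 := (isMonomial_refl a).ne_zero ((simplePerm n a)⁻¹ (fstIdx a))
    rwa [perm_apply_inv] at h3
  have hL := mul_root_mem hpl h0
  set t := mat p (fstIdx a) (sndIdx a) / mat p (fstIdx a) (fstIdx a)
  refine ⟨b₁ * ((P * refl a) * root a (-t) * (P * refl a)⁻¹),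
    mul_mem h₁ (conj_root_mem hP hσ h _), (p * root a (-t))⁻¹, inv_mem hL, ?_⟩
  rw [hp]
  group

lemma exists_eq_mul_refl_mul_of_root {a : Fin (n / 2)} {b : G n} (hb : b ∈ Bminus n) {t : ℂ}
    (ht : t ≠ 0) : ∃ b' ∈ Bminus n, ∃ c : ℂ, b * root a t = b' * refl a * flip n (root a c) := by
  have hpl : BlockLow a (b * root a t) := (blockLow_of_mem hb).mul (blockLow_root a t)
  have h2 : mat (b * root a t) (fstIdx a) (sndIdx a) ≠ 0 := by
    rw [apply_mul_root_snd, hb (fstIdx a) (sndIdx a) (by simp [Fin.lt_def]), zero_add]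
    exact mul_ne_zero ht (diag_ne_zero hb _)
  refine exists_eq_mul_refl_mul hpl ?_
  by_cases hs : IsShort a
  · have h := isotropic_row hs hpl
    intro h0
    rw [h0, mul_zero] at h
    exact pow_ne_zero 2 h2 h.symm
  · rwa [simplePerm_fst_of_not_isShort hs]

lemma cell_mul_root {P : G n} {σ : Equiv.Perm (Fin n)} (hP : IsMonomial P σ)
    (hσ : ∀ i : Fin n, σ⁻¹ i.rev = (σ⁻¹ i).rev) {a : Fin (n / 2)} (h : IsAscent σ a)
    {g : G n} (hg : g ∈ cell P) {t : ℂ} (ht : t ≠ 0) : g * root a t ∈ cell (P * refl a) := by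
  obtain ⟨b₁, h₁, b, hb, rfl⟩ := hg
  obtain ⟨b', hb', c, hc⟩ := exists_eq_mul_refl_mul_of_root (a := a) hb ht
  have : b₁ * P * b * root a t = (b₁ * P * b') * refl a * flip n (root a c) := by
    rw [mul_assoc _ b, hc]
    group
  rw [this]
  exact cell_mul_Bminus (cell_mul_refl hP hσ h ⟨b₁, h₁, b', hb', rfl⟩) (flip_root_mem a c)

lemma exists_eq_of_mem_cell_mul_refl {P : G n} {a : Fin (n / 2)} {g : G n}
    (hg : g ∈ cell (P * refl a)) :
    ∃ g' ∈ cell P, ∃ c : ℂ, g = g' * refl a * flip n (root a c) := by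
  obtain ⟨b₁, h₁, b, hb, rfl⟩ := hg
  have hpl : BlockLow a (refl a * b) := (blockLow_refl a).mul (blockLow_of_mem hb)
  obtain ⟨b', hb', c, hc⟩ := exists_eq_mul_refl_mul hpl (by
    rw [mat_mul, (isMonomial_refl a).mul_apply]
    exact mul_ne_zero ((isMonomial_refl a).ne_zero _) (diag_ne_zero hb _))
  refine ⟨b₁ * P * b', ⟨b₁, h₁, b', hb', rfl⟩, c, ?_⟩
  rw [← mul_assoc b₁, mul_assoc _ (refl a), hc]
  group

end DoubleBruhat

namespace DoubleBruhat

open Matrix PlabicGraph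

variable {n : ℕ}

/-! ### Minors -/

section Det

variable {ι : Type*} [Fintype ι] [DecidableEq ι]

lemma det_eq_zero_of_rank_lt {M : Matrix ι ι ℂ} {ρ χ : ι → ℕ} (h : ∀ i j, ρ i < χ j → M i j = 0)
    (hlt : ∑ i, ρ i < ∑ i, χ i) : M.det = 0 := by
  rw [Matrix.det_apply]
  refine Finset.sum_eq_zero fun π _ => ?_
  rw [Finset.prod_eq_zero_iff.mpr, smul_zero]
  by_contra hc
  push Not at hc
  have : ∑ i, χ i ≤ ∑ i, ρ (π i) :=
    Finset.sum_le_sum fun i hi => not_lt.mp fun hlt => hc i hi (h _ _ hlt)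
  rw [Equiv.sum_comp π ρ] at this
  omega

lemma det_eq_prod_of_rank {M : Matrix ι ι ℂ} {ρ : ι → ℕ} (hρ : Function.Injective ρ)
    (h : ∀ i j, ρ i < ρ j → M i j = 0) : M.det = ∏ i, M i i := by
  rw [Matrix.det_apply, Finset.sum_eq_single 1]
  · simp
  · intro π _ hπ
    rw [Finset.prod_eq_zero_iff.mpr, smul_zero]
    by_contra hc
    push Not at hc
    have hle : ∀ i ∈ Finset.univ, ρ i ≤ ρ (π i) := fun i hi =>
      not_lt.mp fun hlt => hc i hi (h _ _ hlt)
    have heq := (Finset.sum_eq_sum_iff_of_le hle).mp (Equiv.sum_comp π ρ).symm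
    exact hπ (Equiv.ext fun i => hρ (heq i (Finset.mem_univ i)).symm)
  · simp

end Det

/-- The indices after the first block of a simple root. -/
abbrev After (a : Fin (n / 2)) : Type := {y : Fin n // simplePerm n a (fstIdx a) < y}

/-- The set `{c} ∪ After a`. -/
def withAfter (a : Fin (n / 2)) (c : Fin n) : Option (After a) → Fin n
  | none => c
  | some y => y.1

/-- The minor with the columns `c` and `After a`, and with the rows that `σ` takes to the first index
of the block and to `After a`. -/
noncomputable def minor (σ : Equiv.Perm (Fin n)) (a : Fin (n / 2)) (c : Fin n)
    (A : Matrix (Fin n) (Fin n) ℂ) : ℂ :=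
  (A.submatrix (fun k => σ⁻¹ (withAfter a (fstIdx a) k)) (withAfter a c)).det

lemma BlockLow.inv {a : Fin (n / 2)} {g : G n} (hg : BlockLow a g) : BlockLow a g⁻¹ := by
  have h1 : BlockTriangular (mat g) (OrderDual.toDual ∘ blk a) := fun i j h => hg i j h
  have h : mat g⁻¹ = (mat g)⁻¹ := by simp [mat, Matrix.coe_units_inv]
  have := g.1.invertible
  have h' := blockTriangular_inv_of_blockTriangular h1
  intro i j hij
  rw [h]
  exact h' hij

lemma BlockLow.apply_after {a : Fin (n / 2)} {p : G n} (hp : BlockLow a p) {z : Fin n}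
    (hz : z ≤ simplePerm n a (fstIdx a)) (y : After a) : mat p z y.1 = 0 := by
  apply hp
  have s1 := blk_spec a z
  have s2 := blk_spec a y.1
  have s3 := simplePerm_spec a (fstIdx a)
  have h := y.2
  have hy := y.1.2
  rw [Fin.lt_def] at h
  rw [Fin.le_def] at hz
  simp only [fstIdx_val] at s3
  omega

lemma sum_eq_sum_after {a : Fin (n / 2)} (f : Fin n → ℂ)
    (hf : ∀ z, z ≤ simplePerm n a (fstIdx a) → f z = 0) : ∑ z, f z = ∑ z : After a, f z.1 := by
  rw [← Finset.sum_subtype (Finset.univ.filter fun z => simplePerm n a (fstIdx a) < z) (by simp) f]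
  refine (Finset.sum_subset (Finset.subset_univ _) fun z _ hz => hf z ?_).symm
  simpa using hz

/-- The identity on the first index, and the matrix of `p` on `After a`. -/
noncomputable def tailBlock (a : Fin (n / 2)) (p : G n) :
    Matrix (Option (After a)) (Option (After a)) ℂ :=
  Matrix.of fun k l => match k, l with
    | none, none => 1
    | none, some _ => 0
    | some _, none => 0
    | some z, some y => mat p z.1 y.1

lemma tailBlock_mul {a : Fin (n / 2)} {p q : G n} (hq : BlockLow a q) :
    tailBlock a p * tailBlock a q = tailBlock a (p * q) := by
  ext k l
  rw [Matrix.mul_apply, Fintype.sum_option]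
  rcases k with _ | z <;> rcases l with _ | y <;> simp only [tailBlock, Matrix.of_apply] <;>
    try simp
  rw [mat_mul, Matrix.mul_apply, sum_eq_sum_after]
  intro w hw
  rw [hq.apply_after hw, mul_zero]

lemma det_tailBlock_ne_zero {a : Fin (n / 2)} {p : G n} (hp : BlockLow a p) :
    (tailBlock a p).det ≠ 0 := by
  have h := congrArg Matrix.det (tailBlock_mul (p := p) hp.inv)
  have h1 : tailBlock a (1 : G n) = 1 := by
    ext k l
    rcases k with _ | z <;> rcases l with _ | y <;>
      simp [tailBlock, mat_one, Matrix.one_apply, Subtype.ext_iff]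
  rw [Matrix.det_mul, mul_inv_cancel, h1, Matrix.det_one] at h
  exact left_ne_zero_of_mul (h ▸ one_ne_zero)

lemma withAfter_injective {a : Fin (n / 2)} {c : Fin n} (hc : c ≤ simplePerm n a (fstIdx a)) :
    Function.Injective (withAfter a c) := by
  intro k l h
  rcases k with _ | z <;> rcases l with _ | y <;> simp only [withAfter] at h
  · rfl
  · exact absurd (h ▸ y.2) (not_lt.mpr hc)
  · exact absurd (h ▸ z.2) (not_lt.mpr hc)
  · rw [Subtype.ext h]

lemma sndIdx_le (a : Fin (n / 2)) : sndIdx a ≤ simplePerm n a (fstIdx a) := by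
  have s3 := simplePerm_spec a (fstIdx a)
  simp only [fstIdx_val] at s3
  rw [Fin.le_def, sndIdx_val]
  omega

lemma fstIdx_lt_sndIdx (a : Fin (n / 2)) : fstIdx a < sndIdx a := by
  rw [Fin.lt_def]
  simp

lemma IsAscent.lt {σ : Equiv.Perm (Fin n)} (hσ : ∀ i : Fin n, σ⁻¹ i.rev = (σ⁻¹ i).rev)
    {a : Fin (n / 2)} (h : IsAscent σ a) {z : Fin n} (h1 : fstIdx a < z)
    (h2 : z ≤ simplePerm n a (fstIdx a)) : σ⁻¹ (fstIdx a) < σ⁻¹ z := by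
  by_cases hz : z = simplePerm n a (fstIdx a)
  · rw [hz]; exact h
  · have ha := a.2
    have s3 := simplePerm_spec a (fstIdx a)
    have hz' := Fin.ext_iff.not.mp hz
    rw [Fin.lt_def] at h1
    rw [Fin.le_def] at h2
    simp only [fstIdx_val] at s3 h1
    have e1 : z.rev = z := by
      apply Fin.ext; rw [Fin.val_rev]; omega
    have e2 : simplePerm n a (fstIdx a) = (fstIdx a).rev := by
      apply Fin.ext; rw [Fin.val_rev, fstIdx_val]; omega
    have h3 := hσ z
    rw [e1] at h3
    have h3' := congrArg Fin.val h3
    unfold IsAscent at h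
    rw [e2, hσ, Fin.lt_def] at h
    rw [Fin.val_rev] at h h3'
    rw [Fin.lt_def]
    have := (σ⁻¹ z).2
    have := (σ⁻¹ (fstIdx a)).2
    omega

lemma exists_minor_eq {P : G n} {σ : Equiv.Perm (Fin n)} (hP : IsMonomial P σ)
    (hσ : ∀ i : Fin n, σ⁻¹ i.rev = (σ⁻¹ i).rev) {a : Fin (n / 2)} (h : IsAscent σ a)
    {b p : G n} (hb : b ∈ Bminus n) (hp : BlockLow a p) :
    ∃ κ : ℂ, κ ≠ 0 ∧ ∀ c, fstIdx a ≤ c → c ≤ simplePerm n a (fstIdx a) →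
      minor σ a c (mat (b * P * p)) = κ * mat p (fstIdx a) c := by
  set A := fstIdx a with hA
  have hAs : A ≤ simplePerm n a A := (fstIdx_lt_sndIdx a).le.trans (sndIdx_le a)
  set M : Matrix (Fin n) (Fin n) ℂ := mat (P⁻¹ * b * P) with hM
  set f := withAfter a A with hf
  have hM0 : ∀ k l, σ⁻¹ k < σ⁻¹ l → M k l = 0 := by
    intro k l hkl
    have := hP.inv.conj_apply b k l
    rw [inv_inv] at this
    rw [hM, this, hb _ _ hkl]
    simp
  have hM1 : ∀ k, M k k ≠ 0 := by
    intro k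
    have := hP.inv.conj_apply b k k
    rw [inv_inv] at this
    rw [hM, this]
    refine mul_ne_zero (mul_ne_zero (hP.inv.ne_zero _) (diag_ne_zero hb _)) ?_
    have h3 := hP.ne_zero (σ⁻¹ k)
    rwa [perm_apply_inv] at h3
  have hg : ∀ k l, mat (b * P * p) (σ⁻¹ k) l = mat P (σ⁻¹ k) k * (M * mat p) k l := by
    intro k l
    have e : b * P * p = P * (P⁻¹ * b * P * p) := by group
    rw [e, mat_mul, hP.mul_apply, perm_apply_inv, hM, ← mat_mul]
  set N : Matrix (Option (After a)) (Option (After a)) ℂ := (M * mat p).submatrix f f with hN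
  have hafter : ∀ k (y : After a), (M * mat p) k y.1 = ∑ w : After a, M k w.1 * mat p w.1 y.1 := by
    intro k y
    rw [Matrix.mul_apply, sum_eq_sum_after]
    intro w hw
    rw [hp.apply_after hw, mul_zero]
  have hD : ∀ z, z ≤ simplePerm n a A →
      (N.updateCol none fun k => M (f k) z).det =
        (M.submatrix f (withAfter a z)).det * (tailBlock a p).det := by
    intro z _
    rw [← Matrix.det_mul]
    congr 1
    ext k l
    rw [Matrix.mul_apply, Fintype.sum_option]
    rcases l with _ | y
    · simp [tailBlock, withAfter]
    · rw [Matrix.updateCol_ne (by simp)]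
      simp only [tailBlock, withAfter, Matrix.of_apply, Matrix.submatrix_apply, mul_zero, zero_add]
      exact hafter (f k) y
  have hD' : ∀ z : After a, (N.updateCol none fun k => M (f k) z.1).det = 0 := by
    intro z
    have : (N.updateCol none fun k => M (f k) z.1) = M.submatrix f f *
        Matrix.of fun k l => match k, l with
          | none, _ => (0 : ℂ)
          | some w, none => if w = z then 1 else 0
          | some w, some y => mat p w.1 y.1 := by
      ext k l
      rw [Matrix.mul_apply, Fintype.sum_option]
      rcases l with _ | y
      · simp [hf, withAfter]
      · rw [Matrix.updateCol_ne (by simp)]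
        simp only [Matrix.of_apply, Matrix.submatrix_apply, mul_zero, zero_add]
        exact hafter (f k) y
    rw [this, Matrix.det_mul, Matrix.det_eq_zero_of_row_eq_zero (A := Matrix.of _) none (fun _ => rfl),
      mul_zero]
  have hD'' : ∀ z, A < z → z ≤ simplePerm n a A →
      (N.updateCol none fun k => M (f k) z).det = 0 := by
    intro z hz hz'
    rw [hD z hz', det_eq_zero_of_rank_lt (ρ := fun k => (σ⁻¹ (f k) : ℕ))
      (χ := fun k => (σ⁻¹ (withAfter a z k) : ℕ)), zero_mul]
    · exact fun k l hkl => hM0 _ _ hkl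
    · rw [Fintype.sum_option, Fintype.sum_option]
      have := Fin.lt_def.mp (h.lt hσ hz hz')
      rw [← hA] at this
      simp only [withAfter, hf]
      omega
  have hdet : (M.submatrix f f).det ≠ 0 := by
    rw [det_eq_prod_of_rank (ρ := fun k => (σ⁻¹ (f k) : ℕ))]
    · exact Finset.prod_ne_zero_iff.mpr fun k _ => hM1 _
    · intro k l hkl
      exact withAfter_injective hAs (σ⁻¹.injective (Fin.ext hkl))
    · exact fun k l hkl => hM0 _ _ hkl
  refine ⟨(∏ k, mat P (σ⁻¹ (f k)) (f k)) * ((M.submatrix f f).det * (tailBlock a p).det),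
    mul_ne_zero (Finset.prod_ne_zero_iff.mpr fun k _ => ?_)
      (mul_ne_zero hdet (det_tailBlock_ne_zero hp)), fun c hc1 hc2 => ?_⟩
  · have h3 := hP.ne_zero (σ⁻¹ (f k))
    rwa [perm_apply_inv] at h3
  have hm : minor σ a c (mat (b * P * p)) = (∏ k, mat P (σ⁻¹ (f k)) (f k)) *
      (N.updateCol none fun k => (M * mat p) (f k) c).det := by
    rw [minor, ← Matrix.det_mul_column]
    congr 1
    ext k l
    rw [Matrix.submatrix_apply, hg, Matrix.of_apply]
    congr 1
    rcases l with _ | y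
    · rw [Matrix.updateCol_self]
      rfl
    · rw [Matrix.updateCol_ne (by simp)]
      rfl
  have hv : (fun k => (M * mat p) (f k) c) = ∑ z, mat p z c • fun k => M (f k) z := by
    ext k
    simp [Matrix.mul_apply, mul_comm]
  rw [hm, mul_assoc, hv, ← Matrix.cramer_apply, map_sum, Finset.sum_apply,
    Finset.sum_eq_single A]
  · rw [map_smul, Pi.smul_apply, Matrix.cramer_apply, hD A hAs, smul_eq_mul]
    ring
  · intro z _ hz
    rw [map_smul, Pi.smul_apply, Matrix.cramer_apply]
    by_cases h1 : z < A
    · rw [hp z c, zero_smul]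
      have s1 := blk_spec a z
      have s2 := blk_spec a c
      have s3 := simplePerm_spec a A
      rw [Fin.le_def] at hc1 hc2
      rw [Fin.lt_def] at h1
      simp only [hA, fstIdx_val] at *
      omega
    · have h1' : A < z := lt_of_le_of_ne (not_lt.mp h1) (Ne.symm hz)
      by_cases h2 : z ≤ simplePerm n a A
      · rw [hD'' z h1' h2, smul_zero]
      · rw [hD' ⟨z, not_le.mp h2⟩, smul_zero]
  · simp

/-- The parameter of the last factor, as a function on the cell. -/
noncomputable def lastParam (σ : Equiv.Perm (Fin n)) (a : Fin (n / 2))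
    (A : Matrix (Fin n) (Fin n) ℂ) : ℂ := minor σ a (sndIdx a) A / minor σ a (fstIdx a) A

lemma minor_mul_root {P : G n} {σ : Equiv.Perm (Fin n)} (hP : IsMonomial P σ)
    (hσ : ∀ i : Fin n, σ⁻¹ i.rev = (σ⁻¹ i).rev) {a : Fin (n / 2)} (h : IsAscent σ a)
    {g : G n} (hg : g ∈ cell P) (t : ℂ) :
    minor σ a (fstIdx a) (mat (g * root a t)) ≠ 0 ∧ lastParam σ a (mat (g * root a t)) = t := by
  obtain ⟨b, hb, b', hb', rfl⟩ := hg
  obtain ⟨κ, hκ, hm⟩ := exists_minor_eq hP hσ h hb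
    ((blockLow_of_mem hb').mul (blockLow_root a t))
  have e : b * P * b' * root a t = b * P * (b' * root a t) := by group
  have h0 := diag_ne_zero hb' (fstIdx a)
  have h1 := hm (fstIdx a) le_rfl ((fstIdx_lt_sndIdx a).le.trans (sndIdx_le a))
  have h2 := hm (sndIdx a) (fstIdx_lt_sndIdx a).le (sndIdx_le a)
  rw [apply_mul_root_fst] at h1
  rw [apply_mul_root_snd, hb' _ _ (fstIdx_lt_sndIdx a), zero_add] at h2
  rw [e, lastParam, h1, h2]
  refine ⟨mul_ne_zero hκ h0, ?_⟩
  field_simp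

lemma mul_root_lastParam {P : G n} {σ : Equiv.Perm (Fin n)} (hP : IsMonomial P σ)
    (hσ : ∀ i : Fin n, σ⁻¹ i.rev = (σ⁻¹ i).rev) {a : Fin (n / 2)} (h : IsAscent σ a)
    {g : G n} (hg : g ∈ cell (P * refl a))
    (h0 : minor σ a (fstIdx a) (mat g) ≠ 0) :
    lastParam σ a (mat g) ≠ 0 ∧ g * root a (-lastParam σ a (mat g)) ∈ cell P := by
  obtain ⟨b, hb, b', hb', rfl⟩ := hg
  have hpl : BlockLow a (refl a * b') := (blockLow_refl a).mul (blockLow_of_mem hb')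
  obtain ⟨κ, hκ, hm⟩ := exists_minor_eq hP hσ h hb hpl
  have e : b * (P * refl a) * b' = b * P * (refl a * b') := by group
  have h1 := hm (fstIdx a) le_rfl ((fstIdx_lt_sndIdx a).le.trans (sndIdx_le a))
  have h2 := hm (sndIdx a) (fstIdx_lt_sndIdx a).le (sndIdx_le a)
  rw [e] at h0 ⊢
  have hlp : lastParam σ a (mat (b * P * (refl a * b'))) =
      mat (refl a * b') (fstIdx a) (sndIdx a) / mat (refl a * b') (fstIdx a) (fstIdx a) := by
    rw [lastParam, h1, h2, mul_div_mul_left _ _ hκ]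
  rw [h1] at h0
  have h0' := right_ne_zero_of_mul h0
  have hend : mat (refl a * b') (fstIdx a) (simplePerm n a (fstIdx a)) ≠ 0 := by
    rw [mat_mul, (isMonomial_refl a).mul_apply]
    exact mul_ne_zero ((isMonomial_refl a).ne_zero _) (diag_ne_zero hb' _)
  rw [hlp]
  constructor
  · refine div_ne_zero ?_ h0'
    by_cases hs : IsShort a
    · have := isotropic_row hs hpl
      intro h3
      rw [h3] at this
      exact mul_ne_zero (mul_ne_zero two_ne_zero h0') hend (by simpa using this)
    · rwa [← simplePerm_fst_of_not_isShort hs]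
  · exact ⟨b, hb, _, mul_root_mem hpl h0', by group⟩

end DoubleBruhat

namespace DoubleBruhat

open Matrix PlabicGraph

variable {n : ℕ}

/-! ### The exchange condition -/

/-- The permutation `s` is the reflection that exchanges `p` and `q`, and their opposites. -/
structure IsReflection (s : Equiv.Perm (Fin n)) (p q : Fin n) : Prop where
  left : s p = q
  right : s q = p
  left_rev : s p.rev = q.rev
  right_rev : s q.rev = p.rev
  fixed : ∀ x, x ≠ p → x ≠ q → x ≠ p.rev → x ≠ q.rev → s x = x

namespace IsReflection

variable {s s' μ : Equiv.Perm (Fin n)} {p q : Fin n}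

lemma unique (h : IsReflection s p q) (h' : IsReflection s' p q) : s = s' := by
  ext x
  by_cases h1 : x = p
  · rw [h1, h.left, h'.left]
  by_cases h2 : x = q
  · rw [h2, h.right, h'.right]
  by_cases h3 : x = p.rev
  · rw [h3, h.left_rev, h'.left_rev]
  by_cases h4 : x = q.rev
  · rw [h4, h.right_rev, h'.right_rev]
  rw [h.fixed x h1 h2 h3 h4, h'.fixed x h1 h2 h3 h4]

lemma symm_rev (h : IsReflection s p q) : IsReflection s q.rev p.rev where
  left := h.right_rev
  right := h.left_rev
  left_rev := by rw [Fin.rev_rev, Fin.rev_rev, h.right]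
  right_rev := by rw [Fin.rev_rev, Fin.rev_rev, h.left]
  fixed x h1 h2 h3 h4 := by
    rw [Fin.rev_rev] at h3 h4
    exact h.fixed x h4 h3 h2 h1

lemma conj (h : IsReflection s p q) (hμ : ∀ i, μ i.rev = (μ i).rev) :
    IsReflection (μ * s * μ⁻¹) (μ p) (μ q) where
  left := by simp [h.left]
  right := by simp [h.right]
  left_rev := by simp [← hμ, h.left_rev]
  right_rev := by simp [← hμ, h.right_rev]
  fixed x h1 h2 h3 h4 := by
    rw [← hμ] at h3 h4
    have := h.fixed (μ⁻¹ x) (fun e => h1 (Equiv.Perm.inv_eq_iff_eq.mp e))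
      (fun e => h2 (Equiv.Perm.inv_eq_iff_eq.mp e)) (fun e => h3 (Equiv.Perm.inv_eq_iff_eq.mp e))
      (fun e => h4 (Equiv.Perm.inv_eq_iff_eq.mp e))
    rw [Equiv.Perm.mul_apply, Equiv.Perm.mul_apply, this, perm_apply_inv]

end IsReflection

lemma isReflection_simplePerm (a : Fin (n / 2)) :
    IsReflection (simplePerm n a) (fstIdx a) (simplePerm n a (fstIdx a)) where
  left := rfl
  right := simplePerm_simplePerm a _
  left_rev := simplePerm_rev n a _
  right_rev := by rw [simplePerm_rev, simplePerm_simplePerm]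
  fixed x h1 h2 h3 h4 := by
    have s1 := simplePerm_spec a x
    have s2 := simplePerm_spec a (fstIdx a)
    rw [ne_eq, Fin.ext_iff] at h1 h2 h3 h4
    rw [Fin.val_rev] at h3 h4
    simp only [fstIdx_val] at *
    apply Fin.ext
    omega

lemma eq_of_simplePerm_lt {j : Fin (n / 2)} {p q : Fin n} (hp : p.rev ≠ p) (hq : q.rev ≠ q)
    (h : p < q) (h' : simplePerm n j q < simplePerm n j p) :
    (p = fstIdx j ∧ q = simplePerm n j (fstIdx j)) ∨
      (p = (simplePerm n j (fstIdx j)).rev ∧ q = (fstIdx j).rev) := by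
  have s1 := simplePerm_spec j p
  have s2 := simplePerm_spec j q
  have s3 := simplePerm_spec j (fstIdx j)
  rw [ne_eq, Fin.ext_iff, Fin.val_rev] at hp hq
  rw [Fin.lt_def] at h h'
  have e3 : IsShort j ∧ (simplePerm n j (fstIdx j) : ℕ) = j + 2 ∨
      ¬ IsShort j ∧ (simplePerm n j (fstIdx j) : ℕ) = j + 1 := by
    simp only [fstIdx_val] at s3
    omega
  simp only [Fin.ext_iff, Fin.val_rev, fstIdx_val]
  rcases s1 with ⟨hs, s1⟩ | ⟨hs, s1⟩ <;> rcases s2 with ⟨hs', s2⟩ | ⟨hs', s2⟩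
  · have e4 := e3.resolve_right fun h => h.1 hs
    omega
  · exact absurd hs hs'
  · exact absurd hs' hs
  · have e4 := (e3.resolve_left fun h => hs h.1).2
    clear e3 s3 hs'
    rcases s1 with s1 | s1 | s1 | s1 | s1 <;> omega

lemma exists_crossing (s : List (Fin (n / 2))) {p q : Fin n} (h : p < q)
    (h' : (permProd s)⁻¹ q < (permProd s)⁻¹ p) :
    ∃ (s₁ : List (Fin (n / 2))) (j : Fin (n / 2)) (s₂ : List (Fin (n / 2))), s = s₁ ++ j :: s₂ ∧
      (permProd s₂)⁻¹ p < (permProd s₂)⁻¹ q ∧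
      simplePerm n j ((permProd s₂)⁻¹ q) < simplePerm n j ((permProd s₂)⁻¹ p) := by
  induction s using List.reverseRecOn generalizing p q with
  | nil => exact absurd h' h.not_gt
  | append_singleton s j ih =>
    have e : ∀ x, (permProd (s ++ [j]))⁻¹ x = (permProd s)⁻¹ (simplePerm n j x) := by
      intro x
      rw [permProd_append, permProd_singleton, _root_.mul_inv_rev, simplePerm_inv, Equiv.Perm.mul_apply]
    by_cases hc : simplePerm n j q < simplePerm n j p
    · exact ⟨s, j, [], by simp, h, hc⟩
    · rw [e, e] at h'
      have hlt : simplePerm n j p < simplePerm n j q :=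
        lt_of_le_of_ne (not_lt.mp hc) fun h0 => h.ne ((simplePerm n j).injective h0)
      obtain ⟨s₁, k, s₂, rfl, h1, h2⟩ := ih hlt h'
      refine ⟨s₁, k, s₂ ++ [j], by simp, ?_⟩
      have e2 : ∀ x, (permProd (s₂ ++ [j]))⁻¹ x = (permProd s₂)⁻¹ (simplePerm n j x) := by
        intro x
        rw [permProd_append, permProd_singleton, _root_.mul_inv_rev, simplePerm_inv, Equiv.Perm.mul_apply]
      rw [e2, e2]
      exact ⟨h1, h2⟩

lemma exists_shorter {s : List (Fin (n / 2))} {a : Fin (n / 2)} (h : ¬ IsAscent (permProd s) a) :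
    ∃ s' : List (Fin (n / 2)), s'.length < (s ++ [a]).length ∧
      permProd s' = permProd (s ++ [a]) := by
  have hne : fstIdx a ≠ simplePerm n a (fstIdx a) :=
    ((fstIdx_lt_sndIdx a).trans_le (sndIdx_le a)).ne
  have h' : (permProd s)⁻¹ (simplePerm n a (fstIdx a)) < (permProd s)⁻¹ (fstIdx a) :=
    lt_of_le_of_ne (not_lt.mp h) fun h0 => hne ((permProd s)⁻¹.injective h0).symm
  obtain ⟨s₁, j, s₂, rfl, h1, h2⟩ :=
    exists_crossing s ((fstIdx_lt_sndIdx a).trans_le (sndIdx_le a)) h'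
  refine ⟨s₁ ++ s₂, by simp, ?_⟩
  have hmid : ∀ x : Fin n, x.rev ≠ x → ((permProd s₂)⁻¹ x).rev ≠ (permProd s₂)⁻¹ x := by
    intro x hx h0
    rw [← permProd_inv_rev] at h0
    exact hx ((permProd s₂)⁻¹.injective h0)
  have m1 : (fstIdx a).rev ≠ fstIdx a := by
    rw [ne_eq, Fin.ext_iff, Fin.val_rev, fstIdx_val]
    omega
  have m2 : (simplePerm n a (fstIdx a)).rev ≠ simplePerm n a (fstIdx a) := by
    rw [← simplePerm_rev]
    exact fun h0 => m1 ((simplePerm n a).injective h0)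
  have hc := (isReflection_simplePerm a).conj (permProd_inv_rev s₂)
  have hj : IsReflection (simplePerm n j) ((permProd s₂)⁻¹ (fstIdx a))
      ((permProd s₂)⁻¹ (simplePerm n a (fstIdx a))) := by
    rcases eq_of_simplePerm_lt (hmid _ m1) (hmid _ m2) h1 h2 with ⟨e1, e2⟩ | ⟨e1, e2⟩
    · rw [e1, e2]; exact isReflection_simplePerm j
    · rw [e1, e2]; exact (isReflection_simplePerm j).symm_rev
  have hcj := hc.unique hj
  rw [inv_inv] at hcj
  have hsq : simplePerm n j * simplePerm n j = 1 := by
    nth_rewrite 1 [← simplePerm_inv]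
    exact inv_mul_cancel _
  have : j :: s₂ = [j] ++ s₂ := rfl
  rw [this, permProd_append, permProd_append, permProd_append, permProd_append, permProd_singleton,
    permProd_singleton]
  have e : simplePerm n a * permProd s₂ = permProd s₂ * simplePerm n j := by
    rw [← hcj]
    group
  calc permProd s₂ * permProd s₁ = permProd s₂ * (simplePerm n j * simplePerm n j) * permProd s₁ := by
        rw [hsq, mul_one]
    _ = (simplePerm n a * permProd s₂) * simplePerm n j * permProd s₁ := by rw [e]; group
    _ = _ := by group

/-! ### Words -/

/-- The product of simple reflections in the Weyl group. -/
def weylProd (s : List (Fin (n / 2))) : W n := (s.map (simpleReflection n)).prod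

lemma reflProd_mem (s : List (Fin (n / 2))) : reflProd s ∈ N n := by
  refine list_prod_mem fun x hx => ?_
  obtain ⟨a, _, rfl⟩ := List.mem_map.mp hx
  exact (signedPerm (simplePerm n a) (simplePerm_rev n a)).2

lemma weylProd_eq_mk (s : List (Fin (n / 2))) :
    weylProd s = QuotientGroup.mk (⟨reflProd s, reflProd_mem s⟩ : N n) := by
  induction s with
  | nil => rfl
  | cons a s ih =>
    rw [weylProd, List.map_cons, List.prod_cons, ← weylProd, ih]
    rfl

lemma weylProd_eq_of_permProd_eq {s t : List (Fin (n / 2))} (h : permProd s = permProd t) :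
    weylProd s = weylProd t := by
  rw [weylProd_eq_mk, weylProd_eq_mk, QuotientGroup.eq, Subgroup.mem_subgroupOf]
  have h1 := isMonomial_reflProd s
  rw [h] at h1
  exact h1.inv_mul_mem_T (isMonomial_reflProd t)

/-- The letters of a given sign in a double word. -/
def part (ε : Bool) (w : List (Letter n)) : List (Fin (n / 2)) :=
  w.filterMap fun l => if l.2 = ε then some l.1 else none

lemma part_append (ε : Bool) (w w' : List (Letter n)) : part ε (w ++ w') = part ε w ++ part ε w' :=
  List.filterMap_append

lemma part_singleton_self (a : Fin (n / 2)) (ε : Bool) : part ε [(a, ε)] = [a] := by simp [part]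

lemma part_singleton_not (a : Fin (n / 2)) (ε : Bool) : part (!ε) [(a, ε)] = [] := by
  cases ε <;> simp [part]

lemma wordElem_eq (w : List (Letter n)) :
    wordElem w = (weylProd (part false w), weylProd (part true w)) := by
  induction w with
  | nil => rfl
  | cons l w ih =>
    obtain ⟨a, ε⟩ := l
    rw [wordElem, List.map_cons, List.prod_cons, ← wordElem, ih]
    cases ε <;> simp [letterElem, part, weylProd]

lemma length_part (w : List (Letter n)) :
    w.length = (part false w).length + (part true w).length := by
  induction w with
  | nil => rfl
  | cons l w ih =>
    obtain ⟨a, ε⟩ := l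
    have : (a, ε) :: w = [(a, ε)] ++ w := rfl
    rw [this, part_append, part_append]
    cases ε <;> simp [ih, part] <;> omega

lemma part_map_self (ε : Bool) (s : List (Fin (n / 2))) : part ε (s.map fun a => (a, ε)) = s := by
  induction s with
  | nil => rfl
  | cons a s ih => simp [part]

lemma part_map_not (ε : Bool) (s : List (Fin (n / 2))) :
    part (!ε) (s.map fun a => (a, ε)) = [] := by
  induction s with
  | nil => rfl
  | cons a s ih => cases ε <;> simp [part]

lemma IsReducedWord.of_append {w : List (Letter n)} {l : Letter n}
    (h : IsReducedWord (w ++ [l])) : IsReducedWord w := by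
  intro w' hw'
  have := h (w' ++ [l]) (by
    unfold wordElem at hw' ⊢
    rw [List.map_append, List.map_append, List.prod_append, List.prod_append, hw'])
  simpa using this

lemma IsReducedWord.isAscent {w : List (Letter n)} {a : Fin (n / 2)} {ε : Bool}
    (h : IsReducedWord (w ++ [(a, ε)])) : IsAscent (permProd (part ε w)) a := by
  by_contra hc
  obtain ⟨s, hs, he⟩ := exists_shorter hc
  have he' := weylProd_eq_of_permProd_eq he
  have := h (s.map (fun a => (a, ε)) ++ (part (!ε) w).map (fun a => (a, !ε))) (by
    rw [wordElem_eq, wordElem_eq]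
    have e1 := part_singleton_self a ε
    have e2 := part_singleton_not a ε
    have e3 := part_map_self ε s
    have e4 := part_map_not ε s
    have e5 := part_map_self (!ε) (part (!ε) w)
    have e6 := part_map_not (!ε) (part (!ε) w)
    rw [Bool.not_not] at e6
    cases ε <;> simp only [Bool.not_true, Bool.not_false] at * <;>
      simp only [part_append, e1, e2, e3, e4, e5, e6, List.append_nil, List.nil_append, he'])
  have hl := length_part w
  simp only [List.length_append, List.length_map, List.length_singleton] at this hs
  cases ε <;> simp only [Bool.not_true, Bool.not_false] at * <;> omega

end DoubleBruhat

namespace Birational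

variable {ι κ : Type}

/-- On `U`, the function `f` is a quotient of two polynomials whose denominator does not vanish. -/
def IsFracOn (f : (ι → ℂ) → ℂ) (U : Set (ι → ℂ)) : Prop :=
  ∃ p q : MvPolynomial ι ℂ, ∀ z ∈ U, MvPolynomial.eval z q ≠ 0 ∧
    f z = MvPolynomial.eval z p / MvPolynomial.eval z q

namespace IsFracOn

variable {f g : (ι → ℂ) → ℂ} {U U' : Set (ι → ℂ)}

lemma const (c : ℂ) : IsFracOn (fun _ : ι → ℂ => c) U :=
  ⟨MvPolynomial.C c, 1, fun z _ => by simp⟩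

lemma coord (i : ι) : IsFracOn (fun z : ι → ℂ => z i) U :=
  ⟨MvPolynomial.X i, 1, fun z _ => by simp⟩

lemma congr (hf : IsFracOn f U) (h : ∀ z ∈ U, g z = f z) : IsFracOn g U := by
  obtain ⟨p, q, hpq⟩ := hf
  exact ⟨p, q, fun z hz => ⟨(hpq z hz).1, (h z hz).trans (hpq z hz).2⟩⟩

lemma add (hf : IsFracOn f U) (hg : IsFracOn g U) : IsFracOn (fun z => f z + g z) U := by
  obtain ⟨p, q, hpq⟩ := hf
  obtain ⟨p', q', hpq'⟩ := hg
  refine ⟨p * q' + q * p', q * q', fun z hz => ?_⟩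
  obtain ⟨h1, h2⟩ := hpq z hz
  obtain ⟨h3, h4⟩ := hpq' z hz
  simp only [map_mul, map_add]
  exact ⟨mul_ne_zero h1 h3, by rw [h2, h4, div_add_div _ _ h1 h3]⟩

lemma mul (hf : IsFracOn f U) (hg : IsFracOn g U) : IsFracOn (fun z => f z * g z) U := by
  obtain ⟨p, q, hpq⟩ := hf
  obtain ⟨p', q', hpq'⟩ := hg
  refine ⟨p * p', q * q', fun z hz => ?_⟩
  obtain ⟨h1, h2⟩ := hpq z hz
  obtain ⟨h3, h4⟩ := hpq' z hz
  simp only [map_mul]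
  exact ⟨mul_ne_zero h1 h3, by rw [h2, h4, div_mul_div_comm]⟩

lemma neg (hf : IsFracOn f U) : IsFracOn (fun z => - f z) U :=
  ((const (-1)).mul hf).congr fun z _ => by ring

lemma inv (hf : IsFracOn f U) (h : ∀ z ∈ U, f z ≠ 0) : IsFracOn (fun z => (f z)⁻¹) U := by
  obtain ⟨p, q, hpq⟩ := hf
  refine ⟨q, p, fun z hz => ?_⟩
  obtain ⟨h1, h2⟩ := hpq z hz
  have h3 := h z hz
  rw [h2] at h3
  exact ⟨fun h0 => h3 (by rw [h0, zero_div]), by simp only [h2, inv_div]⟩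

lemma div (hf : IsFracOn f U) (hg : IsFracOn g U) (h : ∀ z ∈ U, g z ≠ 0) :
    IsFracOn (fun z => f z / g z) U :=
  (hf.mul (hg.inv h)).congr fun _ _ => div_eq_mul_inv _ _

lemma pow (hf : IsFracOn f U) (k : ℕ) : IsFracOn (fun z => f z ^ k) U := by
  induction k with
  | zero => exact (const 1).congr fun z _ => pow_zero _
  | succ k ih => exact (ih.mul hf).congr fun z _ => pow_succ _ _

lemma sum {α : Type*} (s : Finset α) {F : α → (ι → ℂ) → ℂ} (h : ∀ i ∈ s, IsFracOn (F i) U) :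
    IsFracOn (fun z => ∑ i ∈ s, F i z) U := by
  classical
  induction s using Finset.induction_on with
  | empty => exact (const 0).congr fun z _ => by simp
  | insert a s ha ih =>
    refine ((h a (Finset.mem_insert_self _ _)).add
      (ih fun i hi => h i (Finset.mem_insert_of_mem hi))).congr fun z _ => ?_
    rw [Finset.sum_insert ha]

lemma prod {α : Type*} (s : Finset α) {F : α → (ι → ℂ) → ℂ} (h : ∀ i ∈ s, IsFracOn (F i) U) :
    IsFracOn (fun z => ∏ i ∈ s, F i z) U := by
  classical
  induction s using Finset.induction_on with
  | empty => exact (const 1).congr fun z _ => by simp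
  | insert a s ha ih =>
    refine ((h a (Finset.mem_insert_self _ _)).mul
      (ih fun i hi => h i (Finset.mem_insert_of_mem hi))).congr fun z _ => ?_
    rw [Finset.prod_insert ha]

lemma det {α : Type*} [Fintype α] [DecidableEq α] {F : (ι → ℂ) → Matrix α α ℂ}
    (h : ∀ i j, IsFracOn (fun z => F z i j) U) : IsFracOn (fun z => (F z).det) U := by
  refine (sum Finset.univ (F := fun σ z => ((Equiv.Perm.sign σ : ℤ) : ℂ) * ∏ i, F z (σ i) i)
    fun σ _ => (const _).mul (prod _ fun i _ => h _ _)).congr fun z _ => ?_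
  exact Matrix.det_apply' _

lemma matrix_mul {α β γ : Type*} [Fintype β] {F : (ι → ℂ) → Matrix α β ℂ}
    {F' : (ι → ℂ) → Matrix β γ ℂ} (h : ∀ i j, IsFracOn (fun z => F z i j) U)
    (h' : ∀ i j, IsFracOn (fun z => F' z i j) U) (i : α) (j : γ) :
    IsFracOn (fun z => (F z * F' z) i j) U :=
  (sum Finset.univ fun k _ => (h i k).mul (h' k j)).congr fun _ _ => Matrix.mul_apply

lemma eval_comp {h : (ι → ℂ) → κ → ℂ} (hh : ∀ j, IsFracOn (fun z => h z j) U)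
    (p : MvPolynomial κ ℂ) : IsFracOn (fun z => MvPolynomial.eval (h z) p) U := by
  induction p using MvPolynomial.induction_on with
  | C a => exact (const a).congr fun z _ => by simp
  | add p q hp hq => exact (hp.add hq).congr fun z _ => by simp
  | mul_X p j hp => exact (hp.mul (hh j)).congr fun z _ => by simp

lemma comp {V : Set (κ → ℂ)} {f : (κ → ℂ) → ℂ} (hf : IsFracOn f V) {h : (ι → ℂ) → κ → ℂ}
    (hh : ∀ j, IsFracOn (fun z => h z j) U) (hm : Set.MapsTo h U V) :
    IsFracOn (fun z => f (h z)) U := by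
  obtain ⟨p, q, hpq⟩ := hf
  exact ((eval_comp hh p).div (eval_comp hh q) fun z hz => (hpq _ (hm hz)).1).congr
    fun z hz => (hpq _ (hm hz)).2

end IsFracOn

lemma isRegularOn_of_isFracOn {f : (ι → ℂ) → κ → ℂ} {U : Set (ι → ℂ)}
    (h : ∀ j, IsFracOn (fun z => f z j) U) : IsRegularOn f U := by
  intro j x hx
  obtain ⟨p, q, hpq⟩ := h j
  exact ⟨p, q, (hpq x hx).1, fun z hz _ => (hpq z hz).2⟩

/-- If the image of the open set `δ ≠ 0` of an affine space under a regular map meets the open set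
`a ≠ 0`, then a polynomial that vanishes on this intersection vanishes on the whole image. -/
lemma eval_eq_zero_of_isFracOn {σ : Type} {δ : (σ → ℂ) → ℂ} {φ : (σ → ℂ) → κ → ℂ} {a : (κ → ℂ) → ℂ}
    (hδ : IsFracOn δ Set.univ) (hφ : ∀ j, IsFracOn (fun x => φ x j) {x | δ x ≠ 0})
    (ha : IsFracOn a Set.univ) {x₀ : σ → ℂ} (h₀ : δ x₀ ≠ 0) (h₁ : a (φ x₀) ≠ 0)
    {P : MvPolynomial κ ℂ} (hP : ∀ x, δ x ≠ 0 → a (φ x) ≠ 0 → MvPolynomial.eval (φ x) P = 0)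
    {x : σ → ℂ} (hx : δ x ≠ 0) : MvPolynomial.eval (φ x) P = 0 := by
  obtain ⟨d, d', hd⟩ := hδ
  obtain ⟨p, p', hp⟩ := IsFracOn.eval_comp hφ P
  obtain ⟨r, r', hr⟩ := ha.comp hφ (Set.mapsTo_univ _ _)
  simp only at hp hr
  have key : ∀ x, δ x ≠ 0 → MvPolynomial.eval x d ≠ 0 := fun x hx h0 =>
    hx (by rw [(hd x trivial).2, h0, zero_div])
  have hz : d * r * p = 0 := by
    apply MvPolynomial.funext
    intro y
    rw [map_zero, map_mul, map_mul]
    by_cases h1 : δ y = 0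
    · have := (hd y trivial).2
      rw [h1, eq_comm, div_eq_zero_iff] at this
      rw [this.resolve_right (hd y trivial).1]
      simp
    · by_cases h2 : a (φ y) = 0
      · have := (hr y h1).2
        rw [h2, eq_comm, div_eq_zero_iff] at this
        rw [this.resolve_right (hr y h1).1]
        simp
      · have := (hp y h1).2
        rw [hP y h1 h2, eq_comm, div_eq_zero_iff] at this
        rw [this.resolve_right (hp y h1).1]
        simp
  have hd0 : d ≠ 0 := fun h => key x₀ h₀ (by rw [h, map_zero])
  have hr0 : r ≠ 0 := fun h => h₁ (by rw [(hr x₀ h₀).2, h, map_zero, zero_div])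
  have hp0 : p = 0 := (mul_eq_zero.mp hz).resolve_left (mul_ne_zero hd0 hr0)
  have := (hp x hx).2
  rwa [hp0, map_zero, zero_div] at this

end Birational

namespace DoubleBruhat

open Matrix PlabicGraph Birational

variable {n : ℕ}

/-! ### Gauss decomposition -/

/-- The leading principal submatrix with the rows and columns before `i`. -/
def lead (M : Matrix (Fin n) (Fin n) ℂ) (i : Fin n) : Matrix {j // j < i} {j // j < i} ℂ :=
  M.submatrix Subtype.val Subtype.val

/-- The unipotent lower triangular matrix `L` such that `L * M` is upper triangular. -/
noncomputable def gaussFactor (M : Matrix (Fin n) (Fin n) ℂ) : Matrix (Fin n) (Fin n) ℂ :=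
  Matrix.of fun i j => if h : j < i then
    -(∑ l : {l // l < i}, M i l.1 * (lead M i).adjugate l ⟨j, h⟩) / (lead M i).det
    else if j = i then 1 else 0

lemma gaussFactor_self (M : Matrix (Fin n) (Fin n) ℂ) (i : Fin n) : gaussFactor M i i = 1 := by
  simp [gaussFactor]

lemma gaussFactor_lower (M : Matrix (Fin n) (Fin n) ℂ) :
    BlockTriangular (gaussFactor M) OrderDual.toDual := by
  intro i j hij
  have hij' : i < j := hij
  simp [gaussFactor, hij'.not_gt, hij'.ne']

lemma gaussFactor_mul_apply {M : Matrix (Fin n) (Fin n) ℂ} {i : Fin n}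
    (h : (lead M i).det ≠ 0) {j : Fin n} (hj : j < i) : (gaussFactor M * M) i j = 0 := by
  rw [Matrix.mul_apply, ← Finset.sum_filter_add_sum_filter_not Finset.univ (fun k => k < i)]
  have h1 : ∑ k ∈ Finset.univ.filter (fun k => k < i), gaussFactor M i k * M k j =
      - M i j := by
    rw [Finset.sum_subtype (Finset.univ.filter fun k => k < i) (p := fun k => k < i) (by simp)]
    have hk : ∀ k : {k // k < i}, gaussFactor M i k.1 * M k.1 j =
        -((∑ l : {l // l < i}, M i l.1 * (lead M i).adjugate l k) * lead M i k ⟨j, hj⟩)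
          / (lead M i).det := by
      intro k
      simp only [gaussFactor, Matrix.of_apply, dif_pos k.2, lead, Matrix.submatrix_apply]
      ring
    rw [Finset.sum_congr rfl fun k _ => hk k, ← Finset.sum_div, Finset.sum_neg_distrib,
      div_eq_iff h, neg_mul, neg_inj]
    have hadj := congrFun (congrArg (fun A => (fun l : {l // l < i} => M i l.1) ᵥ* A)
      (Matrix.adjugate_mul (lead M i))) ⟨j, hj⟩
    simp only [← Matrix.vecMul_vecMul, Matrix.vecMul_smul, Matrix.vecMul_one, Pi.smul_apply,
      smul_eq_mul] at hadj
    rw [mul_comm (M i j)]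
    exact hadj
  have h2 : ∑ k ∈ Finset.univ.filter (fun k => ¬ k < i), gaussFactor M i k * M k j = M i j := by
    rw [Finset.sum_eq_single i]
    · rw [gaussFactor_self, one_mul]
    · intro k hk hki
      have : i < k := lt_of_le_of_ne (not_lt.mp (Finset.mem_filter.mp hk).2) (Ne.symm hki)
      rw [gaussFactor_lower M this, zero_mul]
    · simp
  rw [h1, h2, neg_add_cancel]

lemma omega_conj_apply (A : Matrix (Fin n) (Fin n) ℂ) (i j : Fin n) :
    (Omega n * Aᵀ * (Omega n)ᵀ) i j = (-1) ^ (i : ℕ) * A j.rev i.rev * (-1) ^ (j : ℕ) := by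
  simp [Matrix.mul_apply, Omega]

lemma Omega_transpose_mul (n : ℕ) : (Omega n)ᵀ * Omega n = 1 :=
  mul_eq_one_comm.mp (Omega_mul_transpose n)

lemma gaussFactor_rel {M : Matrix (Fin n) (Fin n) ℂ} (hM : M * Omega n * Mᵀ = Omega n)
    (h : ∀ i, (lead M i).det ≠ 0) :
    gaussFactor M * Omega n * (gaussFactor M)ᵀ = Omega n := by
  set L := gaussFactor M with hL
  have hR : BlockTriangular (L * M) id := fun i j hij => gaussFactor_mul_apply (h i) hij
  have hK : L * (Omega n * Lᵀ * (Omega n)ᵀ) = (L * M) * (Omega n * (L * M)ᵀ * (Omega n)ᵀ) := by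
    rw [Matrix.transpose_mul]
    calc L * (Omega n * Lᵀ * (Omega n)ᵀ) = L * ((M * Omega n * Mᵀ) * Lᵀ * (Omega n)ᵀ) := by rw [hM]
      _ = _ := by simp only [Matrix.mul_assoc]
  have hlow : BlockTriangular (Omega n * Lᵀ * (Omega n)ᵀ) OrderDual.toDual := by
    intro i j hij
    have hij' : i < j := hij
    have h0 : L j.rev i.rev = 0 := gaussFactor_lower M (Fin.rev_lt_rev.mpr hij')
    rw [omega_conj_apply, h0, mul_zero, zero_mul]
  have hup : BlockTriangular (Omega n * (L * M)ᵀ * (Omega n)ᵀ) id := by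
    intro i j hij
    have hij' : j < i := hij
    have h0 : (L * M) j.rev i.rev = 0 := hR (Fin.rev_lt_rev.mpr hij')
    rw [omega_conj_apply, h0, mul_zero, zero_mul]
  have hone : L * (Omega n * Lᵀ * (Omega n)ᵀ) = 1 := by
    ext i j
    rcases lt_trichotomy i j with hij | hij | hij
    · rw [((gaussFactor_lower M).mul hlow) hij, Matrix.one_apply_ne hij.ne]
    · subst hij
      rw [Matrix.one_apply_eq, Matrix.mul_apply, Finset.sum_eq_single i]
      · rw [omega_conj_apply, hL, gaussFactor_self, gaussFactor_self, mul_one, one_mul, ← mul_pow]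
        simp
      · intro k _ hk
        rcases lt_or_gt_of_ne hk with hk | hk
        · rw [hlow hk, mul_zero]
        · rw [hL, gaussFactor_lower M hk, zero_mul]
      · simp
    · rw [hK, (hR.mul hup) hij, Matrix.one_apply_ne hij.ne']
  calc L * Omega n * Lᵀ = L * (Omega n * Lᵀ * (Omega n)ᵀ) * Omega n := by
        simp only [Matrix.mul_assoc, Omega_transpose_mul, Matrix.mul_one]
    _ = Omega n := by rw [hone, Matrix.one_mul]

/-- The lower triangular factor of the Gauss decomposition in `G n`. -/
noncomputable def gauss (m : G n) (h : ∀ i, (lead (mat m) i).det ≠ 0) : G n :=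
  ofMat (gaussFactor (mat m)) (gaussFactor_rel (mat_rel m) h)

lemma gauss_mem (m : G n) (h : ∀ i, (lead (mat m) i).det ≠ 0) : gauss m h ∈ Bminus n :=
  fun _ _ hij => gaussFactor_lower (mat m) hij

lemma gauss_mul_mem (m : G n) (h : ∀ i, (lead (mat m) i).det ≠ 0) : gauss m h * m ∈ Bplus n :=
  fun i _ hij => gaussFactor_mul_apply (h i) hij

lemma lead_mul_of_lower {A B : Matrix (Fin n) (Fin n) ℂ} (hA : ∀ i j, i < j → A i j = 0)
    (i : Fin n) : lead (A * B) i = lead A i * lead B i := by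
  ext j k
  simp only [lead, Matrix.submatrix_apply, Matrix.mul_apply]
  rw [← Finset.sum_subtype (Finset.univ.filter fun k => k < i) (p := fun k => k < i) (by simp)
    (fun l => A j.1 l * B l k.1)]
  refine (Finset.sum_subset (Finset.subset_univ _) fun l _ hl => ?_).symm
  have hl' : i ≤ l := by simpa using hl
  rw [hA j.1 l (j.2.trans_le hl'), zero_mul]

lemma lead_mul_of_upper {A B : Matrix (Fin n) (Fin n) ℂ} (hB : ∀ i j, j < i → B i j = 0)
    (i : Fin n) : lead (A * B) i = lead A i * lead B i := by
  ext j k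
  simp only [lead, Matrix.submatrix_apply, Matrix.mul_apply]
  rw [← Finset.sum_subtype (Finset.univ.filter fun k => k < i) (p := fun k => k < i) (by simp)
    (fun l => A j.1 l * B l k.1)]
  refine (Finset.sum_subset (Finset.subset_univ _) fun l _ hl => ?_).symm
  have hl' : i ≤ l := by simpa using hl
  rw [hB l k.1 (k.2.trans_le hl'), mul_zero]

lemma lead_one (i : Fin n) : lead (1 : Matrix (Fin n) (Fin n) ℂ) i = 1 := by
  ext j k
  simp [lead, Matrix.one_apply, Subtype.ext_iff]

lemma det_lead_mul_ne_zero {b c : G n} (hb : b ∈ Bminus n) (hc : c ∈ Bplus n) (i : Fin n) :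
    (lead (mat (b * c)) i).det ≠ 0 := by
  rw [mat_mul, lead_mul_of_lower hb, Matrix.det_mul]
  refine mul_ne_zero ?_ ?_
  · have h := congrArg (fun A => (lead A i).det) (mat_mul_inv b)
    simp only [lead_mul_of_lower hb, lead_one, Matrix.det_mul, Matrix.det_one] at h
    exact left_ne_zero_of_mul (h ▸ one_ne_zero)
  · have h := congrArg (fun A => (lead A i).det) (mat_inv_mul c)
    simp only [lead_mul_of_upper hc, lead_one, Matrix.det_mul, Matrix.det_one] at h
    exact right_ne_zero_of_mul (h ▸ one_ne_zero)

/-! ### Parametrization of Bruhat cells -/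

/-- Words in which every letter increases the length. -/
inductive IsAscending : List (Fin (n / 2)) → Prop
  | nil : IsAscending []
  | snoc {s : List (Fin (n / 2))} {a : Fin (n / 2)} (hs : IsAscending s)
      (ha : IsAscent (permProd s) a) : IsAscending (s ++ [a])

lemma IsReducedWord.isAscending {w : List (Letter n)} (h : IsReducedWord w) (ε : Bool) :
    IsAscending (part ε w) := by
  induction w using List.reverseRecOn with
  | nil => exact IsAscending.nil
  | append_singleton w l ih =>
    obtain ⟨a, ε'⟩ := l
    rw [part_append]
    by_cases he : ε' = ε
    · subst he
      rw [part_singleton_self]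
      exact (ih h.of_append).snoc h.isAscent
    · have : ε = !ε' := by cases ε <;> cases ε' <;> simp_all
      rw [this, part_singleton_not, List.append_nil, ← this]
      exact ih h.of_append

/-- Representatives for the orbits of the Borel subgroup on a Bruhat cell; the word is reversed. -/
noncomputable def chartRev : List (Fin (n / 2)) → (ℕ → ℂ) → G n
  | [], _ => 1
  | a :: s, q => chartRev s q * refl a * flip n (root a (q s.length))

/-- Representatives for the orbits of the Borel subgroup on a Bruhat cell. -/
noncomputable def chart (s : List (Fin (n / 2))) (q : ℕ → ℂ) : G n := chartRev s.reverse q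

lemma chart_append (s : List (Fin (n / 2))) (a : Fin (n / 2)) (q : ℕ → ℂ) :
    chart (s ++ [a]) q = chart s q * refl a * flip n (root a (q s.length)) := by
  simp [chart, chartRev]

lemma chart_congr (s : List (Fin (n / 2))) {q q' : ℕ → ℂ} (h : ∀ k < s.length, q k = q' k) :
    chart s q = chart s q' := by
  induction s using List.reverseRecOn with
  | nil => rfl
  | append_singleton s a ih =>
    rw [List.length_append, List.length_singleton] at h
    rw [chart_append, chart_append, ih fun k hk => h k (by omega), h _ (by omega)]

lemma chart_mem_cell {s : List (Fin (n / 2))} (hs : IsAscending s) (q : ℕ → ℂ) :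
    chart s q ∈ cell (reflProd s) := by
  induction hs with
  | nil => exact ⟨1, one_mem _, 1, one_mem _, by simp [chart, chartRev]⟩
  | snoc hs ha ih =>
    rw [chart_append, reflProd_concat]
    exact cell_mul_Bminus (cell_mul_refl (isMonomial_reflProd _) (permProd_inv_rev _) ha ih)
      (flip_root_mem _ _)

lemma exists_eq_mul_chart {s : List (Fin (n / 2))} {g : G n} (hg : g ∈ cell (reflProd s)) :
    ∃ b ∈ Bminus n, ∃ q, g = b * chart s q := by
  induction s using List.reverseRecOn generalizing g with
  | nil =>
    obtain ⟨b, hb, b', hb', rfl⟩ := hg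
    exact ⟨b * b', mul_mem hb hb', 0, by simp [chart, chartRev]⟩
  | append_singleton s a ih =>
    rw [reflProd_concat] at hg
    obtain ⟨g', hg', c, rfl⟩ := exists_eq_of_mem_cell_mul_refl hg
    obtain ⟨b, hb, q, rfl⟩ := ih hg'
    refine ⟨b, hb, Function.update q s.length c, ?_⟩
    rw [chart_append, Function.update_self,
      chart_congr s (q := Function.update q s.length c) (q' := q) fun k hk => Function.update_of_ne hk.ne _ _]
    group

/-! ### Density in double Bruhat cells -/

/-- The double Bruhat cell of two words. -/
def doubleCell (s t : List (Fin (n / 2))) : Set (G n) :=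
  {g | flip n g ∈ cell (reflProd s) ∧ g ∈ cell (reflProd t)}

/-- The coordinates of an element of `G n` in the space of matrices. -/
def coords (g : G n) : Fin n × Fin n → ℂ := fun p => mat g p.1 p.2

/-- A point of the space of matrices as a matrix. -/
def toMat (z : Fin n × Fin n → ℂ) : Matrix (Fin n) (Fin n) ℂ := Matrix.of fun i j => z (i, j)

lemma toMat_coords (g : G n) : toMat (coords g) = mat g := rfl

section Density

variable (s t : List (Fin (n / 2)))

/-- The element of which the Gauss decomposition is taken to parametrize a double Bruhat cell. -/
noncomputable def mixed (x : Bool × ℕ → ℂ) : G n :=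
  chart t (fun k => x (true, k)) * (flip n (chart s (fun k => x (false, k))))⁻¹

/-- The product of the leading principal minors of `mixed`. -/
noncomputable def mixedMinor (x : Bool × ℕ → ℂ) : ℂ := ∏ i, (lead (mat (mixed s t x)) i).det

/-- The parametrization of a double Bruhat cell. -/
noncomputable def doubleChart (d : G n) (x : Bool × ℕ → ℂ) : Matrix (Fin n) (Fin n) ℂ :=
  mat d * gaussFactor (mat (mixed s t x)) * mat (chart t fun k => x (true, k))

variable {s t}

lemma exists_doubleChart_eq (hs : IsAscending s) (ht : IsAscending t) {d : G n} (hd : d ∈ T n)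
    {x : Bool × ℕ → ℂ} (hx : mixedMinor s t x ≠ 0) :
    ∃ g ∈ doubleCell s t, mat g = doubleChart s t d x := by
  have h := fun i => Finset.prod_ne_zero_iff.mp hx i (Finset.mem_univ i)
  refine ⟨d * gauss (mixed s t x) h * chart t fun k => x (true, k), ⟨?_, ?_⟩, rfl⟩
  · have e : d * gauss (mixed s t x) h * chart t (fun k => x (true, k)) =
        d * (gauss (mixed s t x) h * mixed s t x) * flip n (chart s fun k => x (false, k)) := by
      have hm : chart t (fun k => x (true, k)) =
          mixed s t x * flip n (chart s fun k => x (false, k)) := by simp [mixed]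
      rw [hm]
      group
    rw [e, map_mul, flip_flip]
    exact Bminus_mul_cell ((flip_mem_Bminus _).mpr (mul_mem hd.1 (gauss_mul_mem _ h)))
      (chart_mem_cell hs _)
  · exact Bminus_mul_cell (mul_mem hd.2 (gauss_mem _ h)) (chart_mem_cell ht _)

lemma exists_eq_doubleChart {g : G n} (hg : g ∈ doubleCell s t) :
    ∃ d ∈ T n, ∃ x, mixedMinor s t x ≠ 0 ∧ mat g = doubleChart s t d x := by
  obtain ⟨c, hc, q, hq⟩ := exists_eq_mul_chart hg.1
  obtain ⟨b, hb, r, hr⟩ := exists_eq_mul_chart hg.2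
  have hc' : flip n c ∈ Bplus n := by rw [← flip_mem_Bminus, flip_flip]; exact hc
  have hgc : g = flip n c * flip n (chart s q) := by
    rw [← map_mul, ← hq, flip_flip]
  set x : Bool × ℕ → ℂ := fun p => if p.1 then r p.2 else q p.2 with hxdef
  have hm : mixed s t x = b⁻¹ * flip n c := by
    have h1 : mixed s t x = chart t r * (flip n (chart s q))⁻¹ := by simp [mixed, hxdef]
    have h2 : chart t r = b⁻¹ * g := by rw [hr]; group
    rw [h1, h2, hgc]
    group
  have hlead : ∀ i, (lead (mat (mixed s t x)) i).det ≠ 0 := by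
    intro i
    rw [hm]
    exact det_lead_mul_ne_zero (inv_mem hb) hc' i
  refine ⟨b * (gauss (mixed s t x) hlead)⁻¹,
    Subgroup.mem_inf.mpr ⟨?_, mul_mem hb (inv_mem (gauss_mem _ _))⟩, x, Finset.prod_ne_zero_iff.mpr fun i _ => hlead i, ?_⟩
  · have e : b * (gauss (mixed s t x) hlead)⁻¹ =
        flip n c * (gauss (mixed s t x) hlead * mixed s t x)⁻¹ := by
      have : flip n c = b * mixed s t x := by rw [hm]; group
      rw [this]
      group
    rw [e]
    exact mul_mem hc' (inv_mem (gauss_mul_mem _ hlead))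
  · have e : doubleChart s t (b * (gauss (mixed s t x) hlead)⁻¹) x =
        mat (b * (gauss (mixed s t x) hlead)⁻¹ * gauss (mixed s t x) hlead * chart t r) := by
      simp only [doubleChart, hxdef]
      rfl
    rw [e, hr]
    congr 1
    group

lemma isFracOn_mat_chart {σ : Type} (s : List (Fin (n / 2))) {q : (σ → ℂ) → ℕ → ℂ}
    {U : Set (σ → ℂ)} (hq : ∀ k, IsFracOn (fun x => q x k) U) (i j : Fin n) :
    IsFracOn (fun x => mat (chart s (q x)) i j) U := by
  induction s using List.reverseRecOn generalizing i j with
  | nil => exact IsFracOn.const _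
  | append_singleton s a ih =>
    simp only [chart_append, mat_mul]
    refine IsFracOn.matrix_mul (F := fun x => mat (chart s (q x)) * mat (refl a))
      (F' := fun x => mat (flip n (root a (q x s.length))))
      (IsFracOn.matrix_mul (F' := fun _ => mat (refl a)) ih fun i j => IsFracOn.const _)
      (fun i j => ?_) i j
    simp only [mat_flip, mat_root, rootMatrix, Matrix.of_apply]
    split_ifs
    · exact IsFracOn.const _
    · exact hq _
    · exact ((hq _).pow 2).div (IsFracOn.const _) fun _ _ => two_ne_zero
    · exact IsFracOn.const _

lemma isFracOn_mat_mixed (i j : Fin n) {U : Set (Bool × ℕ → ℂ)} :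
    IsFracOn (fun x => mat (mixed s t x) i j) U := by
  simp only [mixed, mat_mul, mat_inv]
  refine IsFracOn.matrix_mul (F := fun x => mat (chart t fun k => x (true, k)))
    (F' := fun x => Omega n * (mat (flip n (chart s fun k => x (false, k))))ᵀ * (Omega n)ᵀ)
    (isFracOn_mat_chart t fun k => IsFracOn.coord _) (fun i j => ?_) i j
  simp only [omega_conj_apply, mat_flip]
  exact ((IsFracOn.const _).mul (isFracOn_mat_chart s (fun k => IsFracOn.coord _) _ _)).mul
    (IsFracOn.const _)

lemma isFracOn_mixedMinor {U : Set (Bool × ℕ → ℂ)} : IsFracOn (mixedMinor s t) U :=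
  IsFracOn.prod _ fun _ _ => IsFracOn.det fun _ _ => isFracOn_mat_mixed _ _

lemma isFracOn_doubleChart (d : G n) (i j : Fin n) :
    IsFracOn (fun x => doubleChart s t d x i j) {x | mixedMinor s t x ≠ 0} := by
  refine IsFracOn.matrix_mul (F := fun x => mat d * gaussFactor (mat (mixed s t x)))
    (F' := fun x => mat (chart t fun k => x (true, k)))
    (IsFracOn.matrix_mul (F := fun _ => mat d) (F' := fun x => gaussFactor (mat (mixed s t x)))
      (fun i j => IsFracOn.const _) fun i j => ?_)
    (isFracOn_mat_chart t fun k => IsFracOn.coord _) i j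
  simp only [gaussFactor, Matrix.of_apply]
  split_ifs with h
  · refine IsFracOn.div (IsFracOn.neg (IsFracOn.sum _ fun l _ => (isFracOn_mat_mixed _ _).mul ?_))
      (IsFracOn.det fun _ _ => isFracOn_mat_mixed _ _)
      fun x hx => Finset.prod_ne_zero_iff.mp hx i (Finset.mem_univ i)
    simp only [Matrix.adjugate_apply]
    refine IsFracOn.det fun k m => ?_
    simp only [Matrix.updateRow_apply]
    split_ifs
    · exact IsFracOn.const _
    · exact isFracOn_mat_mixed _ _
  · exact IsFracOn.const _
  · exact IsFracOn.const _

/-- A nonempty open subset of a double Bruhat cell that is stable under the torus is dense. -/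
lemma eval_eq_zero_of_mem_doubleCell (hs : IsAscending s) (ht : IsAscending t)
    {a : (Fin n × Fin n → ℂ) → ℂ} (ha : IsFracOn a Set.univ)
    (haT : ∀ d ∈ T n, ∀ g, a (coords g) ≠ 0 → a (coords (d * g)) ≠ 0)
    {g₀ : G n} (hg₀ : g₀ ∈ doubleCell s t) (ha₀ : a (coords g₀) ≠ 0)
    {P : MvPolynomial (Fin n × Fin n) ℂ}
    (hP : ∀ g ∈ doubleCell s t, a (coords g) ≠ 0 → MvPolynomial.eval (coords g) P = 0)
    {g : G n} (hg : g ∈ doubleCell s t) : MvPolynomial.eval (coords g) P = 0 := by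
  obtain ⟨d, hd, x, hx, hgx⟩ := exists_eq_doubleChart hg
  obtain ⟨d₀, hd₀, x₀, hx₀, hgx₀⟩ := exists_eq_doubleChart hg₀
  set φ : (Bool × ℕ → ℂ) → Fin n × Fin n → ℂ := fun x p => doubleChart s t d x p.1 p.2 with hφ
  have hφg : coords g = φ x := by
    ext p
    simp only [coords, hgx, hφ]
  have h1 : coords (d * d₀⁻¹ * g₀) = φ x₀ := by
    ext p
    simp only [coords, hφ]
    have : mat (d * d₀⁻¹ * g₀) = doubleChart s t d x₀ := by
      rw [mat_mul, hgx₀, doubleChart, doubleChart, ← Matrix.mul_assoc, ← Matrix.mul_assoc, ← mat_mul,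
        inv_mul_cancel_right]
    rw [this]
  rw [hφg]
  refine eval_eq_zero_of_isFracOn (δ := mixedMinor s t) (φ := φ) (a := a) isFracOn_mixedMinor
    (fun p => isFracOn_doubleChart d p.1 p.2) ha hx₀ ?_ (fun y hy hay => ?_) hx
  · rw [← h1]
    exact haT _ (mul_mem hd (inv_mem hd₀)) _ ha₀
  · obtain ⟨g', hg', e⟩ := exists_doubleChart_eq hs ht hd hy
    have e' : φ y = coords g' := by
      ext p
      simp only [coords, e, hφ]
    rw [e'] at hay ⊢
    exact hP g' hg' hay

end Density

end DoubleBruhat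

namespace DoubleBruhat

open Matrix PlabicGraph Birational

variable {n : ℕ}

/-! ### Adding a letter to a double word -/

/-- The identity for the sign `true`, and the automorphism `flip` for the sign `false`. -/
def side (ε : Bool) : G n ≃* G n := if ε then MulEquiv.refl _ else flip n

lemma side_true (g : G n) : side true g = g := rfl

lemma side_false (g : G n) : side false g = flip n g := rfl

lemma side_side (ε : Bool) (g : G n) : side ε (side ε g) = g := by
  cases ε
  · exact flip_flip g
  · rfl

lemma side_not (ε : Bool) (g : G n) : side (!ε) (side ε g) = flip n g := by
  cases ε <;> rfl

/-- The double Bruhat cell of a double word. -/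
def wordCell (w : List (Letter n)) : Set (G n) :=
  doubleCell (part false w) (part true w)

lemma mem_wordCell {w : List (Letter n)} {g : G n} :
    g ∈ wordCell w ↔ ∀ ε, side ε g ∈ cell (reflProd (part ε w)) := by
  simp [wordCell, doubleCell, side_true, side_false]

/-- The element of the simple root subgroup of a letter. -/
noncomputable def letterRoot (l : Letter n) (t : ℂ) : G n := side l.2 (root l.1 t)

lemma letterRoot_neg (l : Letter n) (t : ℂ) : letterRoot l (-t) = (letterRoot l t)⁻¹ := by
  rw [letterRoot, root_neg, map_inv, letterRoot]

/-- The identity for the sign `true`, and the reversal of rows and columns for `false`. -/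
def sideMat (ε : Bool) (A : Matrix (Fin n) (Fin n) ℂ) : Matrix (Fin n) (Fin n) ℂ :=
  if ε then A else flipMat A

lemma mat_side (ε : Bool) (g : G n) : mat (side ε g) = sideMat ε (mat g) := by
  cases ε <;> rfl

/-- The function whose nonvanishing allows to split off the last letter of a double word. -/
noncomputable def splitMinor (w : List (Letter n)) (l : Letter n) (z : Fin n × Fin n → ℂ) : ℂ :=
  minor (permProd (part l.2 w)) l.1 (fstIdx l.1) (sideMat l.2 (toMat z))

/-- The parameter of the last letter of a double word. -/
noncomputable def splitParam (w : List (Letter n)) (l : Letter n) (z : Fin n × Fin n → ℂ) : ℂ :=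
  lastParam (permProd (part l.2 w)) l.1 (sideMat l.2 (toMat z))

lemma splitMinor_coords (w : List (Letter n)) (l : Letter n) (g : G n) :
    splitMinor w l (coords g) =
      minor (permProd (part l.2 w)) l.1 (fstIdx l.1) (mat (side l.2 g)) := by
  rw [splitMinor, toMat_coords, mat_side]

lemma splitParam_coords (w : List (Letter n)) (l : Letter n) (g : G n) :
    splitParam w l (coords g) = lastParam (permProd (part l.2 w)) l.1 (mat (side l.2 g)) := by
  rw [splitParam, toMat_coords, mat_side]

lemma part_append_self (w : List (Letter n)) (l : Letter n) :
    part l.2 (w ++ [l]) = part l.2 w ++ [l.1] := by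
  rw [part_append]
  congr 1
  exact part_singleton_self l.1 l.2

lemma part_append_not (w : List (Letter n)) (l : Letter n) :
    part (!l.2) (w ++ [l]) = part (!l.2) w := by
  rw [part_append]
  have := part_singleton_not l.1 l.2
  rw [show [(l.1, l.2)] = [l] from rfl] at this
  rw [this, List.append_nil]

lemma mem_wordCell_append {w : List (Letter n)} {l : Letter n} {g : G n} :
    g ∈ wordCell (w ++ [l]) ↔ side l.2 g ∈ cell (reflProd (part l.2 w) * refl l.1) ∧
      side (!l.2) g ∈ cell (reflProd (part (!l.2) w)) := by
  rw [mem_wordCell, Bool.forall_bool' l.2, part_append_self, part_append_not, reflProd_concat]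

lemma mem_wordCell' {w : List (Letter n)} (ε : Bool) {g : G n} :
    g ∈ wordCell w ↔ side ε g ∈ cell (reflProd (part ε w)) ∧
      side (!ε) g ∈ cell (reflProd (part (!ε) w)) := by
  rw [mem_wordCell, Bool.forall_bool' ε]

lemma side_letterRoot (l : Letter n) (t : ℂ) : side l.2 (letterRoot l t) = root l.1 t :=
  side_side _ _

lemma side_not_letterRoot_mem (l : Letter n) (t : ℂ) :
    side (!l.2) (letterRoot l t) ∈ Bminus n := by
  rw [letterRoot, side_not]
  exact flip_root_mem _ _

lemma mul_letterRoot_mem {w : List (Letter n)} {l : Letter n}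
    (h : IsAscent (permProd (part l.2 w)) l.1) {g : G n} (hg : g ∈ wordCell w) {t : ℂ} (ht : t ≠ 0) :
    g * letterRoot l t ∈ wordCell (w ++ [l]) := by
  rw [mem_wordCell' l.2] at hg
  rw [mem_wordCell_append, map_mul, map_mul, side_letterRoot]
  exact ⟨cell_mul_root (isMonomial_reflProd _) (permProd_inv_rev _) h hg.1 ht,
    cell_mul_Bminus hg.2 (side_not_letterRoot_mem l t)⟩

lemma split_mul_letterRoot {w : List (Letter n)} {l : Letter n}
    (h : IsAscent (permProd (part l.2 w)) l.1) {g : G n} (hg : g ∈ wordCell w) (t : ℂ) :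
    splitMinor w l (coords (g * letterRoot l t)) ≠ 0 ∧
      splitParam w l (coords (g * letterRoot l t)) = t := by
  rw [mem_wordCell' l.2] at hg
  rw [splitMinor_coords, splitParam_coords, map_mul, side_letterRoot]
  exact minor_mul_root (isMonomial_reflProd _) (permProd_inv_rev _) h hg.1 t

lemma mul_letterRoot_splitParam {w : List (Letter n)} {l : Letter n}
    (h : IsAscent (permProd (part l.2 w)) l.1) {g : G n} (hg : g ∈ wordCell (w ++ [l]))
    (h0 : splitMinor w l (coords g) ≠ 0) : splitParam w l (coords g) ≠ 0 ∧
      g * letterRoot l (-splitParam w l (coords g)) ∈ wordCell w := by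
  rw [mem_wordCell_append] at hg
  rw [splitMinor_coords] at h0
  rw [mem_wordCell' l.2, map_mul, map_mul, side_letterRoot, splitParam_coords]
  have := mul_root_lastParam (isMonomial_reflProd _) (permProd_inv_rev _) h hg.1 h0
  exact ⟨this.1, this.2, cell_mul_Bminus hg.2 (side_not_letterRoot_mem l _)⟩

lemma isFracOn_sideMat {U : Set (Fin n × Fin n → ℂ)} (ε : Bool) (i j : Fin n) :
    IsFracOn (fun z => sideMat ε (toMat z) i j) U := by
  cases ε <;> exact IsFracOn.coord _

lemma isFracOn_splitMinor (w : List (Letter n)) (l : Letter n) {U : Set (Fin n × Fin n → ℂ)} :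
    IsFracOn (splitMinor w l) U :=
  IsFracOn.det fun _ _ => isFracOn_sideMat _ _ _

lemma isFracOn_splitParam (w : List (Letter n)) (l : Letter n) {U : Set (Fin n × Fin n → ℂ)}
    (hU : ∀ z ∈ U, splitMinor w l z ≠ 0) : IsFracOn (splitParam w l) U :=
  IsFracOn.div (IsFracOn.det fun _ _ => isFracOn_sideMat _ _ _) (isFracOn_splitMinor w l) hU

lemma splitMinor_torus_mul (w : List (Letter n)) (l : Letter n) {d : G n} (hd : d ∈ T n) (g : G n)
    (h : splitMinor w l (coords g) ≠ 0) : splitMinor w l (coords (d * g)) ≠ 0 := by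
  rw [splitMinor_coords] at h ⊢
  have hd' : ∀ i j, i ≠ j → mat (side l.2 d) i j = 0 := by
    rw [mem_T_iff] at hd
    intro i j hij
    rw [mat_side]
    unfold sideMat
    split_ifs
    · exact hd i j hij
    · exact hd _ _ fun h => hij (Fin.rev_injective h)
  have hlow : side l.2 d ∈ Bminus n := fun i j hij => hd' i j hij.ne
  have e : ∀ i j, mat (side l.2 (d * g)) i j = mat (side l.2 d) i i * mat (side l.2 g) i j := by
    intro i j
    rw [map_mul, mat_mul, Matrix.mul_apply]
    exact Finset.sum_eq_single _ (fun k _ hk => by rw [hd' i k hk.symm, zero_mul]) (by simp)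
  rw [minor] at h ⊢
  have e2 : (mat (side l.2 (d * g))).submatrix
      (fun k => (permProd (part l.2 w))⁻¹ (withAfter l.1 (fstIdx l.1) k))
      (withAfter l.1 (fstIdx l.1)) = Matrix.of fun k m =>
      mat (side l.2 d) ((permProd (part l.2 w))⁻¹ (withAfter l.1 (fstIdx l.1) k))
        ((permProd (part l.2 w))⁻¹ (withAfter l.1 (fstIdx l.1) k)) *
      ((mat (side l.2 g)).submatrix
        (fun k => (permProd (part l.2 w))⁻¹ (withAfter l.1 (fstIdx l.1) k))
        (withAfter l.1 (fstIdx l.1))) k m := by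
    ext k m
    simp only [Matrix.submatrix_apply, e, Matrix.of_apply]
  rw [e2, Matrix.det_mul_column]
  exact mul_ne_zero (Finset.prod_ne_zero_iff.mpr fun k _ => diag_ne_zero hlow _) h

/-- The map `f` is an isomorphism of `X` onto a dense open subset of the double Bruhat cell of a
word, both `f` and its inverse being given by quotients of polynomials. -/
def IsChart {ι : Type} (w : List (Letter n)) (f : (ι → ℂ) → Fin n × Fin n → ℂ)
    (X : Set (ι → ℂ)) : Prop :=
  ∃ (V : Set (Fin n × Fin n → ℂ)) (g : (Fin n × Fin n → ℂ) → ι → ℂ),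
    IsOpenIn V (coords '' wordCell w) ∧ IsDenseIn V (coords '' wordCell w) ∧
    Set.MapsTo f X V ∧ Set.MapsTo g V X ∧ Set.LeftInvOn g f X ∧ Set.RightInvOn g f V ∧
    (∀ j, IsFracOn (fun z => f z j) X) ∧ ∀ j, IsFracOn (fun z => g z j) V

lemma IsChart.mapsBirationallyOnto {ι : Type} {w : List (Letter n)}
    {f : (ι → ℂ) → Fin n × Fin n → ℂ} {X : Set (ι → ℂ)} (h : IsChart w f X) :
    MapsBirationallyOnto f X (coords '' wordCell w) := by
  obtain ⟨V, g, h1, h2, h3, h4, h5, h6, h7, h8⟩ := h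
  refine ⟨X, V, g, ⟨{1}, ?_⟩, fun p hp => hp, h1, h2, h3, h4, h5, h6, isRegularOn_of_isFracOn h7,
    isRegularOn_of_isFracOn h8⟩
  ext x
  simp

/-- The matrix of a point times the matrix of a group element, as a point. -/
def mulCoords (z : Fin n × Fin n → ℂ) (g : G n) : Fin n × Fin n → ℂ :=
  fun p => (toMat z * mat g) p.1 p.2

lemma mulCoords_coords (h g : G n) : mulCoords (coords h) g = coords (h * g) := rfl

lemma isFracOn_letterRoot {κ : Type} {U : Set (κ → ℂ)} (l : Letter n) {τ : (κ → ℂ) → ℂ}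
    (hτ : IsFracOn τ U) (i j : Fin n) : IsFracOn (fun z => mat (letterRoot l (τ z)) i j) U := by
  have key : ∀ i j, IsFracOn (fun z => rootMatrix l.1 (τ z) i j) U := by
    intro i j
    simp only [rootMatrix, Matrix.of_apply]
    split_ifs
    · exact IsFracOn.const _
    · exact hτ
    · exact (hτ.pow 2).div (IsFracOn.const _) fun _ _ => two_ne_zero
    · exact IsFracOn.const _
  simp only [letterRoot, mat_side, mat_root, sideMat]
  split_ifs
  · exact key i j
  · exact key _ _

lemma isFracOn_mulCoords {κ : Type} {U : Set (κ → ℂ)} (l : Letter n)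
    {x : (κ → ℂ) → Fin n × Fin n → ℂ} (hx : ∀ p, IsFracOn (fun z => x z p) U)
    {τ : (κ → ℂ) → ℂ} (hτ : IsFracOn τ U) (p : Fin n × Fin n) :
    IsFracOn (fun z => mulCoords (x z) (letterRoot l (τ z)) p) U :=
  IsFracOn.matrix_mul (F := fun z => toMat (x z)) (F' := fun z => mat (letterRoot l (τ z)))
    (fun _ _ => hx _) (fun _ _ => isFracOn_letterRoot l hτ _ _) _ _

lemma IsChart.append {ι ι' : Type} {w : List (Letter n)} {l : Letter n}
    (hred : IsReducedWord (w ++ [l])) {f : (ι → ℂ) → Fin n × Fin n → ℂ} {X : Set (ι → ℂ)}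
    (hX : IsChart w f X) (hne : X.Nonempty)
    {f' : (ι' → ℂ) → Fin n × Fin n → ℂ} {X' : Set (ι' → ℂ)}
    (glue : (ι → ℂ) → ℂ → ι' → ℂ) (peel : (ι' → ℂ) → ι → ℂ) (par : (ι' → ℂ) → ℂ)
    (hX' : ∀ y ∈ X', par y ≠ 0 ∧ peel y ∈ X ∧ glue (peel y) (par y) = y)
    (hglue : ∀ x ∈ X, ∀ t ≠ 0, glue x t ∈ X' ∧ peel (glue x t) = x ∧ par (glue x t) = t)
    (hf' : ∀ x ∈ X, ∀ t ≠ 0, f' (glue x t) = mulCoords (f x) (letterRoot l t))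
    (hpeel : ∀ j, IsFracOn (fun z => peel z j) X') (hpar : IsFracOn par X')
    (hgf : ∀ (U : Set (Fin n × Fin n → ℂ)) (x : (Fin n × Fin n → ℂ) → ι → ℂ)
      (τ : (Fin n × Fin n → ℂ) → ℂ), (∀ j, IsFracOn (fun z => x z j) U) → IsFracOn τ U →
      (∀ z ∈ U, τ z ≠ 0) → ∀ j, IsFracOn (fun z => glue (x z) (τ z) j) U) :
    IsChart (w ++ [l]) f' X' := by
  have hasc : IsAscent (permProd (part l.2 w)) l.1 := by
    obtain ⟨a, ε⟩ := l
    exact hred.isAscent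
  obtain ⟨V, g, ⟨S, hS⟩, hdense, hf, hg, hgfX, hfgV, hfr, hgr⟩ := hX
  have hVcell : ∀ z ∈ V, ∃ h ∈ wordCell w, coords h = z := by
    intro z hz
    rw [hS] at hz
    exact hz.1
  set back : (Fin n × Fin n → ℂ) → Fin n × Fin n → ℂ := fun z =>
    mulCoords z (letterRoot l (-splitParam w l z)) with hback
  set V' : Set (Fin n × Fin n → ℂ) :=
    {z | z ∈ coords '' wordCell (w ++ [l]) ∧ splitMinor w l z ≠ 0 ∧ back z ∈ V} with hV'
  have hback_coords : ∀ h ∈ wordCell w, ∀ t, back (coords (h * letterRoot l t)) = coords h := by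
    intro h hh t
    rw [hback]
    simp only
    rw [(split_mul_letterRoot hasc hh t).2, mulCoords_coords, letterRoot_neg, mul_inv_cancel_right]
  have hmemV' : ∀ h ∈ wordCell w, coords h ∈ V → ∀ t ≠ 0, coords (h * letterRoot l t) ∈ V' := by
    intro h hh hhV t ht
    refine ⟨⟨_, mul_letterRoot_mem hasc hh ht, rfl⟩, (split_mul_letterRoot hasc hh t).1, ?_⟩
    rwa [hback_coords h hh t]
  have hV'split : ∀ z ∈ V', splitParam w l z ≠ 0 ∧
      z = mulCoords (back z) (letterRoot l (splitParam w l z)) := by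
    rintro z ⟨⟨h, hh, rfl⟩, h0, _⟩
    refine ⟨(mul_letterRoot_splitParam hasc hh h0).1, ?_⟩
    rw [hback]
    simp only
    rw [mulCoords_coords, mulCoords_coords, letterRoot_neg, inv_mul_cancel_right]
  have hbackfrac : ∀ U : Set (Fin n × Fin n → ℂ), (∀ z ∈ U, splitMinor w l z ≠ 0) →
      ∀ p, IsFracOn (fun z => back z p) U := fun U hU p =>
    isFracOn_mulCoords l (fun p => IsFracOn.coord p) (isFracOn_splitParam w l hU).neg p
  refine ⟨V', fun z => glue (g (back z)) (splitParam w l z), ?_, ?_, ?_, ?_, ?_, ?_, ?_, ?_⟩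
  · choose! q r hqr using fun (p : MvPolynomial (Fin n × Fin n) ℂ) =>
      IsFracOn.eval_comp (hbackfrac {z | splitMinor w l z ≠ 0} fun _ h => h) p
    obtain ⟨m, m', hm⟩ := isFracOn_splitMinor w l (U := Set.univ)
    refine ⟨(fun p => m * q p) '' S, ?_⟩
    ext z
    have hmz : MvPolynomial.eval z m ≠ 0 ↔ splitMinor w l z ≠ 0 := by
      rw [(hm z trivial).2, div_ne_zero_iff]
      exact ⟨fun h => ⟨h, (hm z trivial).1⟩, fun h => h.1⟩
    constructor
    · rintro ⟨h1, h2, h3⟩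
      rw [hS] at h3
      obtain ⟨p, hp, hpz⟩ := h3.2
      refine ⟨h1, _, ⟨p, hp, rfl⟩, ?_⟩
      rw [map_mul]
      refine mul_ne_zero (hmz.mpr h2) fun h0 => hpz ?_
      have := (hqr p z h2).2
      simp only [h0, zero_div] at this
      exact this
    · rintro ⟨h1, _, ⟨p, hp, rfl⟩, hpz⟩
      simp only [map_mul] at hpz
      have h2 := hmz.mp (left_ne_zero_of_mul hpz)
      refine ⟨h1, h2, ?_⟩
      obtain ⟨h, hh, rfl⟩ := h1
      rw [hS]
      refine ⟨⟨_, (mul_letterRoot_splitParam hasc hh h2).2, rfl⟩, p, hp, ?_⟩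
      have := (hqr p _ h2).2
      simp only at this
      change MvPolynomial.eval (back (coords h)) p ≠ 0
      rw [this]
      exact div_ne_zero (right_ne_zero_of_mul hpz) (hqr p _ h2).1
  · intro P hP z hz
    obtain ⟨h, hh, rfl⟩ := hz
    obtain ⟨x₀, hx₀⟩ := hne
    obtain ⟨h₀, hh₀, -⟩ := hVcell _ (hf hx₀)
    refine eval_eq_zero_of_mem_doubleCell (hred.isAscending false) (hred.isAscending true)
      (isFracOn_splitMinor w l) (fun d hd g hg => splitMinor_torus_mul w l hd g hg)
      (mul_letterRoot_mem hasc hh₀ one_ne_zero) (split_mul_letterRoot hasc hh₀ 1).1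
      (fun h hh h0 => ?_) hh
    obtain ⟨ht, hmem⟩ := mul_letterRoot_splitParam hasc hh h0
    set t := splitParam w l (coords h) with ht'
    obtain ⟨Q, Q', hQ⟩ := IsFracOn.eval_comp (U := Set.univ)
      (fun p => isFracOn_mulCoords l (fun p => IsFracOn.coord p) (IsFracOn.const t) p) P
    have hQ0 : ∀ z ∈ V, MvPolynomial.eval z Q = 0 := by
      intro z hz
      obtain ⟨h', hh', rfl⟩ := hVcell z hz
      have h1 := (hQ (coords h') trivial).2
      simp only [mulCoords_coords] at h1
      rw [hP _ (hmemV' h' hh' hz t ht), eq_comm, div_eq_zero_iff] at h1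
      exact h1.resolve_right (hQ (coords h') trivial).1
    have h2 := (hQ (coords (h * letterRoot l (-t))) trivial).2
    simp only [mulCoords_coords] at h2
    rw [hdense Q hQ0 _ ⟨_, hmem, rfl⟩, zero_div, letterRoot_neg, inv_mul_cancel_right] at h2
    exact h2
  · intro y hy
    obtain ⟨ht, hp, e⟩ := hX' y hy
    rw [← e, hf' _ hp _ ht]
    obtain ⟨h, hh, he⟩ := hVcell _ (hf hp)
    rw [← he, mulCoords_coords]
    exact hmemV' h hh (he ▸ hf hp) _ ht
  · intro z hz
    exact (hglue _ (hg hz.2.2) _ (hV'split z hz).1).1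
  · intro y hy
    obtain ⟨ht, hp, e⟩ := hX' y hy
    obtain ⟨h, hh, he⟩ := hVcell _ (hf hp)
    have e2 : f' y = coords (h * letterRoot l (par y)) := by
      conv_lhs => rw [← e]
      rw [hf' _ hp _ ht, ← he, mulCoords_coords]
    simp only
    rw [e2, hback_coords h hh, (split_mul_letterRoot hasc hh _).2, he, hgfX hp, e]
  · intro z hz
    obtain ⟨h1, h2⟩ := hV'split z hz
    simp only
    rw [hf' _ (hg hz.2.2) _ h1, hfgV hz.2.2, ← h2]
  · intro p
    have h1 := isFracOn_mulCoords l (U := X') (x := fun z => f (peel z))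
      (fun p => (hfr p).comp hpeel fun y hy => (hX' y hy).2.1) hpar p
    refine h1.congr fun y hy => ?_
    obtain ⟨ht, hp, e⟩ := hX' y hy
    conv_lhs => rw [← e]
    rw [hf' _ hp _ ht]
  · refine hgf V' (fun z => g (back z)) (splitParam w l) (fun j => ?_)
      (isFracOn_splitParam w l fun z hz => hz.2.1) fun z hz => (hV'split z hz).1
    exact (hgr j).comp (hbackfrac V' fun z hz => hz.2.1) fun z hz => hz.2.2

lemma doubleBruhatCell_eq {u v : W n} {w : List (Letter n)} (h : wordElem w = (u, v)) :
    doubleBruhatCell u v = coords '' wordCell w := by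
  rw [wordElem_eq, Prod.mk.injEq] at h
  have key : ∀ (B : Subgroup (G n)), T n ≤ B → ∀ (s : List (Fin (n / 2))) (g : G n),
      g ∈ bruhatCell B (weylProd s) ↔ ∃ b ∈ B, ∃ b' ∈ B, g = b * reflProd s * b' := by
    intro B hB s g
    rw [weylProd_eq_mk]
    constructor
    · rintro ⟨x, hx, b, hb, b', hb', rfl⟩
      rw [eq_comm, QuotientGroup.eq, Subgroup.mem_subgroupOf] at hx
      refine ⟨b, hb, (reflProd s)⁻¹ * x.1 * b', mul_mem (hB hx) hb', by group⟩
    · rintro ⟨b, hb, b', hb', rfl⟩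
      exact ⟨⟨reflProd s, reflProd_mem s⟩, rfl, b, hb, b', hb', rfl⟩
  have hset : bruhatCell (Bplus n) u ∩ bruhatCell (Bminus n) v = wordCell w := by
    ext g
    rw [Set.mem_inter_iff, ← h.1, ← h.2, key _ inf_le_left, key _ inf_le_right]
    refine and_congr ?_ Iff.rfl
    have hfl : ∃ d ∈ T n, flip n (reflProd (part false w)) = reflProd (part false w) * d :=
      ⟨_, (isMonomial_reflProd _).inv_mul_mem_T
        ((isMonomial_reflProd _).flip (permProd_rev (part false w))), by group⟩
    obtain ⟨d, hd, hfl⟩ := hfl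
    constructor
    · rintro ⟨b, hb, b', hb', rfl⟩
      refine ⟨flip n b, (flip_mem_Bminus _).mpr hb, d * flip n b',
        mul_mem hd.2 ((flip_mem_Bminus _).mpr hb'), ?_⟩
      rw [map_mul, map_mul, hfl]
      group
    · rintro ⟨b, hb, b', hb', e⟩
      have hb1 : flip n b ∈ Bplus n := by rw [← flip_mem_Bminus, flip_flip]; exact hb
      have hb2 : flip n b' ∈ Bplus n := by rw [← flip_mem_Bminus, flip_flip]; exact hb'
      refine ⟨flip n b, hb1, d * flip n b', mul_mem hd.1 hb2, ?_⟩
      have := congrArg (flip n) e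
      rw [flip_flip, map_mul, map_mul, hfl] at this
      rw [this]
      group
  rw [doubleBruhatCell, hset]
  rfl

end DoubleBruhat

namespace PlabicGraph

variable {n : ℕ}

/-! ### Path sums in acyclic networks -/

section Paths

variable {Γ : PlabicGraph n} {o : Γ.Orientation}

lemma second_ne_source (e : Γ.Edge) (j : Fin n) : Γ.second e ≠ .source j := by
  unfold second
  rcases Γ.finish e with v | i <;> simp

lemma first_ne_sink (e : Γ.Edge) (j : Fin n) : Γ.first e ≠ .sink j := by
  rcases e with i | e <;> simp [first]

lemma first_eq_source_iff (e : Γ.Edge) (j : Fin n) : Γ.first e = .source j ↔ e = Sum.inl j := by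
  rcases e with i | e <;> simp [first]

lemma second_eq_sink_iff (e : Γ.Edge) (j : Fin n) : Γ.second e = .sink j ↔ e = Γ.sinkEdge j := by
  rw [← Γ.finish_eq_sink_iff]
  unfold second
  rcases Γ.finish e with v | i <;> simp

lemma sinkEdge_injective : Function.Injective Γ.sinkEdge := by
  intro i j h
  have h1 := (second_eq_sink_iff (Γ.sinkEdge i) i).mpr rfl
  rw [h, (second_eq_sink_iff (Γ.sinkEdge j) j).mpr rfl] at h1
  simpa [eq_comm] using h1

lemma head_eq_sink_iff (hs : ∀ j, o (Γ.sinkEdge j) = true) (e : Γ.Edge) (j : Fin n) :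
    Γ.head o e = .sink j ↔ e = Γ.sinkEdge j := by
  unfold head
  split_ifs with h
  · exact second_eq_sink_iff e j
  · refine iff_of_false (first_ne_sink e j) ?_
    rintro rfl
    exact h (hs j)

lemma tail_ne_sink (hs : ∀ j, o (Γ.sinkEdge j) = true) (e : Γ.Edge) (j : Fin n) :
    Γ.tail o e ≠ .sink j := by
  unfold tail
  split_ifs with h
  · exact first_ne_sink e j
  · rw [Ne, second_eq_sink_iff]
    rintro rfl
    exact h (hs j)

lemma tail_eq_source_iff (hs : ∀ j, o (Sum.inl j) = true) (e : Γ.Edge) (j : Fin n) :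
    Γ.tail o e = .source j ↔ e = Sum.inl j := by
  unfold tail
  split_ifs with h
  · exact first_eq_source_iff e j
  · refine iff_of_false (second_ne_source e j) ?_
    rintro rfl
    exact h (hs j)

lemma head_ne_source (hs : ∀ j, o (Sum.inl j) = true) (e : Γ.Edge) (j : Fin n) :
    Γ.head o e ≠ .source j := by
  unfold head
  split_ifs with h
  · exact second_ne_source e j
  · rw [Ne, first_eq_source_iff]
    rintro rfl
    exact h (hs j)

/-- The directed paths from the edge `e` to the sink `j`. -/
def pathsFrom (o : Γ.Orientation) (e : Γ.Edge) (j : Fin n) : Set (List Γ.Edge) :=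
  {γ | γ.IsChain (fun e e' => Γ.head o e = Γ.tail o e') ∧ γ.head? = some e ∧
    γ.getLast?.map (Γ.head o) = some (.sink j)}

open Classical in
lemma pathsFrom_eq (o : Γ.Orientation) (e : Γ.Edge) (j : Fin n) :
    pathsFrom o e j = (if Γ.head o e = .sink j then {[e]} else ∅) ∪
      ⋃ e', if Γ.tail o e' = Γ.head o e then List.cons e '' pathsFrom o e' j else ∅ := by
  ext γ
  rw [Set.mem_union, Set.mem_iUnion]
  constructor
  · rintro ⟨h1, h2, h3⟩
    match γ, h1, h2, h3 with
    | [a], _, h2, h3 =>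
      simp only [List.head?_cons, Option.some.injEq] at h2
      subst h2
      simp only [List.getLast?_singleton, Option.map_some, Option.some.injEq] at h3
      left
      simp [h3]
    | a :: b :: γ, h1, h2, h3 =>
      simp only [List.head?_cons, Option.some.injEq] at h2
      subst h2
      right
      rw [List.isChain_cons_cons] at h1
      refine ⟨b, ?_⟩
      rw [if_pos h1.1.symm]
      refine ⟨_, ⟨h1.2, rfl, ?_⟩, rfl⟩
      rwa [List.getLast?_cons_cons] at h3
  · rintro (h | ⟨e', h⟩)
    · split_ifs at h with h0
      · rw [Set.mem_singleton_iff] at h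
        subst h
        exact ⟨List.isChain_singleton _, rfl, by simp [h0]⟩
      · simp at h
    · split_ifs at h with h0
      · obtain ⟨γ', ⟨h1, h2, h3⟩, rfl⟩ := h
        match γ', h1, h2, h3 with
        | a :: γ, h1, h2, h3 =>
          simp only [List.head?_cons, Option.some.injEq] at h2
          subst h2
          refine ⟨List.isChain_cons_cons.mpr ⟨h0.symm, h1⟩, rfl, ?_⟩
          rwa [List.getLast?_cons_cons]
      · simp at h

/-- There is a function on the edges that increases along directed paths. -/
def IsAcyclicOrientation (o : Γ.Orientation) : Prop :=
  ∃ rank : Γ.Edge → ℕ, ∀ e e', Γ.head o e = Γ.tail o e' → rank e < rank e'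

lemma IsAcyclicOrientation.induction (h : IsAcyclicOrientation o) {p : Γ.Edge → Prop}
    (hp : ∀ e, (∀ e', Γ.head o e = Γ.tail o e' → p e') → p e) (e : Γ.Edge) : p e := by
  obtain ⟨rank, hr⟩ := h
  have hb : ∀ e, rank e ≤ ∑ e', rank e' := fun e =>
    Finset.single_le_sum (f := rank) (fun _ _ => Nat.zero_le _) (Finset.mem_univ e)
  induction hm : (∑ e', rank e') - rank e using Nat.strong_induction_on generalizing e with
  | _ m ih =>
    refine hp e fun e' he' => ih _ ?_ e' rfl
    have h1 := hr e e' he'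
    have h2 := hb e'
    omega

lemma finite_pathsFrom (h : IsAcyclicOrientation o) (e : Γ.Edge) (j : Fin n) :
    (pathsFrom o e j).Finite := by
  refine h.induction (p := fun e => (pathsFrom o e j).Finite) (fun e ih => ?_) e
  classical
  rw [pathsFrom_eq]
  refine Set.Finite.union ?_ (Set.finite_iUnion fun e' => ?_)
  · split_ifs
    · exact Set.finite_singleton _
    · exact Set.finite_empty
  · split_ifs with h'
    · exact (ih e' h'.symm).image _
    · exact Set.finite_empty

open Classical in
/-- The function `P` has the properties of the generating function of the directed paths from an
edge to a sink. -/
def IsPathSum (o : Γ.Orientation) (wt : Γ.Edge → ℂˣ) (P : Γ.Edge → Fin n → ℂ) : Prop :=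
  ∀ e j, P e j = wt e * ((if Γ.head o e = .sink j then 1 else 0) +
    ∑ e', if Γ.tail o e' = Γ.head o e then P e' j else 0)

lemma IsPathSum.unique (h : IsAcyclicOrientation o) {wt : Γ.Edge → ℂˣ} {P Q : Γ.Edge → Fin n → ℂ}
    (hP : IsPathSum o wt P) (hQ : IsPathSum o wt Q) : P = Q := by
  funext e j
  refine h.induction (p := fun e => P e j = Q e j) (fun e ih => ?_) e
  rw [hP, hQ]
  congr 2
  refine Finset.sum_congr rfl fun e' _ => ?_
  split_ifs with h'
  · exact ih e' h'.symm
  · rfl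

/-- The generating function of the directed paths from an edge to a sink. -/
noncomputable def pathSum (o : Γ.Orientation) (wt : Γ.Edge → ℂˣ) (e : Γ.Edge) (j : Fin n) : ℂ :=
  ∑ᶠ γ ∈ pathsFrom o e j, (γ.map fun e => (wt e : ℂ)).prod

lemma isPathSum_pathSum (h : IsAcyclicOrientation o) (wt : Γ.Edge → ℂˣ) :
    IsPathSum o wt (pathSum o wt) := by
  classical
  intro e j
  have hfin : ∀ e', (if Γ.tail o e' = Γ.head o e then List.cons e '' pathsFrom o e' j
      else ∅).Finite := by
    intro e'
    split_ifs with h'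
    · exact (finite_pathsFrom h e' j).image _
    · exact Set.finite_empty
  conv_lhs => rw [pathSum, pathsFrom_eq]
  rw [finsum_mem_union, finsum_mem_iUnion, mul_add, Finset.mul_sum, ← finsum_eq_sum_of_fintype]
  · congr 1
    · split_ifs <;> simp
    · refine finsum_congr fun e' => ?_
      split_ifs with h'
      · rw [finsum_mem_image (List.cons_injective.injOn), pathSum,
          mul_finsum_mem]
        simp
      · simp
  · intro e₁ e₂ hne
    rw [Function.onFun, Set.disjoint_left]
    intro γ h1 h2
    split_ifs at h1 h2
    · obtain ⟨γ₁, h1, rfl⟩ := h1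
      obtain ⟨γ₂, h2, h3⟩ := h2
      rw [List.cons_inj_right] at h3
      subst h3
      have := h1.2.1.symm.trans h2.2.1
      exact hne (by simpa using this)
    all_goals simp_all
  · exact hfin
  · rw [Set.disjoint_left]
    intro γ h1 h2
    rw [Set.mem_iUnion] at h2
    obtain ⟨e', h2⟩ := h2
    split_ifs at h1 h2
    · obtain ⟨γ', h2, rfl⟩ := h2
      simp only [Set.mem_singleton_iff, List.cons.injEq, true_and] at h1
      subst h1
      simpa using h2.2.1
    all_goals simp_all
  · split_ifs
    · exact Set.finite_singleton _
    · exact Set.finite_empty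
  · exact Set.finite_iUnion hfin

/-- The function `θ` is a determination of the angles of the edges which changes by less than a
half turn at each vertex. -/
structure IsAngle (o : Γ.Orientation) (θ : Γ.Edge → ℝ) : Prop where
  dir : ∀ e, ∃ r : ℝ, 0 < r ∧ Γ.dir o e = r * Complex.exp (θ e * Complex.I)
  lt : ∀ e e', Γ.head o e = Γ.tail o e' → |θ e' - θ e| < Real.pi
  source : ∀ j, θ (Sum.inl j) = 0
  sink : ∀ j, θ (Γ.sinkEdge j) = 0

lemma IsAngle.arg {θ : Γ.Edge → ℝ} (h : IsAngle o θ) {e e' : Γ.Edge}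
    (he : Γ.head o e = Γ.tail o e') :
    Complex.arg (Γ.dir o e' / Γ.dir o e) = θ e' - θ e := by
  obtain ⟨r, hr, h1⟩ := h.dir e
  obtain ⟨r', hr', h2⟩ := h.dir e'
  have h3 := abs_lt.mp (h.lt e e' he)
  have e1 : Γ.dir o e' / Γ.dir o e =
      ((r' / r : ℝ) : ℂ) * Complex.exp (((θ e' - θ e : ℝ) : ℂ) * Complex.I) := by
    rw [h1, h2]
    push_cast
    rw [sub_mul, Complex.exp_sub]
    field_simp
  rw [e1, Complex.exp_mul_I, Complex.arg_mul_cos_add_sin_mul_I (div_pos hr' hr)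
    ⟨h3.1, h3.2.le⟩]

lemma IsAngle.sum {θ : Γ.Edge → ℝ} (h : IsAngle o θ) (γ : List Γ.Edge) (e e' : Γ.Edge)
    (hc : γ.IsChain (fun e e' => Γ.head o e = Γ.tail o e')) (h1 : γ.head? = some e)
    (h2 : γ.getLast? = some e') :
    ((γ.zip γ.tail).map fun p => Complex.arg (Γ.dir o p.2 / Γ.dir o p.1)).sum = θ e' - θ e := by
  induction γ generalizing e with
  | nil => simp at h1
  | cons a γ ih =>
    simp only [List.head?_cons, Option.some.injEq] at h1
    subst h1
    cases γ with
    | nil =>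
      simp only [List.getLast?_singleton, Option.some.injEq] at h2
      subst h2
      simp
    | cons b γ =>
      rw [List.isChain_cons_cons] at hc
      rw [List.getLast?_cons_cons] at h2
      have := ih b hc.2 rfl h2
      simp only [List.tail_cons] at this ⊢
      rw [List.zip_cons_cons, List.map_cons, List.sum_cons, this, h.arg hc.1]
      ring

lemma networkMatrix_eq_pathSum (hsrc : ∀ j, o (Sum.inl j) = true)
    (hsink : ∀ j, o (Γ.sinkEdge j) = true) {θ : Γ.Edge → ℝ} (hθ : IsAngle o θ) (wt : Γ.Edge → ℂˣ)
    (i j : Fin n) : Γ.networkMatrix o wt i j = pathSum o wt (Sum.inl i) j := by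
  have hset : ∀ γ, Γ.IsPath o i j γ ↔ γ ∈ pathsFrom o (Sum.inl i) j := by
    intro γ
    unfold IsPath pathsFrom
    refine and_congr Iff.rfl (and_congr ?_ Iff.rfl)
    cases γ with
    | nil => simp
    | cons a γ => simp [tail_eq_source_iff hsrc]
  have hw : ∀ γ, Γ.IsPath o i j γ → Γ.wind o γ = 0 := by
    intro γ hγ
    have h1 := (hset γ).mp hγ
    obtain ⟨e', he', h3⟩ := Option.map_eq_some_iff.mp h1.2.2
    rw [head_eq_sink_iff hsink] at h3
    rw [wind, hθ.sum γ _ e' h1.1 h1.2.1 he', h3, hθ.sink, hθ.source]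
    simp
  rw [networkMatrix, Matrix.of_apply, pathSum]
  refine (finsum_set_coe_eq_finsum_mem (f := fun γ => Complex.exp (Real.pi * Complex.I *
    Γ.wind o γ) * (γ.map fun e => (wt e : ℂ)).prod) {γ | Γ.IsPath o i j γ}).trans ?_
  refine finsum_mem_congr (Set.ext hset) fun γ hγ => ?_
  rw [hw γ ((hset γ).mpr hγ)]
  simp

end Paths

/-! ### Orientations of concatenations -/

section Concat

variable (Λ Δ : PlabicGraph n)

/-- The place of an edge of `Λ` in the concatenation of `Λ` and `Δ`. -/
def liftEdge : Λ.Edge → (Λ.concat Δ).Edge := Sum.map id Sum.inl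

/-- The place of a face of `Λ` in the concatenation of `Λ` and `Δ`. -/
def liftFace : Λ.Face → (Λ.concat Δ).Face := Sum.map id Sum.inl

/-- The vertices of a concatenation that come from the first graph. -/
def oldVertex (v : Λ.V) : (Λ.concat Δ).V := Sum.inl v

/-- The vertices of a concatenation that come from the second graph. -/
def newVertex (v : Δ.V) : (Λ.concat Δ).V := Sum.inr v

/-- The edges of a concatenation that come from the second graph alone. -/
def newEdge (e : Δ.E) : (Λ.concat Δ).Edge := Sum.inr (Sum.inr e)

/-- The faces of a concatenation that come from the second graph alone. -/
def newFace (f : Δ.F) : (Λ.concat Δ).Face := Sum.inr (Sum.inr f)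

/-- The map `glueEdge` with values in the edges of the concatenation. -/
def joinEdge (e : Δ.Edge) : (Λ.concat Δ).Edge := glueEdge Λ Δ e

/-- The map `glueFace` with values in the faces of the concatenation. -/
def joinFace (f : Δ.Face) : (Λ.concat Δ).Face := glueFace Λ Δ f

/-- The place of a node of `Δ` in the concatenation of `Λ` and `Δ` (irrelevant for sources). -/
def glueNode : Δ.Node → (Λ.concat Δ).Node
  | .vertex v => .vertex (newVertex Λ Δ v)
  | .source j => .source j
  | .sink j => .sink j

/-- The place of a node of `Λ` in the concatenation of `Λ` and `Δ`, where a sink is replaced by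
the second end of the edge of `Δ` which is glued to it. -/
def liftNode : Λ.Node → (Λ.concat Δ).Node
  | .vertex v => .vertex (oldVertex Λ Δ v)
  | .source j => .source j
  | .sink j => glueNode Λ Δ (Δ.second (Sum.inl j))

variable {Λ Δ}

lemma oldVertex_injective : Function.Injective (oldVertex Λ Δ) := Sum.inl_injective

lemma newVertex_injective : Function.Injective (newVertex Λ Δ) := Sum.inr_injective

lemma oldVertex_ne_newVertex (v : Λ.V) (v' : Δ.V) : oldVertex Λ Δ v ≠ newVertex Λ Δ v' :=
  Sum.inl_ne_inr

lemma newEdge_injective : Function.Injective (newEdge Λ Δ) :=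
  Sum.inr_injective.comp Sum.inr_injective

lemma newFace_injective : Function.Injective (newFace Λ Δ) :=
  Sum.inr_injective.comp Sum.inr_injective

lemma concat_vertex_cases {p : (Λ.concat Δ).V → Prop} (h1 : ∀ v, p (oldVertex Λ Δ v))
    (h2 : ∀ v, p (newVertex Λ Δ v)) (v : (Λ.concat Δ).V) : p v := by
  rcases v with v | v
  · exact h1 v
  · exact h2 v

lemma liftEdge_injective : Function.Injective (liftEdge Λ Δ) :=
  Sum.map_injective.mpr ⟨Function.injective_id, Sum.inl_injective⟩

lemma liftFace_injective : Function.Injective (liftFace Λ Δ) :=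
  Sum.map_injective.mpr ⟨Function.injective_id, Sum.inl_injective⟩

lemma glueNode_injective : Function.Injective (glueNode Λ Δ) := by
  rintro (a | a | a) (b | b | b) h <;> simp_all [glueNode, newVertex_injective.eq_iff]

lemma joinEdge_inl (j : Fin n) :
    joinEdge Λ Δ (Sum.inl j) = liftEdge Λ Δ (Λ.sinkEdge j) := rfl

lemma joinEdge_inr (e : Δ.E) : joinEdge Λ Δ (Sum.inr e) = newEdge Λ Δ e := rfl

lemma joinFace_inl (r : Fin (n + 1)) :
    joinFace Λ Δ (Sum.inl r) = liftFace Λ Δ (Λ.rightFace r) := rfl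

lemma joinFace_inr (f : Δ.F) : joinFace Λ Δ (Sum.inr f) = newFace Λ Δ f := rfl

lemma liftEdge_ne (e : Λ.Edge) (e' : Δ.E) : liftEdge Λ Δ e ≠ newEdge Λ Δ e' := by
  rcases e with j | e
  · exact Sum.inl_ne_inr
  · exact fun h => Sum.inl_ne_inr (Sum.inr_injective h)

lemma liftFace_ne (f : Λ.Face) (f' : Δ.F) : liftFace Λ Δ f ≠ newFace Λ Δ f' := by
  rcases f with j | f
  · exact Sum.inl_ne_inr
  · exact fun h => Sum.inl_ne_inr (Sum.inr_injective h)

lemma joinEdge_injective : Function.Injective (joinEdge Λ Δ) := by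
  rintro (i | e) (j | e') h
  · rw [joinEdge_inl, joinEdge_inl] at h
    rw [sinkEdge_injective (liftEdge_injective h)]
  · exact absurd h (liftEdge_ne _ _)
  · exact absurd h.symm (liftEdge_ne _ _)
  · rw [newEdge_injective h]

lemma concat_edge_cases {p : (Λ.concat Δ).Edge → Prop} (h1 : ∀ e, p (liftEdge Λ Δ e))
    (h2 : ∀ e : Δ.E, p (newEdge Λ Δ e)) (e : (Λ.concat Δ).Edge) : p e := by
  rcases e with j | e | e
  · exact h1 (Sum.inl j)
  · exact h1 (Sum.inr e)
  · exact h2 e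

lemma concat_face_cases {p : (Λ.concat Δ).Face → Prop} (h1 : ∀ f, p (liftFace Λ Δ f))
    (h2 : ∀ f : Δ.F, p (newFace Λ Δ f)) (f : (Λ.concat Δ).Face) : p f := by
  rcases f with j | f | f
  · exact h1 (Sum.inl j)
  · exact h1 (Sum.inr f)
  · exact h2 f

lemma first_liftEdge (e : Λ.Edge) :
    (Λ.concat Δ).first (liftEdge Λ Δ e) = liftNode Λ Δ (Λ.first e) := by
  rcases e with j | e <;> rfl

lemma second_liftEdge (e : Λ.Edge) :
    (Λ.concat Δ).second (liftEdge Λ Δ e) = liftNode Λ Δ (Λ.second e) := by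
  have key : (Λ.concat Δ).finish (liftEdge Λ Δ e) = glueFinish Λ Δ e := by
    rcases e with j | e <;> rfl
  rw [second, key, glueFinish, second]
  rcases Λ.finish e with v | j
  · rfl
  · simp only [Sum.elim_inr, liftNode, second]
    rcases Δ.finish (Sum.inl j) with v | i <;> rfl

lemma first_newEdge (e : Δ.E) :
    (Λ.concat Δ).first (newEdge Λ Δ e) = glueNode Λ Δ (Δ.first (Sum.inr e)) := rfl

lemma second_newEdge (e : Δ.E) :
    (Λ.concat Δ).second (newEdge Λ Δ e) = glueNode Λ Δ (Δ.second (Sum.inr e)) := by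
  have key : (Λ.concat Δ).finish (newEdge Λ Δ e) =
    (Δ.finish (Sum.inr e)).map Sum.inr id := rfl
  rw [second, key, second]
  rcases Δ.finish (Sum.inr e) with v | i <;> rfl

lemma second_joinEdge (e : Δ.Edge) :
    (Λ.concat Δ).second (joinEdge Λ Δ e) = glueNode Λ Δ (Δ.second e) := by
  rcases e with j | e
  · rw [joinEdge_inl, second_liftEdge, (second_eq_sink_iff _ _).mpr rfl]
    rfl
  · exact second_newEdge e

lemma leftOf_liftEdge (e : Λ.Edge) :
    (Λ.concat Δ).leftOf (liftEdge Λ Δ e) = liftFace Λ Δ (Λ.leftOf e) := by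
  rcases e with j | e <;> rfl

lemma rightOf_liftEdge (e : Λ.Edge) :
    (Λ.concat Δ).rightOf (liftEdge Λ Δ e) = liftFace Λ Δ (Λ.rightOf e) := by
  rcases e with j | e <;> rfl

lemma leftOf_newEdge (e : Δ.E) : (Λ.concat Δ).leftOf (newEdge Λ Δ e) =
    joinFace Λ Δ (Δ.leftOf (Sum.inr e)) := rfl

lemma rightOf_newEdge (e : Δ.E) : (Λ.concat Δ).rightOf (newEdge Λ Δ e) =
    joinFace Λ Δ (Δ.rightOf (Sum.inr e)) := rfl

lemma head_liftEdge (o : (Λ.concat Δ).Orientation) (e : Λ.Edge) :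
    (Λ.concat Δ).head o (liftEdge Λ Δ e) =
      liftNode Λ Δ (Λ.head (fun e => o (liftEdge Λ Δ e)) e) := by
  unfold head
  rw [first_liftEdge, second_liftEdge]
  split_ifs <;> rfl

lemma tail_liftEdge (o : (Λ.concat Δ).Orientation) (e : Λ.Edge) :
    (Λ.concat Δ).tail o (liftEdge Λ Δ e) =
      liftNode Λ Δ (Λ.tail (fun e => o (liftEdge Λ Δ e)) e) := by
  unfold tail
  rw [first_liftEdge, second_liftEdge]
  split_ifs <;> rfl

lemma head_newEdge (o : (Λ.concat Δ).Orientation) (e : Δ.E) :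
    (Λ.concat Δ).head o (newEdge Λ Δ e) =
      glueNode Λ Δ (Δ.head (fun e => o (joinEdge Λ Δ e)) (Sum.inr e)) := by
  unfold head
  rw [first_newEdge, second_newEdge]
  change (if o (newEdge Λ Δ e) = true then _ else _) =
    glueNode Λ Δ (if o (newEdge Λ Δ e) = true then _ else _)
  split_ifs <;> rfl

lemma tail_newEdge (o : (Λ.concat Δ).Orientation) (e : Δ.E) :
    (Λ.concat Δ).tail o (newEdge Λ Δ e) =
      glueNode Λ Δ (Δ.tail (fun e => o (joinEdge Λ Δ e)) (Sum.inr e)) := by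
  unfold tail
  rw [first_newEdge, second_newEdge]
  change (if o (newEdge Λ Δ e) = true then _ else _) =
    glueNode Λ Δ (if o (newEdge Λ Δ e) = true then _ else _)
  split_ifs <;> rfl

lemma head_joinEdge {o : (Λ.concat Δ).Orientation}
    (hs : ∀ j, o (liftEdge Λ Δ (Λ.sinkEdge j)) = true) (e : Δ.Edge) :
    (Λ.concat Δ).head o (joinEdge Λ Δ e) =
      glueNode Λ Δ (Δ.head (fun e => o (joinEdge Λ Δ e)) e) := by
  rcases e with j | e
  · have h : o (joinEdge Λ Δ (Sum.inl j)) = true := hs j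
    simp only [head, h, if_true]
    exact second_joinEdge _
  · exact head_newEdge o e

lemma liftNode_eq_inl {x : Λ.Node} {v : Λ.V} :
    liftNode Λ Δ x = .vertex (oldVertex Λ Δ v) ↔ x = .vertex v := by
  rcases x with a | a | a
  · simp [liftNode, oldVertex_injective.eq_iff]
  · simp [liftNode]
  · simp only [liftNode]
    rcases Δ.second (Sum.inl a) with b | b | b <;> simp [glueNode, (oldVertex_ne_newVertex _ _).symm]

lemma liftNode_eq_inr {x : Λ.Node} {v : Δ.V} :
    liftNode Λ Δ x = .vertex (newVertex Λ Δ v) ↔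
      ∃ j, x = .sink j ∧ Δ.second (Sum.inl j) = .vertex v := by
  rcases x with a | a | a
  · simp [liftNode, oldVertex_ne_newVertex]
  · simp [liftNode]
  · simp only [liftNode]
    constructor
    · intro h
      exact ⟨a, rfl, glueNode_injective (h.trans rfl)⟩
    · rintro ⟨j, hj, h⟩
      simp only [PlabicNode.sink.injEq] at hj
      subst hj
      rw [h]
      rfl

lemma glueNode_ne_inl (x : Δ.Node) (v : Λ.V) : glueNode Λ Δ x ≠ .vertex (oldVertex Λ Δ v) := by
  rcases x with a | a | a <;> simp [glueNode, (oldVertex_ne_newVertex _ _).symm]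

lemma glueNode_eq_inr {x : Δ.Node} {v : Δ.V} :
    glueNode Λ Δ x = .vertex (newVertex Λ Δ v) ↔ x = .vertex v := by
  rcases x with a | a | a <;> simp [glueNode, newVertex_injective.eq_iff]

lemma liftNode_eq_iff {x y : Λ.Node} (hy : ∀ j, y ≠ .sink j) :
    liftNode Λ Δ x = liftNode Λ Δ y ↔ x = y := by
  refine ⟨fun h => ?_, fun h => by rw [h]⟩
  rcases y with v | i | i
  · exact liftNode_eq_inl.mp h
  · rcases x with a | a | a
    · simp [liftNode] at h
    · simpa [liftNode] using h
    · have : glueNode Λ Δ (Δ.second (Sum.inl a)) = glueNode Λ Δ (.source i) := h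
      exact absurd (glueNode_injective this) (second_ne_source _ _)
  · exact absurd rfl (hy i)

lemma glueNode_ne_liftNode {x : Δ.Node} {y : Λ.Node} (hy : ∀ j, y ≠ .sink j)
    (hx : ∀ j, x ≠ .source j) : glueNode Λ Δ x ≠ liftNode Λ Δ y := by
  rcases y with v | i | i
  · exact glueNode_ne_inl _ _
  · exact fun h => hx i (glueNode_injective (h.trans rfl))
  · exact absurd rfl (hy i)

lemma existsUnique_iff_of_injective {α β : Type} {f : α → β} (hf : Function.Injective f)
    {p : α → Prop} {q : β → Prop} (h1 : ∀ a, q (f a) ↔ p a) (h2 : ∀ b, q b → ∃ a, f a = b) :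
    (∃! b, q b) ↔ ∃! a, p a := by
  constructor
  · rintro ⟨b, hb, hu⟩
    obtain ⟨a, rfl⟩ := h2 b hb
    exact ⟨a, (h1 a).mp hb, fun a' ha' => hf (hu _ ((h1 a').mpr ha'))⟩
  · rintro ⟨a, ha, hu⟩
    refine ⟨f a, (h1 a).mpr ha, fun b hb => ?_⟩
    obtain ⟨a', rfl⟩ := h2 b hb
    rw [hu a' ((h1 a').mp hb)]

/-- The conditions of a perfect orientation at the interior vertices. -/
def IsBalanced {Γ : PlabicGraph n} (o : Γ.Orientation) : Prop :=
  (∀ v, Γ.white v = true → ∃! e, Γ.head o e = .vertex v) ∧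
  (∀ v, Γ.white v = false → ∃! e, Γ.tail o e = .vertex v)

lemma existsUnique_head_inl (o : (Λ.concat Δ).Orientation) (v : Λ.V) :
    (∃! e, (Λ.concat Δ).head o e = .vertex (oldVertex Λ Δ v)) ↔
      ∃! e, Λ.head (fun e => o (liftEdge Λ Δ e)) e = .vertex v := by
  refine existsUnique_iff_of_injective liftEdge_injective (fun e => ?_) fun e he => ?_
  · rw [head_liftEdge, liftNode_eq_inl]
  · induction e using concat_edge_cases with
    | h1 e => exact ⟨e, rfl⟩
    | h2 e => exact absurd he (by rw [head_newEdge]; exact glueNode_ne_inl _ _)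

lemma existsUnique_tail_inl (o : (Λ.concat Δ).Orientation) (v : Λ.V) :
    (∃! e, (Λ.concat Δ).tail o e = .vertex (oldVertex Λ Δ v)) ↔
      ∃! e, Λ.tail (fun e => o (liftEdge Λ Δ e)) e = .vertex v := by
  refine existsUnique_iff_of_injective liftEdge_injective (fun e => ?_) fun e he => ?_
  · rw [tail_liftEdge, liftNode_eq_inl]
  · induction e using concat_edge_cases with
    | h1 e => exact ⟨e, rfl⟩
    | h2 e => exact absurd he (by rw [tail_newEdge]; exact glueNode_ne_inl _ _)

lemma existsUnique_head_inr {o : (Λ.concat Δ).Orientation}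
    (hs : ∀ j, o (liftEdge Λ Δ (Λ.sinkEdge j)) = true) (v : Δ.V) :
    (∃! e, (Λ.concat Δ).head o e = .vertex (newVertex Λ Δ v)) ↔
      ∃! e, Δ.head (fun e => o (joinEdge Λ Δ e)) e = .vertex v := by
  refine existsUnique_iff_of_injective joinEdge_injective (fun e => ?_) fun e he => ?_
  · rw [head_joinEdge hs, glueNode_eq_inr]
  · induction e using concat_edge_cases with
    | h1 e =>
      rw [head_liftEdge, liftNode_eq_inr] at he
      obtain ⟨j, hj, -⟩ := he
      rw [head_eq_sink_iff hs] at hj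
      exact ⟨Sum.inl j, by rw [hj]; rfl⟩
    | h2 e => exact ⟨Sum.inr e, rfl⟩

lemma existsUnique_tail_inr {o : (Λ.concat Δ).Orientation}
    (hs : ∀ j, o (liftEdge Λ Δ (Λ.sinkEdge j)) = true) (v : Δ.V) :
    (∃! e, (Λ.concat Δ).tail o e = .vertex (newVertex Λ Δ v)) ↔
      ∃! e, Δ.tail (fun e => o (joinEdge Λ Δ e)) e = .vertex v := by
  have hl : ∀ e, (Λ.concat Δ).tail o (liftEdge Λ Δ e) ≠ .vertex (newVertex Λ Δ v) := by
    intro e he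
    rw [tail_liftEdge, liftNode_eq_inr] at he
    obtain ⟨j, hj, -⟩ := he
    exact tail_ne_sink hs _ _ hj
  refine existsUnique_iff_of_injective joinEdge_injective (fun e => ?_) fun e he => ?_
  · rcases e with j | e
    · refine iff_of_false (hl _) ?_
      have h : o (joinEdge Λ Δ (Sum.inl j)) = true := hs j
      simp [tail, h, first]
    · rw [joinEdge_inr, tail_newEdge, glueNode_eq_inr]
  · induction e using concat_edge_cases with
    | h1 e => exact absurd he (hl e)
    | h2 e => exact ⟨Sum.inr e, rfl⟩

lemma IsBalanced.lift {o : (Λ.concat Δ).Orientation} (h : IsBalanced o) :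
    IsBalanced (Γ := Λ) fun e => o (liftEdge Λ Δ e) :=
  ⟨fun v hv => (existsUnique_head_inl o v).mp (h.1 (Sum.inl v) hv),
    fun v hv => (existsUnique_tail_inl o v).mp (h.2 (Sum.inl v) hv)⟩

lemma IsBalanced.glue {o : (Λ.concat Δ).Orientation}
    (hs : ∀ j, o (liftEdge Λ Δ (Λ.sinkEdge j)) = true) (h : IsBalanced o) :
    IsBalanced (Γ := Δ) fun e => o (joinEdge Λ Δ e) :=
  ⟨fun v hv => (existsUnique_head_inr hs v).mp (h.1 (Sum.inr v) hv),
    fun v hv => (existsUnique_tail_inr hs v).mp (h.2 (Sum.inr v) hv)⟩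

lemma isBalanced_concat {o : (Λ.concat Δ).Orientation}
    (hs : ∀ j, o (liftEdge Λ Δ (Λ.sinkEdge j)) = true)
    (h1 : IsBalanced (Γ := Λ) fun e => o (liftEdge Λ Δ e))
    (h2 : IsBalanced (Γ := Δ) fun e => o (joinEdge Λ Δ e)) : IsBalanced o := by
  constructor
  · rintro (v | v) hv
    · exact (existsUnique_head_inl o v).mpr (h1.1 v hv)
    · exact (existsUnique_head_inr hs v).mpr (h2.1 v hv)
  · rintro (v | v) hv
    · exact (existsUnique_tail_inl o v).mpr (h1.2 v hv)
    · exact (existsUnique_tail_inr hs v).mpr (h2.2 v hv)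

/-- The orientation `o` is the only perfect one, it is acyclic, paths from sources to sinks do not
wind, and the faces at the sinks are as in a planar drawing. -/
structure IsRegular (Γ : PlabicGraph n) (o : Γ.Orientation) : Prop where
  source : ∀ j, o (Sum.inl j) = true
  sink : ∀ j, o (Γ.sinkEdge j) = true
  balanced : IsBalanced o
  unique : ∀ o' : Γ.Orientation, (∀ j, o' (Sum.inl j) = true) → IsBalanced o' → o' = o
  acyclic : IsAcyclicOrientation o
  angle : ∃ θ, IsAngle o θ
  leftOf_sinkEdge : ∀ j, Γ.leftOf (Γ.sinkEdge j) = Γ.rightFace j.succ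
  rightOf_sinkEdge : ∀ j, Γ.rightOf (Γ.sinkEdge j) = Γ.rightFace j.castSucc

lemma IsRegular.isPerfect_iff {Γ : PlabicGraph n} {o : Γ.Orientation} (h : IsRegular Γ o)
    (o' : Γ.Orientation) : Γ.IsPerfect o' ↔ o' = o := by
  constructor
  · rintro ⟨h1, -, h2⟩
    exact h.unique o' h1 h2
  · rintro rfl
    exact ⟨h.source, h.sink, h.balanced⟩

/-- The orientation of a concatenation. -/
def concatOrientation (o₁ : Λ.Orientation) (o₂ : Δ.Orientation) : (Λ.concat Δ).Orientation :=
  Sum.elim (fun j => o₁ (Sum.inl j)) (Sum.elim (fun e => o₁ (Sum.inr e)) fun e => o₂ (Sum.inr e))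

lemma concatOrientation_liftEdge (o₁ : Λ.Orientation) (o₂ : Δ.Orientation) (e : Λ.Edge) :
    concatOrientation o₁ o₂ (liftEdge Λ Δ e) = o₁ e := by
  rcases e with j | e <;> rfl

section

variable {o₁ : Λ.Orientation} {o₂ : Δ.Orientation}

lemma concatOrientation_joinEdge (h1 : IsRegular Λ o₁) (h2 : IsRegular Δ o₂) (e : Δ.Edge) :
    concatOrientation o₁ o₂ (joinEdge Λ Δ e) = o₂ e := by
  rcases e with j | e
  · rw [joinEdge_inl, concatOrientation_liftEdge, h1.sink, h2.source]
  · rfl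

lemma head_concat_lift (o₁ : Λ.Orientation) (o₂ : Δ.Orientation) (e : Λ.Edge) :
    (Λ.concat Δ).head (concatOrientation o₁ o₂) (liftEdge Λ Δ e) =
      liftNode Λ Δ (Λ.head o₁ e) := by
  rw [head_liftEdge]
  simp only [concatOrientation_liftEdge]

lemma tail_concat_lift (o₁ : Λ.Orientation) (o₂ : Δ.Orientation) (e : Λ.Edge) :
    (Λ.concat Δ).tail (concatOrientation o₁ o₂) (liftEdge Λ Δ e) =
      liftNode Λ Δ (Λ.tail o₁ e) := by
  rw [tail_liftEdge]
  simp only [concatOrientation_liftEdge]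

lemma head_concat_inr (o₁ : Λ.Orientation) (o₂ : Δ.Orientation) (e : Δ.E) :
    (Λ.concat Δ).head (concatOrientation o₁ o₂) (newEdge Λ Δ e) =
      glueNode Λ Δ (Δ.head o₂ (Sum.inr e)) := by
  rw [head_newEdge]
  rfl

lemma tail_concat_inr (o₁ : Λ.Orientation) (o₂ : Δ.Orientation) (e : Δ.E) :
    (Λ.concat Δ).tail (concatOrientation o₁ o₂) (newEdge Λ Δ e) =
      glueNode Λ Δ (Δ.tail o₂ (Sum.inr e)) := by
  rw [tail_newEdge]
  rfl

lemma nodePos_liftNode {x : Λ.Node} (hx : ∀ j, x ≠ .sink j) :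
    (Λ.concat Δ).nodePos (liftNode Λ Δ x) = Λ.nodePos x := by
  rcases x with v | j | j
  · rfl
  · rfl
  · exact absurd rfl (hx j)

lemma nodePos_glueNode {x : Δ.Node} (hx : ∀ j, x ≠ .source j) :
    (Λ.concat Δ).nodePos (glueNode Λ Δ x) = Λ.width + Δ.nodePos x := by
  rcases x with v | j | j
  · rfl
  · exact absurd rfl (hx j)
  · simp [nodePos, glueNode, concat, add_assoc]

lemma dir_concat_inr (h2 : IsRegular Δ o₂) (e : Δ.E)
    (ht : ∀ j, Δ.tail o₂ (Sum.inr e) ≠ .source j) :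
    (Λ.concat Δ).dir (concatOrientation o₁ o₂) (newEdge Λ Δ e) =
      Δ.dir o₂ (Sum.inr e) := by
  rw [dir, head_concat_inr, tail_concat_inr, nodePos_glueNode (head_ne_source h2.source _),
    nodePos_glueNode ht, dir]
  ring

lemma dir_concat_lift (h1 : IsRegular Λ o₁) {e : Λ.Edge} (he : ∀ j, e ≠ Λ.sinkEdge j) :
    (Λ.concat Δ).dir (concatOrientation o₁ o₂) (liftEdge Λ Δ e) = Λ.dir o₁ e := by
  rw [dir, head_concat_lift, tail_concat_lift, nodePos_liftNode (tail_ne_sink h1.sink _),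
    nodePos_liftNode, dir]
  intro j
  rw [Ne, head_eq_sink_iff h1.sink]
  exact he j

lemma dir_concat_sinkEdge (h1 : IsRegular Λ o₁) (h2 : IsRegular Δ o₂) (j : Fin n) :
    (Λ.concat Δ).dir (concatOrientation o₁ o₂) (liftEdge Λ Δ (Λ.sinkEdge j)) =
      Λ.dir o₁ (Λ.sinkEdge j) + Δ.dir o₂ (Sum.inl j) := by
  have e1 : Δ.head o₂ (Sum.inl j) = Δ.second (Sum.inl j) := by simp [head, h2.source]
  have e2 : Δ.tail o₂ (Sum.inl j) = .source j := (tail_eq_source_iff h2.source _ _).mpr rfl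
  rw [dir, head_concat_lift, tail_concat_lift, nodePos_liftNode (tail_ne_sink h1.sink _), dir, dir,
    (head_eq_sink_iff h1.sink _ j).mpr rfl, e2, e1, liftNode,
    nodePos_glueNode (second_ne_source _)]
  simp only [nodePos]
  ring

lemma IsRegular.leftOf_joinEdge (h1 : IsRegular Λ o₁) (e : Δ.Edge) :
    (Λ.concat Δ).leftOf (joinEdge Λ Δ e) = joinFace Λ Δ (Δ.leftOf e) := by
  rcases e with j | e
  · rw [joinEdge_inl, leftOf_liftEdge, h1.leftOf_sinkEdge]
    rfl
  · rfl

lemma IsRegular.rightOf_joinEdge (h1 : IsRegular Λ o₁) (e : Δ.Edge) :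
    (Λ.concat Δ).rightOf (joinEdge Λ Δ e) = joinFace Λ Δ (Δ.rightOf e) := by
  rcases e with j | e
  · rw [joinEdge_inl, rightOf_liftEdge, h1.rightOf_sinkEdge]
    rfl
  · rfl

lemma isAcyclicOrientation_concat (h1 : IsRegular Λ o₁) (h2 : IsRegular Δ o₂) :
    IsAcyclicOrientation (concatOrientation o₁ o₂) := by
  obtain ⟨r₁, hr₁⟩ := h1.acyclic
  obtain ⟨r₂, hr₂⟩ := h2.acyclic
  set r : (Λ.concat Δ).Edge → ℕ := Sum.elim (fun j => r₁ (Sum.inl j))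
    (Sum.elim (fun e => r₁ (Sum.inr e)) fun e => (∑ e, r₁ e) + 1 + r₂ (Sum.inr e)) with hr
  have hl : ∀ e : Λ.Edge, r (liftEdge Λ Δ e) = r₁ e := by
    rintro (j | e) <;> rfl
  have hn : ∀ e : Δ.E, r (newEdge Λ Δ e) = (∑ e, r₁ e) + 1 + r₂ (Sum.inr e) := fun e => rfl
  refine ⟨r, fun e e' h => ?_⟩
  induction e using concat_edge_cases with
  | h1 e =>
    rw [head_concat_lift] at h
    induction e' using concat_edge_cases with
    | h1 e' =>
      rw [tail_concat_lift, liftNode_eq_iff (tail_ne_sink h1.sink _)] at h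
      rw [hl, hl]
      exact hr₁ e e' h
    | h2 e' =>
      rw [hl, hn]
      have := Finset.single_le_sum (f := r₁) (fun _ _ => Nat.zero_le _) (Finset.mem_univ e)
      omega
  | h2 e =>
    rw [head_concat_inr] at h
    induction e' using concat_edge_cases with
    | h1 e' =>
      rw [tail_concat_lift] at h
      exact absurd h (glueNode_ne_liftNode (tail_ne_sink h1.sink _) (head_ne_source h2.source _))
    | h2 e' =>
      rw [tail_concat_inr] at h
      have := hr₂ _ _ (glueNode_injective h)
      rw [hn, hn]
      omega

lemma exists_isAngle_concat (h1 : IsRegular Λ o₁) (h2 : IsRegular Δ o₂) :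
    ∃ θ, IsAngle (concatOrientation o₁ o₂) θ := by
  obtain ⟨θ₁, hθ₁⟩ := h1.angle
  obtain ⟨θ₂, hθ₂⟩ := h2.angle
  set θ : (Λ.concat Δ).Edge → ℝ := Sum.elim (fun j => θ₁ (Sum.inl j))
    (Sum.elim (fun e => θ₁ (Sum.inr e)) fun e => θ₂ (Sum.inr e)) with hθ
  have hl : ∀ e : Λ.Edge, θ (liftEdge Λ Δ e) = θ₁ e := by
    rintro (j | e) <;> rfl
  have hr : ∀ e : Δ.E, θ (newEdge Λ Δ e) = θ₂ (Sum.inr e) := fun e => rfl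
  refine ⟨θ, fun e => ?_, fun e e' h => ?_, fun j => hθ₁.source j, fun j => ?_⟩
  · induction e using concat_edge_cases with
    | h1 e =>
      by_cases he : ∃ j, e = Λ.sinkEdge j
      · obtain ⟨j, rfl⟩ := he
        obtain ⟨r, hr, hd⟩ := hθ₁.dir (Λ.sinkEdge j)
        obtain ⟨r', hr', hd'⟩ := hθ₂.dir (Sum.inl j)
        refine ⟨r + r', add_pos hr hr', ?_⟩
        rw [hl, dir_concat_sinkEdge h1 h2, hd, hd', hθ₁.sink, hθ₂.source]
        push_cast
        ring
      · push Not at he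
        rw [hl, dir_concat_lift h1 he]
        exact hθ₁.dir e
    | h2 e =>
      rw [hr, dir_concat_inr h2]
      · exact hθ₂.dir _
      · intro j
        rw [Ne, tail_eq_source_iff h2.source]
        simp
  · induction e using concat_edge_cases with
    | h1 e =>
      rw [head_concat_lift] at h
      induction e' using concat_edge_cases with
      | h1 e' =>
        rw [tail_concat_lift, liftNode_eq_iff (tail_ne_sink h1.sink _)] at h
        rw [hl, hl]
        exact hθ₁.lt e e' h
      | h2 e' =>
        rw [tail_concat_inr] at h
        rw [hl, hr]
        by_cases he : ∃ j, Λ.head o₁ e = .sink j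
        · obtain ⟨j, hj⟩ := he
          rw [hj] at h
          have h' := glueNode_injective h
          have e1 : Δ.head o₂ (Sum.inl j) = Δ.second (Sum.inl j) := by simp [head, h2.source]
          have := hθ₂.lt (Sum.inl j) (Sum.inr e') (by rw [e1, h'])
          rw [head_eq_sink_iff h1.sink] at hj
          rw [hj, hθ₁.sink, ← hθ₂.source j]
          exact this
        · push Not at he
          refine absurd h.symm (glueNode_ne_liftNode he fun j => ?_)
          rw [Ne, tail_eq_source_iff h2.source]
          simp
    | h2 e =>
      rw [head_concat_inr] at h
      induction e' using concat_edge_cases with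
      | h1 e' =>
        rw [tail_concat_lift] at h
        exact absurd h (glueNode_ne_liftNode (tail_ne_sink h1.sink _) (head_ne_source h2.source _))
      | h2 e' =>
        rw [tail_concat_inr] at h
        exact hθ₂.lt _ _ (glueNode_injective h)
  · change θ (joinEdge Λ Δ (Δ.sinkEdge j)) = 0
    have := hθ₂.sink j
    rcases hs : Δ.sinkEdge j with i | e
    · rw [joinEdge_inl, hl, hθ₁.sink]
    · rw [hs] at this
      exact this

lemma IsRegular.concat (h1 : IsRegular Λ o₁) (h2 : IsRegular Δ o₂) :
    IsRegular (Λ.concat Δ) (concatOrientation o₁ o₂) where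
  source j := h1.source j
  sink j := (concatOrientation_joinEdge h1 h2 _).trans (h2.sink j)
  balanced := by
    refine isBalanced_concat (fun j => ?_) ?_ ?_
    · rw [concatOrientation_liftEdge, h1.sink]
    · simp only [concatOrientation_liftEdge]
      exact h1.balanced
    · simp only [concatOrientation_joinEdge h1 h2]
      exact h2.balanced
  unique o' hs hb := by
    have e1 := h1.unique _ (fun j => hs j) hb.lift
    have hs' : ∀ j, o' (liftEdge Λ Δ (Λ.sinkEdge j)) = true := fun j => by
      rw [← h1.sink j, ← e1]
    have e2 := h2.unique _ (fun j => hs' j) (hb.glue hs')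
    funext e
    induction e using concat_edge_cases with
    | h1 e => rw [concatOrientation_liftEdge, ← e1]
    | h2 e => exact congrFun e2 (Sum.inr e)
  acyclic := isAcyclicOrientation_concat h1 h2
  angle := exists_isAngle_concat h1 h2
  leftOf_sinkEdge j := (h1.leftOf_joinEdge _).trans (by rw [h2.leftOf_sinkEdge]; rfl)
  rightOf_sinkEdge j := (h1.rightOf_joinEdge _).trans (by rw [h2.rightOf_sinkEdge]; rfl)

lemma IsRegular.networkMatrix_eq {Γ : PlabicGraph n} {o : Γ.Orientation} (h : IsRegular Γ o)
    {wt : Γ.Edge → ℂˣ} {P : Γ.Edge → Fin n → ℂ} (hP : IsPathSum o wt P) (i j : Fin n) :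
    Γ.networkMatrix o wt i j = P (Sum.inl i) j := by
  obtain ⟨θ, hθ⟩ := h.angle
  rw [networkMatrix_eq_pathSum h.source h.sink hθ,
    IsPathSum.unique h.acyclic hP (isPathSum_pathSum h.acyclic wt)]

lemma IsRegular.exists_isPathSum {Γ : PlabicGraph n} {o : Γ.Orientation} (h : IsRegular Γ o)
    (wt : Γ.Edge → ℂˣ) : ∃ P, IsPathSum o wt P ∧ ∀ i j, Γ.networkMatrix o wt i j = P (Sum.inl i) j :=
  ⟨_, isPathSum_pathSum h.acyclic wt, h.networkMatrix_eq (isPathSum_pathSum h.acyclic wt)⟩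

lemma sum_concat_edge {M : Type} [AddCommMonoid M] (f : (Λ.concat Δ).Edge → M) :
    ∑ e, f e = ∑ e, f (liftEdge Λ Δ e) + ∑ e : Δ.E, f (newEdge Λ Δ e) := by
  have : ∑ e, f e = ∑ j : Fin n, f (Sum.inl j) +
      (∑ e : Λ.E, f (Sum.inr (Sum.inl e)) + ∑ e : Δ.E, f (newEdge Λ Δ e)) := by
    rw [Fintype.sum_sum_type]
    congr 1
    exact Fintype.sum_sum_type _
  rw [this, ← add_assoc, Fintype.sum_sum_type]
  rfl

lemma networkMatrix_concat (h1 : IsRegular Λ o₁) (h2 : IsRegular Δ o₂)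
    (wt : (Λ.concat Δ).Edge → ℂˣ) :
    (Λ.concat Δ).networkMatrix (concatOrientation o₁ o₂) wt =
      Λ.networkMatrix o₁ (fun e => wt (liftEdge Λ Δ e)) *
        Δ.networkMatrix o₂ (Sum.elim 1 fun e => wt (newEdge Λ Δ e)) := by
  classical
  obtain ⟨P₁, hP₁, e1⟩ := h1.exists_isPathSum fun e => wt (liftEdge Λ Δ e)
  obtain ⟨P₂, hP₂, e2⟩ := h2.exists_isPathSum (Sum.elim 1 fun e => wt (newEdge Λ Δ e))
  set P : (Λ.concat Δ).Edge → Fin n → ℂ := Sum.elim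
    (fun i j => ∑ k, P₁ (Sum.inl i) k * P₂ (Sum.inl k) j)
    (Sum.elim (fun e j => ∑ k, P₁ (Sum.inr e) k * P₂ (Sum.inl k) j) fun e => P₂ (Sum.inr e))
    with hPdef
  have hl : ∀ e j, P (liftEdge Λ Δ e) j = ∑ k, P₁ e k * P₂ (Sum.inl k) j := by
    rintro (j | e) <;> intro <;> rfl
  have hr : ∀ (e : Δ.E) j, P (newEdge Λ Δ e) j = P₂ (Sum.inr e) j := fun e j => rfl
  have hnode : ∀ x : Δ.Node, (∀ j, x ≠ .source j) → ∀ j,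
      (if glueNode Λ Δ x = .sink j then 1 else 0) +
        ∑ e' : (Λ.concat Δ).Edge, (if (Λ.concat Δ).tail (concatOrientation o₁ o₂) e' =
          glueNode Λ Δ x then P e' j else 0) =
      (if x = .sink j then 1 else 0) +
        ∑ e' : Δ.Edge, (if Δ.tail o₂ e' = x then P₂ e' j else 0) := by
    intro x hx j
    have h0 : (glueNode Λ Δ x = .sink j) = (x = .sink j) := by
      rcases x with a | a | a <;> simp [glueNode]
    rw [sum_concat_edge, Fintype.sum_sum_type
      (fun e' : Δ.Edge => if Δ.tail o₂ e' = x then P₂ e' j else 0), h0]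
    congr 2
    · rw [Finset.sum_eq_zero, Finset.sum_eq_zero]
      · intro i _
        rw [if_neg]
        rw [(tail_eq_source_iff h2.source _ i).mpr rfl]
        exact (hx i).symm
      · intro e _
        rw [if_neg]
        rw [tail_concat_lift]
        exact (glueNode_ne_liftNode (tail_ne_sink h1.sink _) hx).symm
    · refine Finset.sum_congr rfl fun e _ => ?_
      rw [tail_concat_inr, hr]
      simp only [glueNode_injective.eq_iff]
  have hP : IsPathSum (concatOrientation o₁ o₂) wt P := by
    intro e j
    induction e using concat_edge_cases with
    | h1 e =>
      rw [hl, head_concat_lift]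
      by_cases he : ∃ k, Λ.head o₁ e = .sink k
      · obtain ⟨k, hk⟩ := he
        have h0 : ∀ e' k, Λ.tail o₁ e' ≠ .sink k := tail_ne_sink h1.sink
        rw [hk, liftNode, hnode _ (second_ne_source _)]
        have e3 : ∀ k', P₁ e k' = wt (liftEdge Λ Δ e) * if k = k' then 1 else 0 := by
          intro k'
          rw [hP₁, hk]
          simp [h0]
        simp only [e3]
        simp only [mul_ite, mul_one, mul_zero, ite_mul, zero_mul, Finset.sum_ite_eq,
          Finset.mem_univ, if_true]
        rw [hP₂ (Sum.inl k) j]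
        simp only [Sum.elim_inl, Pi.one_apply, Units.val_one, one_mul]
        have e4 : Δ.head o₂ (Sum.inl k) = Δ.second (Sum.inl k) := by simp [head, h2.source]
        rw [e4]
      · push Not at he
        have e3 : liftNode Λ Δ (Λ.head o₁ e) ≠ .sink j := by
          have := head_ne_source h1.source e
          rcases hx : Λ.head o₁ e with v | i | i
          · simp [liftNode]
          · exact absurd hx (this i)
          · exact absurd hx (he i)
        rw [if_neg e3, zero_add, sum_concat_edge]
        have e4 : ∑ e' : Δ.E, (if (Λ.concat Δ).tail (concatOrientation o₁ o₂)
            (newEdge Λ Δ e') = liftNode Λ Δ (Λ.head o₁ e) then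
              P (newEdge Λ Δ e') j else 0) = 0 := by
          refine Finset.sum_eq_zero fun e' _ => if_neg ?_
          rw [tail_concat_inr]
          refine glueNode_ne_liftNode he fun j => ?_
          rw [Ne, tail_eq_source_iff h2.source]
          simp
        rw [e4, add_zero]
        have e5 : ∀ k, P₁ e k = wt (liftEdge Λ Δ e) *
            ∑ e', if Λ.tail o₁ e' = Λ.head o₁ e then P₁ e' k else 0 := by
          intro k
          rw [hP₁, if_neg (he k), zero_add]
        simp only [e5, mul_assoc]
        rw [← Finset.mul_sum]
        congr 1
        simp only [Finset.sum_mul]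
        rw [Finset.sum_comm]
        refine Finset.sum_congr rfl fun e' _ => ?_
        rw [tail_concat_lift, hl]
        simp only [liftNode_eq_iff he]
        split_ifs <;> simp
    | h2 e =>
      rw [hr, head_concat_inr, hnode _ (head_ne_source h2.source _), hP₂]
      rfl
  ext i j
  rw [(h1.concat h2).networkMatrix_eq hP, Matrix.mul_apply]
  simp only [e1, e2]
  exact hl (Sum.inl i) j

end

end Concat

/-! ### Face weights of concatenations -/

section

variable {M : Type} [CommMonoid M]

open Classical in
/-- The element `a` if `p` holds, and `1` otherwise. -/
noncomputable def sel (p : Prop) (a : M) : M := if p then a else 1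

lemma sel_eq_ite (p : Prop) [Decidable p] (a : M) : sel p a = if p then a else 1 := by
  unfold sel
  congr

lemma sel_pos {p : Prop} (h : p) (a : M) : sel p a = a := if_pos h

lemma sel_neg {p : Prop} (h : ¬ p) (a : M) : sel p a = 1 := if_neg h

lemma sel_one (p : Prop) : sel p (1 : M) = 1 := ite_self _

lemma sel_mul (p : Prop) (a b : M) : sel p (a * b) = sel p a * sel p b := by
  by_cases h : p <;> simp [sel, h]

lemma sel_prod {ι : Type} [Fintype ι] (p : Prop) (f : ι → M) :
    sel p (∏ i, f i) = ∏ i, sel p (f i) := by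
  by_cases h : p <;> simp [sel, h]

lemma sel_and (p q : Prop) (a : M) : sel (p ∧ q) a = sel q (sel p a) := by
  by_cases h : p <;> by_cases h' : q <;> simp [sel, h, h']

lemma sel_units (p : Prop) (a : ℂˣ) : ((sel p a : ℂˣ) : ℂ) = sel p (a : ℂ) := by
  by_cases h : p <;> simp [sel, h]

lemma sel_ne_zero {p : Prop} {a : ℂ} (h : a ≠ 0) : sel p a ≠ 0 := by
  by_cases h' : p <;> simp [sel, h, h']

lemma prod_sel_eq {ι : Type} [Fintype ι] (i : ι) (f : ι → M) :
    ∏ j, sel (i = j) (f j) = f i := by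
  rw [Finset.prod_eq_single i]
  · exact sel_pos rfl _
  · exact fun j _ hj => sel_neg hj.symm _
  · simp

/-- The product over the boundary of a face of `a e` for the edges `e` with the face on the left and
of `b e` for the edges `e` with the face on the right. -/
noncomputable def edgeProd (Γ : PlabicGraph n) (a b : Γ.Edge → M) (f : Γ.Face) : M :=
  ∏ e, sel (Γ.leftOf e = f) (a e) * sel (Γ.rightOf e = f) (b e)

lemma edgeProd_elim_one (Γ : PlabicGraph n) (a b : Γ.E → M) (f : Γ.Face) :
    Γ.edgeProd (Sum.elim 1 a) (Sum.elim 1 b) f =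
      ∏ e, sel (Γ.leftOf (Sum.inr e) = f) (a e) * sel (Γ.rightOf (Sum.inr e) = f) (b e) := by
  unfold edgeProd
  rw [Fintype.prod_sum_type, Finset.prod_eq_one, one_mul]
  · rfl
  · intro j _
    simp [sel_one]

lemma edgeProd_mul (Γ : PlabicGraph n) (a b a' b' : Γ.Edge → M) (f : Γ.Face) :
    Γ.edgeProd (fun e => a e * a' e) (fun e => b e * b' e) f =
      Γ.edgeProd a b f * Γ.edgeProd a' b' f := by
  unfold edgeProd
  rw [← Finset.prod_mul_distrib]
  refine Finset.prod_congr rfl fun e _ => ?_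
  rw [sel_mul, sel_mul, mul_mul_mul_comm]

end

lemma faceWeight_eq_edgeProd {Γ : PlabicGraph n} (o : Γ.Orientation) (wt : Γ.Edge → ℂˣ)
    (f : Γ.Face) : Γ.faceWeight o wt f = Γ.edgeProd (fun e => if o e then wt e else (wt e)⁻¹)
      (fun e => if o e then (wt e)⁻¹ else wt e) f := by
  classical
  unfold faceWeight edgeProd
  refine Finset.prod_congr rfl fun e _ => ?_
  rw [← sel_eq_ite, ← sel_eq_ite]
  by_cases h : o e = true
  · simp only [h, if_true]
  · simp only [h, if_false, Bool.false_eq_true]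
    exact mul_comm _ _

section

variable {Λ Δ : PlabicGraph n} {M : Type} [CommMonoid M]

lemma prod_concat_edge (f : (Λ.concat Δ).Edge → M) :
    ∏ e, f e = (∏ e, f (liftEdge Λ Δ e)) * ∏ e : Δ.E, f (newEdge Λ Δ e) := by
  have : ∏ e, f e = (∏ j : Fin n, f (Sum.inl j)) *
      ((∏ e : Λ.E, f (Sum.inr (Sum.inl e))) * ∏ e : Δ.E, f (Sum.inr (Sum.inr e))) := by
    rw [Fintype.prod_sum_type]
    congr 1
    exact Fintype.prod_sum_type _
  rw [this, ← mul_assoc, Fintype.prod_sum_type (fun e => f (liftEdge Λ Δ e))]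
  rfl

lemma prod_concat_face (f : (Λ.concat Δ).Face → M) :
    ∏ e, f e = (∏ e, f (liftFace Λ Δ e)) * ∏ e : Δ.F, f (newFace Λ Δ e) := by
  have : ∏ e, f e = (∏ j : Fin (n + 1), f (Sum.inl j)) *
      ((∏ e : Λ.F, f (Sum.inr (Sum.inl e))) * ∏ e : Δ.F, f (Sum.inr (Sum.inr e))) := by
    rw [Fintype.prod_sum_type]
    congr 1
    exact Fintype.prod_sum_type _
  rw [this, ← mul_assoc, Fintype.prod_sum_type (fun e => f (liftFace Λ Δ e))]
  rfl

/-- The product of `a r` over the places `r` on the right side at which the face `f` touches it. -/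
noncomputable def rightProd (Γ : PlabicGraph n) (a : Fin (n + 1) → M) (f : Γ.Face) : M :=
  ∏ r, sel (Γ.rightFace r = f) (a r)

lemma rightProd_mul (Γ : PlabicGraph n) (a b : Fin (n + 1) → M) (f : Γ.Face) :
    Γ.rightProd (fun r => a r * b r) f = Γ.rightProd a f * Γ.rightProd b f := by
  simp only [rightProd, sel_mul, Finset.prod_mul_distrib]

lemma rightProd_units (Γ : PlabicGraph n) (a : Fin (n + 1) → ℂˣ) (f : Γ.Face) :
    ((Γ.rightProd a f : ℂˣ) : ℂ) = Γ.rightProd (fun r => (a r : ℂ)) f := by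
  simp only [rightProd, Units.coe_prod, sel_units]

lemma rightProd_ne_zero (Γ : PlabicGraph n) {a : Fin (n + 1) → ℂ} (h : ∀ r, a r ≠ 0)
    (f : Γ.Face) : Γ.rightProd a f ≠ 0 :=
  Finset.prod_ne_zero_iff.mpr fun r _ => sel_ne_zero (h r)

lemma prod_rightProd (Γ : PlabicGraph n) (a : Fin (n + 1) → M) :
    ∏ f, Γ.rightProd a f = ∏ r, a r := by
  unfold rightProd
  rw [Finset.prod_comm]
  refine Finset.prod_congr rfl fun r _ => ?_
  exact prod_sel_eq (Γ.rightFace r) fun _ => a r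

lemma sel_joinFace_eq_liftFace (g : Δ.Face) (f : Λ.Face) (a : M) :
    sel (joinFace Λ Δ g = liftFace Λ Δ f) a = Λ.rightProd (fun r => sel (g = Sum.inl r) a) f := by
  unfold rightProd
  rcases g with r | g
  · simp only [joinFace_inl, Sum.inl.injEq, liftFace_injective.eq_iff]
    rw [Finset.prod_eq_single r]
    · rw [sel_pos rfl]
    · intro r' _ hr'
      rw [sel_neg hr'.symm, sel_one]
    · simp
  · simp only [joinFace_inr]
    rw [sel_neg (liftFace_ne _ _).symm, Finset.prod_eq_one]
    intro r _
    rw [sel_neg (p := Sum.inr g = Sum.inl r) (by simp), sel_one]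

lemma joinFace_eq_newFace (g : Δ.Face) (f : Δ.F) :
    joinFace Λ Δ g = newFace Λ Δ f ↔ g = Sum.inr f := by
  rcases g with r | g
  · rw [joinFace_inl]
    exact iff_of_false (liftFace_ne _ _) (by simp)
  · rw [joinFace_inr, newFace_injective.eq_iff]
    simp

lemma edgeProd_concat_liftFace (a b : (Λ.concat Δ).Edge → M) (f : Λ.Face) :
    (Λ.concat Δ).edgeProd a b (liftFace Λ Δ f) =
      Λ.edgeProd (fun e => a (liftEdge Λ Δ e)) (fun e => b (liftEdge Λ Δ e)) f *
      Λ.rightProd (fun r => Δ.edgeProd (Sum.elim 1 fun e => a (newEdge Λ Δ e))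
        (Sum.elim 1 fun e => b (newEdge Λ Δ e)) (Sum.inl r)) f := by
  rw [edgeProd, prod_concat_edge]
  congr 1
  · rw [edgeProd]
    refine Finset.prod_congr rfl fun e _ => ?_
    simp only [leftOf_liftEdge, rightOf_liftEdge, liftFace_injective.eq_iff]
  · simp only [edgeProd_elim_one, leftOf_newEdge, rightOf_newEdge, sel_joinFace_eq_liftFace]
    simp only [← rightProd_mul]
    unfold rightProd
    rw [Finset.prod_comm]
    refine Finset.prod_congr rfl fun r _ => ?_
    rw [sel_prod]

lemma edgeProd_concat_newFace (a b : (Λ.concat Δ).Edge → M) (f : Δ.F) :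
    (Λ.concat Δ).edgeProd a b (newFace Λ Δ f) =
      Δ.edgeProd (Sum.elim 1 fun e => a (newEdge Λ Δ e))
        (Sum.elim 1 fun e => b (newEdge Λ Δ e)) (Sum.inr f) := by
  rw [edgeProd, prod_concat_edge, edgeProd_elim_one, Finset.prod_eq_one, one_mul]
  · simp only [leftOf_newEdge, rightOf_newEdge, joinFace_eq_newFace]
  · intro e _
    rw [leftOf_liftEdge, rightOf_liftEdge, sel_neg (liftFace_ne _ _), sel_neg (liftFace_ne _ _),
      one_mul]

end

section

variable {Λ Δ : PlabicGraph n}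

lemma faceWeight_elim_one (Γ : PlabicGraph n) (o : Γ.Orientation) (wt : Γ.E → ℂˣ) (f : Γ.Face) :
    Γ.faceWeight o (Sum.elim 1 wt) f =
      Γ.edgeProd (Sum.elim 1 fun e => if o (Sum.inr e) then wt e else (wt e)⁻¹)
        (Sum.elim 1 fun e => if o (Sum.inr e) then (wt e)⁻¹ else wt e) f := by
  rw [faceWeight_eq_edgeProd]
  congr 1 <;>
  · funext e
    rcases e with j | e
    · simp
    · rfl

lemma faceWeight_concat_liftFace (o₁ : Λ.Orientation) (o₂ : Δ.Orientation)
    (wt : (Λ.concat Δ).Edge → ℂˣ) (f : Λ.Face) :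
    (Λ.concat Δ).faceWeight (concatOrientation o₁ o₂) wt (liftFace Λ Δ f) =
      Λ.faceWeight o₁ (fun e => wt (liftEdge Λ Δ e)) f *
      Λ.rightProd (fun r => Δ.faceWeight o₂ (Sum.elim 1 fun e => wt (newEdge Λ Δ e))
        (Sum.inl r)) f := by
  simp only [faceWeight_elim_one]
  simp only [faceWeight_eq_edgeProd, edgeProd_concat_liftFace, concatOrientation_liftEdge]
  rfl

lemma faceWeight_concat_newFace (o₁ : Λ.Orientation) (o₂ : Δ.Orientation)
    (wt : (Λ.concat Δ).Edge → ℂˣ) (f : Δ.F) :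
    (Λ.concat Δ).faceWeight (concatOrientation o₁ o₂) wt (newFace Λ Δ f) =
      Δ.faceWeight o₂ (Sum.elim 1 fun e => wt (newEdge Λ Δ e)) (Sum.inr f) := by
  rw [faceWeight_elim_one, faceWeight_eq_edgeProd, edgeProd_concat_newFace]
  rfl

end

/-! ### Rescaling the edges at the sinks -/

/-- The quotients of consecutive entries of a sequence, which is continued by `1` at both ends. -/
def stepRatio (d : Fin n → ℂˣ) (r : Fin (n + 1)) : ℂˣ :=
  Fin.cases (motive := fun _ => ℂˣ) 1 d r *
    Fin.lastCases (motive := fun _ => ℂˣ) 1 (fun j => (d j)⁻¹) r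

lemma stepRatio_inv (d : Fin n → ℂˣ) (r : Fin (n + 1)) :
    stepRatio (fun j => (d j)⁻¹) r = (stepRatio d r)⁻¹ := by
  unfold stepRatio
  rw [mul_inv]
  congr 1
  · induction r using Fin.cases <;> simp
  · induction r using Fin.lastCases <;> simp

lemma prod_sel_stepRatio (d : Fin n → ℂˣ) (p : Fin (n + 1) → Prop) :
    ∏ r, sel (p r) (stepRatio d r) =
      ∏ j : Fin n, sel (p j.succ) (d j) * sel (p j.castSucc) (d j)⁻¹ := by
  unfold stepRatio
  simp only [sel_mul, Finset.prod_mul_distrib]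
  congr 1
  · rw [Fin.prod_univ_succ]
    simp [sel_one]
  · rw [Fin.prod_univ_castSucc]
    simp [sel_one]

section

variable {Γ : PlabicGraph n} {o : Γ.Orientation}

/-- The edge weights which are `d j` at the sink `j`, and `1` elsewhere. -/
noncomputable def sinkWeights (Γ : PlabicGraph n) (d : Fin n → ℂˣ) (e : Γ.Edge) : ℂˣ :=
  ∏ j, sel (Γ.sinkEdge j = e) (d j)

lemma sinkWeights_sinkEdge (d : Fin n → ℂˣ) (j : Fin n) :
    Γ.sinkWeights d (Γ.sinkEdge j) = d j := by
  unfold sinkWeights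
  simp only [sinkEdge_injective.eq_iff]
  simp only [eq_comm (b := j)]
  exact prod_sel_eq j d

lemma sinkWeights_of_ne (d : Fin n → ℂˣ) {e : Γ.Edge} (h : ∀ j, Γ.sinkEdge j ≠ e) :
    Γ.sinkWeights d e = 1 :=
  Finset.prod_eq_one fun j _ => sel_neg (h j) _

lemma IsRegular.networkMatrix_mul_sinkWeights (h : IsRegular Γ o) (wt : Γ.Edge → ℂˣ)
    (d : Fin n → ℂˣ) : Γ.networkMatrix o (fun e => wt e * Γ.sinkWeights d e) =
      Γ.networkMatrix o wt * Matrix.diagonal fun j => (d j : ℂ) := by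
  classical
  obtain ⟨P, hP, e1⟩ := h.exists_isPathSum wt
  have hP' : IsPathSum o (fun e => wt e * Γ.sinkWeights d e) fun e j => P e j * d j := by
    intro e j
    simp only
    rw [hP e j]
    by_cases he : ∃ k, Γ.sinkEdge k = e
    · obtain ⟨k, rfl⟩ := he
      rw [sinkWeights_sinkEdge, (head_eq_sink_iff h.sink _ k).mpr rfl]
      simp only [tail_ne_sink h.sink, if_false, Finset.sum_const_zero, add_zero,
        PlabicNode.sink.injEq, Units.val_mul]
      split_ifs with hkj
      · rw [hkj]
        ring
      · simp
    · push Not at he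
      rw [sinkWeights_of_ne d he, mul_one, mul_assoc]
      congr 1
      have h0 : ∀ k, Γ.head o e ≠ .sink k := by
        intro k
        rw [Ne, head_eq_sink_iff h.sink]
        exact (he k).symm
      rw [if_neg (h0 j), zero_add, zero_add, Finset.sum_mul]
      refine Finset.sum_congr rfl fun e' _ => ?_
      split_ifs <;> simp
  ext i j
  rw [h.networkMatrix_eq hP', Matrix.mul_diagonal, e1]

lemma faceWeight_mul (o : Γ.Orientation) (wt wt' : Γ.Edge → ℂˣ) (f : Γ.Face) :
    Γ.faceWeight o (fun e => wt e * wt' e) f = Γ.faceWeight o wt f * Γ.faceWeight o wt' f := by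
  simp only [faceWeight_eq_edgeProd]
  rw [← edgeProd_mul]
  congr 1 <;>
  · funext e
    split_ifs
    · first | rfl | exact mul_inv _ _
    · first | rfl | exact mul_inv _ _

lemma IsRegular.faceWeight_sinkWeights (h : IsRegular Γ o) (d : Fin n → ℂˣ) (f : Γ.Face) :
    Γ.faceWeight o (Γ.sinkWeights d) f = Γ.rightProd (stepRatio d) f := by
  rw [faceWeight_eq_edgeProd, edgeProd, rightProd, prod_sel_stepRatio d fun r => Γ.rightFace r = f]
  symm
  refine Fintype.prod_of_injective Γ.sinkEdge sinkEdge_injective _ _ (fun e he => ?_) fun j => ?_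
  · rw [sinkWeights_of_ne d fun j hj => he ⟨j, hj⟩]
    simp [sel_one]
  · rw [sinkWeights_sinkEdge, h.leftOf_sinkEdge, h.rightOf_sinkEdge, h.sink]
    simp

/-- The matrix `A` is the boundary measurement matrix of all networks with the face weights `y`,
and there are such networks. -/
structure Measures (Γ : PlabicGraph n) (o : Γ.Orientation) (y : Γ.Face → ℂ)
    (A : Matrix (Fin n) (Fin n) ℂ) : Prop where
  exists_wt : ∃ wt : Γ.Edge → ℂˣ, ∀ f, (Γ.faceWeight o wt f : ℂ) = y f
  networkMatrix_eq : ∀ wt : Γ.Edge → ℂˣ, (∀ f, (Γ.faceWeight o wt f : ℂ) = y f) →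
    Γ.networkMatrix o wt = A

lemma Measures.meas_eq (h : IsRegular Γ o) {y : Γ.Face → ℂ} {A : Matrix (Fin n) (Fin n) ℂ}
    (hy : Measures Γ o y A) : Γ.meas y = A := by
  have hex : ∃ p : Γ.Orientation × (Γ.Edge → ℂˣ),
      Γ.IsPerfect p.1 ∧ ∀ f, (Γ.faceWeight p.1 p.2 f : ℂ) = y f := by
    obtain ⟨wt, hwt⟩ := hy.exists_wt
    exact ⟨(o, wt), (h.isPerfect_iff o).mpr rfl, hwt⟩
  rw [meas, dif_pos hex]
  obtain ⟨h1, h2⟩ := hex.choose_spec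
  rw [h.isPerfect_iff] at h1
  rw [h1] at h2 ⊢
  exact hy.networkMatrix_eq _ h2

/-- A family of weightings of the new faces such that the boundary measurement matrices are `R t`,
up to diagonal matrices. The function `κ t` tells by which factors the old faces have to be changed
when the graph is appended to another one. -/
structure IsElementary (Γ : PlabicGraph n) (o : Γ.Orientation)
    (R : ℂ → Matrix (Fin n) (Fin n) ℂ) (κ : ℂ → Fin (n + 1) → ℂ) (z : ℂ → Γ.F → ℂ) : Prop where
  exists_wt : ∀ t ≠ 0, ∃ wt : Γ.E → ℂˣ,
    ∀ f, (Γ.faceWeight o (Sum.elim 1 wt) (Sum.inr f) : ℂ) = z t f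
  factor : ∀ t ≠ 0, ∀ wt : Γ.E → ℂˣ,
    (∀ f, (Γ.faceWeight o (Sum.elim 1 wt) (Sum.inr f) : ℂ) = z t f) →
    ∃ d : Fin n → ℂˣ, Γ.networkMatrix o (Sum.elim 1 wt) =
        (Matrix.diagonal fun j => (d j : ℂ)) * R t ∧
      ∀ r, (Γ.faceWeight o (Sum.elim 1 wt) (Sum.inl r) : ℂ) = stepRatio d r * κ t r

end

/-- The weighting of a concatenation which is obtained from a weighting of the first graph and the
families `κ` and `z` for the second one. -/
noncomputable def glueWeights (Λ Δ : PlabicGraph n) (κ : ℂ → Fin (n + 1) → ℂ)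
    (z : ℂ → Δ.F → ℂ) (y : Λ.Face → ℂ) (t : ℂ) : (Λ.concat Δ).Face → ℂ :=
  Sum.elim (fun r => y (Sum.inl r) * Λ.rightProd (κ t) (Sum.inl r))
    (Sum.elim (fun f => y (Sum.inr f) * Λ.rightProd (κ t) (Sum.inr f)) (z t))

section

variable {Λ Δ : PlabicGraph n} {o₁ : Λ.Orientation} {o₂ : Δ.Orientation}
  {R : ℂ → Matrix (Fin n) (Fin n) ℂ} {κ : ℂ → Fin (n + 1) → ℂ} {z : ℂ → Δ.F → ℂ}

lemma glueWeights_liftFace (y : Λ.Face → ℂ) (t : ℂ) (f : Λ.Face) :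
    glueWeights Λ Δ κ z y t (liftFace Λ Δ f) = y f * Λ.rightProd (κ t) f := by
  rcases f with r | f <;> rfl

lemma glueWeights_newFace (y : Λ.Face → ℂ) (t : ℂ) (f : Δ.F) :
    glueWeights Λ Δ κ z y t (newFace Λ Δ f) = z t f := rfl

lemma IsElementary.ne_zero (h : IsElementary Δ o₂ R κ z) {t : ℂ} (ht : t ≠ 0) :
    (∀ r, κ t r ≠ 0) ∧ ∀ f, z t f ≠ 0 := by
  obtain ⟨wt, hwt⟩ := h.exists_wt t ht
  obtain ⟨d, -, hd⟩ := h.factor t ht wt hwt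
  refine ⟨fun r h0 => ?_, fun f => ?_⟩
  · have := hd r
    rw [h0, mul_zero] at this
    exact Units.ne_zero _ this
  · rw [← hwt]
    exact Units.ne_zero _

lemma Measures.concat (h1 : IsRegular Λ o₁) (h2 : IsRegular Δ o₂)
    (he : IsElementary Δ o₂ R κ z) {y : Λ.Face → ℂ} {A : Matrix (Fin n) (Fin n) ℂ}
    (hy : Measures Λ o₁ y A) {t : ℂ} (ht : t ≠ 0) :
    Measures (Λ.concat Δ) (concatOrientation o₁ o₂) (glueWeights Λ Δ κ z y t) (A * R t) := by
  have hκ := fun f => Λ.rightProd_ne_zero (he.ne_zero ht).1 f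
  have hprod : ∀ (wt₂ : Δ.E → ℂˣ) (d : Fin n → ℂˣ),
      (∀ r, (Δ.faceWeight o₂ (Sum.elim 1 wt₂) (Sum.inl r) : ℂ) = stepRatio d r * κ t r) →
      ∀ f, ((Λ.rightProd (fun r => Δ.faceWeight o₂ (Sum.elim 1 wt₂) (Sum.inl r)) f : ℂˣ) : ℂ) =
        (Λ.rightProd (stepRatio d) f : ℂˣ) * Λ.rightProd (κ t) f := by
    intro wt₂ d hd f
    rw [rightProd_units, rightProd_units, ← rightProd_mul]
    simp only [hd]
  constructor
  · obtain ⟨wt₁, hwt₁⟩ := hy.exists_wt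
    obtain ⟨wt₂, hwt₂⟩ := he.exists_wt t ht
    obtain ⟨d, -, hd⟩ := he.factor t ht wt₂ hwt₂
    set wt₁' : Λ.Edge → ℂˣ := fun e => wt₁ e * Λ.sinkWeights (fun j => (d j)⁻¹) e with hwt₁'
    set wt : (Λ.concat Δ).Edge → ℂˣ := Sum.elim (fun j => wt₁' (Sum.inl j))
      (Sum.elim (fun e => wt₁' (Sum.inr e)) wt₂) with hwt
    have hl : (fun e => wt (liftEdge Λ Δ e)) = wt₁' := by
      funext e
      rcases e with j | e <;> rfl
    have hn : (fun e => wt (newEdge Λ Δ e)) = wt₂ := rfl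
    refine ⟨wt, fun f => ?_⟩
    induction f using concat_face_cases with
    | h1 f =>
      rw [faceWeight_concat_liftFace, hl, hn, glueWeights_liftFace, Units.val_mul, hprod wt₂ d hd,
        hwt₁', faceWeight_mul, h1.faceWeight_sinkWeights, Units.val_mul, hwt₁]
      have : Λ.rightProd (stepRatio fun j => (d j)⁻¹) f * Λ.rightProd (stepRatio d) f = 1 := by
        rw [← rightProd_mul]
        refine Finset.prod_eq_one fun r _ => ?_
        beta_reduce
        rw [stepRatio_inv, inv_mul_cancel, sel_one]
      have h3 := congrArg (Units.val) this
      rw [Units.val_mul, Units.val_one] at h3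
      linear_combination y f * Λ.rightProd (κ t) f * h3
    | h2 f =>
      rw [faceWeight_concat_newFace, hn, hwt₂]
      rfl
  · intro wt hwt
    have hz : ∀ f, (Δ.faceWeight o₂ (Sum.elim 1 fun e => wt (newEdge Λ Δ e)) (Sum.inr f) : ℂ) =
        z t f := by
      intro f
      rw [← faceWeight_concat_newFace o₁, hwt]
      rfl
    obtain ⟨d, hd1, hd2⟩ := he.factor t ht _ hz
    have hy' := hy.networkMatrix_eq (fun e => wt (liftEdge Λ Δ e) * Λ.sinkWeights d e)
      fun f => by
        have h3 := hwt (liftFace Λ Δ f)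
        rw [faceWeight_concat_liftFace, glueWeights_liftFace, Units.val_mul, hprod _ d hd2,
          ← mul_assoc] at h3
        rw [faceWeight_mul, h1.faceWeight_sinkWeights, Units.val_mul]
        exact mul_right_cancel₀ (hκ f) h3
    rw [networkMatrix_concat h1 h2, hd1, ← Matrix.mul_assoc, ← h1.networkMatrix_mul_sinkWeights, hy']

end

/-! ### Reflections in the midline -/

/-- The action of a reflection in the midline on vertices, edges and faces; on the edges at the
sources and the faces that touch the left side it is given by the reversal of their numbers. -/
structure Reflection (Γ : PlabicGraph n) where
  onV : Γ.V ≃ Γ.V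
  onE : Γ.E ≃ Γ.E
  onF : Γ.F ≃ Γ.F

/-- The action of a reflection on all edges. -/
def Reflection.onEdge {Γ : PlabicGraph n} (ρ : Reflection Γ) : Γ.Edge ≃ Γ.Edge :=
  Equiv.sumCongr Fin.revPerm ρ.onE

/-- The action of a reflection on all faces. -/
def Reflection.onFace {Γ : PlabicGraph n} (ρ : Reflection Γ) : Γ.Face ≃ Γ.Face :=
  Equiv.sumCongr Fin.revPerm ρ.onF

/-- The face contains, in its boundary, a square with two opposite vertices on the midline and the
other ones black. -/
def HasMidlineSquare (Γ : PlabicGraph n) (f : Γ.Face) : Prop :=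
  ∃ v₁ v₂ v₃ v₄ : Γ.V, ∃ e₁ e₂ e₃ e₄ : Γ.Edge,
    [v₁, v₂, v₃, v₄].Nodup ∧
    (Γ.Borders e₁ f ∧ Γ.Borders e₂ f ∧ Γ.Borders e₃ f ∧ Γ.Borders e₄ f) ∧
    (Γ.Joins e₁ v₁ v₂ ∧ Γ.Joins e₂ v₂ v₃ ∧ Γ.Joins e₃ v₃ v₄ ∧ Γ.Joins e₄ v₄ v₁) ∧
    Γ.white v₂ = false ∧ Γ.white v₄ = false ∧ Γ.OnMidline v₁ ∧ Γ.OnMidline v₃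

/-- The properties of the drawing which show that the graph has only one reflection, and that its
midline squares are what they should be. -/
structure IsDrawn (Γ : PlabicGraph n) : Prop where
  pos_injective : Function.Injective Γ.pos
  width_pos : 0 < Γ.width
  re_pos : ∀ v, 0 < (Γ.pos v).re ∧ (Γ.pos v).re < Γ.width
  first_ne_second : ∀ e, Γ.first e ≠ Γ.second e
  edge_ext : ∀ e e', Γ.first e = Γ.first e' → Γ.second e = Γ.second e' → e = e'
  edge_ext' : ∀ e e', Γ.first e = Γ.second e' → Γ.second e = Γ.first e' → e = e'
  second_injective : Function.Injective fun j => Γ.second (Sum.inl j)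
  borders : ∀ f, ∃ e, Γ.Borders e (Sum.inr f)
  rightFace_injective : Function.Injective Γ.rightFace
  im_sinkEdge : ∀ j, (Γ.nodePos (Γ.first (Γ.sinkEdge j))).im = (j : ℕ)
  im_source : ∀ j, (Γ.nodePos (Γ.second (Sum.inl j))).im = (j : ℕ)
  white_of_onMidline : ∀ v, Γ.OnMidline v → Γ.white v = true
  square : ∀ f, Γ.HasMidlineSquare f →
    Γ.IsMidlineSquare f ∧ (∃ s, f = Sum.inr s) ∧ ∀ r, Γ.rightFace r ≠ f

/-- The graph with the given reflection is move-symmetric. -/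
structure IsMirror (Γ : PlabicGraph n) (ρ : Reflection Γ) : Prop where
  pos_onV : ∀ v, Γ.pos (ρ.onV v) = (starRingEnd ℂ) (Γ.pos v) + ((n : ℂ) - 1) * Complex.I
  edge : ∀ e,
    (Γ.first (ρ.onEdge e) = Γ.reflectNode ρ.onV (Γ.first e) ∧
      Γ.second (ρ.onEdge e) = Γ.reflectNode ρ.onV (Γ.second e) ∧
      Γ.leftOf (ρ.onEdge e) = ρ.onFace (Γ.rightOf e) ∧
      Γ.rightOf (ρ.onEdge e) = ρ.onFace (Γ.leftOf e)) ∨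
    (Γ.first (ρ.onEdge e) = Γ.reflectNode ρ.onV (Γ.second e) ∧
      Γ.second (ρ.onEdge e) = Γ.reflectNode ρ.onV (Γ.first e) ∧
      Γ.leftOf (ρ.onEdge e) = ρ.onFace (Γ.leftOf e) ∧
      Γ.rightOf (ρ.onEdge e) = ρ.onFace (Γ.rightOf e))
  rightFace_rev : ∀ r, Γ.rightFace (Fin.rev r) = ρ.onFace (Γ.rightFace r)
  onFace_square : ∀ f, Γ.IsMidlineSquare f → ρ.onFace f = f
  color_corner : ∀ v, Γ.IsMidlineCorner v → Γ.white (ρ.onV v) = Γ.white v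
  color : ∀ v, ¬ Γ.IsMidlineCorner v → Γ.white (ρ.onV v) = !Γ.white v

section

variable {Γ : PlabicGraph n} {ρ : Reflection Γ}

lemma IsDrawn.hasMidlineSquare_iff (h : IsDrawn Γ) (f : Γ.Face) :
    Γ.HasMidlineSquare f ↔ Γ.IsMidlineSquare f := by
  refine ⟨fun hf => (h.square f hf).1, ?_⟩
  rintro ⟨v₁, v₂, v₃, v₄, e₁, e₂, e₃, e₄, hn, hb, j1, j2, j3, j4, c2, -, c4, m1, m3⟩
  have c1 := h.white_of_onMidline v₁ m1
  rw [c1] at c2 c4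
  refine ⟨v₁, v₂, v₃, v₄, e₁, e₂, e₃, e₄, hn, ⟨?_, ?_, ?_, ?_⟩, ⟨j1, j2, j3, j4⟩, c2, c4, m1, m3⟩
  all_goals simp [hb]

lemma IsDrawn.square_inr (h : IsDrawn Γ) {f : Γ.Face} (hf : Γ.IsMidlineSquare f) :
    ∃ s, f = Sum.inr s := (h.square f ((h.hasMidlineSquare_iff f).mpr hf)).2.1

lemma IsDrawn.not_square_inl (h : IsDrawn Γ) (r : Fin (n + 1)) :
    ¬ Γ.IsMidlineSquare (Sum.inl r) := by
  intro hf
  obtain ⟨s, hs⟩ := h.square_inr hf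
  simp at hs

lemma IsDrawn.not_square_rightFace (h : IsDrawn Γ) (r : Fin (n + 1)) :
    ¬ Γ.IsMidlineSquare (Γ.rightFace r) := fun hf =>
  (h.square _ ((h.hasMidlineSquare_iff _).mpr hf)).2.2 r rfl

/-- The reflection as a move symmetry. -/
def IsMirror.moveSymmetry (h : IsMirror Γ ρ) : Γ.MoveSymmetry where
  onV := ρ.onV
  onE := ρ.onEdge
  onF := ρ.onFace
  pos_onV := h.pos_onV
  edge := h.edge
  color_corner := h.color_corner
  color := h.color

lemma reflectNode_injective (σ : Γ.V ≃ Γ.V) : Function.Injective (Γ.reflectNode σ) := by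
  rintro (a | a | a) (b | b | b) h <;> simp_all [reflectNode]

lemma IsDrawn.moveSymmetry_onF_eq (h : IsDrawn Γ) (hρ : IsMirror Γ ρ) (σ : Γ.MoveSymmetry) :
    σ.onF = ρ.onFace := by
  have hV : σ.onV = ρ.onV := by
    ext v
    apply h.pos_injective
    rw [σ.pos_onV, hρ.pos_onV]
  have hE : ∀ e, σ.onE e = ρ.onEdge e ∧ σ.onF (Γ.leftOf e) = ρ.onFace (Γ.leftOf e) ∧
      σ.onF (Γ.rightOf e) = ρ.onFace (Γ.rightOf e) := by
    intro e
    have hσ := σ.edge e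
    have hρe := hρ.edge e
    rw [hV] at hσ
    have hne : Γ.reflectNode ρ.onV (Γ.first e) ≠ Γ.reflectNode ρ.onV (Γ.second e) :=
      fun h' => h.first_ne_second e (reflectNode_injective _ h')
    rcases hσ with ⟨a1, a2, a3, a4⟩ | ⟨a1, a2, a3, a4⟩ <;>
    rcases hρe with ⟨b1, b2, b3, b4⟩ | ⟨b1, b2, b3, b4⟩
    · have e1 := h.edge_ext _ _ (a1.trans b1.symm) (a2.trans b2.symm)
      rw [e1] at a3 a4
      exact ⟨e1, a4.symm.trans b4, a3.symm.trans b3⟩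
    · have e1 := h.edge_ext' _ _ (a1.trans b2.symm) (a2.trans b1.symm)
      rw [e1] at a1
      exact absurd (a1.symm.trans b1) hne
    · have e1 := h.edge_ext' _ _ (a1.trans b2.symm) (a2.trans b1.symm)
      rw [e1] at a1
      exact absurd (b1.symm.trans a1) hne
    · have e1 := h.edge_ext _ _ (a1.trans b1.symm) (a2.trans b2.symm)
      rw [e1] at a3 a4
      exact ⟨e1, a3.symm.trans b3, a4.symm.trans b4⟩
  have hF : ∀ f : Γ.F, σ.onF (Sum.inr f) = ρ.onFace (Sum.inr f) := by
    intro f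
    obtain ⟨e, he | he⟩ := h.borders f
    · rw [← he]
      exact (hE e).2.1
    · rw [← he]
      exact (hE e).2.2
  ext f
  rcases f with r | f
  · by_cases hn : n = 0
    · subst hn
      obtain ⟨x, hx⟩ := ρ.onFace.surjective (σ.onF (Sum.inl r))
      rcases x with r' | f
      · rw [← hx]
        have : r' = r := Fin.ext (by omega)
        rw [this]
      · rw [← hF] at hx
        have := σ.onF.injective hx
        simp at this
    · induction r using Fin.cases with
      | zero =>
        have := (hE (Sum.inl ⟨0, by omega⟩)).2.2
        exact this
      | succ j => exact (hE (Sum.inl j)).2.1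
  · exact hF f

end

/-! ### Reflections of concatenations -/

section

variable {Λ Δ : PlabicGraph n}

lemma borders_liftEdge (e : Λ.Edge) (f : (Λ.concat Δ).Face) :
    (Λ.concat Δ).Borders (liftEdge Λ Δ e) f ↔ ∃ g, f = liftFace Λ Δ g ∧ Λ.Borders e g := by
  unfold Borders
  rw [leftOf_liftEdge, rightOf_liftEdge]
  grind

lemma borders_newEdge (e : Δ.E) (f : (Λ.concat Δ).Face) :
    (Λ.concat Δ).Borders (newEdge Λ Δ e) f ↔
      ∃ g, f = joinFace Λ Δ g ∧ Δ.Borders (Sum.inr e) g := by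
  unfold Borders
  rw [leftOf_newEdge, rightOf_newEdge]
  grind

lemma joinFace_injective (h : Function.Injective Λ.rightFace) :
    Function.Injective (joinFace Λ Δ) := by
  rintro (r | f) (r' | f') he
  · rw [h (liftFace_injective he)]
  · exact absurd he (liftFace_ne _ _)
  · exact absurd he.symm (liftFace_ne _ _)
  · rw [newFace_injective he]

lemma joins_liftEdge_old (e : Λ.Edge) (v w : Λ.V) :
    (Λ.concat Δ).Joins (liftEdge Λ Δ e) (oldVertex Λ Δ v) (oldVertex Λ Δ w) ↔
      Λ.Joins e v w := by
  unfold Joins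
  simp only [first_liftEdge, second_liftEdge, liftNode_eq_inl]

lemma joins_newEdge_new (e : Δ.E) (v w : Δ.V) :
    (Λ.concat Δ).Joins (newEdge Λ Δ e) (newVertex Λ Δ v) (newVertex Λ Δ w) ↔
      Δ.Joins (Sum.inr e) v w := by
  unfold Joins
  simp only [first_newEdge, second_newEdge, glueNode_eq_inr]

lemma Joins.exists_inr {Γ : PlabicGraph n} {e : Γ.Edge} {v w : Γ.V} (h : Γ.Joins e v w) :
    ∃ e', e = Sum.inr e' := by
  rcases e with j | e
  · rcases h with ⟨h, -⟩ | ⟨h, -⟩ <;> simp [first] at h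
  · exact ⟨e, rfl⟩

lemma pos_newVertex (v : Δ.V) :
    (Λ.concat Δ).pos (newVertex Λ Δ v) = Λ.width + Δ.pos v := rfl

lemma pos_oldVertex (v : Λ.V) : (Λ.concat Δ).pos (oldVertex Λ Δ v) = Λ.pos v := rfl

lemma onMidline_newVertex (v : Δ.V) :
    (Λ.concat Δ).OnMidline (newVertex Λ Δ v) ↔ Δ.OnMidline v := by
  unfold OnMidline
  rw [pos_newVertex]
  simp

lemma white_of_onMidline_concat (h1 : IsDrawn Λ) (h2 : IsDrawn Δ) (v : (Λ.concat Δ).V)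
    (hv : (Λ.concat Δ).OnMidline v) : (Λ.concat Δ).white v = true := by
  induction v using concat_vertex_cases with
  | h1 v => exact h1.white_of_onMidline v hv
  | h2 v => exact h2.white_of_onMidline v ((onMidline_newVertex v).mp hv)

lemma joins_concat (h1 : IsDrawn Λ) (h2 : IsDrawn Δ) {e : (Λ.concat Δ).Edge}
    {x y : (Λ.concat Δ).V} (h : (Λ.concat Δ).Joins e x y)
    (hxy : ((Λ.concat Δ).pos x).im ≠ ((Λ.concat Δ).pos y).im) :
    (∃ e' v w, e = liftEdge Λ Δ e' ∧ x = oldVertex Λ Δ v ∧ y = oldVertex Λ Δ w ∧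
      Λ.Joins e' v w) ∨
    ∃ e' v w, e = newEdge Λ Δ e' ∧ x = newVertex Λ Δ v ∧ y = newVertex Λ Δ w ∧
      Δ.Joins (Sum.inr e') v w := by
  have key : ∀ e' x y, (Λ.concat Δ).first (liftEdge Λ Δ e') = .vertex x →
      (Λ.concat Δ).second (liftEdge Λ Δ e') = .vertex y →
      ((Λ.concat Δ).pos x).im ≠ ((Λ.concat Δ).pos y).im →
      ∃ v w, x = oldVertex Λ Δ v ∧ y = oldVertex Λ Δ w ∧
        Λ.first e' = .vertex v ∧ Λ.second e' = .vertex w := by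
    intro e' x y hx hy hne
    rw [first_liftEdge] at hx
    rw [second_liftEdge] at hy
    rcases hf : Λ.first e' with v | j | j
    · rw [hf] at hx
      simp only [liftNode, PlabicNode.vertex.injEq] at hx
      subst hx
      rcases hs : Λ.second e' with w | j | j
      · rw [hs] at hy
        simp only [liftNode, PlabicNode.vertex.injEq] at hy
        subst hy
        exact ⟨v, w, rfl, rfl, rfl, rfl⟩
      · exact absurd hs (second_ne_source _ _)
      · rw [hs] at hy
        have hj := (second_eq_sink_iff _ _).mp hs
        have i1 := h1.im_sinkEdge j
        rw [← hj, hf] at i1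
        have i2 := h2.im_source j
        rcases hw : Δ.second (Sum.inl j) with w | i | i
        · rw [liftNode, hw, glueNode, PlabicNode.vertex.injEq] at hy
          subst hy
          rw [hw] at i2
          rw [pos_newVertex, pos_oldVertex] at hne
          simp only [nodePos] at i1 i2
          simp [i1, i2] at hne
        · exact absurd hw (second_ne_source _ _)
        · rw [liftNode, hw, glueNode] at hy
          simp at hy
    · rw [hf] at hx
      simp [liftNode] at hx
    · exact absurd hf (first_ne_sink _ _)
  induction e using concat_edge_cases with
  | h1 e =>
    left
    rcases h with ⟨ha, hb⟩ | ⟨ha, hb⟩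
    · obtain ⟨v, w, rfl, rfl, hv, hw⟩ := key e x y ha hb hxy
      exact ⟨e, v, w, rfl, rfl, rfl, Or.inl ⟨hv, hw⟩⟩
    · obtain ⟨v, w, rfl, rfl, hv, hw⟩ := key e y x ha hb hxy.symm
      exact ⟨e, w, v, rfl, rfl, rfl, Or.inr ⟨hv, hw⟩⟩
  | h2 e =>
    right
    have hv : ∀ x : (Λ.concat Δ).V, ∀ z, glueNode Λ Δ z = .vertex x →
        ∃ v, x = newVertex Λ Δ v := by
      intro x z hz
      induction x using concat_vertex_cases with
      | h1 v => exact absurd hz (glueNode_ne_inl _ _)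
      | h2 v => exact ⟨v, rfl⟩
    have hx : ∃ v, x = newVertex Λ Δ v := by
      rcases h with ⟨ha, -⟩ | ⟨-, ha⟩
      · exact hv x _ ((first_newEdge e).symm.trans ha)
      · exact hv x _ ((second_newEdge e).symm.trans ha)
    have hy : ∃ v, y = newVertex Λ Δ v := by
      rcases h with ⟨-, ha⟩ | ⟨ha, -⟩
      · exact hv y _ ((second_newEdge e).symm.trans ha)
      · exact hv y _ ((first_newEdge e).symm.trans ha)
    obtain ⟨v, rfl⟩ := hx
    obtain ⟨w, rfl⟩ := hy
    exact ⟨e, v, w, rfl, rfl, rfl, (joins_newEdge_new e v w).mp h⟩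

lemma Joins.im_ne (h1 : IsDrawn Λ) (h2 : IsDrawn Δ) {x y : (Λ.concat Δ).V}
    (hx : (Λ.concat Δ).OnMidline x) (hy : (Λ.concat Δ).white y = false) :
    ((Λ.concat Δ).pos x).im ≠ ((Λ.concat Δ).pos y).im := by
  intro h
  have := white_of_onMidline_concat h1 h2 y (h.symm.trans hx)
  rw [hy] at this
  exact absurd this (by simp)

lemma Joins.symm {Γ : PlabicGraph n} {e : Γ.Edge} {v w : Γ.V} (h : Γ.Joins e v w) :
    Γ.Joins e w v := Or.symm h

lemma HasMidlineSquare.of_concat (h1 : IsDrawn Λ) (h2 : IsDrawn Δ) {f : (Λ.concat Δ).Face}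
    (hf : (Λ.concat Δ).HasMidlineSquare f) :
    (∃ g, f = liftFace Λ Δ g ∧ Λ.HasMidlineSquare g) ∨
      ∃ g, f = joinFace Λ Δ g ∧ Δ.HasMidlineSquare g := by
  obtain ⟨v₁, v₂, v₃, v₄, e₁, e₂, e₃, e₄, hn, ⟨b1, b2, b3, b4⟩, ⟨j1, j2, j3, j4⟩, c2, c4, m1, m3⟩ :=
    hf
  have j1' := joins_concat h1 h2 j1 (Joins.im_ne h1 h2 m1 c2)
  have j2' := joins_concat h1 h2 j2.symm (Joins.im_ne h1 h2 m3 c2)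
  have j3' := joins_concat h1 h2 j3 (Joins.im_ne h1 h2 m3 c4)
  have j4' := joins_concat h1 h2 j4.symm (Joins.im_ne h1 h2 m1 c4)
  have hne := oldVertex_ne_newVertex (Λ := Λ) (Δ := Δ)
  rcases j1' with ⟨a₁, v₁', v₂', rfl, rfl, rfl, k1⟩ | ⟨a₁, v₁', v₂', rfl, rfl, rfl, k1⟩
  · obtain ⟨a₂, v₃', w, rfl, rfl, hw, k2⟩ := j2'.resolve_right fun ⟨_, _, _, _, _, h, _⟩ => hne _ _ h
    obtain ⟨a₃, u, v₄', rfl, hu, rfl, k3⟩ := j3'.resolve_right fun ⟨_, _, _, _, h, _⟩ => hne _ _ h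
    obtain ⟨a₄, x, y, rfl, hx, hy, k4⟩ := j4'.resolve_right fun ⟨_, _, _, _, h, _⟩ => hne _ _ h
    obtain rfl := oldVertex_injective hw
    obtain rfl := oldVertex_injective hu
    obtain rfl := oldVertex_injective hx
    obtain rfl := oldVertex_injective hy
    rw [borders_liftEdge] at b1 b2 b3 b4
    obtain ⟨g, rfl, b1⟩ := b1
    obtain ⟨g2, hg, b2⟩ := b2
    obtain rfl := liftFace_injective hg
    obtain ⟨g3, hg, b3⟩ := b3
    obtain rfl := liftFace_injective hg
    obtain ⟨g4, hg, b4⟩ := b4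
    obtain rfl := liftFace_injective hg
    exact Or.inl ⟨g, rfl, v₁', v₂', v₃', v₄', a₁, a₂, a₃, a₄,
      List.Nodup.of_map (oldVertex Λ Δ) hn, ⟨b1, b2, b3, b4⟩, ⟨k1, k2.symm, k3, k4.symm⟩, c2, c4,
      m1, m3⟩
  · obtain ⟨a₂, v₃', w, rfl, rfl, hw, k2⟩ :=
      j2'.resolve_left fun ⟨_, _, _, _, _, h, _⟩ => hne _ _ h.symm
    obtain ⟨a₃, u, v₄', rfl, hu, rfl, k3⟩ :=
      j3'.resolve_left fun ⟨_, _, _, _, h, _⟩ => hne _ _ h.symm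
    obtain ⟨a₄, x, y, rfl, hx, hy, k4⟩ :=
      j4'.resolve_left fun ⟨_, _, _, _, h, _⟩ => hne _ _ h.symm
    obtain rfl := newVertex_injective hw
    obtain rfl := newVertex_injective hu
    obtain rfl := newVertex_injective hx
    obtain rfl := newVertex_injective hy
    have hinj := joinFace_injective (Δ := Δ) h1.rightFace_injective
    rw [borders_newEdge] at b1 b2 b3 b4
    obtain ⟨g, rfl, b1⟩ := b1
    obtain ⟨g2, hg, b2⟩ := b2
    obtain rfl := hinj hg
    obtain ⟨g3, hg, b3⟩ := b3
    obtain rfl := hinj hg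
    obtain ⟨g4, hg, b4⟩ := b4
    obtain rfl := hinj hg
    rw [onMidline_newVertex] at m1 m3
    exact Or.inr ⟨g, rfl, v₁', v₂', v₃', v₄', _, _, _, _,
      List.Nodup.of_map (newVertex Λ Δ) hn, ⟨b1, b2, b3, b4⟩, ⟨k1, k2.symm, k3, k4.symm⟩, c2, c4,
      m1, m3⟩

lemma borders_liftFace {g : Λ.Face} (hr : ∀ r, Λ.rightFace r ≠ g) {e : (Λ.concat Δ).Edge}
    (h : (Λ.concat Δ).Borders e (liftFace Λ Δ g)) :
    ∃ e', e = liftEdge Λ Δ e' ∧ Λ.Borders e' g := by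
  induction e using concat_edge_cases with
  | h1 e =>
    rw [borders_liftEdge] at h
    obtain ⟨g', hg, hb⟩ := h
    obtain rfl := liftFace_injective hg
    exact ⟨e, rfl, hb⟩
  | h2 e =>
    rw [borders_newEdge] at h
    obtain ⟨g', hg, -⟩ := h
    rcases g' with r | s
    · rw [joinFace_inl] at hg
      exact absurd (liftFace_injective hg).symm (hr r)
    · exact absurd hg (liftFace_ne _ _)

lemma borders_newFace {s : Δ.F} {e : (Λ.concat Δ).Edge} :
    (Λ.concat Δ).Borders e (newFace Λ Δ s) ↔
      ∃ e', e = newEdge Λ Δ e' ∧ Δ.Borders (Sum.inr e') (Sum.inr s) := by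
  induction e using concat_edge_cases with
  | h1 e =>
    refine iff_of_false (fun h => ?_) fun h => ?_
    · rw [borders_liftEdge] at h
      obtain ⟨g, hg, -⟩ := h
      exact liftFace_ne _ _ hg.symm
    · obtain ⟨e', he', -⟩ := h
      exact liftEdge_ne _ _ he'
  | h2 e =>
    rw [borders_newEdge]
    constructor
    · rintro ⟨g, hg, hb⟩
      rw [eq_comm, joinFace_eq_newFace] at hg
      subst hg
      exact ⟨e, rfl, hb⟩
    · rintro ⟨e', he', hb⟩
      obtain rfl := newEdge_injective he'
      exact ⟨_, rfl, hb⟩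

lemma IsMidlineSquare.lift {g : Λ.Face} (hg : Λ.IsMidlineSquare g)
    (hr : ∀ r, Λ.rightFace r ≠ g) : (Λ.concat Δ).IsMidlineSquare (liftFace Λ Δ g) := by
  obtain ⟨v₁, v₂, v₃, v₄, e₁, e₂, e₃, e₄, hn, hb, j1, j2, j3, j4, c⟩ := hg
  refine ⟨oldVertex Λ Δ v₁, oldVertex Λ Δ v₂, oldVertex Λ Δ v₃, oldVertex Λ Δ v₄,
    liftEdge Λ Δ e₁, liftEdge Λ Δ e₂, liftEdge Λ Δ e₃, liftEdge Λ Δ e₄,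
    List.Nodup.map oldVertex_injective hn, fun e => ?_, (joins_liftEdge_old _ _ _).mpr j1,
    (joins_liftEdge_old _ _ _).mpr j2, (joins_liftEdge_old _ _ _).mpr j3,
    (joins_liftEdge_old _ _ _).mpr j4, c⟩
  constructor
  · intro h
    obtain ⟨e', rfl, h'⟩ := borders_liftFace hr h
    simp only [liftEdge_injective.eq_iff]
    exact (hb e').mp h'
  · have : ∀ e', (e' = e₁ ∨ e' = e₂ ∨ e' = e₃ ∨ e' = e₄) →
        (Λ.concat Δ).Borders (liftEdge Λ Δ e') (liftFace Λ Δ g) := fun e' he' =>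
      (borders_liftEdge _ _).mpr ⟨g, rfl, (hb e').mpr he'⟩
    rintro (rfl | rfl | rfl | rfl)
    all_goals
      apply this
      simp

lemma IsMidlineSquare.new {s : Δ.F} (hs : Δ.IsMidlineSquare (Sum.inr s)) :
    (Λ.concat Δ).IsMidlineSquare (newFace Λ Δ s) := by
  obtain ⟨v₁, v₂, v₃, v₄, e₁, e₂, e₃, e₄, hn, hb, j1, j2, j3, j4, c1, c2, c3, m1, m3⟩ := hs
  obtain ⟨e₁, rfl⟩ := j1.exists_inr
  obtain ⟨e₂, rfl⟩ := j2.exists_inr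
  obtain ⟨e₃, rfl⟩ := j3.exists_inr
  obtain ⟨e₄, rfl⟩ := j4.exists_inr
  refine ⟨newVertex Λ Δ v₁, newVertex Λ Δ v₂, newVertex Λ Δ v₃, newVertex Λ Δ v₄,
    newEdge Λ Δ e₁, newEdge Λ Δ e₂, newEdge Λ Δ e₃, newEdge Λ Δ e₄,
    List.Nodup.map newVertex_injective hn, fun e => ?_, (joins_newEdge_new _ _ _).mpr j1,
    (joins_newEdge_new _ _ _).mpr j2, (joins_newEdge_new _ _ _).mpr j3,
    (joins_newEdge_new _ _ _).mpr j4, c1, c2, c3, (onMidline_newVertex _).mpr m1,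
    (onMidline_newVertex _).mpr m3⟩
  rw [borders_newFace]
  constructor
  · rintro ⟨e', rfl, h⟩
    simp only [newEdge_injective.eq_iff]
    simpa using (hb _).mp h
  · rintro (rfl | rfl | rfl | rfl)
    all_goals
      refine ⟨_, rfl, (hb _).mpr ?_⟩
      simp

lemma isDrawn_square_concat (h1 : IsDrawn Λ) (h2 : IsDrawn Δ) {f : (Λ.concat Δ).Face}
    (hf : (Λ.concat Δ).HasMidlineSquare f) :
    (Λ.concat Δ).IsMidlineSquare f ∧ (∃ s, f = Sum.inr s) ∧
      ∀ r, (Λ.concat Δ).rightFace r ≠ f := by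
  rcases hf.of_concat h1 h2 with ⟨g, rfl, hg⟩ | ⟨g, rfl, hg⟩
  · obtain ⟨a, ⟨s, rfl⟩, b⟩ := h1.square g hg
    refine ⟨a.lift b, ⟨Sum.inl s, rfl⟩, fun r h => ?_⟩
    change joinFace Λ Δ (Δ.rightFace r) = _ at h
    rcases hr : Δ.rightFace r with r' | s'
    · rw [hr, joinFace_inl] at h
      exact b r' (liftFace_injective h)
    · rw [hr] at h
      exact liftFace_ne _ _ h.symm
  · obtain ⟨a, ⟨s, rfl⟩, b⟩ := h2.square g hg
    exact ⟨a.new, ⟨Sum.inr s, rfl⟩, fun r h =>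
      b r (joinFace_injective h1.rightFace_injective h)⟩

lemma liftNode_injective (h2 : IsDrawn Δ) : Function.Injective (liftNode Λ Δ) := by
  intro x y h
  by_cases hy : ∀ j, y ≠ .sink j
  · exact (liftNode_eq_iff hy).mp h
  · by_cases hx : ∀ j, x ≠ .sink j
    · exact ((liftNode_eq_iff hx).mp h.symm).symm
    · push Not at hx hy
      obtain ⟨i, rfl⟩ := hx
      obtain ⟨j, rfl⟩ := hy
      rw [h2.second_injective (glueNode_injective h)]

lemma IsDrawn.concat (h1 : IsDrawn Λ) (h2 : IsDrawn Δ) : IsDrawn (Λ.concat Δ) where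
  pos_injective := by
    intro v w h
    induction v using concat_vertex_cases with
    | h1 v =>
      induction w using concat_vertex_cases with
      | h1 w => rw [h1.pos_injective h]
      | h2 w =>
        have := congrArg Complex.re h
        rw [pos_oldVertex, pos_newVertex, Complex.add_re, Complex.ofReal_re] at this
        linarith [(h1.re_pos v).2, (h2.re_pos w).1]
    | h2 v =>
      induction w using concat_vertex_cases with
      | h1 w =>
        have := congrArg Complex.re h
        rw [pos_oldVertex, pos_newVertex, Complex.add_re, Complex.ofReal_re] at this
        linarith [(h1.re_pos w).2, (h2.re_pos v).1]
      | h2 w =>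
        rw [pos_newVertex, pos_newVertex, add_right_inj] at h
        rw [h2.pos_injective h]
  re_pos v := by
    have hw : (Λ.concat Δ).width = Λ.width + Δ.width := rfl
    rw [hw]
    induction v using concat_vertex_cases with
    | h1 v =>
      rw [pos_oldVertex]
      exact ⟨(h1.re_pos v).1, by linarith [(h1.re_pos v).2, h2.width_pos]⟩
    | h2 v =>
      rw [pos_newVertex, Complex.add_re, Complex.ofReal_re]
      exact ⟨by linarith [(h2.re_pos v).1, h1.width_pos], by linarith [(h2.re_pos v).2]⟩
  width_pos := add_pos h1.width_pos h2.width_pos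
  first_ne_second e := by
    induction e using concat_edge_cases with
    | h1 e =>
      rw [first_liftEdge, second_liftEdge]
      exact fun h => h1.first_ne_second e (liftNode_injective h2 h)
    | h2 e =>
      rw [first_newEdge, second_newEdge]
      exact fun h => h2.first_ne_second _ (glueNode_injective h)
  edge_ext e e' ha hb := by
    induction e using concat_edge_cases <;> induction e' using concat_edge_cases <;>
      simp only [first_liftEdge, second_liftEdge, first_newEdge, second_newEdge] at ha hb
    · rw [h1.edge_ext _ _ (liftNode_injective h2 ha) (liftNode_injective h2 hb)]
    · exact absurd ha.symm (glueNode_ne_liftNode (first_ne_sink _) fun j => by simp [first])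
    · exact absurd ha (glueNode_ne_liftNode (first_ne_sink _) fun j => by simp [first])
    · have := h2.edge_ext _ _ (glueNode_injective ha) (glueNode_injective hb)
      rw [Sum.inr_injective this]
  edge_ext' e e' ha hb := by
    induction e using concat_edge_cases <;> induction e' using concat_edge_cases <;>
      simp only [first_liftEdge, second_liftEdge, first_newEdge, second_newEdge] at ha hb
    · rw [h1.edge_ext' _ _ (liftNode_injective h2 ha) (liftNode_injective h2 hb)]
    · exact absurd ha.symm (glueNode_ne_liftNode (first_ne_sink _) (second_ne_source _))
    · exact absurd hb (glueNode_ne_liftNode (first_ne_sink _) (second_ne_source _))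
    · have := h2.edge_ext' _ _ (glueNode_injective ha) (glueNode_injective hb)
      rw [Sum.inr_injective this]
  second_injective i j h := by
    have e : ∀ j, (Λ.concat Δ).second (Sum.inl j) = liftNode Λ Δ (Λ.second (Sum.inl j)) :=
      fun j => second_liftEdge (Sum.inl j)
    simp only [e] at h
    exact h1.second_injective (liftNode_injective h2 h)
  borders f := by
    rcases f with f | f
    · obtain ⟨e, he⟩ := h1.borders f
      exact ⟨liftEdge Λ Δ e, (borders_liftEdge _ _).mpr ⟨_, rfl, he⟩⟩
    · obtain ⟨e, he⟩ := h2.borders f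
      rcases e with j | e
      · rcases he with he | he <;> simp [leftOf, rightOf] at he
      · exact ⟨newEdge Λ Δ e, borders_newFace.mpr ⟨e, rfl, he⟩⟩
  rightFace_injective r r' h :=
    h2.rightFace_injective (joinFace_injective h1.rightFace_injective h)
  im_sinkEdge j := by
    change ((Λ.concat Δ).nodePos
      ((Λ.concat Δ).first (joinEdge Λ Δ (Δ.sinkEdge j)))).im = _
    have h3 := h2.im_sinkEdge j
    rcases hs : Δ.sinkEdge j with i | e
    · rw [joinEdge_inl, first_liftEdge, nodePos_liftNode (first_ne_sink _), h1.im_sinkEdge]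
      rw [hs] at h3
      simpa [first, nodePos] using h3
    · rw [hs] at h3
      rw [joinEdge_inr, first_newEdge, nodePos_glueNode (by simp [first])]
      simpa using h3
  im_source j := by
    change ((Λ.concat Δ).nodePos ((Λ.concat Δ).second (liftEdge Λ Δ (Sum.inl j)))).im = _
    have h3 := h1.im_source j
    rw [second_liftEdge]
    rcases hs : Λ.second (Sum.inl j) with v | i | i
    · rw [hs] at h3
      rw [nodePos_liftNode (by simp), h3]
    · exact absurd hs (second_ne_source _ _)
    · rw [hs] at h3
      rw [liftNode, nodePos_glueNode (second_ne_source _), Complex.add_im, h2.im_source i]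
      simpa [nodePos] using h3
  white_of_onMidline := white_of_onMidline_concat h1 h2
  square _ := isDrawn_square_concat h1 h2

end

section

variable {Λ Δ : PlabicGraph n} {o₁ : Λ.Orientation} {ρ₁ : Reflection Λ} {ρ₂ : Reflection Δ}

lemma isMidlineSquare_liftFace (h1 : IsDrawn Λ) (h2 : IsDrawn Δ) (g : Λ.Face) :
    (Λ.concat Δ).IsMidlineSquare (liftFace Λ Δ g) ↔ Λ.IsMidlineSquare g := by
  constructor
  · intro h
    rw [← (h1.concat h2).hasMidlineSquare_iff] at h
    rcases h.of_concat h1 h2 with ⟨g', hg, hg'⟩ | ⟨g', hg, hg'⟩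
    · obtain rfl := liftFace_injective hg
      exact (h1.hasMidlineSquare_iff g).mp hg'
    · obtain ⟨s, rfl⟩ := (h2.square g' hg').2.1
      exact absurd hg (liftFace_ne _ _)
  · intro h
    exact h.lift fun r hr => h1.not_square_rightFace r (hr ▸ h)

lemma isMidlineSquare_joinFace (h1 : IsDrawn Λ) (h2 : IsDrawn Δ) (g : Δ.Face) :
    (Λ.concat Δ).IsMidlineSquare (joinFace Λ Δ g) ↔ Δ.IsMidlineSquare g := by
  rcases g with r | s
  · rw [joinFace_inl, isMidlineSquare_liftFace h1 h2]
    exact iff_of_false (h1.not_square_rightFace r) (h2.not_square_inl r)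
  · constructor
    · intro h
      rw [← (h1.concat h2).hasMidlineSquare_iff] at h
      rcases h.of_concat h1 h2 with ⟨g', hg, hg'⟩ | ⟨g', hg, hg'⟩
      · exact absurd hg.symm (liftFace_ne _ _)
      · rw [joinFace_injective h1.rightFace_injective hg]
        exact (h2.hasMidlineSquare_iff g').mp hg'
    · exact fun h => h.new

lemma isMidlineSquare_newFace (h1 : IsDrawn Λ) (h2 : IsDrawn Δ) (s : Δ.F) :
    (Λ.concat Δ).IsMidlineSquare (newFace Λ Δ s) ↔ Δ.IsMidlineSquare (Sum.inr s) :=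
  isMidlineSquare_joinFace h1 h2 (Sum.inr s)

lemma isMidlineCorner_oldVertex (h1 : IsDrawn Λ) (h2 : IsDrawn Δ) (v : Λ.V) :
    (Λ.concat Δ).IsMidlineCorner (oldVertex Λ Δ v) ↔ Λ.IsMidlineCorner v := by
  constructor
  · rintro ⟨f, e, hf, hb, hv⟩
    induction f using concat_face_cases with
    | h1 g =>
      rw [isMidlineSquare_liftFace h1 h2] at hf
      obtain ⟨e, rfl, hb'⟩ := borders_liftFace
        (fun r hr => h1.not_square_rightFace r (hr ▸ hf)) hb
      rw [first_liftEdge, second_liftEdge, liftNode_eq_inl, liftNode_eq_inl] at hv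
      exact ⟨g, e, hf, hb', hv⟩
    | h2 s =>
      obtain ⟨e, rfl, hb'⟩ := borders_newFace.mp hb
      rw [first_newEdge, second_newEdge] at hv
      rcases hv with hv | hv <;> exact absurd hv (glueNode_ne_inl _ _)
  · rintro ⟨g, e, hg, hb, hv⟩
    refine ⟨liftFace Λ Δ g, liftEdge Λ Δ e, (isMidlineSquare_liftFace h1 h2 g).mpr hg,
      (borders_liftEdge _ _).mpr ⟨g, rfl, hb⟩, ?_⟩
    rwa [first_liftEdge, second_liftEdge, liftNode_eq_inl, liftNode_eq_inl]

lemma IsRegular.second_ne_sink (hr : IsRegular Λ o₁) (h1 : IsDrawn Λ) {g : Λ.Face}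
    (hg : Λ.IsMidlineSquare g) {e : Λ.Edge} (hb : Λ.Borders e g) (j : Fin n) :
    Λ.second e ≠ .sink j := by
  rw [Ne, second_eq_sink_iff]
  rintro rfl
  rcases hb with hb | hb
  · rw [hr.leftOf_sinkEdge] at hb
    exact h1.not_square_rightFace _ (hb ▸ hg)
  · rw [hr.rightOf_sinkEdge] at hb
    exact h1.not_square_rightFace _ (hb ▸ hg)

lemma isMidlineCorner_newVertex (hr : IsRegular Λ o₁) (h1 : IsDrawn Λ) (h2 : IsDrawn Δ)
    (v : Δ.V) :
    (Λ.concat Δ).IsMidlineCorner (newVertex Λ Δ v) ↔ Δ.IsMidlineCorner v := by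
  constructor
  · rintro ⟨f, e, hf, hb, hv⟩
    induction f using concat_face_cases with
    | h1 g =>
      rw [isMidlineSquare_liftFace h1 h2] at hf
      obtain ⟨e, rfl, hb'⟩ := borders_liftFace
        (fun r hr => h1.not_square_rightFace r (hr ▸ hf)) hb
      rw [first_liftEdge, second_liftEdge, liftNode_eq_inr, liftNode_eq_inr] at hv
      rcases hv with ⟨j, hv, -⟩ | ⟨j, hv, -⟩
      · exact absurd hv (first_ne_sink _ _)
      · exact absurd hv (hr.second_ne_sink h1 hf hb' j)
    | h2 s =>
      rw [isMidlineSquare_newFace h1 h2] at hf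
      obtain ⟨e, rfl, hb'⟩ := borders_newFace.mp hb
      rw [first_newEdge, second_newEdge, glueNode_eq_inr, glueNode_eq_inr] at hv
      exact ⟨_, _, hf, hb', hv⟩
  · rintro ⟨g, e, hg, hb, hv⟩
    obtain ⟨s, rfl⟩ := h2.square_inr hg
    rcases e with j | e
    · rcases hb with hb | hb <;> simp [leftOf, rightOf] at hb
    refine ⟨newFace Λ Δ s, newEdge Λ Δ e, (isMidlineSquare_newFace h1 h2 s).mpr hg,
      borders_newFace.mpr ⟨e, rfl, hb⟩, ?_⟩
    rwa [first_newEdge, second_newEdge, glueNode_eq_inr, glueNode_eq_inr]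

/-- The reflection of a concatenation. -/
def Reflection.concat (ρ₁ : Reflection Λ) (ρ₂ : Reflection Δ) : Reflection (Λ.concat Δ) where
  onV := Equiv.sumCongr ρ₁.onV ρ₂.onV
  onE := Equiv.sumCongr ρ₁.onE ρ₂.onE
  onF := Equiv.sumCongr ρ₁.onF ρ₂.onF

lemma Reflection.concat_onEdge_lift (e : Λ.Edge) :
    (ρ₁.concat ρ₂).onEdge (liftEdge Λ Δ e) = liftEdge Λ Δ (ρ₁.onEdge e) := by
  rcases e with j | e <;> rfl

lemma Reflection.concat_onFace_lift (f : Λ.Face) :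
    (ρ₁.concat ρ₂).onFace (liftFace Λ Δ f) = liftFace Λ Δ (ρ₁.onFace f) := by
  rcases f with j | f <;> rfl

lemma Reflection.concat_onEdge_new (e : Δ.E) :
    (ρ₁.concat ρ₂).onEdge (newEdge Λ Δ e) = newEdge Λ Δ (ρ₂.onE e) := rfl

lemma Reflection.concat_onFace_new (f : Δ.F) :
    (ρ₁.concat ρ₂).onFace (newFace Λ Δ f) = newFace Λ Δ (ρ₂.onF f) := rfl

lemma IsMirror.onFace_joinFace (m1 : IsMirror Λ ρ₁) (g : Δ.Face) :
    (ρ₁.concat ρ₂).onFace (joinFace Λ Δ g) = joinFace Λ Δ (ρ₂.onFace g) := by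
  rcases g with r | s
  · rw [joinFace_inl, Reflection.concat_onFace_lift, ← m1.rightFace_rev]
    rfl
  · rfl

lemma reflectNode_glueNode (x : Δ.Node) :
    (Λ.concat Δ).reflectNode (ρ₁.concat ρ₂).onV (glueNode Λ Δ x) =
      glueNode Λ Δ (Δ.reflectNode ρ₂.onV x) := by
  rcases x with v | j | j <;> rfl

lemma reflectNode_ne_source {Γ : PlabicGraph n} (σ : Γ.V ≃ Γ.V) (e : Γ.Edge) (j : Fin n) :
    Γ.reflectNode σ (Γ.second e) ≠ .source j := by
  have := second_ne_source (Γ := Γ) e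
  rcases hs : Γ.second e with v | i | i
  · simp [reflectNode]
  · exact absurd hs (this i)
  · simp [reflectNode]

lemma IsMirror.second_inl_rev (m2 : IsMirror Δ ρ₂) (j : Fin n) :
    Δ.second (Sum.inl j.rev) = Δ.reflectNode ρ₂.onV (Δ.second (Sum.inl j)) := by
  rcases m2.edge (Sum.inl j) with ⟨-, h, -⟩ | ⟨h, -⟩
  · exact h
  · exact absurd h.symm (reflectNode_ne_source _ _ j.rev)

lemma IsMirror.reflectNode_liftNode (m2 : IsMirror Δ ρ₂) (x : Λ.Node) :
    (Λ.concat Δ).reflectNode (ρ₁.concat ρ₂).onV (liftNode Λ Δ x) =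
      liftNode Λ Δ (Λ.reflectNode ρ₁.onV x) := by
  rcases x with v | j | j
  · rfl
  · rfl
  · rw [liftNode, reflectNode_glueNode, ← m2.second_inl_rev]
    rfl

lemma IsMirror.concat (hr : IsRegular Λ o₁) (h1 : IsDrawn Λ) (h2 : IsDrawn Δ)
    (m1 : IsMirror Λ ρ₁) (m2 : IsMirror Δ ρ₂) :
    IsMirror (Λ.concat Δ) (ρ₁.concat ρ₂) where
  pos_onV v := by
    induction v using concat_vertex_cases with
    | h1 v => exact m1.pos_onV v
    | h2 v =>
      have := m2.pos_onV v
      change (Λ.width : ℂ) + Δ.pos (ρ₂.onV v) = _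
      rw [this, pos_newVertex, map_add, Complex.conj_ofReal]
      ring
  edge e := by
    induction e using concat_edge_cases with
    | h1 e =>
      simp only [Reflection.concat_onEdge_lift, first_liftEdge, second_liftEdge, leftOf_liftEdge,
        rightOf_liftEdge, m2.reflectNode_liftNode, Reflection.concat_onFace_lift]
      rcases m1.edge e with ⟨a, b, c, d⟩ | ⟨a, b, c, d⟩
      · left
        rw [a, b, c, d]
        exact ⟨rfl, rfl, rfl, rfl⟩
      · right
        rw [a, b, c, d]
        exact ⟨rfl, rfl, rfl, rfl⟩
    | h2 e =>
      simp only [Reflection.concat_onEdge_new, first_newEdge, second_newEdge, leftOf_newEdge,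
        rightOf_newEdge, reflectNode_glueNode, m1.onFace_joinFace]
      rcases m2.edge (Sum.inr e) with ⟨a, b, c, d⟩ | ⟨a, b, c, d⟩
      · left
        rw [← a, ← b, ← c, ← d]
        exact ⟨rfl, rfl, rfl, rfl⟩
      · right
        rw [← a, ← b, ← c, ← d]
        exact ⟨rfl, rfl, rfl, rfl⟩
  rightFace_rev r := by
    change joinFace Λ Δ (Δ.rightFace r.rev) =
      (ρ₁.concat ρ₂).onFace (joinFace Λ Δ (Δ.rightFace r))
    rw [m1.onFace_joinFace, m2.rightFace_rev]
  onFace_square f hf := by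
    induction f using concat_face_cases with
    | h1 g =>
      rw [isMidlineSquare_liftFace h1 h2] at hf
      rw [Reflection.concat_onFace_lift, m1.onFace_square g hf]
    | h2 s =>
      rw [isMidlineSquare_newFace h1 h2] at hf
      have := m2.onFace_square _ hf
      rw [Reflection.concat_onFace_new]
      congr 1
      exact Sum.inr_injective this
  color_corner v hv := by
    induction v using concat_vertex_cases with
    | h1 v => exact m1.color_corner v ((isMidlineCorner_oldVertex h1 h2 v).mp hv)
    | h2 v => exact m2.color_corner v ((isMidlineCorner_newVertex hr h1 h2 v).mp hv)
  color v hv := by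
    induction v using concat_vertex_cases with
    | h1 v => exact m1.color v fun h => hv ((isMidlineCorner_oldVertex h1 h2 v).mpr h)
    | h2 v => exact m2.color v fun h => hv ((isMidlineCorner_newVertex hr h1 h2 v).mpr h)

end

/-! ### Move-symmetric weightings -/

/-- The factor by which the square moves at midline squares of weight `1` change the weight of a
face. -/
noncomputable def squareFactor (Γ : PlabicGraph n) : Γ.Face → ℂ :=
  Γ.edgeProd (fun e => sel (Γ.IsMidlineSquare (Γ.rightOf e)) (Γ.moveFactor 1 (Γ.first e)))
    fun e => sel (Γ.IsMidlineSquare (Γ.leftOf e)) (Γ.moveFactor 1 (Γ.second e))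

lemma squareMoves_eq {Γ : PlabicGraph n} {y : Γ.Face → ℂ} (hy : ∀ f, Γ.IsMidlineSquare f → y f = 1)
    {f : Γ.Face} (hf : ¬ Γ.IsMidlineSquare f) : Γ.squareMoves y f = y f * Γ.squareFactor f := by
  classical
  rw [squareMoves, if_neg hf, squareFactor, edgeProd]
  congr 1
  refine Finset.prod_congr rfl fun e _ => ?_
  rw [← sel_eq_ite, ← sel_eq_ite, mul_comm, sel_and, sel_and]
  have : ∀ g x, sel (Γ.IsMidlineSquare g) (Γ.moveFactor (y g) x) =
      sel (Γ.IsMidlineSquare g) (Γ.moveFactor 1 x) := by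
    intro g x
    by_cases hg : Γ.IsMidlineSquare g
    · rw [hy g hg]
    · rw [sel_neg hg, sel_neg hg]
  rw [this, this]

lemma squareFactor_ne_zero (Γ : PlabicGraph n) (f : Γ.Face) : Γ.squareFactor f ≠ 0 := by
  classical
  have h : ∀ x, Γ.moveFactor 1 x ≠ 0 := by
    intro x
    unfold moveFactor
    split_ifs <;> norm_num
  exact Finset.prod_ne_zero_iff.mpr fun e _ =>
    mul_ne_zero (sel_ne_zero (sel_ne_zero (h _))) (sel_ne_zero (sel_ne_zero (h _)))

lemma IsMirror.mem_moveSymmetricWeightings_iff {Γ : PlabicGraph n} {ρ : Reflection Γ}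
    (h : IsDrawn Γ) (m : IsMirror Γ ρ) (y : Γ.Face → ℂ) :
    y ∈ Γ.moveSymmetricWeightings ↔ ((∀ f, y f ≠ 0) ∧ ∏ f, y f = 1) ∧
      (∀ f, Γ.IsMidlineSquare f → y f = 1) ∧
      ∀ f, ¬ Γ.IsMidlineSquare f → y (ρ.onFace f) = y f * Γ.squareFactor f := by
  classical
  constructor
  · rintro ⟨h1, h2, σ, hσ⟩
    rw [h.moveSymmetry_onF_eq m σ] at hσ
    have hsq : ∀ f, Γ.IsMidlineSquare f → y f = 1 := by
      intro f hf
      have h3 := hσ f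
      rw [m.onFace_square f hf, squareMoves, if_pos hf] at h3
      have h4 : (y f - 1) * (1 + y f) = 0 := by
        have : y f * y f = 1 := by
          nth_rw 2 [h3]
          exact mul_inv_cancel₀ (h1.1 f)
        linear_combination this
      rcases mul_eq_zero.mp h4 with h5 | h5
      · exact sub_eq_zero.mp h5
      · exact absurd h5 (h2 f hf)
    exact ⟨h1, hsq, fun f hf => (hσ f).trans (squareMoves_eq hsq hf)⟩
  · rintro ⟨h1, h2, h3⟩
    refine ⟨h1, fun f hf => by rw [h2 f hf]; norm_num, m.moveSymmetry, fun f => ?_⟩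
    change y (ρ.onFace f) = _
    by_cases hf : Γ.IsMidlineSquare f
    · rw [m.onFace_square f hf, squareMoves, if_pos hf, h2 f hf, inv_one]
    · rw [squareMoves_eq h2 hf, h3 f hf]

section

variable {Λ Δ : PlabicGraph n} {o₁ : Λ.Orientation} {ρ₁ : Reflection Λ} {ρ₂ : Reflection Δ}

lemma moveFactor_glueNode (y : ℂ) (x : Δ.Node) :
    (Λ.concat Δ).moveFactor y (glueNode Λ Δ x) = Δ.moveFactor y x := by
  classical
  have : (Λ.concat Δ).IsWhiteNode (glueNode Λ Δ x) ↔ Δ.IsWhiteNode x := by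
    constructor
    · rintro ⟨v, hv, hw⟩
      induction v using concat_vertex_cases with
      | h1 v => exact absurd hv (glueNode_ne_inl _ _)
      | h2 v => exact ⟨v, glueNode_eq_inr.mp hv, hw⟩
    · rintro ⟨v, rfl, hw⟩
      exact ⟨newVertex Λ Δ v, rfl, hw⟩
  unfold moveFactor
  simp only [this]

lemma moveFactor_liftNode (y : ℂ) {x : Λ.Node} (hx : ∀ j, x ≠ .sink j) :
    (Λ.concat Δ).moveFactor y (liftNode Λ Δ x) = Λ.moveFactor y x := by
  classical
  have : (Λ.concat Δ).IsWhiteNode (liftNode Λ Δ x) ↔ Λ.IsWhiteNode x := by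
    constructor
    · rintro ⟨v, hv, hw⟩
      induction v using concat_vertex_cases with
      | h1 v => exact ⟨v, liftNode_eq_inl.mp hv, hw⟩
      | h2 v =>
        obtain ⟨j, hj, -⟩ := liftNode_eq_inr.mp hv
        exact absurd hj (hx j)
    · rintro ⟨v, rfl, hw⟩
      exact ⟨oldVertex Λ Δ v, rfl, hw⟩
  unfold moveFactor
  simp only [this]

lemma squareFactor_eq_elim (h2 : IsDrawn Δ) : Δ.squareFactor =
    Δ.edgeProd
      (Sum.elim 1 fun e => sel (Δ.IsMidlineSquare (Δ.rightOf (Sum.inr e)))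
        (Δ.moveFactor 1 (Δ.first (Sum.inr e))))
      (Sum.elim 1 fun e => sel (Δ.IsMidlineSquare (Δ.leftOf (Sum.inr e)))
        (Δ.moveFactor 1 (Δ.second (Sum.inr e)))) := by
  unfold squareFactor
  congr 1
  all_goals
    funext e
    rcases e with j | e
    · exact sel_neg (h2.not_square_inl _) _
    · rfl

lemma squareFactor_concat_newEdge (h1 : IsDrawn Λ) (h2 : IsDrawn Δ) (e : Δ.E) :
    sel ((Λ.concat Δ).IsMidlineSquare ((Λ.concat Δ).rightOf (newEdge Λ Δ e)))
        ((Λ.concat Δ).moveFactor 1 ((Λ.concat Δ).first (newEdge Λ Δ e))) =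
      sel (Δ.IsMidlineSquare (Δ.rightOf (Sum.inr e)))
        (Δ.moveFactor 1 (Δ.first (Sum.inr e))) ∧
    sel ((Λ.concat Δ).IsMidlineSquare ((Λ.concat Δ).leftOf (newEdge Λ Δ e)))
        ((Λ.concat Δ).moveFactor 1 ((Λ.concat Δ).second (newEdge Λ Δ e))) =
      sel (Δ.IsMidlineSquare (Δ.leftOf (Sum.inr e)))
        (Δ.moveFactor 1 (Δ.second (Sum.inr e))) := by
  rw [rightOf_newEdge, leftOf_newEdge, first_newEdge, second_newEdge, moveFactor_glueNode,
    moveFactor_glueNode, isMidlineSquare_joinFace h1 h2, isMidlineSquare_joinFace h1 h2]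
  exact ⟨rfl, rfl⟩

lemma squareFactor_newFace (h1 : IsDrawn Λ) (h2 : IsDrawn Δ) (s : Δ.F) :
    (Λ.concat Δ).squareFactor (newFace Λ Δ s) = Δ.squareFactor (Sum.inr s) := by
  rw [squareFactor_eq_elim h2, squareFactor, edgeProd_concat_newFace]
  simp only [squareFactor_concat_newEdge h1 h2]

lemma squareFactor_liftFace (hr : IsRegular Λ o₁) (h1 : IsDrawn Λ) (h2 : IsDrawn Δ)
    (f : Λ.Face) :
    (Λ.concat Δ).squareFactor (liftFace Λ Δ f) =
      Λ.squareFactor f * Λ.rightProd (fun r => Δ.squareFactor (Sum.inl r)) f := by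
  rw [squareFactor_eq_elim h2, squareFactor, edgeProd_concat_liftFace]
  simp only [squareFactor_concat_newEdge h1 h2]
  congr 1
  unfold squareFactor
  congr 1
  · funext e
    rw [rightOf_liftEdge, first_liftEdge, moveFactor_liftNode _ (first_ne_sink e),
      isMidlineSquare_liftFace h1 h2]
  · funext e
    rw [leftOf_liftEdge, second_liftEdge, isMidlineSquare_liftFace h1 h2]
    by_cases hg : Λ.IsMidlineSquare (Λ.leftOf e)
    · rw [moveFactor_liftNode _ (hr.second_ne_sink h1 hg (Or.inl rfl))]
    · rw [sel_neg hg, sel_neg hg]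

/-- The families `κ` and `z` describe all weightings which are compatible with the reflection. -/
structure IsSymmetricFamily (Γ : PlabicGraph n) (ρ : Reflection Γ) (κ : ℂ → Fin (n + 1) → ℂ)
    (z : ℂ → Γ.F → ℂ) (par : (Γ.F → ℂ) → ℂ) : Prop where
  κ_rev : ∀ t ≠ 0, ∀ r, κ t r.rev = κ t r * Γ.squareFactor (Sum.inl r)
  z_square : ∀ t ≠ 0, ∀ f, Γ.IsMidlineSquare (Sum.inr f) → z t f = 1
  z_onF : ∀ t ≠ 0, ∀ f, ¬ Γ.IsMidlineSquare (Sum.inr f) →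
    z t (ρ.onF f) = z t f * Γ.squareFactor (Sum.inr f)
  prod : ∀ t ≠ 0, (∏ r, κ t r) * ∏ f, z t f = 1
  par_z : ∀ t ≠ 0, par (z t) = t
  z_par : ∀ y : Γ.F → ℂ, (∀ f, y f ≠ 0) → (∀ f, Γ.IsMidlineSquare (Sum.inr f) → y f = 1) →
    (∀ f, ¬ Γ.IsMidlineSquare (Sum.inr f) → y (ρ.onF f) = y f * Γ.squareFactor (Sum.inr f)) →
    par y ≠ 0 ∧ z (par y) = y

variable {κ : ℂ → Fin (n + 1) → ℂ} {z : ℂ → Δ.F → ℂ} {par : (Δ.F → ℂ) → ℂ}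
  {R : ℂ → Matrix (Fin n) (Fin n) ℂ} {o₂ : Δ.Orientation}

lemma rightProd_onFace (m1 : IsMirror Λ ρ₁) {a b : Fin (n + 1) → ℂ}
    (h : ∀ r, a r.rev = a r * b r) (f : Λ.Face) :
    Λ.rightProd a (ρ₁.onFace f) = Λ.rightProd a f * Λ.rightProd b f := by
  rw [← rightProd_mul]
  unfold rightProd
  rw [← Equiv.prod_comp Fin.revPerm]
  refine Finset.prod_congr rfl fun r _ => ?_
  simp only [Fin.revPerm_apply]
  rw [m1.rightFace_rev, ρ₁.onFace.injective.eq_iff, h]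

lemma rightProd_square (h1 : IsDrawn Λ) (a : Fin (n + 1) → ℂ) {f : Λ.Face}
    (hf : Λ.IsMidlineSquare f) : Λ.rightProd a f = 1 :=
  Finset.prod_eq_one fun r _ => sel_neg (fun hr : Λ.rightFace r = f =>
    h1.not_square_rightFace r (hr ▸ hf)) _

lemma glueWeights_mem_iff (hr : IsRegular Λ o₁) (h1 : IsDrawn Λ) (h2 : IsDrawn Δ)
    (m1 : IsMirror Λ ρ₁) (m2 : IsMirror Δ ρ₂) (he : IsElementary Δ o₂ R κ z)
    (hs : IsSymmetricFamily Δ ρ₂ κ z par) (y : Λ.Face → ℂ) {t : ℂ} (ht : t ≠ 0) :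
    glueWeights Λ Δ κ z y t ∈ (Λ.concat Δ).moveSymmetricWeightings ↔
      y ∈ Λ.moveSymmetricWeightings := by
  rw [(m1.concat hr h1 h2 m2).mem_moveSymmetricWeightings_iff (h1.concat h2),
    m1.mem_moveSymmetricWeightings_iff h1, prod_concat_face]
  obtain ⟨hκ, hz⟩ := he.ne_zero ht
  have hP := fun f => Λ.rightProd_ne_zero hκ f
  have hprod : (∏ f, Λ.rightProd (κ t) f) * ∏ f, z t f = 1 := by
    rw [prod_rightProd, hs.prod t ht]
  simp only [glueWeights_liftFace, glueWeights_newFace, Finset.prod_mul_distrib]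
  rw [mul_assoc, hprod, mul_one]
  have hon : ∀ f, glueWeights Λ Δ κ z y t ((ρ₁.concat ρ₂).onFace (liftFace Λ Δ f)) =
      glueWeights Λ Δ κ z y t (liftFace Λ Δ f) *
        (Λ.concat Δ).squareFactor (liftFace Λ Δ f) ↔
      y (ρ₁.onFace f) = y f * Λ.squareFactor f := by
    intro f
    rw [Reflection.concat_onFace_lift, glueWeights_liftFace, glueWeights_liftFace,
      squareFactor_liftFace hr h1 h2, rightProd_onFace m1 (hs.κ_rev t ht)]
    have h3 : Λ.rightProd (κ t) f * Λ.rightProd (fun r => Δ.squareFactor (Sum.inl r)) f ≠ 0 :=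
      mul_ne_zero (hP f) (Λ.rightProd_ne_zero (fun r => Δ.squareFactor_ne_zero _) f)
    constructor
    · intro h
      refine mul_right_cancel₀ h3 ?_
      linear_combination h
    · intro h
      rw [h]
      ring
  constructor
  · rintro ⟨⟨a1, a2⟩, a3, a4⟩
    refine ⟨⟨fun f => ?_, a2⟩, fun f hf => ?_, fun f hf => ?_⟩
    · have := a1 (liftFace Λ Δ f)
      rw [glueWeights_liftFace] at this
      exact left_ne_zero_of_mul this
    · have := a3 (liftFace Λ Δ f) ((isMidlineSquare_liftFace h1 h2 f).mpr hf)
      rwa [glueWeights_liftFace, rightProd_square h1 _ hf, mul_one] at this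
    · exact (hon f).mp (a4 _ fun h => hf ((isMidlineSquare_liftFace h1 h2 f).mp h))
  · rintro ⟨⟨a1, a2⟩, a3, a4⟩
    refine ⟨⟨fun f => ?_, a2⟩, fun f hf => ?_, fun f hf => ?_⟩
    all_goals induction f using concat_face_cases with
      | h1 f => ?_
      | h2 s => ?_
    · rw [glueWeights_liftFace]
      exact mul_ne_zero (a1 f) (hP f)
    · exact hz s
    · rw [isMidlineSquare_liftFace h1 h2] at hf
      rw [glueWeights_liftFace, rightProd_square h1 _ hf, mul_one, a3 f hf]
    · rw [isMidlineSquare_newFace h1 h2] at hf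
      exact hs.z_square t ht s hf
    · rw [isMidlineSquare_liftFace h1 h2] at hf
      exact (hon f).mpr (a4 f hf)
    · rw [isMidlineSquare_newFace h1 h2] at hf
      rw [Reflection.concat_onFace_new, squareFactor_newFace h1 h2]
      exact hs.z_onF t ht s hf

/-- The inverse of `glueWeights`. -/
noncomputable def peelWeights (Λ Δ : PlabicGraph n) (κ : ℂ → Fin (n + 1) → ℂ)
    (par : (Δ.F → ℂ) → ℂ) (y : (Λ.concat Δ).Face → ℂ) (f : Λ.Face) : ℂ :=
  y (liftFace Λ Δ f) / Λ.rightProd (κ (par fun s => y (newFace Λ Δ s))) f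

lemma peelWeights_glueWeights (he : IsElementary Δ o₂ R κ z)
    (hs : IsSymmetricFamily Δ ρ₂ κ z par) (y : Λ.Face → ℂ) {t : ℂ} (ht : t ≠ 0) :
    peelWeights Λ Δ κ par (glueWeights Λ Δ κ z y t) = y := by
  funext f
  have : (par fun s => glueWeights Λ Δ κ z y t (newFace Λ Δ s)) = t := hs.par_z t ht
  rw [peelWeights, this, glueWeights_liftFace]
  exact mul_div_cancel_right₀ _ (Λ.rightProd_ne_zero (he.ne_zero ht).1 f)

lemma glueWeights_peelWeights (hr : IsRegular Λ o₁) (h1 : IsDrawn Λ) (h2 : IsDrawn Δ)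
    (m1 : IsMirror Λ ρ₁) (m2 : IsMirror Δ ρ₂) (he : IsElementary Δ o₂ R κ z)
    (hs : IsSymmetricFamily Δ ρ₂ κ z par) {y : (Λ.concat Δ).Face → ℂ}
    (hy : y ∈ (Λ.concat Δ).moveSymmetricWeightings) :
    (par fun s => y (newFace Λ Δ s)) ≠ 0 ∧
      glueWeights Λ Δ κ z (peelWeights Λ Δ κ par y) (par fun s => y (newFace Λ Δ s)) = y := by
  rw [(m1.concat hr h1 h2 m2).mem_moveSymmetricWeightings_iff (h1.concat h2)] at hy
  obtain ⟨⟨a1, a2⟩, a3, a4⟩ := hy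
  obtain ⟨ht, hz⟩ := hs.z_par (fun s => y (newFace Λ Δ s)) (fun s => a1 _)
    (fun s h => a3 _ ((isMidlineSquare_newFace h1 h2 s).mpr h)) fun s h => by
      have := a4 (newFace Λ Δ s) fun h' => h ((isMidlineSquare_newFace h1 h2 s).mp h')
      rwa [squareFactor_newFace h1 h2, Reflection.concat_onFace_new] at this
  refine ⟨ht, ?_⟩
  funext f
  induction f using concat_face_cases with
  | h1 f =>
    rw [glueWeights_liftFace, peelWeights]
    exact div_mul_cancel₀ _ (Λ.rightProd_ne_zero (he.ne_zero ht).1 f)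
  | h2 s => exact congrFun hz s

end

open DoubleBruhat

/-! ### Graphs without midline squares -/

lemma squareFactor_eq_one {Γ : PlabicGraph n} (h : ∀ f, ¬ Γ.IsMidlineSquare f) (f : Γ.Face) :
    Γ.squareFactor f = 1 := by
  refine Finset.prod_eq_one fun e _ => ?_
  beta_reduce
  rw [sel_neg (h _), sel_neg (h _), sel_one, sel_one, one_mul]

lemma not_hasMidlineSquare {Γ : PlabicGraph n} (h : ∀ v, ¬ Γ.OnMidline v) (f : Γ.Face) :
    ¬ Γ.HasMidlineSquare f := by
  rintro ⟨v₁, v₂, v₃, v₄, e₁, e₂, e₃, e₄, -, -, -, -, -, m1, -⟩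
  exact h v₁ m1

lemma not_isMidlineSquare {Γ : PlabicGraph n} (h : ∀ v, ¬ Γ.OnMidline v) (f : Γ.Face) :
    ¬ Γ.IsMidlineSquare f := by
  rintro ⟨v₁, v₂, v₃, v₄, e₁, e₂, e₃, e₄, -, -, -, -, -, -, -, -, -, m1, -⟩
  exact h v₁ m1

lemma stepRatio_succ (d : Fin n → ℂˣ) (j : Fin n) (h : (j : ℕ) + 1 < n) :
    stepRatio d j.succ = d j * (d ⟨j + 1, h⟩)⁻¹ := by
  have e : j.succ = Fin.castSucc ⟨j + 1, h⟩ := rfl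
  unfold stepRatio
  congr 1
  rw [e, Fin.lastCases_castSucc]

/-! ### The graphs `bridges` -/

section Bridges

variable {a : Fin (n / 2)} {p : Bool}

lemma isTouched_iff {j : Fin n} : IsTouched a j ↔
    (j : ℕ) = a ∨ (j : ℕ) = n - 2 - a ∨ (j : ℕ) = a + 1 ∨ (j : ℕ) = n - 1 - a := by
  constructor
  · rintro (h | ⟨i, hi | hi, hj⟩)
    · rcases h with h | h <;> omega
    · omega
    · omega
  · rintro (h | h | h | h)
    · exact Or.inl (Or.inl h)
    · exact Or.inl (Or.inr h)
    · exact Or.inr ⟨⟨a, by omega⟩, Or.inl rfl, h⟩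
    · exact Or.inr ⟨⟨n - 2 - a, by omega⟩, Or.inr rfl, by simp only; omega⟩

lemma isTouched_rev {j : Fin n} (h : IsTouched a j) : IsTouched a j.rev := by
  rw [isTouched_iff] at *
  simp only [Fin.val_rev]
  omega

lemma not_isLower_succ (hs : ¬ IsShort a) {i j : Fin n} (hi : IsLower a i) (hj : IsLower a j) :
    (j : ℕ) ≠ i + 1 := by
  unfold IsShort at hs
  rcases hi with hi | hi <;> rcases hj with hj | hj <;> omega

/-- The lower end of the vertical edge opposite to the one above the strand `j`. -/
def lowerRev (j : Fin n) (h : IsLower a j) : {j : Fin n // IsLower a j} :=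
  ⟨⟨n - 2 - j, by have := h.lt; omega⟩, by
    rcases h with h | h
    · exact Or.inr (by simp only; omega)
    · exact Or.inl (by simp only; omega)⟩

lemma lowerRev_val (j : Fin n) (h : IsLower a j) : ((lowerRev j h).1 : ℕ) = n - 2 - j := rfl

/-- The vertex of `bridges` on a strand. -/
def bridgeVertex (p : Bool) (j : Fin n) (h : IsTouched a j) : (bridges n a p).V := ⟨j, h⟩

/-- The right half of a strand. -/
def bridgeRight (p : Bool) (j : Fin n) (h : IsTouched a j) : (bridges n a p).Edge :=
  Sum.inr (Sum.inl ⟨j, h⟩)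

/-- The vertical edge above a strand. -/
def bridgeUp (p : Bool) (j : Fin n) (h : IsLower a j) : (bridges n a p).Edge :=
  Sum.inr (Sum.inr ⟨j, h⟩)

/-- The upper end of a vertical edge. -/
def bridgeTop (p : Bool) (j : Fin n) (h : IsLower a j) : (bridges n a p).V :=
  bridgeVertex p ⟨j + 1, h.lt⟩ (Or.inr ⟨j, h, rfl⟩)

/-- The lower end of a vertical edge. -/
def bridgeBottom (p : Bool) (j : Fin n) (h : IsLower a j) : (bridges n a p).V :=
  bridgeVertex p j (Or.inl h)

lemma bridgeVertex_inj {i j : Fin n} {hi : IsTouched a i} {hj : IsTouched a j} :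
    bridgeVertex p i hi = bridgeVertex p j hj ↔ i = j := by
  constructor
  · intro h
    exact congrArg Subtype.val h
  · rintro rfl
    rfl

lemma bridges_edge_cases {q : (bridges n a p).Edge → Prop} (h0 : ∀ j, q (Sum.inl j))
    (h1 : ∀ j h, q (bridgeRight p j h)) (h2 : ∀ j h, q (bridgeUp p j h)) (e) : q e := by
  rcases e with j | ⟨j, h⟩ | ⟨j, h⟩
  · exact h0 j
  · exact h1 j h
  · exact h2 j h

lemma bridges_vertex_cases {q : (bridges n a p).V → Prop} (h1 : ∀ j h, q (bridgeVertex p j h)) (v) :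
    q v := h1 v.1 v.2

lemma bridges_first_right (j : Fin n) (h : IsTouched a j) :
    (bridges n a p).first (bridgeRight p j h) = .vertex (bridgeVertex p j h) := rfl

lemma bridges_second_right (j : Fin n) (h : IsTouched a j) :
    (bridges n a p).second (bridgeRight p j h) = .sink j := rfl

lemma bridges_first_up (j : Fin n) (h : IsLower a j) :
    (bridges n a p).first (bridgeUp p j h) = .vertex (bridgeBottom p j h) := rfl

lemma bridges_second_up (j : Fin n) (h : IsLower a j) :
    (bridges n a p).second (bridgeUp p j h) = .vertex (bridgeTop p j h) := rfl

lemma bridges_second_inl {j : Fin n} (h : IsTouched a j) :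
    (bridges n a p).second (Sum.inl j) = .vertex (bridgeVertex p j h) := by
  have : (bridges n a p).finish (Sum.inl j) = Sum.inl (bridgeVertex p j h) := by
    simp only [bridges, Sum.elim_inl]
    exact dif_pos h
  rw [second, this]
  rfl

lemma bridges_second_inl_of_not {j : Fin n} (h : ¬ IsTouched a j) :
    (bridges n a p).second (Sum.inl j) = .sink j := by
  have : (bridges n a p).finish (Sum.inl j) = Sum.inr j := by
    simp only [bridges, Sum.elim_inl]
    exact dif_neg h
  rw [second, this]
  rfl

lemma bridges_sinkEdge {j : Fin n} (h : IsTouched a j) :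
    (bridges n a p).sinkEdge j = bridgeRight p j h :=
  ((second_eq_sink_iff _ _).mp (bridges_second_right j h)).symm

lemma bridges_sinkEdge_of_not {j : Fin n} (h : ¬ IsTouched a j) :
    (bridges n a p).sinkEdge j = Sum.inl j :=
  ((second_eq_sink_iff _ _).mp (bridges_second_inl_of_not h)).symm

lemma bridges_white (j : Fin n) (h : IsTouched a j) :
    (bridges n a p).white (bridgeVertex p j h) = (decide (IsLower a j) == p) := rfl

lemma bridges_white_bottom (j : Fin n) (h : IsLower a j) :
    (bridges n a p).white (bridgeBottom p j h) = p := by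
  unfold bridgeBottom
  rw [bridges_white, decide_eq_true h]
  cases p <;> rfl

lemma bridges_white_top (hs : ¬ IsShort a) (j : Fin n) (h : IsLower a j) :
    (bridges n a p).white (bridgeTop p j h) = !p := by
  unfold bridgeTop
  rw [bridges_white, decide_eq_false fun h' => not_isLower_succ hs h h' rfl]
  cases p <;> rfl

lemma bridges_sum {M : Type} [AddCommMonoid M] (f : (bridges n a p).Edge → M) :
    ∑ e, f e = ∑ j, f (Sum.inl j) + (∑ v : {j : Fin n // IsTouched a j}, f (bridgeRight p v.1 v.2) +
      ∑ v : {j : Fin n // IsLower a j}, f (bridgeUp p v.1 v.2)) := by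
  rw [Fintype.sum_sum_type]
  congr 1
  exact Fintype.sum_sum_type _

lemma bridges_prod {M : Type} [CommMonoid M] (f : (bridges n a p).E → M) :
    ∏ e, f e = (∏ v : {j : Fin n // IsTouched a j}, f (Sum.inl v)) *
      ∏ v : {j : Fin n // IsLower a j}, f (Sum.inr v) :=
  Fintype.prod_sum_type _

lemma bridgesRightFace_succ {j : Fin n} (h : IsLower a j) :
    bridgesRightFace a j.succ = Sum.inr ⟨j, h⟩ := by
  simp only [bridgesRightFace, Fin.cases_succ]
  exact dif_pos h

lemma bridgesRightFace_of_not {r : Fin (n + 1)} (h : ∀ j, IsLower a j → r ≠ j.succ) :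
    bridgesRightFace a r = Sum.inl r := by
  induction r using Fin.cases with
  | zero => rfl
  | succ j =>
    simp only [bridgesRightFace, Fin.cases_succ]
    exact dif_neg fun h' => h j h' rfl

lemma bridgesRightFace_injective : Function.Injective (bridgesRightFace a) := by
  intro r r' h
  by_cases h1 : ∃ j, IsLower a j ∧ r = j.succ <;> by_cases h2 : ∃ j, IsLower a j ∧ r' = j.succ
  · obtain ⟨j, hj, rfl⟩ := h1
    obtain ⟨j', hj', rfl⟩ := h2
    rw [bridgesRightFace_succ hj, bridgesRightFace_succ hj'] at h
    simpa using h
  · obtain ⟨j, hj, rfl⟩ := h1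
    push Not at h2
    rw [bridgesRightFace_succ hj, bridgesRightFace_of_not h2] at h
    simp at h
  · obtain ⟨j, hj, rfl⟩ := h2
    push Not at h1
    rw [bridgesRightFace_succ hj, bridgesRightFace_of_not h1] at h
    simp at h
  · push Not at h1 h2
    rw [bridgesRightFace_of_not h1, bridgesRightFace_of_not h2] at h
    simpa using h

/-- The perfect orientation of `bridges`. -/
def bridgesOrientation (p : Bool) : (bridges n a p).Orientation :=
  Sum.elim (fun _ => true) (Sum.elim (fun _ => true) fun _ => p)

lemma bridgesOrientation_right (j : Fin n) (h : IsTouched a j) :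
    bridgesOrientation p (bridgeRight p j h) = true := rfl

lemma bridgesOrientation_up (j : Fin n) (h : IsLower a j) :
    bridgesOrientation p (bridgeUp p j h) = p := rfl

lemma bridgesOrientation_inl (j : Fin n) :
    bridgesOrientation (a := a) p (Sum.inl j) = true := rfl

/-- An orientation of `bridges` with all strands directed to the right and the vertical edges as
they should be has the right incoming and outgoing edges. -/
lemma bridges_head_white (hs : ¬ IsShort a) (j : Fin n) (h : IsTouched a j)
    (hw : (bridges n a p).white (bridgeVertex p j h) = true) (e : (bridges n a p).Edge) :
    (bridges n a p).head (bridgesOrientation p) e = .vertex (bridgeVertex p j h) ↔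
      e = Sum.inl j := by
  constructor
  · intro he
    induction e using bridges_edge_cases with
    | h0 i =>
      unfold head at he
      rw [bridgesOrientation_inl, if_pos rfl] at he
      by_cases hi : IsTouched a i
      · rw [bridges_second_inl hi, PlabicNode.vertex.injEq, bridgeVertex_inj] at he
        rw [he]
      · rw [bridges_second_inl_of_not hi] at he
        simp at he
    | h1 i hi =>
      unfold head at he
      rw [bridgesOrientation_right, if_pos rfl, bridges_second_right] at he
      simp at he
    | h2 i hi =>
      unfold head at he
      rw [bridgesOrientation_up, bridges_first_up, bridges_second_up] at he
      split_ifs at he with hp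
      · rw [PlabicNode.vertex.injEq] at he
        rw [← he, bridges_white_top hs, hp] at hw
        simp at hw
      · rw [PlabicNode.vertex.injEq] at he
        rw [← he, bridges_white_bottom] at hw
        exact absurd hw hp
  · rintro rfl
    exact bridges_second_inl h

lemma bridges_tail_black (hs : ¬ IsShort a) (j : Fin n) (h : IsTouched a j)
    (hw : (bridges n a p).white (bridgeVertex p j h) = false) (e : (bridges n a p).Edge) :
    (bridges n a p).tail (bridgesOrientation p) e = .vertex (bridgeVertex p j h) ↔
      e = bridgeRight p j h := by
  constructor
  · intro he
    induction e using bridges_edge_cases with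
    | h0 i =>
      unfold tail at he
      rw [bridgesOrientation_inl, if_pos rfl] at he
      simp [first] at he
    | h1 i hi =>
      unfold tail at he
      rw [bridgesOrientation_right, if_pos rfl, bridges_first_right, PlabicNode.vertex.injEq,
        bridgeVertex_inj] at he
      subst he
      rfl
    | h2 i hi =>
      unfold tail at he
      rw [bridgesOrientation_up, bridges_first_up, bridges_second_up] at he
      split_ifs at he with hp
      · rw [PlabicNode.vertex.injEq] at he
        rw [← he, bridges_white_bottom, hp] at hw
        simp at hw
      · rw [PlabicNode.vertex.injEq] at he
        rw [← he, bridges_white_top hs] at hw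
        simp at hw
        exact absurd hw hp
  · rintro rfl
    rfl

lemma bridges_balanced (hs : ¬ IsShort a) : IsBalanced (bridgesOrientation (a := a) p) := by
  constructor
  · intro v hv
    induction v using bridges_vertex_cases with
    | h1 j h =>
      refine ⟨Sum.inl j, (bridges_head_white hs j h hv _).mpr rfl, fun e he => ?_⟩
      exact (bridges_head_white hs j h hv e).mp he
  · intro v hv
    induction v using bridges_vertex_cases with
    | h1 j h =>
      refine ⟨bridgeRight p j h, (bridges_tail_black hs j h hv _).mpr rfl, fun e he => ?_⟩
      exact (bridges_tail_black hs j h hv e).mp he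

lemma bridges_unique (hs : ¬ IsShort a) (o : (bridges n a p).Orientation)
    (ho : ∀ j, o (Sum.inl j) = true) (hb : IsBalanced o) : o = bridgesOrientation p := by
  have hwhite : ∀ j h, (bridges n a p).white (bridgeVertex p j h) = true → ∀ e,
      (bridges n a p).head o e = .vertex (bridgeVertex p j h) → e = Sum.inl j := by
    intro j h hw e he
    refine (hb.1 _ hw).unique he ?_
    unfold head
    rw [ho, if_pos rfl, bridges_second_inl h]
  have hup : ∀ j h, o (bridgeUp p j h) = p := by
    intro j h
    cases p with
    | true =>
      by_contra hne
      have := hwhite j (Or.inl h) (bridges_white_bottom j h) (bridgeUp true j h) (by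
        unfold head
        rw [if_neg hne]
        rfl)
      simp [bridgeUp] at this
    | false =>
      by_contra hne
      have := hwhite ⟨j + 1, h.lt⟩ (Or.inr ⟨j, h, rfl⟩) (bridges_white_top hs j h)
        (bridgeUp false j h) (by
        unfold head
        rw [if_pos (by simpa using hne)]
        rfl)
      simp [bridgeUp] at this
  funext e
  induction e using bridges_edge_cases with
  | h0 j => exact ho j
  | h2 j h => exact hup j h
  | h1 j h =>
    rw [bridgesOrientation_right]
    cases hw : (bridges n a p).white (bridgeVertex p j h) with
    | true =>
      by_contra hne
      have := hwhite j h hw (bridgeRight p j h) (by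
        unfold head
        rw [if_neg hne]
        rfl)
      simp [bridgeRight] at this
    | false =>
      obtain ⟨e, he, -⟩ := hb.2 _ hw
      induction e using bridges_edge_cases with
      | h0 i =>
        unfold tail at he
        rw [ho, if_pos rfl] at he
        simp [first] at he
      | h1 i hi =>
        unfold tail at he
        rw [bridges_first_right, bridges_second_right] at he
        split_ifs at he with h'
        rw [PlabicNode.vertex.injEq, bridgeVertex_inj] at he
        subst he
        exact h'
      | h2 i hi =>
        unfold tail at he
        rw [hup, bridges_first_up, bridges_second_up] at he
        split_ifs at he with hp
        · rw [PlabicNode.vertex.injEq] at he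
          rw [← he, bridges_white_bottom, hp] at hw
          simp at hw
        · rw [PlabicNode.vertex.injEq] at he
          rw [← he, bridges_white_top hs] at hw
          simp at hw
          exact absurd hw hp

lemma bridges_head_right (j : Fin n) (h : IsTouched a j) :
    (bridges n a p).head (bridgesOrientation p) (bridgeRight p j h) = .sink j := rfl

lemma bridges_tail_right (j : Fin n) (h : IsTouched a j) :
    (bridges n a p).tail (bridgesOrientation p) (bridgeRight p j h) =
      .vertex (bridgeVertex p j h) := rfl

lemma bridges_tail_inl (j : Fin n) :
    (bridges n a p).tail (bridgesOrientation p) (Sum.inl j) = .source j := rfl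

lemma bridges_head_up (j : Fin n) (h : IsLower a j) :
    (bridges n a p).head (bridgesOrientation p) (bridgeUp p j h) =
      .vertex (if p then bridgeTop p j h else bridgeBottom p j h) := by
  unfold head
  rw [bridgesOrientation_up, bridges_first_up, bridges_second_up]
  split_ifs <;> rfl

lemma bridges_tail_up (j : Fin n) (h : IsLower a j) :
    (bridges n a p).tail (bridgesOrientation p) (bridgeUp p j h) =
      .vertex (if p then bridgeBottom p j h else bridgeTop p j h) := by
  unfold tail
  rw [bridgesOrientation_up, bridges_first_up, bridges_second_up]
  split_ifs <;> rfl

lemma bridges_sink (j : Fin n) :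
    bridgesOrientation p ((bridges n a p).sinkEdge j) = true := by
  by_cases h : IsTouched a j
  · rw [bridges_sinkEdge h]
    rfl
  · rw [bridges_sinkEdge_of_not h]
    rfl

lemma bridges_acyclic (hs : ¬ IsShort a) : IsAcyclicOrientation (bridgesOrientation (a := a) p) := by
  set rank : (bridges n a p).Edge → ℕ := Sum.elim (fun _ => 0) (Sum.elim (fun _ => 2) fun _ => 1)
    with hrank
  have r1 : ∀ j h, rank (bridgeRight p j h) = 2 := fun _ _ => rfl
  have r2 : ∀ j h, rank (bridgeUp p j h) = 1 := fun _ _ => rfl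
  have r0 : ∀ j, rank (Sum.inl j) = 0 := fun _ => rfl
  refine ⟨rank, fun e e' he => ?_⟩
  induction e' using bridges_edge_cases with
  | h0 j => exact absurd he (head_ne_source (fun _ => rfl) _ _)
  | h1 j h =>
    induction e using bridges_edge_cases with
    | h0 i => rw [r0, r1]; omega
    | h1 i hi => rw [bridges_head_right, bridges_tail_right] at he; simp at he
    | h2 i hi => rw [r1, r2]; omega
  | h2 j h =>
    induction e using bridges_edge_cases with
    | h0 i => rw [r0, r2]; omega
    | h1 i hi => rw [bridges_head_right, bridges_tail_up] at he; simp at he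
    | h2 i hi =>
      rw [bridges_head_up, bridges_tail_up, PlabicNode.vertex.injEq] at he
      have he' := congrArg (bridges n a p).white he
      cases p
      · simp only [Bool.false_eq_true, if_false] at he'
        rw [bridges_white_bottom, bridges_white_top hs] at he'
        simp at he'
      · simp only [if_true] at he'
        rw [bridges_white_bottom, bridges_white_top hs] at he'
        simp at he'

lemma bridges_pos (j : Fin n) (h : IsTouched a j) :
    (bridges n a p).pos (bridgeVertex p j h) = 1 / 2 + (j : ℕ) * Complex.I := rfl

lemma bridges_width : (bridges n a p).width = 1 := rfl

lemma bridges_angle : ∃ θ, IsAngle (bridgesOrientation (a := a) p) θ := by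
  set θ₀ : ℝ := if p then Real.pi / 2 else -(Real.pi / 2) with hθ₀
  set θ : (bridges n a p).Edge → ℝ := Sum.elim (fun _ => 0) (Sum.elim (fun _ => 0) fun _ => θ₀)
    with hθ
  have r1 : ∀ j h, θ (bridgeRight p j h) = 0 := fun _ _ => rfl
  have r2 : ∀ j h, θ (bridgeUp p j h) = θ₀ := fun _ _ => rfl
  have r0 : ∀ j, θ (Sum.inl j) = 0 := fun _ => rfl
  have hπ := Real.pi_pos
  have habs : |θ₀| = Real.pi / 2 := by
    rw [hθ₀]
    split_ifs
    · exact abs_of_pos (by linarith)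
    · rw [abs_neg]
      exact abs_of_pos (by linarith)
  have hdiff : ∀ e, θ e = 0 ∨ θ e = θ₀ := by
    intro e
    induction e using bridges_edge_cases with
    | h0 j => exact Or.inl rfl
    | h1 j h => exact Or.inl rfl
    | h2 j h => exact Or.inr rfl
  refine ⟨θ, fun e => ?_, fun e e' he => ?_, r0, fun j => ?_⟩
  · induction e using bridges_edge_cases with
    | h0 j =>
      rw [r0]
      unfold dir
      rw [bridges_tail_inl]
      have hh : (bridges n a p).head (bridgesOrientation p) (Sum.inl j) =
        (bridges n a p).second (Sum.inl j) := rfl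
      rw [hh]
      by_cases h : IsTouched a j
      · refine ⟨1 / 2, by norm_num, ?_⟩
        rw [bridges_second_inl h]
        simp [nodePos, bridges_pos]
      · refine ⟨1, by norm_num, ?_⟩
        rw [bridges_second_inl_of_not h]
        simp [nodePos, bridges_width]
    | h1 j h =>
      refine ⟨1 / 2, by norm_num, ?_⟩
      rw [r1]
      unfold dir
      rw [bridges_head_right, bridges_tail_right]
      simp only [nodePos, bridges_width, bridges_pos]
      push_cast
      simp
      ring
    | h2 j h =>
      refine ⟨1, by norm_num, ?_⟩
      rw [r2, hθ₀]
      unfold dir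
      rw [bridges_head_up, bridges_tail_up]
      cases p
      · simp only [Bool.false_eq_true, if_false, nodePos, bridgeTop, bridgeBottom, bridges_pos]
        push_cast
        rw [neg_mul, Complex.exp_neg, Complex.exp_pi_div_two_mul_I]
        simp
        ring
      · simp only [if_true, nodePos, bridgeTop, bridgeBottom, bridges_pos]
        push_cast
        rw [Complex.exp_pi_div_two_mul_I]
        ring
  · rcases hdiff e with h | h <;> rcases hdiff e' with h' | h' <;> rw [h, h']
    · simpa using hπ
    · rw [sub_zero, habs]
      linarith
    · rw [zero_sub, abs_neg, habs]
      linarith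
    · simpa using hπ
  · by_cases h : IsTouched a j
    · rw [bridges_sinkEdge h, r1]
    · rw [bridges_sinkEdge_of_not h, r0]

lemma not_isLower_of_not_isTouched {i j : Fin n} (h : ¬ IsTouched a j) (hi : IsLower a i) :
    i ≠ j ∧ (j : ℕ) ≠ i + 1 :=
  ⟨fun e => h (Or.inl (e ▸ hi)), fun e => h (Or.inr ⟨i, hi, e⟩)⟩

lemma bridges_isRegular (hs : ¬ IsShort a) : IsRegular (bridges n a p) (bridgesOrientation p) where
  source _ := rfl
  sink := bridges_sink
  balanced := bridges_balanced hs
  unique := bridges_unique hs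
  acyclic := bridges_acyclic hs
  angle := bridges_angle
  leftOf_sinkEdge j := by
    by_cases h : IsTouched a j
    · rw [bridges_sinkEdge h]
      rfl
    · rw [bridges_sinkEdge_of_not h]
      refine (bridgesRightFace_of_not fun i hi e => ?_).symm
      exact (not_isLower_of_not_isTouched h hi).1 (Fin.succ_injective _ e).symm
  rightOf_sinkEdge j := by
    by_cases h : IsTouched a j
    · rw [bridges_sinkEdge h]
      rfl
    · rw [bridges_sinkEdge_of_not h]
      refine (bridgesRightFace_of_not fun i hi e => ?_).symm
      refine (not_isLower_of_not_isTouched h hi).2 ?_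
      have := congrArg Fin.val e
      simpa using this

/-! ### Weights of the graphs `bridges` -/

open Classical in
/-- The weights of the right halves of the strands. -/
noncomputable def bridgeStrand (wt : (bridges n a p).E → ℂˣ) (j : Fin n) : ℂˣ :=
  if h : IsTouched a j then wt (Sum.inl ⟨j, h⟩) else 1

lemma bridgeStrand_of_isTouched (wt : (bridges n a p).E → ℂˣ) {j : Fin n} (h : IsTouched a j) :
    bridgeStrand wt j = wt (Sum.inl ⟨j, h⟩) := dif_pos h

lemma bridgeStrand_of_not (wt : (bridges n a p).E → ℂˣ) {j : Fin n} (h : ¬ IsTouched a j) :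
    bridgeStrand wt j = 1 := dif_neg h

/-- The weight of a vertical edge, directed up. -/
noncomputable def bridgeRise (wt : (bridges n a p).E → ℂˣ) (j : {j : Fin n // IsLower a j}) : ℂˣ :=
  if p then wt (Sum.inr j) else (wt (Sum.inr j))⁻¹

lemma bridges_faceWeight (wt : (bridges n a p).E → ℂˣ) (f : (bridges n a p).Face) :
    (bridges n a p).faceWeight (bridgesOrientation p) (Sum.elim 1 wt) f =
      (bridges n a p).rightProd (stepRatio (bridgeStrand wt)) f *
      ∏ j : {j : Fin n // IsLower a j}, sel (Sum.inl j.1.succ = f) (bridgeRise wt j) *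
        sel (Sum.inr j = f) (bridgeRise wt j)⁻¹ := by
  rw [faceWeight_elim_one, edgeProd_elim_one, bridges_prod]
  congr 1
  · rw [rightProd, prod_sel_stepRatio _ fun r => (bridges n a p).rightFace r = f]
    refine Fintype.prod_of_injective (fun v : {j : Fin n // IsTouched a j} => v.1)
      Subtype.val_injective _ _ (fun j hj => ?_) fun v => ?_
    · rw [bridgeStrand_of_not wt fun h => hj ⟨⟨j, h⟩, rfl⟩, inv_one, sel_one, sel_one, one_mul]
    · rw [bridgeStrand_of_isTouched wt v.2]
      rfl
  · refine Finset.prod_congr rfl fun j _ => ?_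
    unfold bridgeRise
    have : bridgesOrientation (a := a) p (Sum.inr (Sum.inr j)) = p := rfl
    rw [this]
    cases p
    · simp only [Bool.false_eq_true, if_false, inv_inv]
      rfl
    · rfl

lemma rightProd_eq {Γ : PlabicGraph n} {f : Γ.Face} {r : Fin (n + 1)}
    (h : ∀ r', Γ.rightFace r' = f ↔ r = r') (b : Fin (n + 1) → ℂˣ) : Γ.rightProd b f = b r := by
  unfold rightProd
  simp only [h]
  exact prod_sel_eq _ b

lemma bridges_rightProd_succ (b : Fin (n + 1) → ℂˣ) (j : {j : Fin n // IsLower a j}) :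
    (bridges n a p).rightProd b (Sum.inr j) = b j.1.succ := by
  refine rightProd_eq (fun r => ?_) b
  have e : (bridges n a p).rightFace j.1.succ = Sum.inr j := bridgesRightFace_succ j.2
  exact ⟨fun h => (bridgesRightFace_injective (a := a)
    (show (bridges n a p).rightFace _ = (bridges n a p).rightFace _ from h.trans e.symm)).symm, fun h => h ▸ e⟩

lemma bridges_faceWeight_inr (wt : (bridges n a p).E → ℂˣ) (j : {j : Fin n // IsLower a j}) :
    (bridges n a p).faceWeight (bridgesOrientation p) (Sum.elim 1 wt) (Sum.inr j) =
      stepRatio (bridgeStrand wt) j.1.succ * (bridgeRise wt j)⁻¹ := by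
  rw [bridges_faceWeight, bridges_rightProd_succ]
  congr 1
  rw [Finset.prod_eq_single j]
  · rw [sel_neg (by simp), one_mul]
    exact sel_pos rfl _
  · intro i _ hi
    rw [sel_neg (by simp), one_mul]
    exact sel_neg (fun h => hi (Sum.inr_injective h)) _
  · simp

lemma bridges_faceWeight_succ (wt : (bridges n a p).E → ℂˣ) (j : {j : Fin n // IsLower a j}) :
    (bridges n a p).faceWeight (bridgesOrientation p) (Sum.elim 1 wt) (Sum.inl j.1.succ) =
      bridgeRise wt j := by
  rw [bridges_faceWeight]
  have h1 : (bridges n a p).rightProd (stepRatio (bridgeStrand wt)) (Sum.inl j.1.succ) = 1 := by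
    refine Finset.prod_eq_one fun r _ => sel_neg (fun h => ?_) _
    change bridgesRightFace a r = Sum.inl j.1.succ at h
    by_cases hr : ∃ i, IsLower a i ∧ r = i.succ
    · obtain ⟨i, hi, rfl⟩ := hr
      rw [bridgesRightFace_succ hi] at h
      simp at h
    · push Not at hr
      rw [bridgesRightFace_of_not hr] at h
      exact hr j.1 j.2 (Sum.inl_injective h)
  rw [h1, one_mul, Finset.prod_eq_single j]
  · rw [sel_pos rfl, sel_neg (by simp), mul_one]
  · intro i _ hi
    rw [sel_neg fun h => hi (Subtype.ext (Fin.succ_injective _ (Sum.inl_injective h))),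
      sel_neg (by simp), one_mul]
  · simp

lemma bridges_faceWeight_inl (wt : (bridges n a p).E → ℂˣ) {r : Fin (n + 1)}
    (hr : ∀ j, IsLower a j → r ≠ j.succ) :
    (bridges n a p).faceWeight (bridgesOrientation p) (Sum.elim 1 wt) (Sum.inl r) =
      stepRatio (bridgeStrand wt) r := by
  rw [bridges_faceWeight]
  have h1 : (bridges n a p).rightProd (stepRatio (bridgeStrand wt)) (Sum.inl r) =
      stepRatio (bridgeStrand wt) r := by
    refine rightProd_eq (fun r' => ?_) _
    have e : (bridges n a p).rightFace r = Sum.inl r := bridgesRightFace_of_not hr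
    exact ⟨fun h => (bridgesRightFace_injective (a := a)
    (show (bridges n a p).rightFace _ = (bridges n a p).rightFace _ from h.trans e.symm)).symm, fun h => h ▸ e⟩
  rw [h1, Finset.prod_eq_one, mul_one]
  intro j _
  rw [sel_neg fun h => hr j.1 j.2 (Sum.inl_injective h).symm, sel_neg (by simp), one_mul]

/-- The path sums of `bridges`. -/
noncomputable def bridgePathSum (wt : (bridges n a p).E → ℂˣ) :
    (bridges n a p).Edge → Fin n → ℂ :=
  Sum.elim
    (fun i k => (if i = k then (bridgeStrand wt i : ℂ) else 0) +
      ∑ j : {j : Fin n // IsLower a j}, if p then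
        (if j.1 = i ∧ (k : ℕ) = j.1 + 1 then (wt (Sum.inr j) : ℂ) * bridgeStrand wt k else 0)
        else (if (i : ℕ) = j.1 + 1 ∧ j.1 = k then (wt (Sum.inr j) : ℂ) * bridgeStrand wt k else 0))
    (Sum.elim (fun j k => if j.1 = k then (bridgeStrand wt k : ℂ) else 0)
      fun j k => if p then
        (if (k : ℕ) = j.1 + 1 then (wt (Sum.inr j) : ℂ) * bridgeStrand wt k else 0)
        else (if j.1 = k then (wt (Sum.inr j) : ℂ) * bridgeStrand wt k else 0))

lemma bridges_isPathSum (hs : ¬ IsShort a) (wt : (bridges n a p).E → ℂˣ) :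
    IsPathSum (bridgesOrientation p) (Sum.elim 1 wt) (bridgePathSum wt) := by
  classical
  set P := bridgePathSum wt with hP
  have hright : ∀ j h k, P (bridgeRight p j h) k = if j = k then (bridgeStrand wt k : ℂ) else 0 :=
    fun _ _ _ => rfl
  have hup : ∀ j h k, P (bridgeUp p j h) k = if p then
      (if (k : ℕ) = j + 1 then (wt (Sum.inr ⟨j, h⟩) : ℂ) * bridgeStrand wt k else 0)
      else (if j = k then (wt (Sum.inr ⟨j, h⟩) : ℂ) * bridgeStrand wt k else 0) := fun _ _ _ => rfl
  have hsink : ∀ j k, ∑ e', (if (bridges n a p).tail (bridgesOrientation p) e' = .sink j then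
      P e' k else 0) = 0 := fun j k => Finset.sum_eq_zero fun e _ =>
    if_neg (tail_ne_sink bridges_sink e j)
  have hvertex : ∀ i h k, ∑ e', (if (bridges n a p).tail (bridgesOrientation p) e' =
      .vertex (bridgeVertex p i h) then P e' k else 0) = P (bridgeRight p i h) k +
      ∑ j : {j : Fin n // IsLower a j}, if (if p then bridgeBottom p j.1 j.2 else
        bridgeTop p j.1 j.2) = bridgeVertex p i h then P (bridgeUp p j.1 j.2) k else 0 := by
    intro i h k
    rw [bridges_sum, Finset.sum_eq_zero, zero_add]
    · congr 1
      · rw [Finset.sum_eq_single ⟨i, h⟩]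
        · rw [bridges_tail_right, if_pos rfl]
        · intro v _ hv
          rw [bridges_tail_right, if_neg]
          rw [PlabicNode.vertex.injEq, bridgeVertex_inj]
          exact fun e => hv (Subtype.ext e)
        · simp
      · refine Finset.sum_congr rfl fun j _ => ?_
        rw [bridges_tail_up]
        simp only [PlabicNode.vertex.injEq]
    · intro j _
      rw [bridges_tail_inl, if_neg (by simp)]
  intro e k
  induction e using bridges_edge_cases with
  | h0 i =>
    have hh : (bridges n a p).head (bridgesOrientation p) (Sum.inl i) =
      (bridges n a p).second (Sum.inl i) := rfl
    have hw : (Sum.elim 1 wt : (bridges n a p).Edge → ℂˣ) (Sum.inl i) = 1 := rfl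
    have hPi : P (Sum.inl i) k = (if i = k then (bridgeStrand wt i : ℂ) else 0) +
      ∑ j : {j : Fin n // IsLower a j}, if p then
        (if j.1 = i ∧ (k : ℕ) = j.1 + 1 then (wt (Sum.inr j) : ℂ) * bridgeStrand wt k else 0)
        else (if (i : ℕ) = j.1 + 1 ∧ j.1 = k then (wt (Sum.inr j) : ℂ) * bridgeStrand wt k else 0) :=
      rfl
    rw [hh, hw, Units.val_one, one_mul, hPi]
    by_cases hi : IsTouched a i
    · rw [bridges_second_inl hi, hvertex, hright,
        if_neg (show ¬ PlabicNode.vertex (bridgeVertex p i hi) = PlabicNode.sink k by simp), zero_add]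
      congr 1
      · split_ifs with h
        · rw [h]
        · rfl
      · refine Finset.sum_congr rfl fun j _ => ?_
        rw [hup]
        cases p
        · simp only [Bool.false_eq_true, if_false, bridgeTop, bridgeVertex_inj, ite_and,
            Fin.ext_iff]
          simp only [eq_comm (a := (i : ℕ))]
        · simp only [if_true, bridgeBottom, bridgeVertex_inj, ite_and]
    · rw [bridges_second_inl_of_not hi, hsink, add_zero, bridgeStrand_of_not wt hi,
        Finset.sum_eq_zero]
      · simp
      · intro j _
        have := not_isLower_of_not_isTouched hi j.2
        simp [this.1, this.2]
  | h1 i h =>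
    rw [hright, bridges_head_right, hsink, add_zero]
    have hw : (Sum.elim 1 wt : (bridges n a p).Edge → ℂˣ) (bridgeRight p i h) =
      bridgeStrand wt i := (bridgeStrand_of_isTouched wt h).symm
    rw [hw]
    simp only [PlabicNode.sink.injEq]
    split_ifs with h'
    · rw [h', mul_one]
    · simp
  | h2 i h =>
    have hw : (Sum.elim 1 wt : (bridges n a p).Edge → ℂˣ) (bridgeUp p i h) =
      wt (Sum.inr ⟨i, h⟩) := rfl
    rw [hup, bridges_head_up, hw, if_neg (show ¬ PlabicNode.vertex (if p then bridgeTop p i h else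
      bridgeBottom p i h) = PlabicNode.sink k by simp), zero_add]
    cases p
    · simp only [Bool.false_eq_true, if_false]
      unfold bridgeBottom
      rw [hvertex, hright, Finset.sum_eq_zero, add_zero]
      · simp
      · intro j _
        rw [if_neg]
        simp only [Bool.false_eq_true, if_false]
        intro e
        have := congrArg (bridges n a false).white e
        rw [bridges_white_top hs] at this
        exact absurd (this.trans (bridges_white_bottom i h)) (by simp)
    · simp only [if_true]
      unfold bridgeTop
      rw [hvertex, hright, Finset.sum_eq_zero, add_zero]
      · simp only [Fin.ext_iff, eq_comm (a := (k : ℕ)), mul_ite, mul_zero]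
      · intro j _
        rw [if_neg]
        simp only [if_true]
        intro e
        have := congrArg (bridges n a true).white e
        rw [bridges_white_bottom] at this
        exact absurd (this.trans (bridges_white_top hs i h)) (by simp)

lemma mat_letterRoot_of_not_isShort (hs : ¬ IsShort a) (t : ℂ) (i k : Fin n) :
    mat (letterRoot (a, p) t) i k = if i = k then 1 else
      if p then (if (k : ℕ) = i + 1 ∧ IsLower a i then t else 0)
      else (if (i : ℕ) = k + 1 ∧ IsLower a k then t else 0) := by
  have key : ∀ i k, rootMatrix a t i k = if i = k then 1 else
      (if (k : ℕ) = i + 1 ∧ IsLower a i then t else 0) := by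
    intro i k
    simp only [rootMatrix, Matrix.of_apply]
    simp [hs]
  rw [letterRoot, mat_side, mat_root, sideMat]
  cases p
  · simp only [Bool.false_eq_true, if_false]
    have : flipMat (rootMatrix a t) i k = rootMatrix a t k i := rootMatrix_rev a t k i
    rw [this, key]
    simp only [eq_comm (a := k)]
  · simp only [if_true]
    exact key i k

/-- The parameter of a positive letter, or its inverse for a negative letter. -/
noncomputable def bridgeParam (p : Bool) (t : ℂ) : ℂ := if p then t else t⁻¹

open Classical in
/-- The factors at the old faces for `bridges`. -/
noncomputable def bridgeFactor (a : Fin (n / 2)) (p : Bool) (t : ℂ) (r : Fin (n + 1)) : ℂ :=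
  if ∃ j, IsLower a j ∧ r = j.succ then bridgeParam p t else 1

lemma bridgeParam_ne_zero {t : ℂ} (ht : t ≠ 0) : bridgeParam p t ≠ 0 := by
  unfold bridgeParam
  split_ifs
  · exact ht
  · exact inv_ne_zero ht

lemma bridges_isElementary (hs : ¬ IsShort a) :
    IsElementary (bridges n a p) (bridgesOrientation p) (fun t => mat (letterRoot (a, p) t))
      (bridgeFactor a p) fun t _ => (bridgeParam p t)⁻¹ where
  exists_wt t ht := by
    obtain ⟨wt, hwt⟩ : ∃ wt : (bridges n a p).E → ℂˣ, wt =
      (Sum.elim (fun _ => 1) fun _ => Units.mk0 t ht :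
        {j : Fin n // IsTouched a j} ⊕ {j : Fin n // IsLower a j} → ℂˣ) := ⟨_, rfl⟩
    refine ⟨wt, fun (f : {j : Fin n // IsLower a j}) => (congrArg _
      (bridges_faceWeight_inr wt f)).trans ?_⟩
    have h1 : bridgeStrand wt = 1 := by
      funext j
      by_cases h : IsTouched a j
      · rw [bridgeStrand_of_isTouched _ h, hwt]
        rfl
      · exact bridgeStrand_of_not _ h
    have h3 : wt (Sum.inr f) = Units.mk0 t ht := by rw [hwt]; rfl
    have h2 : stepRatio (1 : Fin n → ℂˣ) f.1.succ = 1 := by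
      rw [stepRatio_succ _ _ f.2.lt]
      simp
    rw [h1, h2, one_mul]
    unfold bridgeRise bridgeParam
    rw [h3]
    cases p <;> simp
  factor t ht wt hwt := by
    have hrise : ∀ j, (bridgeRise wt j : ℂ) =
        stepRatio (bridgeStrand wt) j.1.succ * bridgeParam p t := by
      intro j
      have := hwt j
      have this := (congrArg Units.val (bridges_faceWeight_inr wt j)).symm.trans this
      rw [Units.val_mul, Units.val_inv_eq_inv_val] at this
      have h0 := bridgeParam_ne_zero (p := p) ht
      have h1 := (bridgeRise wt j).ne_zero
      field_simp at this
      linear_combination -this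
    refine ⟨bridgeStrand wt, ?_, fun r => ?_⟩
    · ext i k
      rw [(bridges_isRegular hs).networkMatrix_eq (bridges_isPathSum hs wt), Matrix.diagonal_mul,
        mat_letterRoot_of_not_isShort hs]
      change (if i = k then (bridgeStrand wt i : ℂ) else 0) +
        ∑ j : {j : Fin n // IsLower a j}, (if p then
          (if j.1 = i ∧ (k : ℕ) = j.1 + 1 then (wt (Sum.inr j) : ℂ) * bridgeStrand wt k else 0)
          else (if (i : ℕ) = j.1 + 1 ∧ j.1 = k then
            (wt (Sum.inr j) : ℂ) * bridgeStrand wt k else 0)) = _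
      have hr := fun j => hrise j
      by_cases hik : i = k
      · subst hik
        rw [if_pos rfl, if_pos rfl, mul_one, Finset.sum_eq_zero, add_zero]
        intro j _
        split_ifs with h1 h2 h2
        · rw [← h2.1] at h2
          omega
        · rfl
        · rw [← h2.2] at h2
          omega
        · rfl
      · rw [if_neg hik, if_neg hik, zero_add]
        cases p
        · simp only [Bool.false_eq_true, if_false]
          by_cases hk : (i : ℕ) = k + 1 ∧ IsLower a k
          · rw [if_pos hk, Finset.sum_eq_single ⟨k, hk.2⟩]
            · rw [if_pos ⟨hk.1, rfl⟩]
              have h3 := hr ⟨k, hk.2⟩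
              have hi : (⟨k + 1, hk.2.lt⟩ : Fin n) = i := Fin.ext hk.1.symm
              simp only [bridgeRise, bridgeParam, stepRatio_succ _ _ hk.2.lt, hi,
                Bool.false_eq_true, if_false, Units.val_mul, Units.val_inv_eq_inv_val] at h3
              have h4 := (wt (Sum.inr ⟨k, hk.2⟩)).ne_zero
              have h5 := (bridgeStrand wt i).ne_zero
              field_simp at h3
              linear_combination -h3
            · intro j _ hj
              rw [if_neg fun h => hj (Subtype.ext h.2)]
            · simp
          · rw [if_neg hk, mul_zero, Finset.sum_eq_zero]
            intro j _
            rw [if_neg]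
            rintro ⟨h1, h2⟩
            exact hk ⟨h2 ▸ h1, h2 ▸ j.2⟩
        · simp only [if_true]
          by_cases hk : (k : ℕ) = i + 1 ∧ IsLower a i
          · rw [if_pos hk, Finset.sum_eq_single ⟨i, hk.2⟩]
            · rw [if_pos ⟨rfl, hk.1⟩]
              have h3 := hr ⟨i, hk.2⟩
              have hi : (⟨i + 1, hk.2.lt⟩ : Fin n) = k := Fin.ext hk.1.symm
              simp only [bridgeRise, bridgeParam, stepRatio_succ _ _ hk.2.lt, hi,
                if_true, Units.val_mul, Units.val_inv_eq_inv_val] at h3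
              have h5 := (bridgeStrand wt k).ne_zero
              field_simp at h3
              linear_combination h3
            · intro j _ hj
              rw [if_neg fun h => hj (Subtype.ext h.1)]
            · simp
          · rw [if_neg hk, mul_zero, Finset.sum_eq_zero]
            intro j _
            rw [if_neg]
            rintro ⟨h1, h2⟩
            exact hk ⟨h1 ▸ h2, h1 ▸ j.2⟩
    · unfold bridgeFactor
      split_ifs with h
      · obtain ⟨j, hj, rfl⟩ := h
        rw [← hrise ⟨j, hj⟩, ← bridges_faceWeight_succ]
      · push Not at h
        rw [bridges_faceWeight_inl _ h, mul_one]

/-! ### The symmetry of the graphs `bridges` -/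

lemma bridges_not_onMidline (hs : ¬ IsShort a) (v : (bridges n a p).V) :
    ¬ (bridges n a p).OnMidline v := by
  induction v using bridges_vertex_cases with
  | h1 j h =>
    intro hm
    unfold OnMidline at hm
    rw [bridges_pos] at hm
    have e : (2 * (j : ℕ) + 1 : ℝ) = n := by
      simp at hm
      linarith
    have e' : 2 * (j : ℕ) + 1 = n := by exact_mod_cast e
    rw [isTouched_iff] at h
    unfold IsShort at hs
    omega

lemma bridges_isDrawn (hs : ¬ IsShort a) : IsDrawn (bridges n a p) where
  pos_injective v v' h := by
    induction v using bridges_vertex_cases with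
    | h1 i hi =>
      induction v' using bridges_vertex_cases with
      | h1 j hj =>
        rw [bridges_pos, bridges_pos] at h
        rw [bridgeVertex_inj]
        simpa [Fin.ext_iff] using h
  width_pos := by
    rw [bridges_width]
    exact one_pos
  re_pos v := by
    induction v using bridges_vertex_cases with
    | h1 j h =>
      rw [bridges_pos, bridges_width]
      norm_num
  first_ne_second e := by
    induction e using bridges_edge_cases with
    | h0 j => exact fun h => second_ne_source _ _ h.symm
    | h1 j h =>
      rw [bridges_first_right, bridges_second_right]
      simp
    | h2 j h =>
      rw [bridges_first_up, bridges_second_up]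
      unfold bridgeBottom bridgeTop
      rw [Ne, PlabicNode.vertex.injEq, bridgeVertex_inj, Fin.ext_iff]
      simp
  edge_ext e e' h1 h2 := by
    induction e using bridges_edge_cases with
    | h0 i =>
      rw [(first_eq_source_iff e' i).mp h1.symm]
    | h1 i hi =>
      rw [bridges_second_right] at h2
      rw [(second_eq_sink_iff _ _).mp h2.symm, bridges_sinkEdge hi]
    | h2 i hi =>
      induction e' using bridges_edge_cases with
      | h0 j =>
        rw [bridges_first_up] at h1
        simp [first] at h1
      | h1 j hj =>
        rw [bridges_second_up, bridges_second_right] at h2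
        simp at h2
      | h2 j hj =>
        rw [bridges_first_up, bridges_first_up, PlabicNode.vertex.injEq] at h1
        have := bridgeVertex_inj.mp h1
        subst this
        rfl
  edge_ext' e e' h1 h2 := by
    induction e using bridges_edge_cases with
    | h0 i => exact absurd h1.symm (second_ne_source _ _)
    | h1 i hi =>
      rw [bridges_second_right] at h2
      exact absurd h2.symm (first_ne_sink _ _)
    | h2 i hi =>
      induction e' using bridges_edge_cases with
      | h0 j => exact absurd h2 (second_ne_source _ _)
      | h1 j hj =>
        rw [bridges_second_right] at h1
        exact absurd h1 (first_ne_sink _ _)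
      | h2 j hj =>
        rw [bridges_first_up, bridges_second_up, PlabicNode.vertex.injEq] at h1
        have := congrArg Fin.val (bridgeVertex_inj.mp h1)
        exact absurd this (not_isLower_succ hs hj hi)
  second_injective i j h := by
    beta_reduce at h
    by_cases hi : IsTouched a i <;> by_cases hj : IsTouched a j
    · rw [bridges_second_inl hi, bridges_second_inl hj, PlabicNode.vertex.injEq,
        bridgeVertex_inj] at h
      exact h
    · rw [bridges_second_inl hi, bridges_second_inl_of_not hj] at h
      simp at h
    · rw [bridges_second_inl_of_not hi, bridges_second_inl hj] at h
      simp at h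
    · rw [bridges_second_inl_of_not hi, bridges_second_inl_of_not hj] at h
      simpa using h
  borders f := ⟨Sum.inr (Sum.inr f), Or.inr rfl⟩
  rightFace_injective := bridgesRightFace_injective
  im_sinkEdge j := by
    by_cases h : IsTouched a j
    · rw [bridges_sinkEdge h, bridges_first_right]
      change ((bridges n a p).pos (bridgeVertex p j h)).im = _
      rw [bridges_pos]
      simp
    · rw [bridges_sinkEdge_of_not h]
      simp [first, nodePos]
  im_source j := by
    by_cases h : IsTouched a j
    · rw [bridges_second_inl h]
      change ((bridges n a p).pos (bridgeVertex p j h)).im = _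
      rw [bridges_pos]
      simp
    · rw [bridges_second_inl_of_not h]
      simp [nodePos]
  white_of_onMidline v hv := absurd hv (bridges_not_onMidline hs v)
  square f hf := absurd hf (not_hasMidlineSquare (bridges_not_onMidline hs) f)

lemma lowerRev_lowerRev (j : {j : Fin n // IsLower a j}) :
    lowerRev (lowerRev j.1 j.2).1 (lowerRev j.1 j.2).2 = j := by
  have := j.2.lt
  refine Subtype.ext (Fin.ext ?_)
  rw [lowerRev_val, lowerRev_val]
  omega

/-- The reflection of `bridges`. -/
def bridgesReflection (a : Fin (n / 2)) (p : Bool) : Reflection (bridges n a p) :=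
  have hV : Function.Involutive fun v : {j : Fin n // IsTouched a j} =>
      (⟨v.1.rev, isTouched_rev v.2⟩ : {j : Fin n // IsTouched a j}) :=
    fun v => Subtype.ext (Fin.rev_rev v.1)
  have hF : Function.Involutive fun j : {j : Fin n // IsLower a j} => lowerRev j.1 j.2 :=
    lowerRev_lowerRev
  { onV := hV.toPerm
    onE := Equiv.sumCongr hV.toPerm hF.toPerm
    onF := hF.toPerm }

lemma bridgesRightFace_rev (r : Fin (n + 1)) :
    (bridges n a p).rightFace r.rev = (bridgesReflection a p).onFace ((bridges n a p).rightFace r) := by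
  have hsucc : ∀ j (h : IsLower a j), j.succ.rev = (lowerRev j h).1.succ := by
    intro j h
    have := h.lt
    refine Fin.ext ?_
    rw [Fin.val_rev, Fin.val_succ, Fin.val_succ, lowerRev_val]
    omega
  by_cases hr : ∃ j, IsLower a j ∧ r = j.succ
  · obtain ⟨j, hj, rfl⟩ := hr
    have e1 : (bridges n a p).rightFace j.succ = Sum.inr ⟨j, hj⟩ := bridgesRightFace_succ hj
    have e2 : (bridges n a p).rightFace (lowerRev j hj).1.succ = Sum.inr (lowerRev j hj) :=
      bridgesRightFace_succ (lowerRev j hj).2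
    rw [e1, hsucc j hj, e2]
    rfl
  · push Not at hr
    have e1 : (bridges n a p).rightFace r = Sum.inl r := bridgesRightFace_of_not hr
    have e2 : (bridges n a p).rightFace r.rev = Sum.inl r.rev := by
      refine bridgesRightFace_of_not (a := a) (r := r.rev) fun j hj e => hr (lowerRev j hj).1 (lowerRev j hj).2 ?_
      rw [← hsucc, ← e, Fin.rev_rev]
    rw [e1, e2]
    rfl

lemma isLower_rev_iff (hs : ¬ IsShort a) {j : Fin n} (h : IsTouched a j) :
    IsLower a j.rev ↔ ¬ IsLower a j := by
  rw [isTouched_iff] at h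
  unfold IsShort at hs
  unfold IsLower
  rw [Fin.val_rev]
  omega

lemma bridges_isMirror (hs : ¬ IsShort a) :
    IsMirror (bridges n a p) (bridgesReflection a p) where
  pos_onV v := by
    induction v using bridges_vertex_cases with
    | h1 j h =>
      have e : (bridgesReflection a p).onV (bridgeVertex p j h) =
        bridgeVertex p j.rev (isTouched_rev h) := rfl
      rw [e, bridges_pos, bridges_pos, Fin.val_rev, Nat.cast_sub (by omega)]
      have e2 : (starRingEnd ℂ) (1 / 2 : ℂ) = 1 / 2 := by
        rw [map_div₀, map_one, map_ofNat]
      rw [map_add, map_mul, e2, map_natCast, Complex.conj_I]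
      push_cast
      ring
  edge e := by
    induction e using bridges_edge_cases with
    | h0 j =>
      refine Or.inl ⟨rfl, ?_, ?_, ?_⟩
      · have e : (bridgesReflection a p).onEdge (Sum.inl j) = Sum.inl j.rev := rfl
        rw [e]
        by_cases h : IsTouched a j
        · rw [bridges_second_inl h, bridges_second_inl (isTouched_rev h)]
          rfl
        · have h' : ¬ IsTouched a j.rev := fun h' => h (Fin.rev_rev j ▸ isTouched_rev h')
          rw [bridges_second_inl_of_not h, bridges_second_inl_of_not h']
          rfl
      · exact congrArg Sum.inl (Fin.rev_castSucc j).symm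
      · exact congrArg Sum.inl (Fin.rev_succ j).symm
    | h1 j h =>
      refine Or.inl ⟨rfl, rfl, ?_, ?_⟩
      · have := bridgesRightFace_rev (a := a) (p := p) j.castSucc
        rw [Fin.rev_castSucc] at this
        exact this
      · have := bridgesRightFace_rev (a := a) (p := p) j.succ
        rw [Fin.rev_succ] at this
        exact this
    | h2 j h =>
      have hlt := h.lt
      refine Or.inr ⟨?_, ?_, ?_, rfl⟩
      · refine congrArg PlabicNode.vertex (bridgeVertex_inj.mpr (Fin.ext ?_))
        change n - 2 - (j : ℕ) = n - (j + 1 + 1)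
        omega
      · refine congrArg PlabicNode.vertex (bridgeVertex_inj.mpr (Fin.ext ?_))
        change n - 2 - (j : ℕ) + 1 = n - (j + 1)
        omega
      · refine congrArg Sum.inl (Fin.ext ?_)
        simp only [Fin.revPerm_apply, Fin.val_rev, Fin.val_succ]
        change n - 2 - (j : ℕ) + 1 = _
        omega
  rightFace_rev := bridgesRightFace_rev
  onFace_square f hf := absurd hf (not_isMidlineSquare (bridges_not_onMidline hs) f)
  color_corner v := by
    rintro ⟨f, e, hf, -⟩
    exact absurd hf (not_isMidlineSquare (bridges_not_onMidline hs) f)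
  color v _ := by
    induction v using bridges_vertex_cases with
    | h1 j h =>
      have e : (bridgesReflection a p).onV (bridgeVertex p j h) =
        bridgeVertex p j.rev (isTouched_rev h) := rfl
      have hr := isLower_rev_iff hs h
      rw [e, bridges_white, bridges_white]
      by_cases hl : IsLower a j
      · rw [decide_eq_true hl, decide_eq_false fun h' => hr.mp h' hl]
        cases p <;> rfl
      · rw [decide_eq_false hl, decide_eq_true (hr.mpr hl)]
        cases p <;> rfl

/-- The parameter of a weighting of `bridges`. -/
noncomputable def bridgesPar (a : Fin (n / 2)) (p : Bool) (y : (bridges n a p).F → ℂ) : ℂ :=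
  bridgeParam p (y ⟨⟨a, by omega⟩, Or.inl rfl⟩)⁻¹

lemma bridgeParam_bridgeParam (t : ℂ) : bridgeParam p (bridgeParam p t) = t := by
  unfold bridgeParam
  cases p <;> simp

lemma bridges_isSymmetricFamily (hs : ¬ IsShort a) :
    IsSymmetricFamily (bridges n a p) (bridgesReflection a p) (bridgeFactor a p)
      (fun t _ => (bridgeParam p t)⁻¹) (bridgesPar a p) where
  κ_rev t ht r := by
    rw [squareFactor_eq_one (not_isMidlineSquare (bridges_not_onMidline hs)), mul_one]
    have : ∀ r : Fin (n + 1), (∃ j, IsLower a j ∧ r = j.succ) →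
        ∃ j, IsLower a j ∧ r.rev = j.succ := by
      rintro r ⟨j, hj, rfl⟩
      refine ⟨_, (lowerRev j hj).2, Fin.ext ?_⟩
      have := hj.lt
      rw [Fin.val_rev, Fin.val_succ, Fin.val_succ, lowerRev_val]
      omega
    unfold bridgeFactor
    congr 1
    rw [eq_iff_iff]
    exact ⟨fun h => Fin.rev_rev r ▸ this _ h, this r⟩
  z_square t ht f hf := absurd hf (not_isMidlineSquare (bridges_not_onMidline hs) _)
  z_onF t ht f _ := by
    rw [squareFactor_eq_one (not_isMidlineSquare (bridges_not_onMidline hs)), mul_one]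
  prod t ht := by
    have h0 : bridgeFactor a p t 0 = 1 := if_neg fun ⟨j, _, h⟩ => Fin.succ_ne_zero j h.symm
    rw [Fin.prod_univ_succ, h0, one_mul]
    have h1 : ∏ j : Fin n, bridgeFactor a p t j.succ =
        ∏ _j : {j : Fin n // IsLower a j}, bridgeParam p t := by
      refine (Fintype.prod_of_injective (fun j : {j : Fin n // IsLower a j} => j.1)
        Subtype.val_injective _ _ (fun j hj => ?_) fun j => ?_).symm
      · refine if_neg ?_
        rintro ⟨i, hi, h⟩
        exact hj ⟨⟨i, hi⟩, (Fin.succ_injective _ h).symm⟩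
      · exact (if_pos ⟨j.1, j.2, rfl⟩).symm
    rw [h1]
    have h2 : ∏ _f : (bridges n a p).F, (bridgeParam p t)⁻¹ =
      ∏ _j : {j : Fin n // IsLower a j}, (bridgeParam p t)⁻¹ := rfl
    rw [h2, ← Finset.prod_mul_distrib]
    exact Finset.prod_eq_one fun _ _ => mul_inv_cancel₀ (bridgeParam_ne_zero ht)
  par_z t ht := by
    unfold bridgesPar
    rw [inv_inv, bridgeParam_bridgeParam]
  z_par y h0 _ h2 := by
    refine ⟨bridgeParam_ne_zero (inv_ne_zero (h0 _)), ?_⟩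
    funext f
    unfold bridgesPar
    rw [bridgeParam_bridgeParam, inv_inv]
    obtain ⟨⟨j, hj⟩, hf⟩ : ∃ j : {j : Fin n // IsLower a j}, f = j := ⟨f, rfl⟩
    subst hf
    rcases hj with hj | hj
    · exact congrArg y (Subtype.ext (Fin.ext hj.symm))
    · have := h2 ⟨⟨a, by omega⟩, Or.inl rfl⟩ (not_isMidlineSquare (bridges_not_onMidline hs) _)
      rw [squareFactor_eq_one (not_isMidlineSquare (bridges_not_onMidline hs)), mul_one] at this
      rw [← this]
      exact congrArg y (Subtype.ext (Fin.ext hj.symm))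

end Bridges

/-! ### The graphs `square` -/

namespace SquareEdge

/-- The first end of an edge. -/
def start : SquareEdge → SquareVertex
  | westNorth => .west
  | northEast => .north
  | westSouth => .west
  | southEast => .south
  | bottomSouth => .bottom
  | northTop => .north
  | bottomOut => .bottom
  | eastOut => .east
  | topOut => .top

/-- The second end of an edge, unless it is a sink. -/
def finish : SquareEdge → Option SquareVertex
  | westNorth => some .north
  | northEast => some .east
  | westSouth => some .south
  | southEast => some .east
  | bottomSouth => some .south
  | northTop => some .top
  | bottomOut => none
  | eastOut => none
  | topOut => none

/-- The perfect orientation. -/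
def forward (p : Bool) : SquareEdge → Bool
  | northEast => !p
  | southEast => p
  | bottomSouth => p
  | northTop => p
  | _ => true

/-- The vertex at which an edge of the perfectly oriented graph begins. -/
def tail (p : Bool) (e : SquareEdge) : SquareVertex :=
  if forward p e then e.start else e.finish.getD .west

/-- The vertex at which an edge of the perfectly oriented graph ends, unless it is a sink. -/
def head (p : Bool) (e : SquareEdge) : Option SquareVertex :=
  if forward p e then e.finish else some e.start

/-- A rank function for the perfect orientation. -/
def rank (p : Bool) : SquareEdge → ℕ
  | westNorth => 1
  | westSouth => 1
  | bottomSouth => if p then 1 else 4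
  | northTop => if p then 4 else 1
  | southEast => if p then 2 else 3
  | northEast => if p then 3 else 2
  | _ => 5

/-- The angle of an oriented edge, in eighths of a full turn. -/
def angle (p : Bool) : SquareEdge → ℤ
  | westNorth => 1
  | westSouth => -1
  | bottomSouth => if p then 2 else -2
  | northTop => if p then 2 else -2
  | southEast => if p then 1 else -3
  | northEast => if p then 3 else -1
  | _ => 0

end SquareEdge

/-- The vertex on the first edge of a strand, if any. -/
def squareEntry (b : ℕ) (j : Fin n) : Option SquareVertex :=
  if (j : ℕ) = b then some .bottom else if (j : ℕ) = b + 1 then some .west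
  else if (j : ℕ) = b + 2 then some .top else none

section Square

variable {b : ℕ} {hb : b + 2 < n} {p : Bool}

lemma square_sum {M : Type} [AddCommMonoid M] (f : SquareEdge → M) :
    ∑ e, f e = f .westNorth + (f .northEast + (f .westSouth + (f .southEast + (f .bottomSouth +
      (f .northTop + (f .bottomOut + (f .eastOut + f .topOut))))))) := by
  change ∑ e ∈ {.westNorth, .northEast, .westSouth, .southEast, .bottomSouth, .northTop, .bottomOut,
    .eastOut, .topOut}, f e = _
  simp

lemma square_prod {M : Type} [CommMonoid M] (f : SquareEdge → M) :
    ∏ e, f e = f .westNorth * (f .northEast * (f .westSouth * (f .southEast * (f .bottomSouth *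
      (f .northTop * (f .bottomOut * (f .eastOut * f .topOut))))))) := by
  change ∏ e ∈ {.westNorth, .northEast, .westSouth, .southEast, .bottomSouth, .northTop, .bottomOut,
    .eastOut, .topOut}, f e = _
  simp

lemma square_first (e : SquareEdge) :
    (square n b hb p).first (Sum.inr e) = .vertex e.start := by
  cases e <;> rfl

lemma square_second_eq_iff (e : SquareEdge) (v : SquareVertex) :
    (square n b hb p).second (Sum.inr e) = .vertex v ↔ e.finish = some v := by
  have key : ∀ (x : SquareVertex ⊕ Fin n) (y : Option SquareVertex),
      x.elim some (fun _ => none) = y →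
      ((Sum.elim PlabicNode.vertex PlabicNode.sink x : PlabicNode SquareVertex n) = .vertex v ↔
        y = some v) := by
    rintro (x | x) y rfl <;> simp
  exact key ((square n b hb p).finish (Sum.inr e)) e.finish (by cases e <;> rfl)

lemma square_second_inl_eq_iff (j : Fin n) (v : SquareVertex) :
    (square n b hb p).second (Sum.inl j) = .vertex v ↔ squareEntry b j = some v := by
  change (Sum.elim PlabicNode.vertex PlabicNode.sink (if (j : ℕ) = b then Sum.inl .bottom
      else if (j : ℕ) = b + 1 then Sum.inl .west else if (j : ℕ) = b + 2 then Sum.inl .top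
      else Sum.inr j) : PlabicNode SquareVertex n) = .vertex v ↔ _
  unfold squareEntry
  split_ifs <;> simp

lemma square_second_inl_of_not {j : Fin n} (h0 : (j : ℕ) ≠ b) (h1 : (j : ℕ) ≠ b + 1)
    (h2 : (j : ℕ) ≠ b + 2) : (square n b hb p).second (Sum.inl j) = .sink j := by
  change (Sum.elim PlabicNode.vertex PlabicNode.sink (if (j : ℕ) = b then Sum.inl .bottom
      else if (j : ℕ) = b + 1 then Sum.inl .west else if (j : ℕ) = b + 2 then Sum.inl .top
      else Sum.inr j) : PlabicNode SquareVertex n) = .sink j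
  rw [if_neg h0, if_neg h1, if_neg h2]
  rfl

lemma squareEntry_injective {i j : Fin n} {v : SquareVertex} (hi : squareEntry b i = some v)
    (hj : squareEntry b j = some v) : i = j := by
  unfold squareEntry at hi hj
  refine Fin.ext ?_
  split_ifs at hi hj <;> simp only [Option.some.injEq] at hi hj <;>
    first | omega | exact absurd (hi.trans hj.symm) (by decide)

lemma square_head_eq_iff (o : (square n b hb p).Orientation) (e : SquareEdge) (v : SquareVertex) :
    (square n b hb p).head o (Sum.inr e) = .vertex v ↔
      (o (Sum.inr e) = true ∧ e.finish = some v) ∨ (o (Sum.inr e) = false ∧ e.start = v) := by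
  unfold PlabicGraph.head
  cases h : o (Sum.inr e)
  · simp only [Bool.false_eq_true, if_false, false_and, true_and, false_or]
    rw [square_first]
    exact ⟨fun h => PlabicNode.vertex.inj h, fun h => congrArg _ h⟩
  · simp only [if_true, true_and, Bool.true_eq_false, false_and, or_false]
    exact square_second_eq_iff e v

lemma square_tail_eq_iff (o : (square n b hb p).Orientation) (e : SquareEdge) (v : SquareVertex) :
    (square n b hb p).tail o (Sum.inr e) = .vertex v ↔
      (o (Sum.inr e) = true ∧ e.start = v) ∨ (o (Sum.inr e) = false ∧ e.finish = some v) := by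
  unfold PlabicGraph.tail
  cases h : o (Sum.inr e)
  · simp only [Bool.false_eq_true, if_false, false_and, true_and, false_or]
    exact square_second_eq_iff e v
  · simp only [if_true, true_and, Bool.true_eq_false, false_and, or_false]
    rw [square_first]
    exact ⟨fun h => PlabicNode.vertex.inj h, fun h => congrArg _ h⟩

lemma square_head_inl_eq_iff {o : (square n b hb p).Orientation} (ho : ∀ j, o (Sum.inl j) = true)
    (j : Fin n) (v : SquareVertex) :
    (square n b hb p).head o (Sum.inl j) = .vertex v ↔ squareEntry b j = some v := by
  unfold PlabicGraph.head
  rw [ho, if_pos rfl]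
  exact square_second_inl_eq_iff j v

lemma square_tail_inl_ne {o : (square n b hb p).Orientation} (ho : ∀ j, o (Sum.inl j) = true)
    (j : Fin n) (v : SquareVertex) : (square n b hb p).tail o (Sum.inl j) ≠ .vertex v := by
  unfold PlabicGraph.tail
  rw [ho, if_pos rfl]
  simp [first]

/-- The perfect orientation of `square`. -/
def squareOrientation (n b : ℕ) (hb : b + 2 < n) (p : Bool) : (square n b hb p).Orientation :=
  Sum.elim (fun _ => true) (SquareEdge.forward p)

lemma square_head (e : SquareEdge) (v : SquareVertex) :
    (square n b hb p).head (squareOrientation n b hb p) (Sum.inr e) = .vertex v ↔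
      e.head p = some v := by
  rw [square_head_eq_iff]
  change (e.forward p = true ∧ _) ∨ (e.forward p = false ∧ _) ↔ _
  unfold SquareEdge.head
  cases e.forward p <;> simp

lemma square_tail (e : SquareEdge) :
    (square n b hb p).tail (squareOrientation n b hb p) (Sum.inr e) = .vertex (e.tail p) := by
  rw [square_tail_eq_iff]
  change (e.forward p = true ∧ _) ∨ (e.forward p = false ∧ _)
  revert p
  cases e <;> decide

/-- The color of a vertex. -/
def squareWhite (p : Bool) : SquareVertex → Bool
  | .west => true
  | .north => false
  | .east => true
  | .south => false
  | .top => !p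
  | .bottom => p

lemma square_white (v : SquareVertex) : (square n b hb p).white v = squareWhite p v := by
  cases v <;> rfl

lemma exists_squareEntry (hb : b + 2 < n) {v : SquareVertex} (h1 : squareWhite p v = true)
    (h2 : v ≠ .east) : ∃ j : Fin n, squareEntry b j = some v := by
  cases v
  · exact ⟨⟨b + 1, by omega⟩, by simp [squareEntry]⟩
  · simp [squareWhite] at h1
  · exact absurd rfl h2
  · simp [squareWhite] at h1
  · exact ⟨⟨b + 2, hb⟩, by simp [squareEntry]⟩
  · exact ⟨⟨b, by omega⟩, by simp [squareEntry]⟩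

lemma square_balanced : IsBalanced (squareOrientation n b hb p) := by
  have hs : ∀ j, squareOrientation n b hb p (Sum.inl j) = true := fun _ => rfl
  have hentry : ∀ v : SquareVertex, squareWhite p v = true → v ≠ .east →
      (∃ j : Fin n, squareEntry b j = some v) ∧ ∀ e : SquareEdge, e.head p ≠ some v := by
    intro v h1 h2
    refine ⟨exists_squareEntry hb h1 h2, ?_⟩
    clear hs
    revert p v
    decide
  constructor
  · intro (v : SquareVertex) hv
    rw [square_white] at hv
    by_cases h : v = .east
    · subst h
      have hu : ∃ e₀ : SquareEdge, ∀ e : SquareEdge, e.head p = some .east ↔ e = e₀ := by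
        clear hs hentry hv
        revert p
        decide
      obtain ⟨e₀, he₀⟩ := hu
      refine ⟨Sum.inr e₀, (square_head e₀ _).mpr ((he₀ _).mpr rfl), ?_⟩
      rintro (j | e) he
      · rw [square_head_inl_eq_iff hs] at he
        unfold squareEntry at he
        split_ifs at he <;> simp at he
      · rw [(he₀ _).mp ((square_head e _).mp he)]
    · obtain ⟨⟨j, hj⟩, hne⟩ := hentry v hv h
      refine ⟨Sum.inl j, (square_head_inl_eq_iff hs j v).mpr hj, ?_⟩
      rintro (i | e) he
      · rw [squareEntry_injective ((square_head_inl_eq_iff hs i v).mp he) hj]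
      · exact absurd ((square_head e v).mp he) (hne e)
  · intro (v : SquareVertex) hv
    rw [square_white] at hv
    have hu : ∃ e₀ : SquareEdge, ∀ e : SquareEdge, e.tail p = v ↔ e = e₀ := by
      clear hs hentry
      revert p v
      decide
    obtain ⟨e₀, he₀⟩ := hu
    refine ⟨Sum.inr e₀, (square_tail e₀).trans (congrArg _ ((he₀ _).mpr rfl)), ?_⟩
    rintro (j | e) he
    · exact absurd he (square_tail_inl_ne hs j v)
    · rw [(he₀ e).mp (PlabicNode.vertex.inj ((square_tail e).symm.trans he))]

lemma forward_unique {f : SquareEdge → Bool}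
    (hentry : ∀ v, squareWhite p v = true → v ≠ .east → ∀ e : SquareEdge,
      ¬ ((f e = true ∧ e.finish = some v) ∨ (f e = false ∧ e.start = v)))
    (heast : ∀ e e' : SquareEdge,
      ((f e = true ∧ e.finish = some .east) ∨ (f e = false ∧ e.start = .east)) →
      ((f e' = true ∧ e'.finish = some .east) ∨ (f e' = false ∧ e'.start = .east)) → e = e')
    (hblack : ∀ v, squareWhite p v = false → ∃ e : SquareEdge,
      (f e = true ∧ e.start = v) ∨ (f e = false ∧ e.finish = some v)) (e : SquareEdge) :
    f e = SquareEdge.forward p e := by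
  have hw := hentry .west rfl (by decide)
  have w1 : f .westNorth = true := by
    simpa [SquareEdge.start, SquareEdge.finish] using hw .westNorth
  have w2 : f .westSouth = true := by
    simpa [SquareEdge.start, SquareEdge.finish] using hw .westSouth
  cases p
  · have ht := hentry .top rfl (by decide)
    have t1 : f .northTop = false := by
      simpa [SquareEdge.start, SquareEdge.finish] using ht .northTop
    have t2 : f .topOut = true := by
      simpa [SquareEdge.start, SquareEdge.finish] using ht .topOut
    have n1 : f .northEast = true := by
      obtain ⟨e, he⟩ := hblack .north rfl
      revert he
      cases e <;> simp [SquareEdge.start, SquareEdge.finish, w1, w2, t1]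
    have e1 : f .southEast = false := by
      by_contra h
      exact absurd (heast .southEast .northEast (Or.inl ⟨by simpa using h, rfl⟩)
        (Or.inl ⟨n1, rfl⟩)) (by decide)
    have e2 : f .eastOut = true := by
      by_contra h
      exact absurd (heast .eastOut .northEast (Or.inr ⟨by simpa using h, rfl⟩)
        (Or.inl ⟨n1, rfl⟩)) (by decide)
    have s1 : f .bottomSouth = false := by
      obtain ⟨e, he⟩ := hblack .south rfl
      revert he
      cases e <;> simp [SquareEdge.start, SquareEdge.finish, w1, w2, e1]
    have b1 : f .bottomOut = true := by
      obtain ⟨e, he⟩ := hblack .bottom rfl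
      revert he
      cases e <;> simp [SquareEdge.start, SquareEdge.finish, s1]
    cases e <;> simp [w1, w2, t1, t2, n1, e1, e2, s1, b1, SquareEdge.forward]
  · have ht := hentry .bottom rfl (by decide)
    have t1 : f .bottomSouth = true := by
      simpa [SquareEdge.start, SquareEdge.finish] using ht .bottomSouth
    have t2 : f .bottomOut = true := by
      simpa [SquareEdge.start, SquareEdge.finish] using ht .bottomOut
    have n1 : f .southEast = true := by
      obtain ⟨e, he⟩ := hblack .south rfl
      revert he
      cases e <;> simp [SquareEdge.start, SquareEdge.finish, w1, w2, t1]
    have e1 : f .northEast = false := by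
      by_contra h
      exact absurd (heast .northEast .southEast (Or.inl ⟨by simpa using h, rfl⟩)
        (Or.inl ⟨n1, rfl⟩)) (by decide)
    have e2 : f .eastOut = true := by
      by_contra h
      exact absurd (heast .eastOut .southEast (Or.inr ⟨by simpa using h, rfl⟩)
        (Or.inl ⟨n1, rfl⟩)) (by decide)
    have s1 : f .northTop = true := by
      obtain ⟨e, he⟩ := hblack .north rfl
      revert he
      cases e <;> simp [SquareEdge.start, SquareEdge.finish, w1, w2, e1]
    have b1 : f .topOut = true := by
      obtain ⟨e, he⟩ := hblack .top rfl
      revert he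
      cases e <;> simp [SquareEdge.start, SquareEdge.finish, s1]
    cases e <;> simp [w1, w2, t1, t2, n1, e1, e2, s1, b1, SquareEdge.forward]

lemma square_unique (o : (square n b hb p).Orientation) (ho : ∀ j, o (Sum.inl j) = true)
    (hbal : IsBalanced o) : o = squareOrientation n b hb p := by
  obtain ⟨f, hf⟩ : ∃ f : SquareEdge → Bool, ∀ e : SquareEdge, o (Sum.inr e) = f e :=
    ⟨fun e => o (Sum.inr e), fun _ => rfl⟩
  have hentry : ∀ v : SquareVertex, squareWhite p v = true → ∀ j : Fin n, squareEntry b j = some v →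
      ∀ e : SquareEdge, ¬ ((f e = true ∧ e.finish = some v) ∨ (f e = false ∧ e.start = v)) := by
    intro v hv j hj e he
    rw [← hf, ← square_head_eq_iff] at he
    have := (hbal.1 v ((square_white v).trans hv)).unique he
      ((square_head_inl_eq_iff ho j v).mpr hj)
    simp at this
  have hwhite : ∀ e e' : SquareEdge, ((f e = true ∧ e.finish = some .east) ∨
      (f e = false ∧ e.start = .east)) → ((f e' = true ∧ e'.finish = some .east) ∨
      (f e' = false ∧ e'.start = .east)) → e = e' := by
    intro e e' he he'
    rw [← hf, ← square_head_eq_iff] at he he'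
    exact Sum.inr_injective ((hbal.1 SquareVertex.east (square_white _)).unique he he')
  have hblack : ∀ v, squareWhite p v = false → ∃ e : SquareEdge,
      (f e = true ∧ e.start = v) ∨ (f e = false ∧ e.finish = some v) := by
    intro v hv
    obtain ⟨j | e, he, -⟩ := hbal.2 v ((square_white v).trans hv)
    · exact absurd he (square_tail_inl_ne ho j v)
    · exact ⟨e, ((square_tail_eq_iff o e v).mp he).imp (And.imp_left (hf e).symm.trans)
        (And.imp_left (hf e).symm.trans)⟩
  have key : ∀ e, f e = SquareEdge.forward p e := by
    refine forward_unique (fun v h1 h2 => ?_) hwhite hblack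
    obtain ⟨j, hj⟩ := exists_squareEntry hb h1 h2
    exact hentry v h1 j hj
  funext e
  rcases e with j | e
  · exact ho j
  · exact (hf e).trans (key e)

lemma square_acyclic : IsAcyclicOrientation (squareOrientation n b hb p) := by
  refine ⟨Sum.elim (fun _ => 0) (SquareEdge.rank p), ?_⟩
  rintro (i | e) (j | d) he
  · exact absurd he (head_ne_source (fun _ => rfl) _ _)
  · change 0 < SquareEdge.rank p d
    have : ∀ (p : Bool) (e : SquareEdge), 0 < e.rank p := by decide
    exact this p d
  · exact absurd he (head_ne_source (fun _ => rfl) _ _)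
  · have : ∀ (p : Bool) (e d : SquareEdge), e.head p = some (d.tail p) → e.rank p < d.rank p := by
      decide
    exact this p e d ((square_head e _).mp (he.trans (square_tail d)))

/-! ### Angles in the graphs `square` -/

lemma exp_pi_div_four_mul_I : Complex.exp ((Real.pi / 4 : ℝ) * Complex.I) =
    (Real.sqrt 2 / 2 : ℝ) * (1 + Complex.I) := by
  rw [Complex.exp_mul_I, ← Complex.ofReal_cos, ← Complex.ofReal_sin, Real.cos_pi_div_four,
    Real.sin_pi_div_four]
  ring

lemma exp_angle (k : ℤ) : Complex.exp (((k * (Real.pi / 4) : ℝ) : ℂ) * Complex.I) =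
    ((Real.sqrt 2 / 2 : ℝ) * (1 + Complex.I)) ^ k := by
  rw [← exp_pi_div_four_mul_I, ← Complex.exp_int_mul]
  congr 1
  push_cast
  ring

/-- The direction of an oriented edge. -/
noncomputable def SquareEdge.dir (p : Bool) : SquareEdge → ℂ
  | .westNorth => (1 + Complex.I) / 4
  | .westSouth => (1 - Complex.I) / 4
  | .bottomSouth => if p then 3 / 4 * Complex.I else -(3 / 4 * Complex.I)
  | .northTop => if p then 3 / 4 * Complex.I else -(3 / 4 * Complex.I)
  | .southEast => if p then (1 + Complex.I) / 4 else -(1 + Complex.I) / 4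
  | .northEast => if p then (-1 + Complex.I) / 4 else (1 - Complex.I) / 4
  | .bottomOut => 1 / 2
  | .eastOut => 1 / 4
  | .topOut => 1 / 2

lemma SquareEdge.dir_eq (p : Bool) (e : SquareEdge) : ∃ r : ℝ, 0 < r ∧
    e.dir p = r * Complex.exp (((e.angle p * (Real.pi / 4) : ℝ) : ℂ) * Complex.I) := by
  have h2 : ((Real.sqrt 2 / 2 : ℝ) : ℂ) ^ 2 = 1 / 2 := by
    rw [← Complex.ofReal_pow, div_pow, Real.sq_sqrt (by norm_num)]
    push_cast
    norm_num
  have hc : (0 : ℝ) < Real.sqrt 2 / 2 := by positivity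
  set c : ℝ := Real.sqrt 2 / 2 with hcdef
  have hc0 : (c : ℂ) ≠ 0 := by exact_mod_cast hc.ne'
  have hI := Complex.I_mul_I
  have h1I : (1 + Complex.I) ≠ 0 := fun h => by
    have := congrArg Complex.re h
    simp at this
  have k1 : (c * (1 + Complex.I)) ^ (1 : ℤ) = c * (1 + Complex.I) := zpow_one _
  have k2 : (c * (1 + Complex.I)) ^ (2 : ℤ) = Complex.I := by
    rw [zpow_ofNat, mul_pow, h2]
    linear_combination (1 / 2 : ℂ) * hI
  have k3 : (c * (1 + Complex.I)) ^ (3 : ℤ) = c * (-1 + Complex.I) := by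
    rw [zpow_ofNat, pow_succ, ← zpow_ofNat, k2]
    linear_combination (c : ℂ) * hI
  have m1 : (c * (1 + Complex.I)) ^ (-1 : ℤ) = c * (1 - Complex.I) := by
    rw [zpow_neg, k1]
    refine inv_eq_of_mul_eq_one_left ?_
    linear_combination (2 : ℂ) * h2 - (c : ℂ) ^ 2 * hI
  have m2 : (c * (1 + Complex.I)) ^ (-2 : ℤ) = -Complex.I := by
    rw [zpow_neg, k2, Complex.inv_I]
  have m3 : (c * (1 + Complex.I)) ^ (-3 : ℤ) = c * (-1 - Complex.I) := by
    rw [zpow_neg, k3]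
    refine inv_eq_of_mul_eq_one_left ?_
    linear_combination (2 : ℂ) * h2 - (c : ℂ) ^ 2 * hI
  have hcc : ((c / 2 : ℝ) : ℂ) * c = 1 / 4 := by
    push_cast
    linear_combination (1 / 2 : ℂ) * h2
  rw [exp_angle, ← hcdef]
  cases e <;> cases p <;> simp only [SquareEdge.dir, SquareEdge.angle, if_true, if_false,
    Bool.false_eq_true, k1, k2, k3, m1, m2, m3, zpow_zero, mul_one]
  case bottomOut.false | bottomOut.true | topOut.false | topOut.true =>
    exact ⟨1 / 2, by norm_num, by norm_num⟩
  case eastOut.false | eastOut.true => exact ⟨1 / 4, by norm_num, by norm_num⟩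
  case bottomSouth.false | bottomSouth.true | northTop.false | northTop.true =>
    exact ⟨3 / 4, by norm_num, by push_cast; ring⟩
  all_goals
    refine ⟨c / 2, by positivity, ?_⟩
    rw [← mul_assoc, hcc]
    ring

lemma square_dir (e : SquareEdge) :
    (square n b hb p).dir (squareOrientation n b hb p) (Sum.inr e) = e.dir p := by
  have hw : (((square n b hb p).width : ℝ) : ℂ) = 1 := Complex.ofReal_one
  cases e <;> cases p <;>
  · simp only [PlabicGraph.dir, PlabicGraph.head, PlabicGraph.tail, squareOrientation,
      Sum.elim_inr, SquareEdge.forward, SquareEdge.dir, if_true, if_false, Bool.false_eq_true,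
      Bool.not_true, Bool.not_false, first, second, square, nodePos, Sum.elim_inl]
    push_cast
    ring

lemma square_sinkEdge (j : Fin n) : (square n b hb p).sinkEdge j =
    if (j : ℕ) = b then Sum.inr .bottomOut else if (j : ℕ) = b + 1 then Sum.inr .eastOut
    else if (j : ℕ) = b + 2 then Sum.inr .topOut else Sum.inl j := rfl

lemma square_angle : ∃ θ, IsAngle (squareOrientation n b hb p) θ := by
  set θ : Fin n ⊕ SquareEdge → ℝ :=
    Sum.elim (fun _ => 0) fun e => e.angle p * (Real.pi / 4) with hθ
  have hπ := Real.pi_pos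
  have hlt : ∀ k : ℤ, |k| < 4 → |(k : ℝ) * (Real.pi / 4)| < Real.pi := by
    intro k hk
    have hk' : |(k : ℝ)| < 4 := by exact_mod_cast hk
    rw [abs_mul, abs_of_pos (by positivity : (0 : ℝ) < Real.pi / 4)]
    nlinarith
  refine ⟨θ, ⟨?_, ?_, fun _ => rfl, fun j => ?_⟩⟩
  · rintro (j | e)
    · have hd : ∃ r : ℝ, 0 < r ∧
          (square n b hb p).dir (squareOrientation n b hb p) (Sum.inl j) = r := by
        change ∃ r : ℝ, 0 < r ∧ (square n b hb p).nodePos ((square n b hb p).second (Sum.inl j)) -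
          (j : ℕ) * Complex.I = r
        by_cases h0 : (j : ℕ) = b
        · rw [(square_second_inl_eq_iff j .bottom).mpr (by simp [squareEntry, h0])]
          refine ⟨1 / 2, by norm_num, ?_⟩
          simp [nodePos, square, h0]
        by_cases h1 : (j : ℕ) = b + 1
        · rw [(square_second_inl_eq_iff j .west).mpr (by simp [squareEntry, h1])]
          refine ⟨1 / 4, by norm_num, ?_⟩
          simp [nodePos, square, h1]
        by_cases h2 : (j : ℕ) = b + 2
        · rw [(square_second_inl_eq_iff j .top).mpr (by simp [squareEntry, h2])]
          refine ⟨1 / 2, by norm_num, ?_⟩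
          simp [nodePos, square, h2]
        · rw [square_second_inl_of_not h0 h1 h2]
          refine ⟨1, by norm_num, ?_⟩
          simp [nodePos, square]
      obtain ⟨r, hr, hd⟩ := hd
      refine ⟨r, hr, hd.trans ?_⟩
      change (r : ℂ) = r * Complex.exp (((0 : ℝ) : ℂ) * Complex.I)
      simp
    · rw [show (square n b hb p).dir (squareOrientation n b hb p) (Sum.inr e) = _ from square_dir e]
      exact SquareEdge.dir_eq p e
  · have hbound : ∀ (p : Bool) (e : SquareEdge), |e.angle p| < 4 := by decide
    rintro (i | e) (j | e') he
    · exact absurd he (head_ne_source (fun _ => rfl) _ _)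
    · change |(SquareEdge.angle p e' : ℝ) * (Real.pi / 4) - 0| < Real.pi
      rw [sub_zero]
      exact hlt _ (hbound p e')
    · exact absurd he (head_ne_source (fun _ => rfl) _ _)
    · have : ∀ (p : Bool) (e e' : SquareEdge), e.head p = some (e'.tail p) →
          |e'.angle p - e.angle p| < 4 := by decide
      have h := hlt _ (this p e e' ((square_head e _).mp (he.trans (square_tail e'))))
      change |(SquareEdge.angle p e' : ℝ) * (Real.pi / 4) -
        (SquareEdge.angle p e : ℝ) * (Real.pi / 4)| < Real.pi
      push_cast at h
      rwa [← sub_mul]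
  · rw [square_sinkEdge]
    have h0 : ((0 : ℤ) : ℝ) * (Real.pi / 4) = 0 := by simp
    split_ifs
    · exact h0
    · exact h0
    · exact h0
    · rfl

lemma square_isRegular : IsRegular (square n b hb p) (squareOrientation n b hb p) where
  source _ := rfl
  sink j := by
    rw [square_sinkEdge]
    split_ifs <;> rfl
  balanced := square_balanced
  unique := square_unique
  acyclic := square_acyclic
  angle := square_angle
  leftOf_sinkEdge j := by
    rw [square_sinkEdge]
    change _ = squareRightFace n b j.succ
    unfold squareRightFace
    simp only [Fin.val_succ]
    split_ifs <;> first | omega | rfl | skip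
    exact congrArg Sum.inl (Fin.ext (by simp only [Fin.val_succ]; omega))
  rightOf_sinkEdge j := by
    rw [square_sinkEdge]
    change _ = squareRightFace n b j.castSucc
    unfold squareRightFace
    simp only [Fin.val_castSucc]
    split_ifs <;> first | omega | rfl | skip
    exact congrArg Sum.inl (Fin.ext (by simp only [Fin.val_castSucc]; omega))

/-! ### Weights of the graphs `square` -/

/-- The weight of an edge with respect to its reference direction. -/
def edgePow (p : Bool) (wt : SquareEdge → ℂˣ) (e : SquareEdge) : ℂˣ :=
  if e.forward p then wt e else (wt e)⁻¹

lemma square_faceWeight (wt : SquareEdge → ℂˣ) (f : Fin (n + 1) ⊕ SquareFace) :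
    (square n b hb p).faceWeight (squareOrientation n b hb p) (Sum.elim 1 wt) f =
      (sel (Sum.inl ⟨b + 2, by omega⟩ = f) (edgePow p wt .westNorth) *
        sel (Sum.inr .square = f) (edgePow p wt .westNorth)⁻¹) *
      ((sel (Sum.inr .upperRight = f) (edgePow p wt .northEast) *
        sel (Sum.inr .square = f) (edgePow p wt .northEast)⁻¹) *
      ((sel (Sum.inr .square = f) (edgePow p wt .westSouth) *
        sel (Sum.inl ⟨b + 1, by omega⟩ = f) (edgePow p wt .westSouth)⁻¹) *
      ((sel (Sum.inr .square = f) (edgePow p wt .southEast) *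
        sel (Sum.inr .lowerRight = f) (edgePow p wt .southEast)⁻¹) *
      ((sel (Sum.inl ⟨b + 1, by omega⟩ = f) (edgePow p wt .bottomSouth) *
        sel (Sum.inr .lowerRight = f) (edgePow p wt .bottomSouth)⁻¹) *
      ((sel (Sum.inl ⟨b + 2, by omega⟩ = f) (edgePow p wt .northTop) *
        sel (Sum.inr .upperRight = f) (edgePow p wt .northTop)⁻¹) *
      ((sel (Sum.inr .lowerRight = f) (edgePow p wt .bottomOut) *
        sel (Sum.inl ⟨b, by omega⟩ = f) (edgePow p wt .bottomOut)⁻¹) *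
      ((sel (Sum.inr .upperRight = f) (edgePow p wt .eastOut) *
        sel (Sum.inr .lowerRight = f) (edgePow p wt .eastOut)⁻¹) *
      (sel (Sum.inl ⟨b + 3, by omega⟩ = f) (edgePow p wt .topOut) *
        sel (Sum.inr .upperRight = f) (edgePow p wt .topOut)⁻¹)))))))) := by
  have hpow : ∀ e : SquareEdge,
      (if squareOrientation n b hb p (Sum.inr e) then (wt e)⁻¹ else wt e) =
        (edgePow p wt e)⁻¹ := by
    intro e
    change (if e.forward p then (wt e)⁻¹ else wt e) = _
    unfold edgePow
    split_ifs <;> simp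
  refine (faceWeight_elim_one _ _ _ _).trans ((edgeProd_elim_one _ _ _ _).trans
    ((square_prod _).trans ?_))
  simp only [hpow]
  rfl

/-- The weights of the strands of `square`. -/
noncomputable def squareStrand (b : ℕ) (p : Bool) (wt : SquareEdge → ℂˣ) (j : ℕ) : ℂˣ :=
  if j = b then wt .bottomOut
  else if j = b + 1 then wt .westSouth * edgePow p wt .southEast * wt .eastOut
  else if j = b + 2 then wt .topOut else 1

/-- The path sums of `square` at the edges other than those at the sources. -/
noncomputable def squarePathSum (b : ℕ) (p : Bool) (wt : SquareEdge → ℂˣ) (k : ℕ) :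
    SquareEdge → ℂ :=
  let B : ℂ := wt .bottomOut * if k = b then 1 else 0
  let E : ℂ := wt .eastOut * if k = b + 1 then 1 else 0
  let T : ℂ := wt .topOut * if k = b + 2 then 1 else 0
  let N : ℂ := if p then wt .northTop * T else
    wt .northEast * (E + wt .southEast * (wt .bottomSouth * B))
  let S : ℂ := if p then wt .southEast * (E + wt .northEast * (wt .northTop * T)) else
    wt .bottomSouth * B
  fun e => match e with
    | .westNorth => wt .westNorth * N
    | .westSouth => wt .westSouth * S
    | .bottomSouth => wt .bottomSouth * if p then S else B
    | .northTop => wt .northTop * if p then T else N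
    | .southEast => wt .southEast * if p then E + wt .northEast * (wt .northTop * T) else S
    | .northEast => wt .northEast * if p then N else E + wt .southEast * (wt .bottomSouth * B)
    | .bottomOut => B
    | .eastOut => E
    | .topOut => T

lemma sum_squareEdge_tail (P : SquareEdge → ℂ) (v : SquareVertex) (p : Bool) :
    ∑ e : SquareEdge, (if e.tail p = v then P e else 0) = match v with
      | .west => P .westNorth + P .westSouth
      | .north => if p then P .northTop else P .northEast
      | .east => if p then P .northEast + P .eastOut else P .southEast + P .eastOut
      | .south => if p then P .southEast else P .bottomSouth
      | .top => if p then P .topOut else P .northTop + P .topOut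
      | .bottom => if p then P .bottomSouth + P .bottomOut else P .bottomOut := by
  rw [square_sum]
  cases v <;> cases p <;> simp [SquareEdge.tail, SquareEdge.forward, SquareEdge.start,
    SquareEdge.finish]

/-- The path sums of `square`. -/
noncomputable def squarePathSums (b : ℕ) (p : Bool) (wt : SquareEdge → ℂˣ) :
    Fin n ⊕ SquareEdge → Fin n → ℂ :=
  Sum.elim (fun i k => if (i : ℕ) = b then
      ∑ e : SquareEdge, (if e.tail p = .bottom then squarePathSum b p wt k e else 0)
    else if (i : ℕ) = b + 1 then
      ∑ e : SquareEdge, (if e.tail p = .west then squarePathSum b p wt k e else 0)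
    else if (i : ℕ) = b + 2 then
      ∑ e : SquareEdge, (if e.tail p = .top then squarePathSum b p wt k e else 0)
    else if i = k then 1 else 0) fun e k => squarePathSum b p wt k e

lemma square_isPathSum (wt : SquareEdge → ℂˣ) :
    IsPathSum (squareOrientation n b hb p) (Sum.elim 1 wt) (squarePathSums b p wt) := by
  classical
  have hs : ∀ j, squareOrientation n b hb p (Sum.inl j) = true := fun _ => rfl
  have hsink : ∀ j, squareOrientation n b hb p ((square n b hb p).sinkEdge j) = true :=
    square_isRegular.sink
  have hvertex : ∀ (x : (square n b hb p).Node) (v : SquareVertex) (k : Fin n), x = .vertex v →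
      ((if x = .sink k then 1 else 0) + ∑ e',
        if (square n b hb p).tail (squareOrientation n b hb p) e' = x then
          squarePathSums b p wt e' k else 0) =
      ∑ e : SquareEdge, if e.tail p = v then squarePathSum b p wt k e else 0 := by
    rintro x v k rfl
    rw [if_neg (by simp), zero_add, Fintype.sum_sum_type, Finset.sum_eq_zero, zero_add]
    · refine Finset.sum_congr rfl fun (e : SquareEdge) _ => ?_
      refine if_congr ?_ rfl rfl
      rw [show (square n b hb p).tail (squareOrientation n b hb p) (Sum.inr e) = _ from
        square_tail e]
      exact ⟨fun h => PlabicNode.vertex.inj h, fun h => congrArg _ h⟩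
    · intro j _
      exact if_neg (square_tail_inl_ne hs j v)
  have hout : ∀ (x : (square n b hb p).Node) (j k : Fin n), x = .sink j →
      ((if x = .sink k then 1 else 0) + ∑ e',
        if (square n b hb p).tail (squareOrientation n b hb p) e' = x then
          squarePathSums b p wt e' k else 0) = if j = k then 1 else 0 := by
    rintro x j k rfl
    rw [Finset.sum_eq_zero fun e _ => if_neg (tail_ne_sink hsink e j), add_zero]
    simp
  rintro (j | e) k
  · refine Eq.trans ?_ (congrArg (fun c : ℂ => c * _) (Units.val_one (α := ℂ))).symm
    rw [one_mul]
    have hj := square_head_inl_eq_iff hs j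
    change (if (j : ℕ) = b then _ else if (j : ℕ) = b + 1 then _ else if (j : ℕ) = b + 2 then _
      else if j = k then (1 : ℂ) else 0) = _
    by_cases h0 : (j : ℕ) = b
    · rw [if_pos h0]
      exact (hvertex _ .bottom k ((hj _).mpr (by simp [squareEntry, h0]))).symm
    by_cases h1 : (j : ℕ) = b + 1
    · rw [if_neg h0, if_pos h1]
      exact (hvertex _ .west k ((hj _).mpr (by simp [squareEntry, h1]))).symm
    by_cases h2 : (j : ℕ) = b + 2
    · rw [if_neg h0, if_neg h1, if_pos h2]
      exact (hvertex _ .top k ((hj _).mpr (by simp [squareEntry, h2]))).symm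
    · rw [if_neg h0, if_neg h1, if_neg h2]
      exact (hout _ j k (square_second_inl_of_not h0 h1 h2)).symm
  · change squarePathSum b p wt k e = wt e * _
    have hin : ∀ v : SquareVertex, e.head p = some v → squarePathSum b p wt k e = wt e *
        ∑ e' : SquareEdge, (if e'.tail p = v then squarePathSum b p wt k e' else 0) →
        squarePathSum b p wt k e = _ := fun v h1 h2 =>
      h2.trans (congrArg (fun c : ℂ => wt e * c) (hvertex _ v k ((square_head e v).mpr h1)).symm)
    have hlast : ∀ j : Fin n, (square n b hb p).head (squareOrientation n b hb p) (Sum.inr e) =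
        .sink j → squarePathSum b p wt k e = wt e * (if j = k then 1 else 0) →
        squarePathSum b p wt k e = _ := fun j h1 h2 =>
      h2.trans (congrArg (fun c : ℂ => wt e * c) (hout _ j k h1).symm)
    cases e
    case bottomOut =>
      refine hlast ⟨b, by omega⟩ rfl ?_
      simp [squarePathSum, Fin.ext_iff, eq_comm]
    case eastOut =>
      refine hlast ⟨b + 1, by omega⟩ rfl ?_
      simp [squarePathSum, Fin.ext_iff, eq_comm]
    case topOut =>
      refine hlast ⟨b + 2, by omega⟩ rfl ?_
      simp [squarePathSum, Fin.ext_iff, eq_comm]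
    all_goals
      cases p <;>
      · refine hin _ rfl ?_
        rw [sum_squareEdge_tail]
        simp only [squarePathSum, SquareEdge.start, if_true, if_false, Bool.false_eq_true]
        try ring

/-- The parameter of a positive letter, or the double of its inverse for a negative letter. -/
noncomputable def squareParam (p : Bool) (t : ℂ) : ℂ := if p then t else 2 / t

lemma squareParam_ne_zero {t : ℂ} (ht : t ≠ 0) : squareParam p t ≠ 0 := by
  unfold squareParam
  split_ifs
  · exact ht
  · exact div_ne_zero two_ne_zero ht

lemma squareParam_squareParam {t : ℂ} (ht : t ≠ 0) : squareParam p (squareParam p t) = t := by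
  unfold squareParam
  cases p
  · simp only [Bool.false_eq_true, if_false]
    field_simp
  · rfl

/-- The factors at the old faces for `square`. -/
noncomputable def squareOldFactor (b : ℕ) (p : Bool) (t : ℂ) (r : Fin (n + 1)) : ℂ :=
  if (r : ℕ) = b + 1 then squareParam p t else if (r : ℕ) = b + 2 then squareParam p t / 2 else 1

/-- The weights of the new faces for `square`. -/
noncomputable def squareNewWeight (p : Bool) (t : ℂ) : SquareFace → ℂ
  | .square => 1
  | .lowerRight => (squareParam p t)⁻¹
  | .upperRight => 2 * (squareParam p t)⁻¹

lemma square_faceWeight_inr (wt : SquareEdge → ℂˣ) (f : SquareFace) :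
    (square n b hb p).faceWeight (squareOrientation n b hb p) (Sum.elim 1 wt) (Sum.inr f) =
      match f with
      | .square => (edgePow p wt .westNorth)⁻¹ * (edgePow p wt .northEast)⁻¹ *
          (edgePow p wt .westSouth * edgePow p wt .southEast)
      | .lowerRight => (edgePow p wt .southEast)⁻¹ *
          (edgePow p wt .bottomSouth)⁻¹ *
          (edgePow p wt .bottomOut * (edgePow p wt .eastOut)⁻¹)
      | .upperRight => edgePow p wt .northEast * (edgePow p wt .northTop)⁻¹ *
          (edgePow p wt .eastOut * (edgePow p wt .topOut)⁻¹) := by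
  refine (square_faceWeight wt (Sum.inr f)).trans ?_
  cases f <;> simp [sel_eq_ite, mul_assoc]

lemma stepRatio_eq (g : ℕ → ℂˣ) (r : Fin (n + 1)) : stepRatio (fun j : Fin n => g j) r =
    (if (r : ℕ) = 0 then 1 else g (r - 1)) * if (r : ℕ) < n then (g r)⁻¹ else 1 := by
  unfold stepRatio
  congr 1
  · induction r using Fin.cases with
    | zero => simp
    | succ j => simp
  · induction r using Fin.lastCases with
    | last => simp
    | cast j => simp

lemma mat_letterRoot (a : Fin (n / 2)) (t : ℂ) (i k : Fin n) :
    mat (letterRoot (a, p) t) i k = if p then rootMatrix a t i k else rootMatrix a t k i := by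
  rw [letterRoot, mat_side, mat_root, sideMat]
  cases p
  · exact rootMatrix_rev a t k i
  · rfl

lemma rootMatrix_of_isShort {a : Fin (n / 2)} (hs : IsShort a) (t : ℂ) (i k : Fin n) :
    rootMatrix a t i k = if (i : ℕ) = k then 1 else
      if ((i : ℕ) = a ∧ (k : ℕ) = a + 1) ∨ ((i : ℕ) = a + 1 ∧ (k : ℕ) = a + 2) then t else
      if (i : ℕ) = a ∧ (k : ℕ) = a + 2 then t ^ 2 / 2 else 0 := by
  have := hs.1
  simp only [rootMatrix, Matrix.of_apply, Fin.ext_iff, IsLower]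
  split_ifs <;> first | rfl | omega

lemma square_network {a : Fin (n / 2)} (hs : IsShort a) {t : ℂ} (ht : t ≠ 0) (wt : SquareEdge → ℂˣ)
    (h1 : (edgePow p wt .westSouth * edgePow p wt .southEast : ℂ) =
      edgePow p wt .westNorth * edgePow p wt .northEast)
    (h2 : (squareParam p t * wt .bottomOut : ℂ) = edgePow p wt .southEast *
      edgePow p wt .bottomSouth * wt .eastOut)
    (h3 : (squareParam p t * edgePow p wt .northEast * wt .eastOut : ℂ) =
      2 * edgePow p wt .northTop * wt .topOut) (i k : Fin n) :
    squarePathSums a p wt (Sum.inl i) k =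
      squareStrand a p wt i * mat (letterRoot (a, p) t) i k := by
  have hwt := fun e => (wt e).ne_zero
  have e1 := hwt .eastOut
  have e2 := hwt .southEast
  have e3 := hwt .northEast
  have e4 := hwt .bottomSouth
  have e5 := hwt .northTop
  rw [mat_letterRoot]
  simp only [rootMatrix_of_isShort hs]
  simp only [squarePathSums, Sum.elim_inl, sum_squareEdge_tail, squarePathSum, squareStrand]
  cases p
  · simp only [edgePow, SquareEdge.forward, squareParam, Bool.false_eq_true, if_false,
      if_true, Bool.not_false, Units.val_inv_eq_inv_val] at h1 h2 h3
    have g1 : (wt .westSouth : ℂ) = wt .westNorth * wt .northEast * wt .southEast := by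
      field_simp at h1
      linear_combination h1
    have g2 : (2 * wt .bottomOut * wt .southEast * wt .bottomSouth : ℂ) = t * wt .eastOut := by
      field_simp at h2
      linear_combination h2
    have g3 : (wt .northEast * wt .eastOut * wt .northTop : ℂ) = t * wt .topOut := by
      field_simp at h3
      linear_combination h3
    by_cases i0 : (i : ℕ) = a
    · simp [i0, eq_comm]
    by_cases i1 : (i : ℕ) = a + 1
    · by_cases k0 : (k : ℕ) = a
      · simp [i1, k0, edgePow, SquareEdge.forward]
        field_simp
        linear_combination (-(wt .southEast * wt .bottomSouth * wt .bottomOut) : ℂ) * g1 + (wt .westSouth : ℂ) * g2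
      by_cases k1 : (k : ℕ) = a + 1
      · simp [i1, k1, edgePow, SquareEdge.forward]
        field_simp
        exact g1.symm
      · simp [i1, k0, k1]
    by_cases i2 : (i : ℕ) = a + 2
    · by_cases k0 : (k : ℕ) = a
      · simp [i2, k0]
        refine mul_left_cancel₀ e1 ?_
        linear_combination (wt .southEast * wt .bottomSouth * wt .bottomOut : ℂ) * g3 +
          (t * wt .topOut / 2 : ℂ) * g2
      by_cases k1 : (k : ℕ) = a + 1
      · simp [i2, k1]
        linear_combination g3
      by_cases k2 : (k : ℕ) = a + 2
      · simp [i2, k2]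
      · simp [i2, k0, k1, k2]
    · simp [i0, i1, i2, Fin.ext_iff, eq_comm (a := (k : ℕ))]
  · simp only [edgePow, SquareEdge.forward, squareParam, if_false, Bool.false_eq_true,
      if_true, Bool.not_true, Units.val_inv_eq_inv_val] at h1 h2 h3
    have g1 : (wt .westNorth : ℂ) = wt .westSouth * wt .northEast * wt .southEast := by
      field_simp at h1
      linear_combination -h1
    have g3 : (t * wt .eastOut : ℂ) = 2 * wt .northTop * wt .topOut * wt .northEast := by
      field_simp at h3
      linear_combination h3
    by_cases i0 : (i : ℕ) = a
    · by_cases k0 : (k : ℕ) = a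
      · simp [i0, k0]
      by_cases k1 : (k : ℕ) = a + 1
      · simp [i0, k1]
        linear_combination -h2
      by_cases k2 : (k : ℕ) = a + 2
      · simp [i0, k2]
        refine mul_left_cancel₀ e1 ?_
        linear_combination (-(wt .northEast * wt .northTop * wt .topOut) : ℂ) * h2 -
          (t * wt .bottomOut / 2 : ℂ) * g3
      · simp [i0, k0, k1, k2]
        exact fun h => absurd h.symm k0
    by_cases i1 : (i : ℕ) = a + 1
    · by_cases k1 : (k : ℕ) = a + 1
      · simp [i1, k1, edgePow, SquareEdge.forward]
        ring
      by_cases k2 : (k : ℕ) = a + 2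
      · simp [i1, k2, edgePow, SquareEdge.forward]
        linear_combination (wt .northTop * wt .topOut : ℂ) * g1 -
          (wt .westSouth * wt .southEast : ℂ) * g3
      · simp [i1, k1, k2]
        exact fun h => k1 h.symm
    by_cases i2 : (i : ℕ) = a + 2
    · simp [i2, eq_comm]
    · simp [i0, i1, i2, Fin.ext_iff]

lemma square_relations {t : ℂ} (ht : t ≠ 0) (wt : SquareEdge → ℂˣ) (hwt : ∀ f : SquareFace,
      ((square n b hb p).faceWeight (squareOrientation n b hb p) (Sum.elim 1 wt) (Sum.inr f) : ℂ) =
        squareNewWeight p t f) :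
    (edgePow p wt .westSouth * edgePow p wt .southEast : ℂ) =
      edgePow p wt .westNorth * edgePow p wt .northEast ∧
    (squareParam p t * wt .bottomOut : ℂ) = edgePow p wt .southEast *
      edgePow p wt .bottomSouth * wt .eastOut ∧
    (squareParam p t * edgePow p wt .northEast * wt .eastOut : ℂ) =
      2 * edgePow p wt .northTop * wt .topOut := by
  have hp := squareParam_ne_zero (p := p) ht
  have hu := fun e => (edgePow p wt e).ne_zero
  have hb : edgePow p wt .bottomOut = wt .bottomOut := rfl
  have he : edgePow p wt .eastOut = wt .eastOut := rfl
  have ht : edgePow p wt .topOut = wt .topOut := rfl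
  have a1 := hwt .square
  have a2 := hwt .lowerRight
  have a3 := hwt .upperRight
  rw [square_faceWeight_inr] at a1 a2 a3
  simp only [squareNewWeight, Units.val_mul, Units.val_inv_eq_inv_val] at a1 a2 a3
  rw [← hb, ← he, ← ht]
  have := hu .westNorth
  have := hu .northEast
  have := hu .southEast
  have := hu .bottomSouth
  have := hu .northTop
  have := hu .eastOut
  have := hu .topOut
  field_simp at a1 a2 a3
  refine ⟨?_, ?_, ?_⟩
  · linear_combination a1
  · linear_combination a2
  · linear_combination a3

lemma square_faceWeight_inl {t : ℂ} (wt : SquareEdge → ℂˣ)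
    (h1 : (edgePow p wt .westSouth * edgePow p wt .southEast : ℂ) =
      edgePow p wt .westNorth * edgePow p wt .northEast)
    (h2 : (squareParam p t * wt .bottomOut : ℂ) = edgePow p wt .southEast *
      edgePow p wt .bottomSouth * wt .eastOut)
    (h3 : (squareParam p t * edgePow p wt .northEast * wt .eastOut : ℂ) =
      2 * edgePow p wt .northTop * wt .topOut) (r : Fin (n + 1)) :
    ((square n b hb p).faceWeight (squareOrientation n b hb p) (Sum.elim 1 wt) (Sum.inl r) : ℂ) =
      stepRatio (fun j => squareStrand b p wt j) r * squareOldFactor b p t r := by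
  refine (congrArg Units.val (square_faceWeight wt (Sum.inl r))).trans ?_
  have n2 := hb
  have hn : edgePow p wt .westSouth = wt .westSouth := rfl
  have hb : edgePow p wt .bottomOut = wt .bottomOut := rfl
  have hw : edgePow p wt .westNorth = wt .westNorth := rfl
  have ht : edgePow p wt .topOut = wt .topOut := rfl
  have := (edgePow p wt .southEast).ne_zero
  have := (edgePow p wt .northEast).ne_zero
  have := (wt .bottomOut).ne_zero
  have := (wt .westSouth).ne_zero
  have := (wt .eastOut).ne_zero
  have := (wt .topOut).ne_zero
  rw [hn, hw] at h1
  rw [stepRatio_eq (squareStrand b p wt)]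
  simp only [hn, hb, hw, ht, sel_eq_ite, Sum.inl.injEq, reduceCtorEq, if_false, one_mul, mul_one,
    Fin.ext_iff, eq_comm (b := (r : ℕ)), squareStrand, squareOldFactor]
  have n0 : b < n := by omega
  have n1 : b + 1 < n := by omega
  by_cases r0 : (r : ℕ) = b
  · by_cases b0 : b = 0
    · subst b0
      simp [r0, n0]
    · have e1 : ¬ b - 1 = b := by omega
      have e2 : ¬ b - 1 = b + 1 := by omega
      have e3 : ¬ b - 1 = b + 2 := by omega
      simp [r0, e1, e2, e3, b0, n0]
  by_cases r1 : (r : ℕ) = b + 1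
  · simp [r1, n1]
    field_simp
    linear_combination -h2
  by_cases r2 : (r : ℕ) = b + 2
  · simp [r2, n2]
    field_simp
    linear_combination (-(wt .eastOut * squareParam p t) : ℂ) * h1 - (wt .westNorth : ℂ) * h3
  by_cases r3 : (r : ℕ) = b + 3
  · simp [r3]
  · have e0 : ¬ (r : ℕ) - 1 = b := by omega
    have e1 : ¬ (r : ℕ) - 1 = b + 1 := by omega
    have e2 : ¬ (r : ℕ) - 1 = b + 2 := by omega
    simp [r0, r1, r2, r3, e0, e1, e2]

lemma edgePow_power (p : Bool) (wt : SquareEdge → ℂˣ) (e : SquareEdge) :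
    edgePow p (edgePow p wt) e = wt e := by
  unfold edgePow
  by_cases h : e.forward p <;> simp [h]

lemma square_isElementary {a : Fin (n / 2)} (hs : IsShort a) (hb : (a : ℕ) + 2 < n) :
    IsElementary (square n a hb p) (squareOrientation n a hb p) (fun t => mat (letterRoot (a, p) t))
      (squareOldFactor a p) (squareNewWeight p) where
  exists_wt t ht := by
    have hp := squareParam_ne_zero (p := p) ht
    obtain ⟨wt, hwt⟩ : ∃ wt : SquareEdge → ℂˣ, ∀ e, edgePow p wt e =
        if e = .bottomSouth then Units.mk0 _ hp
        else if e = .northTop then Units.mk0 _ (div_ne_zero hp two_ne_zero) else 1 :=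
      ⟨edgePow p _, edgePow_power p _⟩
    refine ⟨wt, fun (f : SquareFace) => ?_⟩
    rw [show (square n a hb p).faceWeight (squareOrientation n a hb p) (Sum.elim 1 wt)
      (Sum.inr f) = _ from square_faceWeight_inr wt f]
    simp only [hwt]
    cases f <;> simp [squareNewWeight, div_eq_mul_inv, mul_comm]
  factor t ht wt hwt := by
    obtain ⟨h1, h2, h3⟩ := square_relations ht wt hwt
    refine ⟨fun j => squareStrand a p wt j, ?_, square_faceWeight_inl wt h1 h2 h3⟩
    ext i k
    rw [square_isRegular.networkMatrix_eq (square_isPathSum wt), Matrix.diagonal_mul]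
    exact square_network hs ht wt h1 h2 h3 i k

/-! ### The symmetry of the graphs `square` -/

/-- Four times the coordinates of a vertex, relative to the strand of the vertex `bottom`. -/
def squareCoord : SquareVertex → ℤ × ℤ
  | .west => (1, 4)
  | .north => (2, 5)
  | .east => (3, 4)
  | .south => (2, 3)
  | .top => (2, 8)
  | .bottom => (2, 0)

lemma square_pos (v : SquareVertex) : (square n b hb p).pos v =
    ((squareCoord v).1 / 4 : ℝ) + (b + (squareCoord v).2 / 4 : ℝ) * Complex.I := by
  cases v <;>
  · simp only [square, squareCoord]
    push_cast
    ring

lemma square_re (v : SquareVertex) : ((square n b hb p).pos v).re = (squareCoord v).1 / 4 := by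
  rw [square_pos]
  simp only [Complex.add_re, Complex.ofReal_re, Complex.re_ofReal_mul, Complex.I_re]
  ring

lemma square_im (v : SquareVertex) :
    ((square n b hb p).pos v).im = b + (squareCoord v).2 / 4 := by
  rw [square_pos]
  simp only [Complex.add_im, Complex.ofReal_im, Complex.im_ofReal_mul, Complex.I_im]
  ring

lemma square_onMidline_iff (hn : n = 2 * b + 3) (v : SquareVertex) :
    (square n b hb p).OnMidline v ↔ v = .west ∨ v = .east := by
  have h : (square n b hb p).OnMidline v ↔ (squareCoord v).2 = 4 := by
    unfold OnMidline
    rw [square_im, hn, ← @Int.cast_inj ℝ]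
    push_cast
    constructor <;> intro h <;> linarith
  rw [h]
  clear h
  revert v
  decide

lemma square_joins {e : (square n b hb p).Edge} {v w : SquareVertex}
    (h : (square n b hb p).Joins e v w) : ∃ s : SquareEdge, e = Sum.inr s ∧
      ((s.start = v ∧ s.finish = some w) ∨ (s.start = w ∧ s.finish = some v)) := by
  rcases e with j | s
  · rcases h with ⟨h, -⟩ | ⟨h, -⟩ <;> simp [first] at h
  · refine ⟨s, rfl, ?_⟩
    have hf : (square n b hb p).first (Sum.inr s) = .vertex (SquareEdge.start s) := square_first s
    rcases h with ⟨h1, h2⟩ | ⟨h1, h2⟩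
    · exact Or.inl ⟨PlabicNode.vertex.inj (hf.symm.trans h1), (square_second_eq_iff s w).mp h2⟩
    · exact Or.inr ⟨PlabicNode.vertex.inj (hf.symm.trans h1), (square_second_eq_iff s v).mp h2⟩

lemma square_joins_west {e : (square n b hb p).Edge} {w : SquareVertex}
    (h : (square n b hb p).Joins e .west w ∨ (square n b hb p).Joins e w .west) :
    (e = Sum.inr .westNorth ∧ w = .north) ∨ (e = Sum.inr .westSouth ∧ w = .south) := by
  have key : ∀ (s : SquareEdge) (w : SquareVertex),
      ((s.start = .west ∧ s.finish = some w) ∨ (s.start = w ∧ s.finish = some .west)) →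
      (s = .westNorth ∧ w = .north) ∨ (s = .westSouth ∧ w = .south) := by decide
  obtain ⟨s, rfl, hs⟩ : ∃ s : SquareEdge, e = Sum.inr s ∧
      ((s.start = .west ∧ s.finish = some w) ∨ (s.start = w ∧ s.finish = some .west)) := by
    rcases h with h | h
    · exact square_joins h
    · obtain ⟨s, hs, h⟩ := square_joins h
      exact ⟨s, hs, h.symm⟩
  rcases key s w hs with ⟨rfl, rfl⟩ | ⟨rfl, rfl⟩
  · exact Or.inl ⟨rfl, rfl⟩
  · exact Or.inr ⟨rfl, rfl⟩

lemma square_borders_iff (e : (square n b hb p).Edge) :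
    (square n b hb p).Borders e (Sum.inr SquareFace.square) ↔ e = Sum.inr .westNorth ∨
      e = Sum.inr .northEast ∨ e = Sum.inr .southEast ∨ e = Sum.inr .westSouth := by
  have key : ∀ s : SquareEdge, (square n b hb p).Borders (Sum.inr s) (Sum.inr SquareFace.square) ↔
      s = .westNorth ∨ s = .northEast ∨ s = .southEast ∨ s = .westSouth := by
    intro s
    cases s <;> simp [Borders, leftOf, rightOf, square]
  rcases e with j | s
  · simp [Borders, leftOf, rightOf]
  · refine (key s).trans ?_
    have hinj : ∀ s s' : SquareEdge, s = s' ↔ (Sum.inr s : Fin n ⊕ SquareEdge) = Sum.inr s' := by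
      simp
    exact or_congr (hinj _ _) (or_congr (hinj _ _) (or_congr (hinj _ _) (hinj _ _)))

lemma square_isMidlineSquare (hn : n = 2 * b + 3) :
    (square n b hb p).IsMidlineSquare (Sum.inr SquareFace.square) :=
  ⟨SquareVertex.west, SquareVertex.north, SquareVertex.east, SquareVertex.south,
    Sum.inr .westNorth, Sum.inr .northEast, Sum.inr .southEast, Sum.inr .westSouth,
    (by decide : [SquareVertex.west, SquareVertex.north, SquareVertex.east,
      SquareVertex.south].Nodup), square_borders_iff,
    Or.inl ⟨rfl, rfl⟩, Or.inl ⟨rfl, rfl⟩, Or.inr ⟨rfl, rfl⟩, Or.inr ⟨rfl, rfl⟩, rfl, rfl, rfl,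
    (square_onMidline_iff hn _).mpr (Or.inl rfl), (square_onMidline_iff hn _).mpr (Or.inr rfl)⟩

lemma eq_square_of_borders {f : (square n b hb p).Face}
    (h1 : (square n b hb p).Borders (Sum.inr SquareEdge.westNorth) f)
    (h2 : (square n b hb p).Borders (Sum.inr SquareEdge.westSouth) f) :
    f = Sum.inr SquareFace.square := by
  rcases h1 with rfl | rfl
  · rcases h2 with h | h
    · exact h.symm
    · have := congrArg Fin.val (Sum.inl_injective h)
      simp at this
  · rfl

lemma eq_square_of_hasMidlineSquare (hn : n = 2 * b + 3) {f : (square n b hb p).Face}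
    (hf : (square n b hb p).HasMidlineSquare f) : f = Sum.inr SquareFace.square := by
  obtain ⟨v₁, v₂, v₃, v₄, e₁, e₂, e₃, e₄, hnd, ⟨b1, b2, b3, b4⟩, ⟨j1, j2, j3, j4⟩, -, -, m1, m3⟩ := hf
  have h13 : v₁ ≠ v₃ := by
    rintro rfl
    simp at hnd
  have h24 : v₂ ≠ v₄ := by
    rintro rfl
    simp at hnd
  rw [show (square n b hb p).OnMidline v₁ ↔ _ from square_onMidline_iff hn v₁] at m1
  rw [show (square n b hb p).OnMidline v₃ ↔ _ from square_onMidline_iff hn v₃] at m3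
  have key : ∀ e e' : (square n b hb p).Edge, ∀ w w' : SquareVertex, w ≠ w' →
      (square n b hb p).Borders e f → (square n b hb p).Borders e' f →
      ((square n b hb p).Joins e .west w ∨ (square n b hb p).Joins e w .west) →
      ((square n b hb p).Joins e' .west w' ∨ (square n b hb p).Joins e' w' .west) →
      f = Sum.inr SquareFace.square := by
    intro e e' w w' hw hb1 hb2 h1 h2
    rcases square_joins_west h1 with ⟨rfl, rfl⟩ | ⟨rfl, rfl⟩ <;>
      rcases square_joins_west h2 with ⟨rfl, rfl⟩ | ⟨rfl, rfl⟩
    · exact absurd rfl hw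
    · exact eq_square_of_borders hb1 hb2
    · exact eq_square_of_borders hb2 hb1
    · exact absurd rfl hw
  rcases m1 with rfl | rfl
  · exact key e₁ e₄ v₂ v₄ h24 b1 b4 (Or.inl j1) (Or.inr j4)
  · rcases m3 with rfl | rfl
    · exact key e₂ e₃ v₂ v₄ h24 b2 b3 (Or.inr j2) (Or.inl j3)
    · exact absurd rfl h13

lemma square_rightFace_injective : Function.Injective (square n b hb p).rightFace := by
  intro r r' h
  change squareRightFace n b r = squareRightFace n b r' at h
  unfold squareRightFace at h
  refine Fin.ext ?_
  split_ifs at h <;> simp [Fin.ext_iff] at h <;> omega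

lemma square_isDrawn (hn : n = 2 * b + 3) : IsDrawn (square n b hb p) where
  pos_injective (v w : SquareVertex) h := by
    have h1 := congrArg Complex.re h
    have h2 := congrArg Complex.im h
    rw [show ((square n b hb p).pos v).re = _ from square_re v,
      show ((square n b hb p).pos w).re = _ from square_re w] at h1
    rw [show ((square n b hb p).pos v).im = _ from square_im v,
      show ((square n b hb p).pos w).im = _ from square_im w] at h2
    have c1 : (squareCoord v).1 = (squareCoord w).1 := by
      rw [← @Int.cast_inj ℝ]
      linarith
    have c2 : (squareCoord v).2 = (squareCoord w).2 := by
      rw [← @Int.cast_inj ℝ]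
      linarith
    have key : ∀ v w, squareCoord v = squareCoord w → v = w := by decide
    exact key v w (Prod.ext c1 c2)
  width_pos := one_pos
  re_pos (v : SquareVertex) := by
    have hw : (square n b hb p).width = 1 := rfl
    rw [show ((square n b hb p).pos v).re = _ from square_re v, hw]
    cases v <;> norm_num [squareCoord]
  first_ne_second e := by
    rcases e with j | s
    · exact fun h => second_ne_source _ _ h.symm
    · intro h
      have h' := (square_second_eq_iff s _).mp (h.symm.trans (square_first s))
      have key : ∀ s : SquareEdge, s.finish ≠ some s.start := by decide
      exact key s h'
  edge_ext e e' h1 h2 := by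
    rcases e with j | s
    · rw [(first_eq_source_iff e' j).mp h1.symm]
    · rcases e' with j | s'
      · exact absurd h1 (by simp [first])
      · have key : ∀ s s' : SquareEdge, s.start = s'.start →
            (∀ v, s.finish = some v ↔ s'.finish = some v) → s = s' := by decide
        refine congrArg Sum.inr (key s s' ?_ fun v => ?_)
        · exact PlabicNode.vertex.inj ((square_first s).symm.trans (h1.trans (square_first s')))
        · rw [← square_second_eq_iff (n := n) (b := b) (hb := hb) (p := p) s,
            ← square_second_eq_iff (n := n) (b := b) (hb := hb) (p := p) s']
          exact ⟨fun h => h2.symm.trans h, fun h => h2.trans h⟩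
  edge_ext' e e' h1 h2 := by
    rcases e with j | s
    · exact absurd h1.symm (second_ne_source _ _)
    · rcases e' with j | s'
      · exact absurd h2 (second_ne_source _ _)
      · have key : ∀ s s' : SquareEdge, s'.finish = some s.start → s.finish = some s'.start →
            s = s' := by decide
        refine congrArg Sum.inr (key s s' ?_ ?_)
        · exact (square_second_eq_iff s' _).mp (h1.symm.trans (square_first s))
        · exact (square_second_eq_iff s _).mp (h2.trans (square_first s'))
  second_injective i j h := by
    beta_reduce at h
    by_cases hi : (i : ℕ) ≠ b ∧ (i : ℕ) ≠ b + 1 ∧ (i : ℕ) ≠ b + 2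
    · have h1 := square_second_inl_of_not (hb := hb) (p := p) hi.1 hi.2.1 hi.2.2
      exact Sum.inl_injective (((second_eq_sink_iff _ _).mp h1).trans
        ((second_eq_sink_iff _ _).mp (h.symm.trans h1)).symm)
    · obtain ⟨v, hv⟩ : ∃ v, squareEntry b i = some v := by
        unfold squareEntry
        split_ifs <;> first | exact ⟨_, rfl⟩ | omega
      have h' := (square_second_inl_eq_iff (hb := hb) (p := p) i v).mpr hv
      exact squareEntry_injective hv ((square_second_inl_eq_iff j v).mp (h.symm.trans h'))
  borders f := by
    cases (f : SquareFace)
    · exact ⟨Sum.inr .westNorth, Or.inr rfl⟩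
    · exact ⟨Sum.inr .southEast, Or.inr rfl⟩
    · exact ⟨Sum.inr .northEast, Or.inl rfl⟩
  rightFace_injective := square_rightFace_injective
  im_sinkEdge j := by
    rw [square_sinkEdge]
    split_ifs with h0 h1 h2
    · exact (square_im .bottom).trans (by simp [squareCoord, h0])
    · exact (square_im .east).trans (by simp [squareCoord, h1])
    · exact (square_im .top).trans (by simp [squareCoord, h2]; norm_num)
    · simp [first, nodePos]
  im_source j := by
    by_cases h0 : (j : ℕ) = b
    · rw [(square_second_inl_eq_iff j .bottom).mpr (by simp [squareEntry, h0])]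
      exact (square_im .bottom).trans (by simp [squareCoord, h0])
    by_cases h1 : (j : ℕ) = b + 1
    · rw [(square_second_inl_eq_iff j .west).mpr (by simp [squareEntry, h1])]
      exact (square_im .west).trans (by simp [squareCoord, h1])
    by_cases h2 : (j : ℕ) = b + 2
    · rw [(square_second_inl_eq_iff j .top).mpr (by simp [squareEntry, h2])]
      exact (square_im .top).trans (by simp [squareCoord, h2]; norm_num)
    · rw [square_second_inl_of_not h0 h1 h2]
      simp [nodePos]
  white_of_onMidline v hv := by
    rcases (square_onMidline_iff hn v).mp hv with rfl | rfl <;> rfl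
  square f hf := by
    rw [eq_square_of_hasMidlineSquare hn hf]
    refine ⟨square_isMidlineSquare hn, ⟨_, rfl⟩, fun r h => ?_⟩
    change squareRightFace n b r = Sum.inr SquareFace.square at h
    unfold squareRightFace at h
    split_ifs at h <;> simp at h

/-- The action of the reflection on vertices. -/
def SquareVertex.mirror : SquareVertex → SquareVertex
  | .west => .west
  | .north => .south
  | .east => .east
  | .south => .north
  | .top => .bottom
  | .bottom => .top

/-- The action of the reflection on edges. -/
def SquareEdge.mirror : SquareEdge → SquareEdge
  | .westNorth => .westSouth
  | .northEast => .southEast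
  | .westSouth => .westNorth
  | .southEast => .northEast
  | .bottomSouth => .northTop
  | .northTop => .bottomSouth
  | .bottomOut => .topOut
  | .eastOut => .eastOut
  | .topOut => .bottomOut

/-- The action of the reflection on faces. -/
def SquareFace.mirror : SquareFace → SquareFace
  | .square => .square
  | .lowerRight => .upperRight
  | .upperRight => .lowerRight

/-- The reflection of `square`. -/
def squareReflection (n b : ℕ) (hb : b + 2 < n) (p : Bool) : Reflection (square n b hb p) where
  onV := Function.Involutive.toPerm SquareVertex.mirror (by intro v; cases v <;> rfl)
  onE := Function.Involutive.toPerm SquareEdge.mirror (by intro v; cases v <;> rfl)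
  onF := Function.Involutive.toPerm SquareFace.mirror (by intro v; cases v <;> rfl)

lemma square_isMidlineSquare_iff (hn : n = 2 * b + 3) (f : (square n b hb p).Face) :
    (square n b hb p).IsMidlineSquare f ↔ f = Sum.inr SquareFace.square := by
  constructor
  · intro h
    exact eq_square_of_hasMidlineSquare hn (((square_isDrawn hn).hasMidlineSquare_iff f).mpr h)
  · rintro rfl
    exact square_isMidlineSquare hn

lemma square_isMidlineCorner_iff (hn : n = 2 * b + 3) (v : SquareVertex) :
    (square n b hb p).IsMidlineCorner v ↔ v ≠ .top ∧ v ≠ .bottom := by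
  constructor
  · rintro ⟨f, e, hf, he, hv⟩
    rw [(square_isMidlineSquare_iff hn f).mp hf] at he
    replace he := (square_borders_iff e).mp he
    have key : ∀ s : SquareEdge, s = .westNorth ∨ s = .northEast ∨ s = .southEast ∨
        s = .westSouth → s.start = v ∨ s.finish = some v → v ≠ .top ∧ v ≠ .bottom := by
      clear hv
      revert v
      decide
    have hf' : ∀ s : SquareEdge, ((square n b hb p).first (Sum.inr s) = .vertex v ∨
        (square n b hb p).second (Sum.inr s) = .vertex v) → s.start = v ∨ s.finish = some v :=
      fun s => Or.imp (fun h => PlabicNode.vertex.inj ((square_first s).symm.trans h))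
        (square_second_eq_iff s v).mp
    rcases he with rfl | rfl | rfl | rfl
    · exact key .westNorth (by decide) (hf' _ hv)
    · exact key .northEast (by decide) (hf' _ hv)
    · exact key .southEast (by decide) (hf' _ hv)
    · exact key .westSouth (by decide) (hf' _ hv)
  · rintro ⟨h1, h2⟩
    have key : ∀ s : SquareEdge, s = .westNorth ∨ s = .northEast ∨ s = .southEast ∨
        s = .westSouth → s.start = v → (square n b hb p).IsMidlineCorner v := by
      rintro s hs rfl
      refine ⟨Sum.inr SquareFace.square, Sum.inr s, square_isMidlineSquare hn, ?_,
        Or.inl (square_first s)⟩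
      rw [square_borders_iff]
      rcases hs with rfl | rfl | rfl | rfl <;> simp
    cases v
    · exact key .westNorth (by decide) rfl
    · exact key .northEast (by decide) rfl
    · exact ⟨Sum.inr SquareFace.square, Sum.inr .northEast, square_isMidlineSquare hn,
        (square_borders_iff _).mpr (Or.inr (Or.inl rfl)), Or.inr rfl⟩
    · exact key .southEast (by decide) rfl
    · exact absurd rfl h1
    · exact absurd rfl h2

lemma square_isMirror (hn : n = 2 * b + 3) :
    IsMirror (square n b hb p) (squareReflection n b hb p) where
  pos_onV (v : SquareVertex) := by
    have hc : ∀ v : SquareVertex, (squareCoord v.mirror).1 = (squareCoord v).1 ∧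
        (squareCoord v.mirror).2 = 8 - (squareCoord v).2 := by decide
    refine (square_pos v.mirror).trans ?_
    rw [show (square n b hb p).pos v = _ from square_pos v, (hc v).1, (hc v).2, map_add, map_mul,
      Complex.conj_ofReal, Complex.conj_ofReal, Complex.conj_I, hn]
    push_cast
    ring
  edge e := by
    have hfin : ∀ (i j : Fin (n + 1)), (i : ℕ) + j = n →
        (Sum.inl j : Fin (n + 1) ⊕ SquareFace) = Sum.inl i.rev := by
      intro i j h
      refine congrArg Sum.inl (Fin.ext ?_)
      rw [Fin.val_rev]
      omega
    have hsnk : ∀ (i j : Fin n), (i : ℕ) + j + 1 = n →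
        (PlabicNode.sink j : PlabicNode SquareVertex n) = PlabicNode.sink i.rev := by
      intro i j h
      refine congrArg PlabicNode.sink (Fin.ext ?_)
      rw [Fin.val_rev]
      omega
    rcases e with j | s
    · refine Or.inl ⟨rfl, ?_, congrArg Sum.inl (Fin.rev_castSucc j).symm,
        congrArg Sum.inl (Fin.rev_succ j).symm⟩
      change (square n b hb p).second (Sum.inl j.rev) = _
      by_cases h0 : (j : ℕ) = b
      · rw [(square_second_inl_eq_iff j .bottom).mpr (by simp [squareEntry, h0])]
        refine (square_second_inl_eq_iff j.rev .top).mpr ?_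
        unfold squareEntry
        rw [Fin.val_rev, if_neg (by omega), if_neg (by omega), if_pos (by omega)]
      by_cases h1 : (j : ℕ) = b + 1
      · rw [(square_second_inl_eq_iff j .west).mpr (by simp [squareEntry, h1])]
        refine (square_second_inl_eq_iff j.rev .west).mpr ?_
        unfold squareEntry
        rw [Fin.val_rev, if_neg (by omega), if_pos (by omega)]
      by_cases h2 : (j : ℕ) = b + 2
      · rw [(square_second_inl_eq_iff j .top).mpr (by simp [squareEntry, h2])]
        refine (square_second_inl_eq_iff j.rev .bottom).mpr ?_
        unfold squareEntry
        rw [Fin.val_rev, if_pos (by omega)]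
      · rw [square_second_inl_of_not h0 h1 h2, square_second_inl_of_not]
        · rfl
        all_goals rw [Fin.val_rev]; omega
    · cases s
      case bottomSouth => exact Or.inr ⟨rfl, rfl, hfin _ _ (by simp only; omega), rfl⟩
      case northTop => exact Or.inr ⟨rfl, rfl, hfin _ _ (by simp only; omega), rfl⟩
      case westNorth => exact Or.inl ⟨rfl, rfl, rfl, hfin _ _ (by simp only; omega)⟩
      case westSouth => exact Or.inl ⟨rfl, rfl, hfin _ _ (by simp only; omega), rfl⟩
      case northEast => exact Or.inl ⟨rfl, rfl, rfl, rfl⟩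
      case southEast => exact Or.inl ⟨rfl, rfl, rfl, rfl⟩
      case eastOut => exact Or.inl ⟨rfl, hsnk _ _ (by simp only; omega), rfl, rfl⟩
      case bottomOut =>
        exact Or.inl ⟨rfl, hsnk _ _ (by simp only; omega), hfin _ _ (by simp only; omega), rfl⟩
      case topOut =>
        exact Or.inl ⟨rfl, hsnk _ _ (by simp only; omega), rfl, hfin _ _ (by simp only; omega)⟩
  rightFace_rev r := by
    change squareRightFace n b r.rev = (squareReflection n b hb p).onFace (squareRightFace n b r)
    unfold squareRightFace
    rw [Fin.val_rev]
    split_ifs <;> first | rfl | omega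
  onFace_square f hf := by
    rw [(square_isMidlineSquare_iff hn f).mp hf]
    rfl
  color_corner (v : SquareVertex) hv := by
    obtain ⟨h1, h2⟩ := (square_isMidlineCorner_iff hn v).mp hv
    refine (square_white v.mirror).trans (Eq.trans ?_ (square_white v).symm)
    clear hv
    revert p v
    decide
  color (v : SquareVertex) hv := by
    have hv' : v = .top ∨ v = .bottom := by
      by_contra h
      push Not at h
      exact hv ((square_isMidlineCorner_iff hn v).mpr h)
    rw [show (square n b hb p).white v = _ from square_white v]
    refine (square_white v.mirror).trans ?_
    clear hv
    revert p v
    decide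

lemma square_moveFactor (v : SquareVertex) (x : (square n b hb p).Node) (hx : x = .vertex v) :
    (square n b hb p).moveFactor 1 x = if squareWhite p v then 2 else 1 / 2 := by
  subst hx
  have : (square n b hb p).IsWhiteNode (.vertex v) ↔ squareWhite p v = true := by
    constructor
    · rintro ⟨w, hw, h⟩
      have := PlabicNode.vertex.inj hw
      subst this
      exact (square_white v).symm.trans h
    · exact fun h => ⟨v, rfl, (square_white v).trans h⟩
  unfold moveFactor
  by_cases h : squareWhite p v = true
  · rw [if_pos (this.mpr h), if_pos h]
    norm_num
  · rw [if_neg (mt this.mp h), if_neg h]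
    norm_num

lemma square_squareFactor (hn : n = 2 * b + 3) (f : Fin (n + 1) ⊕ SquareFace) :
    (square n b hb p).squareFactor f =
      sel (Sum.inl ⟨b + 2, by omega⟩ = f) 2 * (sel (Sum.inr .upperRight = f) (1 / 2) *
      (sel (Sum.inl ⟨b + 1, by omega⟩ = f) (1 / 2) * sel (Sum.inr .lowerRight = f) 2)) := by
  have hno : ∀ g : Fin (n + 1) ⊕ SquareFace, g ≠ Sum.inr .square →
      ¬ (square n b hb p).IsMidlineSquare g := fun g hg h =>
    hg ((square_isMidlineSquare_iff hn g).mp h)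
  have hyes := square_isMidlineSquare (hb := hb) (p := p) hn
  set c : Fin n ⊕ SquareEdge → ℂ := fun e =>
    sel ((square n b hb p).leftOf e = f) (sel ((square n b hb p).IsMidlineSquare
      ((square n b hb p).rightOf e)) ((square n b hb p).moveFactor 1 ((square n b hb p).first e))) *
    sel ((square n b hb p).rightOf e = f) (sel ((square n b hb p).IsMidlineSquare
      ((square n b hb p).leftOf e)) ((square n b hb p).moveFactor 1 ((square n b hb p).second e)))
    with hc
  have h0 : ∀ e : Fin n ⊕ SquareEdge, ¬ (square n b hb p).IsMidlineSquare ((square n b hb p).rightOf e) →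
      ¬ (square n b hb p).IsMidlineSquare ((square n b hb p).leftOf e) → c e = 1 := by
    intro e h1 h2
    rw [hc]
    beta_reduce
    rw [sel_neg h1, sel_neg h2, sel_one, sel_one, one_mul]
  have h1 : ∀ (e : Fin n ⊕ SquareEdge) x, (square n b hb p).IsMidlineSquare ((square n b hb p).rightOf e) →
      ¬ (square n b hb p).IsMidlineSquare ((square n b hb p).leftOf e) →
      (square n b hb p).moveFactor 1 ((square n b hb p).first e) = x →
      c e = sel ((square n b hb p).leftOf e = f) x := by
    rintro e x h1 h2 rfl
    rw [hc]
    beta_reduce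
    rw [sel_pos h1, sel_neg h2, sel_one, mul_one]
  have h2 : ∀ (e : Fin n ⊕ SquareEdge) x, ¬ (square n b hb p).IsMidlineSquare ((square n b hb p).rightOf e) →
      (square n b hb p).IsMidlineSquare ((square n b hb p).leftOf e) →
      (square n b hb p).moveFactor 1 ((square n b hb p).second e) = x →
      c e = sel ((square n b hb p).rightOf e = f) x := by
    rintro e x h1 h2 rfl
    rw [hc]
    beta_reduce
    rw [sel_neg h1, sel_pos h2, sel_one, one_mul]
  have hprod : (square n b hb p).squareFactor f = ∏ e, c e := rfl
  rw [hprod, Fintype.prod_sum_type, Finset.prod_eq_one, one_mul, square_prod]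
  · rw [h1 (Sum.inr .westNorth) 2 hyes (hno (Sum.inl _) (by simp)) (square_moveFactor .west _ rfl),
      h1 (Sum.inr .northEast) (1 / 2) hyes (hno (Sum.inr .upperRight) (by simp))
        (square_moveFactor .north _ rfl),
      h2 (Sum.inr .westSouth) (1 / 2) (hno (Sum.inl _) (by simp)) hyes
        (square_moveFactor .south _ rfl),
      h2 (Sum.inr .southEast) 2 (hno (Sum.inr .lowerRight) (by simp)) hyes
        (square_moveFactor .east _ rfl),
      h0 (Sum.inr .bottomSouth) (hno (Sum.inr .lowerRight) (by simp)) (hno (Sum.inl _) (by simp)),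
      h0 (Sum.inr .northTop) (hno (Sum.inr .upperRight) (by simp)) (hno (Sum.inl _) (by simp)),
      h0 (Sum.inr .bottomOut) (hno (Sum.inl _) (by simp)) (hno (Sum.inr .lowerRight) (by simp)),
      h0 (Sum.inr .eastOut) (hno (Sum.inr .lowerRight) (by simp))
        (hno (Sum.inr .upperRight) (by simp)),
      h0 (Sum.inr .topOut) (hno (Sum.inr .upperRight) (by simp)) (hno (Sum.inl _) (by simp))]
    simp only [mul_one]
    rfl
  · intro j _
    exact h0 _ (hno (Sum.inl _) (by simp)) (hno (Sum.inl _) (by simp))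

/-- The parameter of a weighting of `square`. -/
noncomputable def squarePar (n b : ℕ) (hb : b + 2 < n) (p : Bool) (y : (square n b hb p).F → ℂ) : ℂ :=
  squareParam p (y SquareFace.lowerRight)⁻¹

lemma square_isSymmetricFamily (hn : n = 2 * b + 3) :
    IsSymmetricFamily (square n b hb p) (squareReflection n b hb p) (squareOldFactor b p)
      (squareNewWeight p) (squarePar n b hb p) where
  κ_rev t ht r := by
    rw [show (square n b hb p).squareFactor (Sum.inl r) = _ from square_squareFactor hn (Sum.inl r)]
    have := r.2
    simp only [squareOldFactor, sel_eq_ite, Sum.inl.injEq, reduceCtorEq, if_false, one_mul, mul_one,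
      Fin.ext_iff, Fin.val_rev]
    split_ifs <;> first | omega | ring
  z_square t ht f hf := by
    have : f = SquareFace.square := Sum.inr_injective ((square_isMidlineSquare_iff hn _).mp hf)
    rw [this]
    rfl
  z_onF t ht (f : SquareFace) hf := by
    rw [show (square n b hb p).squareFactor (Sum.inr f) = _ from square_squareFactor hn (Sum.inr f)]
    change squareNewWeight p t f.mirror = squareNewWeight p t f * _
    cases f
    · exact absurd (square_isMidlineSquare hn) hf
    all_goals
      simp [sel_eq_ite, squareNewWeight, SquareFace.mirror]
      try ring
  prod t ht := by
    have hp := squareParam_ne_zero (p := p) ht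
    have h1 : ∀ r : Fin (n + 1), squareOldFactor b p t r =
        sel (⟨b + 1, by omega⟩ = r) (squareParam p t) *
          sel (⟨b + 2, by omega⟩ = r) (squareParam p t / 2) := by
      intro r
      simp only [squareOldFactor, sel_eq_ite, Fin.ext_iff, eq_comm (b := (r : ℕ))]
      split_ifs <;> first | omega | ring
    have h2 : ∏ f, squareNewWeight p t f = (squareParam p t)⁻¹ * (2 * (squareParam p t)⁻¹) := by
      change ∏ f ∈ {SquareFace.square, SquareFace.lowerRight, SquareFace.upperRight}, _ = _
      simp [squareNewWeight]
    simp only [h1]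
    rw [Finset.prod_mul_distrib, prod_sel_eq _ fun _ => squareParam p t,
      prod_sel_eq _ fun _ => squareParam p t / 2]
    refine (congrArg _ h2).trans ?_
    field_simp
  par_z t ht := by
    unfold squarePar squareNewWeight
    rw [inv_inv, squareParam_squareParam ht]
  z_par y h0 h1 h2 := by
    have hy := inv_ne_zero (h0 SquareFace.lowerRight)
    refine ⟨squareParam_ne_zero hy, ?_⟩
    have hs : squareParam p (squarePar n b hb p y) = (y SquareFace.lowerRight)⁻¹ :=
      squareParam_squareParam hy
    have hne : ¬ (square n b hb p).IsMidlineSquare (Sum.inr SquareFace.lowerRight) := by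
      intro h
      have := Sum.inr_injective ((square_isMidlineSquare_iff hn _).mp h)
      exact absurd (show SquareFace.lowerRight = SquareFace.square from this) (by clear this; decide)
    have hup := h2 SquareFace.lowerRight hne
    rw [show (square n b hb p).squareFactor (Sum.inr SquareFace.lowerRight) = _ from
      square_squareFactor hn (Sum.inr SquareFace.lowerRight)] at hup
    funext f
    cases (f : SquareFace)
    · exact (h1 SquareFace.square (square_isMidlineSquare hn)).symm
    · change (squareParam p (squarePar n b hb p y))⁻¹ = _
      rw [hs, inv_inv]
    · change 2 * (squareParam p (squarePar n b hb p y))⁻¹ = _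
      rw [hs, inv_inv]
      refine Eq.trans ?_ hup.symm
      simp [sel_eq_ite, mul_comm]

end Square

open Birational

/-! ### The graphs of letters -/

/-- The properties of the graph of a letter that control concatenation with it on the right. Here
`κ` and `z` are the factors of the old face weights and the new face weights, as functions of the
parameter `par` of the letter. -/
structure IsLetterGraph (Γ : PlabicGraph n) (o : Γ.Orientation) (ρ : Reflection Γ)
    (R : ℂ → Matrix (Fin n) (Fin n) ℂ) (κ : ℂ → Fin (n + 1) → ℂ) (z : ℂ → Γ.F → ℂ)
    (par : (Γ.F → ℂ) → ℂ) : Prop where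
  regular : IsRegular Γ o
  drawn : IsDrawn Γ
  mirror : IsMirror Γ ρ
  elementary : IsElementary Γ o R κ z
  family : IsSymmetricFamily Γ ρ κ z par
  κ_frac : ∀ {ι : Type} {U : Set (ι → ℂ)} {τ : (ι → ℂ) → ℂ}, IsFracOn τ U → (∀ x ∈ U, τ x ≠ 0) →
    ∀ r, IsFracOn (fun x => κ (τ x) r) U
  z_frac : ∀ {ι : Type} {U : Set (ι → ℂ)} {τ : (ι → ℂ) → ℂ}, IsFracOn τ U → (∀ x ∈ U, τ x ≠ 0) →
    ∀ f, IsFracOn (fun x => z (τ x) f) U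
  par_frac : ∀ {ι : Type} {U : Set (ι → ℂ)} {y : (ι → ℂ) → Γ.F → ℂ},
    (∀ f, IsFracOn (fun x => y x f) U) → (∀ x ∈ U, ∀ f, y x f ≠ 0) →
    IsFracOn (fun x => par (y x)) U

section Frac

variable {ι : Type} {U : Set (ι → ℂ)} {τ : (ι → ℂ) → ℂ} {p : Bool}

lemma isFracOn_bridgeParam (h : IsFracOn τ U) (h0 : ∀ x ∈ U, τ x ≠ 0) :
    IsFracOn (fun x => bridgeParam p (τ x)) U := by
  cases p
  · exact h.inv h0
  · exact h

lemma isFracOn_squareParam (h : IsFracOn τ U) (h0 : ∀ x ∈ U, τ x ≠ 0) :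
    IsFracOn (fun x => squareParam p (τ x)) U := by
  cases p
  · exact (IsFracOn.const 2).div h h0
  · exact h

end Frac

lemma bridges_isLetterGraph {a : Fin (n / 2)} {p : Bool} (hs : ¬ IsShort a) :
    IsLetterGraph (bridges n a p) (bridgesOrientation p) (bridgesReflection a p)
      (fun t => mat (letterRoot (a, p) t)) (bridgeFactor a p) (fun t _ => (bridgeParam p t)⁻¹)
      (bridgesPar a p) where
  regular := bridges_isRegular hs
  drawn := bridges_isDrawn hs
  mirror := bridges_isMirror hs
  elementary := bridges_isElementary hs
  family := bridges_isSymmetricFamily hs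
  κ_frac h h0 r := by
    unfold bridgeFactor
    split_ifs
    · exact isFracOn_bridgeParam h h0
    · exact IsFracOn.const 1
  z_frac h h0 _ := (isFracOn_bridgeParam h h0).inv fun x hx => bridgeParam_ne_zero (h0 x hx)
  par_frac h h0 := isFracOn_bridgeParam ((h _).inv fun x hx => h0 x hx _)
    fun x hx => inv_ne_zero (h0 x hx _)

lemma square_isLetterGraph {a : Fin (n / 2)} {p : Bool} (hs : IsShort a) (hb : (a : ℕ) + 2 < n) :
    IsLetterGraph (square n a hb p) (squareOrientation n a hb p) (squareReflection n a hb p)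
      (fun t => mat (letterRoot (a, p) t)) (squareOldFactor a p) (squareNewWeight p)
      (squarePar n a hb p) where
  regular := square_isRegular
  drawn := square_isDrawn (by unfold IsShort at hs; omega)
  mirror := square_isMirror (by unfold IsShort at hs; omega)
  elementary := square_isElementary hs hb
  family := square_isSymmetricFamily (by unfold IsShort at hs; omega)
  κ_frac h h0 r := by
    unfold squareOldFactor
    split_ifs
    · exact isFracOn_squareParam h h0
    · exact (isFracOn_squareParam h h0).div (IsFracOn.const 2) fun _ _ => two_ne_zero
    · exact IsFracOn.const 1
  z_frac h h0 (f : SquareFace) := by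
    have := (isFracOn_squareParam (p := p) h h0).inv fun x hx => squareParam_ne_zero (h0 x hx)
    cases f
    · exact IsFracOn.const 1
    · exact this
    · exact (IsFracOn.const 2).mul this
  par_frac h h0 := isFracOn_squareParam ((h _).inv fun x hx => h0 x hx _)
    fun x hx => inv_ne_zero (h0 x hx _)

lemma ofLetter_isLetterGraph (l : Letter n) :
    ∃ o ρ κ z par, IsLetterGraph (ofLetter l) o ρ (fun t => mat (letterRoot l t)) κ z par := by
  obtain ⟨a, p⟩ := l
  by_cases hs : IsShort a
  · have hb : (a : ℕ) + 2 < n := by unfold IsShort at hs; omega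
    have e : ofLetter (a, p) = square n a hb p := dif_pos hs
    rw [e]
    exact ⟨_, _, _, _, _, square_isLetterGraph hs hb⟩
  · have e : ofLetter (a, p) = bridges n a p := dif_neg hs
    rw [e]
    exact ⟨_, _, _, _, _, bridges_isLetterGraph hs⟩

section Append

variable {Λ Δ : PlabicGraph n} {o₁ : Λ.Orientation} {o₂ : Δ.Orientation} {ρ₁ : Reflection Λ}
  {ρ₂ : Reflection Δ} {κ : ℂ → Fin (n + 1) → ℂ} {z : ℂ → Δ.F → ℂ} {par : (Δ.F → ℂ) → ℂ}

lemma isFracOn_rightProd {ι : Type} {U : Set (ι → ℂ)} {a : (ι → ℂ) → Fin (n + 1) → ℂ}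
    (h : ∀ r, IsFracOn (fun x => a x r) U) (f : Λ.Face) :
    IsFracOn (fun x => Λ.rightProd (a x) f) U := by
  unfold rightProd
  refine IsFracOn.prod _ fun r _ => ?_
  by_cases hr : Λ.rightFace r = f
  · simpa only [sel_pos hr] using h r
  · simpa only [sel_neg hr] using IsFracOn.const 1

lemma IsLetterGraph.isChart_concat {l : Letter n}
    (hl : IsLetterGraph Δ o₂ ρ₂ (fun t => mat (letterRoot l t)) κ z par) (hr : IsRegular Λ o₁)
    (hd : IsDrawn Λ) (hm : IsMirror Λ ρ₁)
    (hmeas : ∀ y ∈ Λ.moveSymmetricWeightings, Measures Λ o₁ y (Λ.meas y))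
    (hne : Λ.moveSymmetricWeightings.Nonempty) {w : List (Letter n)}
    (hred : IsReducedWord (w ++ [l]))
    (hc : IsChart w (fun y p => Λ.meas y p.1 p.2) Λ.moveSymmetricWeightings) :
    IsChart (w ++ [l]) (fun y p => (Λ.concat Δ).meas y p.1 p.2)
      (Λ.concat Δ).moveSymmetricWeightings := by
  have hpar : IsFracOn (fun y : (Λ.concat Δ).Face → ℂ => par fun s => y (newFace Λ Δ s))
      (Λ.concat Δ).moveSymmetricWeightings :=
    hl.par_frac (fun f => IsFracOn.coord _) fun y hy f => hy.1.1 _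
  have hpar0 := fun y hy => (glueWeights_peelWeights hr hd hl.drawn hm hl.mirror hl.elementary
    hl.family (y := y) hy).1
  refine hc.append hred hne (glueWeights Λ Δ κ z) (peelWeights Λ Δ κ par)
    (fun y => par fun s => y (newFace Λ Δ s)) ?_ ?_ ?_ ?_ hpar ?_
  · intro y hy
    have h := glueWeights_peelWeights hr hd hl.drawn hm hl.mirror hl.elementary hl.family hy
    refine ⟨h.1, ?_, h.2⟩
    rw [← glueWeights_mem_iff hr hd hl.drawn hm hl.mirror hl.elementary hl.family _ h.1, h.2]
    exact hy
  · intro x hx t ht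
    exact ⟨(glueWeights_mem_iff hr hd hl.drawn hm hl.mirror hl.elementary hl.family _ ht).mpr hx,
      peelWeights_glueWeights hl.elementary hl.family x ht, hl.family.par_z t ht⟩
  · intro x hx t ht
    funext p
    rw [((hmeas x hx).concat hr hl.regular hl.elementary ht).meas_eq (hr.concat hl.regular)]
    rfl
  · intro f
    exact (IsFracOn.coord _).div (isFracOn_rightProd (hl.κ_frac hpar hpar0) f)
      fun y hy => rightProd_ne_zero Λ (hl.elementary.ne_zero (hpar0 y hy)).1 f
  · intro U x τ hx hτ hτ0 f
    induction f using concat_face_cases with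
    | h1 f =>
      simp only [glueWeights_liftFace]
      exact (hx f).mul (isFracOn_rightProd (hl.κ_frac hτ hτ0) f)
    | h2 f => exact hl.z_frac hτ hτ0 f

end Append

/-! ### The graph of the empty word -/

lemma strands_edge_cases {q : (strands n).Edge → Prop} (h : ∀ j : Fin n, q (Sum.inl j))
    (e : (strands n).Edge) : q e := by
  rcases e with j | e
  · exact h j
  · exact e.elim

lemma strands_isRegular : IsRegular (strands n) fun _ => true where
  source _ := rfl
  sink _ := rfl
  balanced := ⟨fun v => v.elim, fun v => v.elim⟩
  unique o ho _ := by
    funext e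
    induction e using strands_edge_cases with
    | h j => exact ho j
  acyclic := by
    refine ⟨fun _ => 0, fun e e' h => ?_⟩
    induction e using strands_edge_cases with
    | h i => exact absurd h.symm (tail_ne_sink (Γ := strands n) (fun _ => rfl) e' i)
  angle := by
    refine ⟨fun _ => 0, fun e => ⟨1, one_pos, ?_⟩, fun e e' _ => ?_, fun _ => rfl, fun _ => rfl⟩
    · induction e using strands_edge_cases with
      | h j =>
        change ((strands n).width : ℂ) + (j : ℕ) * Complex.I - (j : ℕ) * Complex.I = _
        simp [strands]
    · simpa using Real.pi_pos
  leftOf_sinkEdge _ := rfl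
  rightOf_sinkEdge _ := rfl

lemma strands_isDrawn : IsDrawn (strands n) where
  pos_injective v := v.elim
  width_pos := one_pos
  re_pos v := v.elim
  first_ne_second e := by
    induction e using strands_edge_cases with
    | h j => exact first_ne_sink (Γ := strands n) (Sum.inl j) j
  edge_ext e e' h _ := by
    induction e using strands_edge_cases with
    | h j =>
      induction e' using strands_edge_cases with
      | h j' => exact congrArg Sum.inl (PlabicNode.source.inj h)
  edge_ext' e e' h _ := by
    induction e using strands_edge_cases with
    | h j =>
      induction e' using strands_edge_cases with
      | h j' => exact absurd h (first_ne_sink (Γ := strands n) (Sum.inl j) j')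
  second_injective _ _ h := PlabicNode.sink.inj h
  borders f := f.elim
  rightFace_injective := Sum.inl_injective
  im_sinkEdge j := by
    change ((j : ℕ) * Complex.I : ℂ).im = _
    simp
  im_source j := by
    change (((strands n).width : ℂ) + (j : ℕ) * Complex.I).im = _
    simp
  white_of_onMidline v := v.elim
  square f h := absurd h (not_hasMidlineSquare (fun v : Empty => v.elim) f)

/-- The reflection of `strands` in the midline. -/
def strandsReflection (n : ℕ) : Reflection (strands n) where
  onV := Equiv.refl _
  onE := Equiv.refl _
  onF := Equiv.refl _

lemma strands_isMirror : IsMirror (strands n) (strandsReflection n) where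
  pos_onV v := v.elim
  edge e := by
    induction e using strands_edge_cases with
    | h j => exact Or.inl ⟨rfl, rfl, congrArg Sum.inl (Fin.rev_castSucc j).symm,
        congrArg Sum.inl (Fin.rev_succ j).symm⟩
  rightFace_rev _ := rfl
  onFace_square f hf := absurd hf (not_isMidlineSquare (fun v : Empty => v.elim) f)
  color_corner v := v.elim
  color v := v.elim

lemma strands_mem_iff (y : (strands n).Face → ℂ) :
    y ∈ (strands n).moveSymmetricWeightings ↔ (∀ r, y (Sum.inl r) ≠ 0) ∧
      ∏ r, y (Sum.inl r) = 1 ∧ ∀ r, y (Sum.inl (Fin.rev r)) = y (Sum.inl r) := by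
  have hno : ∀ f, ¬ (strands n).IsMidlineSquare f := not_isMidlineSquare fun v : Empty => v.elim
  rw [strands_isMirror.mem_moveSymmetricWeightings_iff strands_isDrawn, and_assoc]
  refine and_congr ⟨fun h r => h _, ?_⟩ (and_congr ?_ ⟨fun h r => ?_, fun h => ?_⟩)
  · rintro h (r | f)
    · exact h r
    · exact f.elim
  · have : IsEmpty (strands n).F := inferInstanceAs (IsEmpty Empty)
    rw [show (∏ f, y f : ℂ) = _ from Fintype.prod_sum_type y,
      Fintype.prod_empty fun f => y (Sum.inr f), mul_one]
  · have := h.2 (Sum.inl r) (hno _)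
    rw [squareFactor_eq_one hno, mul_one] at this
    exact this
  · refine ⟨fun f hf => absurd hf (hno f), ?_⟩
    rintro (r | f) -
    · rw [squareFactor_eq_one hno, mul_one]
      exact h r
    · exact f.elim

/-- A sequence of `n` numbers, continued by `1` at both ends. -/
def padded (a : Fin n → ℂ) (k : ℕ) : ℂ := if h : 0 < k ∧ k ≤ n then a ⟨k - 1, by omega⟩ else 1

lemma padded_succ (a : Fin n → ℂ) (j : Fin n) : padded a (j + 1) = a j := by
  unfold padded
  rw [dif_pos ⟨by omega, by omega⟩]
  rfl

lemma padded_zero (a : Fin n → ℂ) : padded a 0 = 1 := dif_neg (by simp)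

lemma padded_last (a : Fin n → ℂ) : padded a (n + 1) = 1 := dif_neg (by simp)

lemma padded_ne_zero {a : Fin n → ℂ} (h : ∀ j, a j ≠ 0) (k : ℕ) : padded a k ≠ 0 := by
  unfold padded
  split_ifs
  · exact h _
  · exact one_ne_zero

lemma coe_stepRatio (d : Fin n → ℂˣ) (r : Fin (n + 1)) :
    (stepRatio d r : ℂ) = padded (fun j => (d j : ℂ)) r / padded (fun j => (d j : ℂ)) (r + 1) := by
  have h1 : ((Fin.cases (motive := fun _ => ℂˣ) 1 d r : ℂˣ) : ℂ) =
      padded (fun j => (d j : ℂ)) r := by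
    induction r using Fin.cases with
    | zero => simp [padded_zero]
    | succ j => simp [padded_succ]
  have h2 : ((Fin.lastCases (motive := fun _ => ℂˣ) 1 (fun j => (d j)⁻¹) r : ℂˣ) : ℂ) =
      (padded (fun j => (d j : ℂ)) (r + 1))⁻¹ := by
    induction r using Fin.lastCases with
    | last => simp [padded_last]
    | cast j => simp [padded_succ]
  rw [stepRatio, Units.val_mul, h1, h2, div_eq_mul_inv]

/-- The product of the first `k` terms of a finite sequence. -/
def partialProd (y : Fin (n + 1) → ℂ) (k : ℕ) : ℂ :=
  ∏ s ∈ Finset.range k, if h : s < n + 1 then y ⟨s, h⟩ else 1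

lemma partialProd_succ (y : Fin (n + 1) → ℂ) (r : Fin (n + 1)) :
    partialProd y (r + 1) = partialProd y r * y r := by
  unfold partialProd
  rw [Finset.prod_range_succ, dif_pos r.2]

lemma partialProd_last (y : Fin (n + 1) → ℂ) : partialProd y (n + 1) = ∏ r, y r := by
  unfold partialProd
  rw [← Fin.prod_univ_eq_prod_range fun s => if h : s < n + 1 then y ⟨s, h⟩ else 1]
  exact Finset.prod_congr rfl fun r _ => dif_pos r.2

lemma partialProd_ne_zero {y : Fin (n + 1) → ℂ} (h : ∀ r, y r ≠ 0) (k : ℕ) :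
    partialProd y k ≠ 0 := by
  refine Finset.prod_ne_zero_iff.mpr fun s _ => ?_
  split_ifs
  · exact h _
  · exact one_ne_zero

lemma partialProd_mul_padded {y : Fin (n + 1) → ℂ} {a : Fin n → ℂ} (h : ∀ j, a j ≠ 0)
    (hy : ∀ r : Fin (n + 1), y r = padded a r / padded a (r + 1)) (k : ℕ) (hk : k ≤ n + 1) :
    partialProd y k * padded a k = 1 := by
  induction k with
  | zero => simp [partialProd, padded_zero]
  | succ k ih =>
    have h1 := partialProd_succ y ⟨k, hk⟩
    simp only at h1
    have h2 := padded_ne_zero h (k + 1)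
    rw [h1, hy, mul_assoc, div_mul_cancel₀ _ h2]
    exact ih (by omega)

lemma partialProd_mul_partialProd {y : Fin (n + 1) → ℂ} (h1 : ∏ r, y r = 1)
    (hs : ∀ r, y (Fin.rev r) = y r) (k : ℕ) (hk : k ≤ n + 1) :
    partialProd y k * partialProd y (n + 1 - k) = 1 := by
  have e : partialProd y (n + 1 - k) = ∏ s ∈ Finset.Ico k (n + 1),
      if h : s < n + 1 then y ⟨s, h⟩ else 1 := by
    unfold partialProd
    refine Finset.prod_bij' (fun s _ => n - s) (fun s _ => n - s) ?_ ?_ ?_ ?_ ?_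
    · intro s hs
      simp only [Finset.mem_range, Finset.mem_Ico] at *
      omega
    · intro s hs
      simp only [Finset.mem_range, Finset.mem_Ico] at *
      omega
    · intro s hs
      simp only [Finset.mem_range] at *
      omega
    · intro s hs
      simp only [Finset.mem_Ico] at *
      omega
    · intro s h
      simp only [Finset.mem_range] at h
      rw [dif_pos (by omega), dif_pos (by omega), ← hs]
      congr 1
      refine Fin.ext ?_
      rw [Fin.val_rev]
      change n + 1 - (s + 1) = n - s
      omega
  rw [e, partialProd, Finset.prod_range_mul_prod_Ico _ hk, ← partialProd, partialProd_last, h1]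

/-- The diagonal entries of the boundary measurement matrix of `strands`. -/
noncomputable def strandsDiag (y : (strands n).Face → ℂ) (j : Fin n) : ℂ :=
  (partialProd (fun r => y (Sum.inl r)) (j + 1))⁻¹

lemma padded_strandsDiag {y : (strands n).Face → ℂ} (h1 : ∏ r, y (Sum.inl r) = 1) (k : ℕ)
    (hk : k ≤ n + 1) : padded (strandsDiag y) k = (partialProd (fun r => y (Sum.inl r)) k)⁻¹ := by
  rcases k with _ | k
  · simp [padded_zero, partialProd]
  · rcases Nat.lt_or_ge k n with h | h
    · exact padded_succ _ ⟨k, h⟩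
    · have : k = n := by omega
      rw [this, padded_last, partialProd_last, h1, inv_one]

lemma padded_div_padded {y : (strands n).Face → ℂ} (h0 : ∀ r, y (Sum.inl r) ≠ 0)
    (h1 : ∏ r, y (Sum.inl r) = 1) (r : Fin (n + 1)) :
    padded (strandsDiag y) r / padded (strandsDiag y) (r + 1) = y (Sum.inl r) := by
  rw [padded_strandsDiag h1 _ (by omega), padded_strandsDiag h1 _ (by omega), partialProd_succ]
  have := partialProd_ne_zero h0 r
  have := h0 r
  field_simp

lemma strands_faceWeight (wt : (strands n).Edge → ℂˣ) (r : Fin (n + 1)) :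
    (strands n).faceWeight (fun _ => true) wt (Sum.inl r) =
      stepRatio (fun j => wt (Sum.inl j)) r := by
  have e : wt = (strands n).sinkWeights fun j => wt (Sum.inl j) := by
    funext e
    induction e using strands_edge_cases with
    | h j => exact (sinkWeights_sinkEdge (Γ := strands n) (fun j => wt (Sum.inl j)) j).symm
  conv_lhs => rw [e]
  rw [strands_isRegular.faceWeight_sinkWeights]
  exact rightProd_eq (fun r' => ⟨fun h => (Sum.inl_injective h).symm, fun h => h ▸ rfl⟩) _

lemma strands_networkMatrix (wt : (strands n).Edge → ℂˣ) :
    (strands n).networkMatrix (fun _ => true) wt = Matrix.diagonal fun j => (wt (Sum.inl j) : ℂ) := by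
  have hP : IsPathSum (Γ := strands n) (fun _ => true) wt
      (Sum.elim (fun i j => if i = j then (wt (Sum.inl i) : ℂ) else 0) Empty.elim) := by
    intro e j
    induction e using strands_edge_cases with
    | h i =>
      have h1 : (strands n).head (fun _ => true) (Sum.inl i) = .sink i := rfl
      have h2 := tail_ne_sink (Γ := strands n) (o := fun _ => true) (fun _ => rfl)
      simp only [h1, h2, if_false, Finset.sum_const_zero, add_zero, PlabicNode.sink.injEq, mul_ite,
        mul_one, mul_zero]
      rfl
  ext i j
  rw [strands_isRegular.networkMatrix_eq hP, Matrix.diagonal_apply]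
  rfl

lemma strands_measures {y : (strands n).Face → ℂ} (h0 : ∀ r, y (Sum.inl r) ≠ 0)
    (h1 : ∏ r, y (Sum.inl r) = 1) :
    Measures (strands n) (fun _ => true) y (Matrix.diagonal (strandsDiag y)) where
  exists_wt := by
    have hd : ∀ j, strandsDiag y j ≠ 0 := fun j => inv_ne_zero (partialProd_ne_zero h0 _)
    refine ⟨Sum.elim (fun j => Units.mk0 _ (hd j)) Empty.elim, ?_⟩
    rintro (r | f)
    · rw [strands_faceWeight, coe_stepRatio]
      exact padded_div_padded h0 h1 r
    · exact f.elim
  networkMatrix_eq wt hwt := by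
    rw [strands_networkMatrix]
    congr 1
    funext j
    have h := partialProd_mul_padded (y := fun r => y (Sum.inl r))
      (a := fun j => (wt (Sum.inl j) : ℂ)) (fun j => (wt (Sum.inl j)).ne_zero) (fun r => by
        rw [← hwt (Sum.inl r), strands_faceWeight, coe_stepRatio]) (j + 1) (by omega)
    rw [padded_succ] at h
    exact eq_inv_of_mul_eq_one_right h

lemma mem_wordCell_nil_iff {g : G n} : g ∈ wordCell [] ↔ g ∈ T n := by
  have h1 : ∀ g : G n, g ∈ cell (reflProd []) ↔ g ∈ Bminus n := by
    intro g
    constructor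
    · rintro ⟨b, hb, b', hb', rfl⟩
      exact (Bminus n).mul_mem ((Bminus n).mul_mem hb (Bminus n).one_mem) hb'
    · exact fun h => ⟨g, h, 1, (Bminus n).one_mem, by simp [reflProd]⟩
  have h2 : DoubleBruhat.flip n g ∈ Bminus n ↔ g ∈ Bplus n := by
    constructor
    · intro h i j hij
      have := h i.rev j.rev (Fin.rev_lt_rev.mpr hij)
      change mat g i.rev.rev j.rev.rev = 0 at this
      rwa [Fin.rev_rev, Fin.rev_rev] at this
    · exact fun h i j hij => h i.rev j.rev (Fin.rev_lt_rev.mpr hij)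
  change DoubleBruhat.flip n g ∈ cell (reflProd []) ∧ g ∈ cell (reflProd []) ↔ _
  rw [h1, h1, h2]
  rfl

lemma diagonal_mul_Omega_mul_transpose {a : Fin n → ℂ} (h : ∀ j, a j * a j.rev = 1) :
    Matrix.diagonal a * Omega n * (Matrix.diagonal a).transpose = Omega n := by
  ext i j
  rw [Matrix.diagonal_transpose, Matrix.mul_diagonal, Matrix.diagonal_mul]
  simp only [Omega, Matrix.of_apply]
  split_ifs with hj
  · rw [hj, mul_right_comm, h, one_mul]
  · simp

lemma mul_rev_eq_one_of_mem_T {g : G n} (hg : g ∈ T n) (j : Fin n) :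
    mat g j j * mat g j.rev j.rev = 1 := by
  rw [mem_T_iff] at hg
  have h := sum_entries g j j.rev
  rw [if_pos rfl, Finset.sum_eq_single j (fun c _ hc => by rw [hg j c hc.symm, zero_mul])
    (by simp)] at h
  have h0 : ((-1 : ℂ)) ^ (j : ℕ) ≠ 0 := pow_ne_zero _ (by norm_num)
  refine mul_right_cancel₀ h0 ?_
  rw [one_mul, mul_assoc, mul_comm (mat g j.rev j.rev), h]

lemma isFracOn_partialProd {ι : Type} {U : Set (ι → ℂ)} {y : (ι → ℂ) → Fin (n + 1) → ℂ}
    (h : ∀ r, IsFracOn (fun x => y x r) U) (k : ℕ) : IsFracOn (fun x => partialProd (y x) k) U := by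
  unfold partialProd
  refine IsFracOn.prod _ fun s _ => ?_
  split_ifs
  · exact h _
  · exact IsFracOn.const 1

lemma isFracOn_padded {ι : Type} {U : Set (ι → ℂ)} {a : (ι → ℂ) → Fin n → ℂ}
    (h : ∀ r, IsFracOn (fun x => a x r) U) (k : ℕ) : IsFracOn (fun x => padded (a x) k) U := by
  unfold padded
  split_ifs
  · exact h _
  · exact IsFracOn.const 1

/-- The face weights of `strands` with a given diagonal matrix. -/
noncomputable def strandsWeights (z : Fin n × Fin n → ℂ) : (strands n).Face → ℂ :=
  Sum.elim (fun r => padded (fun j => z (j, j)) r / padded (fun j => z (j, j)) (r + 1)) Empty.elim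

lemma strandsDiag_strandsWeights {z : Fin n × Fin n → ℂ} (h : ∀ j, z (j, j) ≠ 0) (j : Fin n) :
    strandsDiag (strandsWeights z) j = z (j, j) := by
  have := partialProd_mul_padded (y := fun r => strandsWeights z (Sum.inl r))
    (a := fun j => z (j, j)) h (fun r => rfl) (j + 1) (by omega)
  rw [padded_succ] at this
  exact (eq_inv_of_mul_eq_one_right this).symm

lemma padded_mul_padded {a : Fin n → ℂ} (h : ∀ j, a j * a j.rev = 1) (k : ℕ) (hk : k ≤ n + 1) :
    padded a k * padded a (n + 1 - k) = 1 := by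
  rcases k with _ | k
  · simp [padded_zero, padded_last]
  · rcases Nat.lt_or_ge k n with hn | hn
    · have e : n + 1 - (k + 1) = ((Fin.rev ⟨k, hn⟩ : Fin n) : ℕ) + 1 := by
        rw [Fin.val_rev]
        change n + 1 - (k + 1) = n - (k + 1) + 1
        omega
      rw [e, padded_succ]
      have := padded_succ a ⟨k, hn⟩
      simp only at this
      rw [this]
      exact h _
    · have : k = n := by omega
      simp [this, padded_last, padded_zero]

lemma strandsWeights_mem {z : Fin n × Fin n → ℂ} (h : ∀ j, z (j, j) * z (j.rev, j.rev) = 1) :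
    strandsWeights z ∈ (strands n).moveSymmetricWeightings := by
  have h0 : ∀ j, z (j, j) ≠ 0 := fun j => left_ne_zero_of_mul_eq_one (h j)
  have hp := padded_ne_zero h0
  refine (strands_mem_iff _).mpr ⟨fun r => div_ne_zero (hp _) (hp _), ?_, fun r => ?_⟩
  · have := partialProd_mul_padded (y := fun r => strandsWeights z (Sum.inl r))
      (a := fun j => z (j, j)) h0 (fun r => rfl) (n + 1) le_rfl
    rwa [padded_last, mul_one, partialProd_last] at this
  · have h1 := padded_mul_padded h r (by omega)
    have h2 := padded_mul_padded h (r + 1) (by omega)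
    change padded _ (n + 1 - (r + 1)) / padded _ (n + 1 - (r + 1) + 1) = padded _ r / padded _ (r + 1)
    have e : n + 1 - ((r : ℕ) + 1) + 1 = n + 1 - r := by omega
    rw [e, div_eq_div_iff (hp _) (hp _), mul_comm, h2, h1]

lemma strands_isChart :
    IsChart [] (fun y (p : Fin n × Fin n) => (strands n).meas y p.1 p.2)
      (strands n).moveSymmetricWeightings := by
  have hmeas : ∀ y ∈ (strands n).moveSymmetricWeightings,
      (strands n).meas y = Matrix.diagonal (strandsDiag y) := fun y hy =>
    have h := (strands_mem_iff y).mp hy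
    (strands_measures h.1 h.2.1).meas_eq strands_isRegular
  have hcell : ∀ z ∈ coords '' wordCell ([] : List (Letter n)),
      (∀ i j, i ≠ j → z (i, j) = 0) ∧ ∀ j, z (j, j) * z (j.rev, j.rev) = 1 := by
    rintro _ ⟨g, hg, rfl⟩
    rw [mem_wordCell_nil_iff] at hg
    exact ⟨(mem_T_iff g).mp hg, mul_rev_eq_one_of_mem_T hg⟩
  refine ⟨_, strandsWeights, ⟨{1}, Set.ext fun z => by simp⟩, fun p hp => hp, ?_, ?_, ?_, ?_, ?_, ?_⟩
  · intro y hy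
    obtain ⟨h0, h1, h2⟩ := (strands_mem_iff y).mp hy
    have hd : ∀ j : Fin n, strandsDiag y j * strandsDiag y j.rev = 1 := by
      intro j
      have := partialProd_mul_partialProd h1 h2 (j + 1) (by omega)
      unfold strandsDiag
      rw [← mul_inv, Fin.val_rev, show n - ((j : ℕ) + 1) + 1 = n + 1 - (j + 1) by omega, this,
        inv_one]
    refine ⟨ofMat _ (diagonal_mul_Omega_mul_transpose hd), ?_, ?_⟩
    · rw [mem_wordCell_nil_iff, mem_T_iff, mat_ofMat]
      exact fun i j hij => Matrix.diagonal_apply_ne _ hij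
    · funext p
      beta_reduce
      rw [hmeas y hy]
      rfl
  · exact fun z hz => strandsWeights_mem (hcell z hz).2
  · intro y hy
    obtain ⟨h0, h1, -⟩ := (strands_mem_iff y).mp hy
    beta_reduce
    rw [hmeas y hy]
    funext f
    rcases f with r | f
    · have e : (fun j => Matrix.diagonal (strandsDiag y) j j) = strandsDiag y := by
        funext j
        exact Matrix.diagonal_apply_eq _ _
      change padded (fun j => Matrix.diagonal (strandsDiag y) j j) r /
        padded (fun j => Matrix.diagonal (strandsDiag y) j j) (r + 1) = _
      rw [e]
      exact padded_div_padded h0 h1 r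
    · exact f.elim
  · intro z hz
    obtain ⟨h1, h2⟩ := hcell z hz
    beta_reduce
    rw [hmeas _ (strandsWeights_mem h2)]
    funext ⟨i, j⟩
    change Matrix.diagonal (strandsDiag (strandsWeights z)) i j = z (i, j)
    rw [Matrix.diagonal_apply]
    split_ifs with hij
    · subst hij
      exact strandsDiag_strandsWeights (fun j => left_ne_zero_of_mul_eq_one (h2 j)) i
    · exact (h1 i j hij).symm
  · rintro ⟨i, j⟩
    by_cases hij : i = j
    · subst hij
      refine IsFracOn.congr (f := fun y => strandsDiag y i) ?_ fun y hy => ?_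
      · exact (isFracOn_partialProd (fun r => IsFracOn.coord _) _).inv fun y hy =>
          partialProd_ne_zero ((strands_mem_iff y).mp hy).1 _
      · beta_reduce
        rw [hmeas y hy, Matrix.diagonal_apply_eq]
    · refine (IsFracOn.const 0).congr fun y hy => ?_
      beta_reduce
      rw [hmeas y hy, Matrix.diagonal_apply_ne _ hij]
  · rintro (r | f)
    · have h : ∀ k, IsFracOn (fun z : Fin n × Fin n → ℂ => padded (fun j => z (j, j)) k)
          (coords '' wordCell []) := fun k => isFracOn_padded (fun j => IsFracOn.coord _) k
      exact (h r).div (h (r + 1)) fun z hz =>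
        padded_ne_zero (fun j => left_ne_zero_of_mul_eq_one ((hcell z hz).2 j)) _
    · exact f.elim

lemma exists_orientation_reflection_ofWord (w : List (Letter n)) :
    ∃ (o : (ofWord w).Orientation) (ρ : Reflection (ofWord w)), IsRegular (ofWord w) o ∧
      IsDrawn (ofWord w) ∧ IsMirror (ofWord w) ρ ∧
      (∀ y ∈ (ofWord w).moveSymmetricWeightings, Measures (ofWord w) o y ((ofWord w).meas y)) ∧
      (ofWord w).moveSymmetricWeightings.Nonempty ∧
      (IsReducedWord w → IsChart w (fun y p => (ofWord w).meas y p.1 p.2)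
        (ofWord w).moveSymmetricWeightings) := by
  induction w using List.reverseRecOn with
  | nil =>
    change ∃ (o : (strands n).Orientation) (ρ : Reflection (strands n)), _
    refine ⟨_, _, strands_isRegular, strands_isDrawn, strands_isMirror, fun y hy => ?_, ?_,
      fun _ => strands_isChart⟩
    · have h := (strands_mem_iff y).mp hy
      have hm := strands_measures h.1 h.2.1
      rwa [← hm.meas_eq strands_isRegular] at hm
    · exact ⟨_, strandsWeights_mem (z := fun _ => 1) fun j => one_mul 1⟩
  | append_singleton w l ih =>
    have e : ofWord (w ++ [l]) = (ofWord w).concat (ofLetter l) := by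
      simp [ofWord]
    rw [e]
    obtain ⟨o₁, ρ₁, hr, hd, hm, hmeas, hne, hc⟩ := ih
    obtain ⟨o₂, ρ₂, κ, z, par, hl⟩ := ofLetter_isLetterGraph l
    refine ⟨concatOrientation o₁ o₂, ρ₁.concat ρ₂, hr.concat hl.regular, hd.concat hl.drawn,
      hm.concat hr hd hl.drawn hl.mirror, fun y hy => ?_, ?_, fun hred => ?_⟩
    · obtain ⟨h1, h2⟩ := glueWeights_peelWeights hr hd hl.drawn hm hl.mirror hl.elementary
        hl.family hy
      have hp := hy
      rw [← h2, glueWeights_mem_iff hr hd hl.drawn hm hl.mirror hl.elementary hl.family _ h1] at hp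
      have hmy := (hmeas _ hp).concat hr hl.regular hl.elementary h1
      rw [h2] at hmy
      rwa [hmy.meas_eq (hr.concat hl.regular)]
    · obtain ⟨y, hy⟩ := hne
      exact ⟨_, (glueWeights_mem_iff hr hd hl.drawn hm hl.mirror hl.elementary hl.family y
        one_ne_zero).mpr hy⟩
    · exact hl.isChart_concat hr hd hm hmeas hne hred (hc hred.of_append)

end PlabicGraph

/-- For even `n = 2k` the group `DoubleBruhat.G n` is `Sp_{2k}`, for odd `n = 2k + 1` it is
`O_{2k+1}`. -/
theorem mainTheorem3 (n : ℕ) (u v : DoubleBruhat.W n) (w : List (DoubleBruhat.Letter n))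
    (hw : DoubleBruhat.wordElem w = (u, v)) (hred : DoubleBruhat.IsReducedWord w) :
    Birational.MapsBirationallyOnto
      (fun y (p : Fin n × Fin n) => (PlabicGraph.ofWord w).meas y p.1 p.2)
      (PlabicGraph.ofWord w).moveSymmetricWeightings
      (DoubleBruhat.doubleBruhatCell u v) := by
  obtain ⟨o, ρ, -, -, -, -, -, h⟩ := PlabicGraph.exists_orientation_reflection_ofWord w
  rw [DoubleBruhat.doubleBruhatCell_eq hw]
  exact (h hred).mapsBirationallyOnto
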